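/- **Setting.** Let $\mathfrak g=\mathfrak g_{\bar 0}\oplus\mathfrak g_{\bar 1}$ be a finite-dimensional simple Lie superalgebra over $\mathbb C$ with a nondegenerate, even, supersymmetric, invariant bilinear form $(\cdot|\cdot)$, and let $(e,h,f)$ be an $\mathfrak{sl}_2$-triple of even elements, normalized by $(e|f)=\tfrac12(h|h)=1$. Let $\mathfrak g=\bigoplus_{i\in\frac12\mathbb Z}\mathfrak g(i)$ be the eigenspace decomposition of $\operatorname{ad}\frac h2$, and put $\mathfrak m=\bigoplus_{i\ge 1}\mathfrak g(i)$, $\mathfrak n=\bigoplus_{i>0}\mathfrak g(i)$, $\mathfrak p=\bigoplus_{i<1}\mathfrak g(i)$, and $\mathfrak m^\perp=\bigoplus_{i>-1}\mathfrak g(i)$, the orthogonal complement of $\mathfrak m$. Let $d$ be the largest $i$ with $\mathfrak g(i)\ne0$, let $s\in\mathfrak g(d)$ be a nonzero even element, and let $k\in\mathbb C$. Let $\mathcal P=S(\mathbb C[\partial]\otimes\mathfrak g)$ be the differential superalgebra generated by $\mathfrak g$. For $i=1,2$ let $\{\cdot_\lambda\cdot\}_i$ be the $\lambda$-bracket on $\mathcal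 P$ which, for $a,b\in\mathfrak g$, is given by $$\{a_\lambda b\}_1=[a,b]+k\lambda(a|b),\qquad \{a_\lambda b\}_2=(s|[a,b]).$$ Let $\mathcal I\subset\mathcal P$ be the differential ideal generated by $m+(f|m)$, $m\in\mathfrak m$, and let $\mathcal V=\mathcal P/\mathcal I$. The classical affine $W$-superalgebra is $W=W(\mathfrak g,f,k)=\{A+\mathcal I\in\mathcal V:\ \{n_\lambda A\}_1\in\mathcal I[\lambda]\ \text{for all } n\in\mathfrak n\}$, with the two $\lambda$-brackets induced from $\mathcal P$. For $u\in W$ let $\int u$ be its class in $W/\partial W$, and put $[\int u,\int v]_i=\int\{u_\lambda v\}_i|_{\lambda=0}$. On $\mathfrak g((z^{-1}))\otimes\mathcal V$ (completed, i.e. $\mathfrak g\otimes\mathcal V((z^{-1}))$) use $[a\otimes F,b\otimes G]=(-1)^{p(b)p(F)}[a,b]\otimes FG$, $(az^m\otimes F|bz^n\otimes G)=(-1)^{p(b)p(F)}\delta_{m+n,0}(a|b)FG$, $(a\otimes F)^\sigma=(-1)^{p(a)p(F)}a\otimes F$, and $[\partial,a\otimes F]=a\otimes\partial F$. Grade $\mathfrak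 g((z^{-1}))$ by $\deg z=-d-1$ and $\deg a=i$ for $a\in\mathfrak g(i)$; a subscript $t$ denotes the degree-$t$ part. Let $\Lambda=f+zs$ and assume that $\Lambda$ is semisimple in $\mathfrak g((z^{-1}))$, i.e. $\operatorname{ad}\Lambda$ is a semisimple endomorphism of the $\mathbb C((z^{-1}))$-vector space $\mathfrak g((z^{-1}))$. Let $q_{\rm univ}=\sum_i q_i\otimes q^i$, where $(q^i)$ is a basis of $\mathfrak p$ and $(q_i)$ is the basis of $\mathfrak m^\perp$ with $(q_i|q^j)=\delta_{ij}$. There is a unique pair of even elements $S\in\prod_{t>0}\operatorname{im}(\operatorname{ad}\Lambda)_t\otimes\mathcal V$ and $\mathsf h\in\prod_{t>-1}\ker(\operatorname{ad}\Lambda)_t\otimes\mathcal V$ such that $$e^{\operatorname{ad}S^\sigma}\bigl(k\partial+q_{\rm univ}^\sigma-\Lambda\otimes1\bigr)=k\partial+\mathsf h^\sigma-\Lambda\otimes1 .$$ Put $H_n=(\mathsf h^\sigma\,|\,z^n\Lambda\otimes1)\in\mathcal V$ for $n\in\mathbb Z$. **Theorem.** Under these assumptions the pair $(S,\mathsf h)$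 exists and is unique, and the following hold. 1. For every $n\in\mathbb Z$ there is an even $\hat H_n\in W$ with $H_n-\hat H_n\in\partial\mathcal V$. Fix any such choice and write $\int H_n:=\int\hat H_n$ and $\{H_{n\,\lambda}\,u\}_i|_{\lambda=0}:=\{\hat H_{n\,\lambda}\,u\}_i|_{\lambda=0}$ (for $u\in W$). 2. (Lenard–Magri relations) For all $i\in\mathbb Z$ and $u\in W$, the elements $\{H_{i\,\lambda}u\}_1|_{\lambda=0}$ and $\{H_{i+1\,\lambda}u\}_2|_{\lambda=0}$ lie in $W$ and $$[\textstyle\int H_i,\int u]_1=[\int H_{i+1},\int u]_2;\qquad\text{moreover } [\textstyle\int H_0,\int u]_2=0 .$$ 3. For every $i\in\mathbb Z$, all the $\int H_j$ ($j\in\mathbb Z$) are integrals of motion of the equation $\dfrac{du}{dt}=\{H_{i\,\lambda}u\}_1|_{\lambda=0}$, $u\in W$; that is, $\int\{H_{i\,\lambda}H_j\}_1|_{\lambda=0}=0$. 4. The $\int H_j$, $j\in\mathbb Z_{\ge0}$, are linearly independent in $W/\partial W$. Hence, for every $i\in\mathbb Z$, this equation is an integrable super-Hamiltonian equation on $W$: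 its Hamiltonian is an even element of $W$, and it has infinitely many linearly independent integrals of motion. -/

import Mathlib

open scoped TensorProduct Polynomial

noncomputable section

namespace WSuper

/-- The sign `(-1)^i` of a parity `i ∈ ℤ/2`. -/
def sg (i : ZMod 2) : ℂ := if i = 0 then 1 else -1

/-- A (complex) Lie superalgebra. The `ℤ/2`-grading `g = g₀ ⊕ g₁` is encoded by the parity
involution `par`, which acts on `gᵢ` as `(-1)^i`; so `gᵢ = {a | par a = (-1)^i a}`. -/
structure LieSuperalgebra (g : Type*) [AddCommGroup g] [Module ℂ g] where
  par : g →ₗ[ℂ] g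
  par_par : ∀ a, par (par a) = a
  br : g →ₗ[ℂ] g →ₗ[ℂ] g
  par_br : ∀ a b, par (br a b) = br (par a) (par b)
  skew : ∀ (i j : ZMod 2) (a b : g), par a = sg i • a → par b = sg j • b →
    br a b = -(sg (i * j) • br b a)
  jacobi : ∀ (i j : ZMod 2) (a b c : g), par a = sg i • a → par b = sg j • b →
    br a (br b c) = br (br a b) c + sg (i * j) • br b (br a c)

/-- Simplicity of a Lie superalgebra: it is not abelian, and has no graded ideals besides `0` and
itself. -/
def LieSuperalgebra.IsSimple {g : Type*} [AddCommGroup g] [Module ℂ g]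
    (L : LieSuperalgebra g) : Prop :=
  (∃ a b, L.br a b ≠ 0) ∧
    ∀ J : Submodule ℂ g, (∀ a ∈ J, L.par a ∈ J) → (∀ a, ∀ b ∈ J, L.br a b ∈ J) → J = ⊥ ∨ J = ⊤

/-- The data of the construction: a simple Lie superalgebra, a nondegenerate invariant even
supersymmetric bilinear form `B`, and an even `sl₂`-triple `(e,h,f)` with
`(e|f) = (h|h)/2 = 1`. -/
structure Setup (g : Type*) [AddCommGroup g] [Module ℂ g] extends LieSuperalgebra g where
  simple : toLieSuperalgebra.IsSimple
  B : g →ₗ[ℂ] g →ₗ[ℂ] ℂ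
  B_even : ∀ a b, B (par a) (par b) = B a b
  B_symm : ∀ (i j : ZMod 2) (a b : g), par a = sg i • a → par b = sg j • b →
    B a b = sg (i * j) * B b a
  B_inv : ∀ a b c, B (br a b) c = B a (br b c)
  B_nondeg : ∀ a, (∀ b, B a b = 0) → a = 0
  e : g
  h : g
  f : g
  e_even : par e = e
  h_even : par h = h
  f_even : par f = f
  br_h_e : br h e = (2 : ℂ) • e
  br_h_f : br h f = -((2 : ℂ) • f)
  br_e_f : br e f = h
  B_e_f : B e f = 1
  B_h_h : B h h = 2

namespace Setup

variable {g : Type*} [AddCommGroup g] [Module ℂ g] (S : Setup g)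

/-- `gr j` is the eigenspace `g(j/2)` of `ad (h/2)` with eigenvalue `j/2`. -/
def gr (j : ℤ) : Submodule ℂ g := Module.End.eigenspace (S.br S.h) (j : ℂ)

/-- `𝔪 = ⨁_{i ≥ 1} g(i)` -/
def mm : Submodule ℂ g := ⨆ j : ℤ, ⨆ _ : 2 ≤ j, S.gr j

/-- `𝔫 = ⨁_{i > 0} g(i)` -/
def nn : Submodule ℂ g := ⨆ j : ℤ, ⨆ _ : 0 < j, S.gr j

/-- `𝔭 = ⨁_{i < 1} g(i)` -/
def pp : Submodule ℂ g := ⨆ j : ℤ, ⨆ _ : j < 2, S.gr j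

/-- `𝔪^⊥ = ⨁_{i > -1} g(i)` -/
def mperp : Submodule ℂ g := ⨆ j : ℤ, ⨆ _ : -2 < j, S.gr j

/-- The even component of an element of `g`. -/
def ev : g →ₗ[ℂ] g := (2⁻¹ : ℂ) • (LinearMap.id + S.par)

/-- The odd component of an element of `g`. -/
def od : g →ₗ[ℂ] g := (2⁻¹ : ℂ) • (LinearMap.id - S.par)

/-- Generator `∂^n a` of the free algebra on which the differential superalgebras below are
presented. -/
def sy (n : ℕ) (a : g) : FreeAlgebra ℂ (ℕ × g) := FreeAlgebra.ι ℂ (n, a)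

/-- Relations presenting, for `q = false`, the supersymmetric algebra `S(ℂ[∂] ⊗ g)`, and, for
`q = true`, its quotient by the differential ideal generated by `m + (f|m)`, `m ∈ 𝔪`
(that ideal is generated as an ideal by the `m + (f|m)` and the `∂^(n+1) m`). -/
inductive Rel (q : Bool) : FreeAlgebra ℂ (ℕ × g) → FreeAlgebra ℂ (ℕ × g) → Prop
  | add (n : ℕ) (a b : g) : Rel q (sy n (a + b)) (sy n a + sy n b)
  | smul (n : ℕ) (c : ℂ) (a : g) : Rel q (sy n (c • a)) (c • sy n a)
  | comm (n m : ℕ) (i j : ZMod 2) (a b : g) (ha : S.par a = sg i • a) (hb : S.par b = sg j • b) :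
      Rel q (sy n a * sy m b) (sg (i * j) • (sy m b * sy n a))
  | ideal_zero (hq : q = true) (a : g) (ha : a ∈ S.mm) :
      Rel q (sy 0 a) (algebraMap ℂ _ (-(S.B S.f a)))
  | ideal_succ (hq : q = true) (n : ℕ) (a : g) (ha : a ∈ S.mm) : Rel q (sy (n + 1) a) 0

/-- The differential superalgebra presented by `Rel q`. -/
def DA (q : Bool) : Type _ := RingQuot (S.Rel q)

instance (q : Bool) : Ring (S.DA q) := inferInstanceAs (Ring (RingQuot (S.Rel q)))

instance (q : Bool) : Algebra ℂ (S.DA q) := inferInstanceAs (Algebra ℂ (RingQuot (S.Rel q)))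

/-- The differential superalgebra `𝒫 = S(ℂ[∂] ⊗ g)` underlying the affine Poisson vertex algebra. -/
abbrev P : Type _ := S.DA false

/-- The quotient `𝒱 = 𝒫 / ℐ`, where `ℐ` is the differential ideal generated by `m + (f|m)`,
`m ∈ 𝔪`. -/
abbrev V : Type _ := S.DA true

/-- The projection from the free algebra. -/
def proj (q : Bool) : FreeAlgebra ℂ (ℕ × g) →ₐ[ℂ] S.DA q := RingQuot.mkAlgHom ℂ (S.Rel q)

lemma proj_surjective (q : Bool) : Function.Surjective (S.proj q) :=
  RingQuot.mkAlgHom_surjective ℂ (S.Rel q)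

lemma proj_rel (q : Bool) {x y : FreeAlgebra ℂ (ℕ × g)} (hxy : S.Rel q x y) :
    S.proj q x = S.proj q y := RingQuot.mkAlgHom_rel ℂ hxy

/-- Universal property of the presentation. -/
def lift (q : Bool) {A : Type*} [Ring A] [Algebra ℂ A] (F : ℕ × g → A)
    (hF : ∀ x y, S.Rel q x y → FreeAlgebra.lift ℂ F x = FreeAlgebra.lift ℂ F y) :
    S.DA q →ₐ[ℂ] A :=
  RingQuot.liftAlgHom ℂ ⟨FreeAlgebra.lift ℂ F, fun x y hxy => hF x y hxy⟩

lemma lift_proj (q : Bool) {A : Type*} [Ring A] [Algebra ℂ A] (F : ℕ × g → A)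
    (hF : ∀ x y, S.Rel q x y → FreeAlgebra.lift ℂ F x = FreeAlgebra.lift ℂ F y)
    (x : FreeAlgebra ℂ (ℕ × g)) : S.lift q F hF (S.proj q x) = FreeAlgebra.lift ℂ F x :=
  RingQuot.liftAlgHom_mkAlgHom_apply ℂ _ _ _

/-- The element `∂^n a`, for `a ∈ g`. -/
def gen (q : Bool) (n : ℕ) : g →ₗ[ℂ] S.DA q where
  toFun a := S.proj q (sy n a)
  map_add' a b := by rw [S.proj_rel q (Rel.add n a b), map_add]
  map_smul' c a := by rw [S.proj_rel q (Rel.smul n c a), map_smul, RingHom.id_apply]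

lemma proj_sy (q : Bool) (n : ℕ) (a : g) : S.proj q (sy n a) = S.gen q n a := rfl

lemma gen_comm (q : Bool) (n m : ℕ) (i j : ZMod 2) (a b : g) (ha : S.par a = sg i • a)
    (hb : S.par b = sg j • b) :
    S.gen q n a * S.gen q m b = sg (i * j) • (S.gen q m b * S.gen q n a) := by
  have := S.proj_rel q (Rel.comm n m i j a b ha hb)
  simpa only [map_mul, map_smul, proj_sy] using this

lemma gen_true_zero (a : g) (ha : a ∈ S.mm) :
    S.gen true 0 a = algebraMap ℂ _ (-(S.B S.f a)) := by
  have := S.proj_rel true (Rel.ideal_zero rfl a ha)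
  rwa [AlgHom.commutes] at this

lemma gen_true_succ (n : ℕ) (a : g) (ha : a ∈ S.mm) : S.gen true (n + 1) a = 0 := by
  have := S.proj_rel true (Rel.ideal_succ rfl n a ha)
  rwa [map_zero] at this

lemma DA_induction (q : Bool) {motive : S.DA q → Prop}
    (scalar : ∀ c : ℂ, motive (algebraMap ℂ _ c)) (gen : ∀ n a, motive (S.gen q n a))
    (mul : ∀ x y, motive x → motive y → motive (x * y))
    (add : ∀ x y, motive x → motive y → motive (x + y)) (x : S.DA q) : motive x := by
  obtain ⟨x, rfl⟩ := S.proj_surjective q x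
  induction x using FreeAlgebra.induction with
  | grade0 r => rw [AlgHom.commutes]; exact scalar r
  | grade1 x => exact gen x.1 x.2
  | mul a b ha hb => rw [map_mul]; exact mul _ _ ha hb
  | add a b ha hb => rw [map_add]; exact add _ _ ha hb

lemma par_mem_gr {j : ℤ} {a : g} (ha : a ∈ S.gr j) : S.par a ∈ S.gr j := by
  rw [gr, Module.End.mem_eigenspace_iff] at ha ⊢
  rw [← map_smul, ← ha, S.par_br, S.h_even]

lemma par_mem_mm {a : g} (ha : a ∈ S.mm) : S.par a ∈ S.mm := by
  have : S.mm ≤ S.mm.comap S.par := by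
    refine iSup₂_le fun j hj x hx => ?_
    exact (le_iSup₂_of_le (f := fun (j : ℤ) (_ : 2 ≤ j) => S.gr j) j hj le_rfl)
      (S.par_mem_gr hx)
  exact this ha

lemma par_homog {i : ZMod 2} {a : g} (ha : S.par a = sg i • a) :
    S.par (S.par a) = sg i • S.par a := by
  rw [ha, map_smul, ha]

/-- The parity involution `F ↦ (-1)^{p(F)} F`. -/
def sgn (q : Bool) : S.DA q →ₐ[ℂ] S.DA q :=
  S.lift q (fun x => S.gen q x.1 (S.par x.2)) (by
    intro x y hxy
    induction hxy with
    | add n a b => simp [sy]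
    | smul n c a => simp [sy]
    | comm n m i j a b ha hb =>
      simpa [sy] using S.gen_comm q n m i j _ _ (S.par_homog ha) (S.par_homog hb)
    | ideal_zero hq a ha =>
      subst hq
      simp only [sy, FreeAlgebra.lift_ι_apply, AlgHom.commutes]
      rw [S.gen_true_zero _ (S.par_mem_mm ha)]
      conv_lhs => rw [← S.f_even, S.B_even]
    | ideal_succ hq n a ha =>
      subst hq
      simp only [sy, FreeAlgebra.lift_ι_apply, map_zero]
      exact S.gen_true_succ n _ (S.par_mem_mm ha))

lemma sgn_gen (q : Bool) (n : ℕ) (a : g) : S.sgn q (S.gen q n a) = S.gen q n (S.par a) := by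
  rw [sgn, ← proj_sy, lift_proj, sy, FreeAlgebra.lift_ι_apply]

/-- The algebra homomorphism `x ↦ !![x, ∂x; 0, x]`. -/
def derHom (q : Bool) : S.DA q →ₐ[ℂ] Matrix (Fin 2) (Fin 2) (S.DA q) :=
  S.lift q (fun x => !![S.gen q x.1 x.2, S.gen q (x.1 + 1) x.2; 0, S.gen q x.1 x.2]) (by
    intro x y hxy
    induction hxy with
    | add n a b => ext i j; fin_cases i <;> fin_cases j <;> simp [sy]
    | smul n c a => ext i j; fin_cases i <;> fin_cases j <;> simp [sy]
    | comm n m i j a b ha hb =>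
      have h1 := S.gen_comm q n m i j a b ha hb
      have h2 := S.gen_comm q (n + 1) m i j a b ha hb
      have h3 := S.gen_comm q n (m + 1) i j a b ha hb
      ext k l
      fin_cases k <;> fin_cases l <;> simp [sy, h1, h2, h3, add_comm]
    | ideal_zero hq a ha =>
      subst hq
      have h1 := S.gen_true_zero a ha
      have h2 := S.gen_true_succ 0 a ha
      rw [zero_add] at h2
      simp only [sy, FreeAlgebra.lift_ι_apply, AlgHom.commutes, zero_add, h1, h2]
      ext k l
      fin_cases k <;> fin_cases l <;> simp [Matrix.algebraMap_matrix_apply]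
    | ideal_succ hq n a ha =>
      subst hq
      have h1 := S.gen_true_succ n a ha
      have h2 := S.gen_true_succ (n + 1) a ha
      simp only [sy, FreeAlgebra.lift_ι_apply, map_zero, h1, h2]
      ext k l
      fin_cases k <;> fin_cases l <;> simp)

/-- The even derivation `∂` with `∂ (∂^n a) = ∂^(n+1) a`. -/
def der (q : Bool) : S.DA q →ₗ[ℂ] S.DA q where
  toFun x := S.derHom q x 0 1
  map_add' x y := by simp
  map_smul' c x := by simp

/-- The quotient map `𝒫 → 𝒱 = 𝒫 / ℐ`. -/
def rho : S.P →ₐ[ℂ] S.V :=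
  S.lift false (fun x => S.gen true x.1 x.2) (by
    intro x y hxy
    induction hxy with
    | add n a b => simp [sy]
    | smul n c a => simp [sy]
    | comm n m i j a b ha hb => simpa [sy] using S.gen_comm true n m i j a b ha hb
    | ideal_zero hq => exact absurd hq (by decide)
    | ideal_succ hq => exact absurd hq (by decide))

lemma rho_gen (n : ℕ) (a : g) : S.rho (S.gen false n a) = S.gen true n a := by
  rw [rho, ← proj_sy, lift_proj, sy, FreeAlgebra.lift_ι_apply]

lemma rho_surjective : Function.Surjective S.rho := by
  intro x
  induction x using S.DA_induction true with
  | scalar c => exact ⟨algebraMap ℂ _ c, AlgHom.commutes _ _⟩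
  | gen n a => exact ⟨_, S.rho_gen n a⟩
  | mul x y hx hy =>
    obtain ⟨x, rfl⟩ := hx
    obtain ⟨y, rfl⟩ := hy
    exact ⟨x * y, map_mul _ _ _⟩
  | add x y hx hy =>
    obtain ⟨x, rfl⟩ := hx
    obtain ⟨y, rfl⟩ := hy
    exact ⟨x + y, map_add _ _ _⟩

/-! ### The `λ`-brackets on `𝒫`

The variable `λ` is the polynomial variable of `𝒫[λ]`. -/

/-- Coefficientwise action of an endomorphism of `𝒫` on `𝒫[λ]`. -/
def cw (φ : S.P →ₗ[ℂ] S.P) : S.P[X] →ₗ[ℂ] S.P[X] :=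
  Polynomial.lsum fun n => (Polynomial.monomial n).restrictScalars ℂ ∘ₗ φ

/-- The operator `λ + ∂` on `𝒫[λ]`. -/
def lamD : S.P[X] →ₗ[ℂ] S.P[X] := LinearMap.mulLeft ℂ Polynomial.X + S.cw (S.der false)

/-- The substitution `Σ c_n λ^n ↦ Σ (-λ-∂)^n c_n`. -/
def flip : S.P[X] →ₗ[ℂ] S.P[X] :=
  Polynomial.lsum fun n => ((-S.lamD) ^ n) ∘ₗ (Polynomial.monomial 0).restrictScalars ℂ

/-- The parity involution on `𝒫[λ]` (with `λ` even). -/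
def sgnX : S.P[X] →ₗ[ℂ] S.P[X] := S.cw (S.sgn false).toLinearMap

/-- `x ↦ (-1)^{i p(x)} x` on `g`. -/
def tw (i : ZMod 2) : g →ₗ[ℂ] g := if i = 0 then LinearMap.id else S.par

/-- The component of parity `i` of a linear map `φ : g → 𝒫[λ]`. -/
def comp (i : ZMod 2) (φ : g →ₗ[ℂ] S.P[X]) : g →ₗ[ℂ] S.P[X] :=
  (2⁻¹ : ℂ) • (φ + sg i • (S.sgnX ∘ₗ φ ∘ₗ S.par))

lemma zmod2_cases (i : ZMod 2) : i = 0 ∨ i = 1 := by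
  revert i
  decide

lemma tw_homog (i : ZMod 2) {j : ZMod 2} {a : g} (ha : S.par a = sg j • a) :
    S.tw i a = sg (i * j) • a := by
  rcases zmod2_cases i with rfl | rfl <;> simp [tw, sg] at ha ⊢
  simpa [sg] using ha

lemma coeff_cw (φ : S.P →ₗ[ℂ] S.P) (p : S.P[X]) (n : ℕ) :
    (S.cw φ p).coeff n = φ (p.coeff n) := by
  induction p using Polynomial.induction_on' with
  | add p q hp hq => simp [hp, hq]
  | monomial m a =>
    simp only [cw, Polynomial.lsum_apply]
    rw [Polynomial.sum_monomial_index _ _ (by simp)]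
    simp only [LinearMap.comp_apply, LinearMap.restrictScalars_apply, Polynomial.coeff_monomial]
    split_ifs <;> simp

lemma sgn_sgn (q : Bool) (x : S.DA q) : S.sgn q (S.sgn q x) = x := by
  induction x using S.DA_induction q with
  | scalar c => simp
  | gen n a => rw [sgn_gen, sgn_gen, S.par_par]
  | mul x y hx hy => rw [map_mul, map_mul, hx, hy]
  | add x y hx hy => rw [map_add, map_add, hx, hy]

lemma derHom_gen (q : Bool) (n : ℕ) (a : g) :
    S.derHom q (S.gen q n a) = !![S.gen q n a, S.gen q (n + 1) a; 0, S.gen q n a] := by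
  conv_lhs => rw [derHom, ← proj_sy, lift_proj, sy, FreeAlgebra.lift_ι_apply]

lemma der_gen (q : Bool) (n : ℕ) (a : g) : S.der q (S.gen q n a) = S.gen q (n + 1) a := by
  change S.derHom q (S.gen q n a) 0 1 = _
  rw [derHom_gen]
  rfl

lemma derHom_diag (q : Bool) (x : S.DA q) :
    S.derHom q x 0 0 = x ∧ S.derHom q x 1 0 = 0 ∧ S.derHom q x 1 1 = x := by
  induction x using S.DA_induction q with
  | scalar c => simp [Matrix.algebraMap_matrix_apply]
  | gen n a => simp [derHom_gen]
  | mul x y hx hy => simp [Matrix.mul_apply, Fin.sum_univ_two, hx, hy]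
  | add x y hx hy => simp [hx, hy]

lemma der_mul (q : Bool) (x y : S.DA q) : S.der q (x * y) = S.der q x * y + x * S.der q y := by
  change S.derHom q (x * y) 0 1 = S.derHom q x 0 1 * y + x * S.derHom q y 0 1
  simp [Matrix.mul_apply, Fin.sum_univ_two, derHom_diag, add_comm]

lemma der_algebraMap (q : Bool) (c : ℂ) : S.der q (algebraMap ℂ _ c) = 0 := by
  change S.derHom q (algebraMap ℂ _ c) 0 1 = 0
  simp [Matrix.algebraMap_matrix_apply]

lemma sgn_der (q : Bool) (x : S.DA q) : S.sgn q (S.der q x) = S.der q (S.sgn q x) := by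
  induction x using S.DA_induction q with
  | scalar c => simp [der_algebraMap]
  | gen n a => rw [der_gen, sgn_gen, sgn_gen, der_gen]
  | mul x y hx hy => simp only [der_mul, map_add, map_mul, hx, hy]
  | add x y hx hy => simp only [map_add, hx, hy]

lemma sgnX_lamD (p : S.P[X]) : S.sgnX (S.lamD p) = S.lamD (S.sgnX p) := by
  ext n
  cases n <;>
  simp [sgnX, lamD, coeff_cw, Polynomial.coeff_X_mul, sgn_der]

lemma sgnX_lamD_pow (n : ℕ) (p : S.P[X]) :
    S.sgnX ((S.lamD ^ n) p) = (S.lamD ^ n) (S.sgnX p) := by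
  induction n with
  | zero => rfl
  | succ n ih => rw [pow_succ', Module.End.mul_apply, sgnX_lamD, ih, Module.End.mul_apply]

lemma sgnX_comp (i : ZMod 2) (φ : g →ₗ[ℂ] S.P[X]) (a : g) :
    S.sgnX (S.comp i φ a) = sg i • S.comp i φ (S.par a) := by
  have h1 : ∀ p : S.P[X], S.sgnX (S.sgnX p) = p := fun p => by
    ext n; simp [sgnX, coeff_cw, sgn_sgn]
  rcases zmod2_cases i with rfl | rfl <;>
  simp [comp, sg, h1, S.par_par, add_comm, ← smul_neg]

lemma gen_mul (q : Bool) (n : ℕ) (j : ZMod 2) (a : g) (ha : S.par a = sg j • a) (x : S.DA q) :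
    S.gen q n a * x = (if j = 0 then x else S.sgn q x) * S.gen q n a := by
  induction x using S.DA_induction q with
  | scalar c => simp [Algebra.commutes]
  | gen m b =>
    have h0 : S.par (S.ev b) = sg 0 • S.ev b := by
      simp [ev, sg, S.par_par, add_comm]
    have h1 : S.par (S.od b) = sg 1 • S.od b := by
      simp [od, sg, S.par_par, ← smul_neg]
    have hb : b = S.ev b + S.od b := by
      simp only [ev, od, LinearMap.smul_apply, LinearMap.add_apply, LinearMap.sub_apply,
        LinearMap.id_apply, ← smul_add, add_add_sub_cancel]
      rw [← two_smul ℂ b, smul_smul]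
      norm_num
    rw [hb]
    simp only [map_add, mul_add, sgn_gen]
    rw [S.gen_comm q n m j 0 a _ ha h0, S.gen_comm q n m j 1 a _ ha h1, h0, h1]
    rcases zmod2_cases j with rfl | rfl <;> simp [sg, add_mul]
  | mul x y hx hy =>
    rw [← mul_assoc, hx, mul_assoc, hy, ← mul_assoc]
    split_ifs <;> simp
  | add x y hx hy =>
    rw [mul_add, hx, hy, ← add_mul]
    split_ifs <;> simp

lemma C_gen_mul (n : ℕ) (i j : ZMod 2) (a : g) (ha : S.par a = sg j • a) (p : S.P[X])
    (hp : S.sgnX p = sg i • p) :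
    Polynomial.C (S.gen false n a) * p = sg (i * j) • (p * Polynomial.C (S.gen false n a)) := by
  ext m
  have hm : S.sgn false (p.coeff m) = sg i • p.coeff m := by
    have := congrArg (fun r => Polynomial.coeff r m) hp
    simpa [sgnX, coeff_cw] using this
  rw [Polynomial.coeff_C_mul, Polynomial.coeff_smul, Polynomial.coeff_mul_C,
    S.gen_mul false n j a ha, hm]
  rcases zmod2_cases j with rfl | rfl <;> simp [sg]

/-- The algebra homomorphism `x ↦ !![(-1)^{i p(x)} x, D x; 0, x]`, where `D` is the super-derivation
`𝒫 → 𝒫[λ]` of parity `i` such that `D (∂^n a) = (λ+∂)^n (φᵢ a)`, `φᵢ` being the component of parity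
`i` of `φ`. -/
def extHom (i : ZMod 2) (φ : g →ₗ[ℂ] S.P[X]) :
    S.P →ₐ[ℂ] Matrix (Fin 2) (Fin 2) S.P[X] :=
  S.lift false (fun x => !![Polynomial.C (S.gen false x.1 (S.tw i x.2)),
      (S.lamD ^ x.1) (S.comp i φ x.2); 0, Polynomial.C (S.gen false x.1 x.2)]) (by
    intro x y hxy
    induction hxy with
    | add n a b => ext k l; fin_cases k <;> fin_cases l <;> simp [sy]
    | smul n c a => ext k l; fin_cases k <;> fin_cases l <;> simp [sy, Polynomial.smul_C]
    | comm n m j l a b ha hb =>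
      have key : ∀ (n m : ℕ) (j l : ZMod 2) (a b : g), S.par a = sg j • a → S.par b = sg l • b →
          Polynomial.C (S.gen false n (S.tw i a)) * (S.lamD ^ m) (S.comp i φ b) =
            sg (j * l) •
              ((S.lamD ^ m) (S.comp i φ b) * Polynomial.C (S.gen false n a)) := by
        intro n m j l a b ha hb
        have hp : S.sgnX ((S.lamD ^ m) (S.comp i φ b)) =
            sg (i + l) • (S.lamD ^ m) (S.comp i φ b) := by
          rw [sgnX_lamD_pow, sgnX_comp, hb, map_smul, map_smul, map_smul, smul_smul]
          congr 1
          rcases zmod2_cases i with rfl | rfl <;> rcases zmod2_cases l with rfl | rfl <;>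
            simp [sg, show (1 : ZMod 2) + 1 = 0 from rfl]
        rw [S.tw_homog i ha, map_smul, ← Polynomial.smul_C, smul_mul_assoc,
          S.C_gen_mul n (i + l) j a ha _ hp, smul_smul]
        congr 1
        rcases zmod2_cases i with rfl | rfl <;> rcases zmod2_cases l with rfl | rfl <;>
          rcases zmod2_cases j with rfl | rfl <;>
          simp [sg, show (1 : ZMod 2) + 1 = 0 from rfl]
      have k1 := key n m j l a b ha hb
      have k2 := key m n l j b a hb ha
      have h1 := S.gen_comm false n m j l a b ha hb
      have h2 : S.gen false n (S.tw i a) * S.gen false m (S.tw i b) =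
          sg (j * l) • (S.gen false m (S.tw i b) * S.gen false n (S.tw i a)) := by
        rw [S.tw_homog i ha, S.tw_homog i hb, map_smul, map_smul, smul_mul_smul_comm, h1,
          smul_mul_smul_comm, smul_smul, smul_smul]
        congr 1
        ring
      have h3 : sg (j * l) * sg (l * j) = 1 := by
        rcases zmod2_cases l with rfl | rfl <;> rcases zmod2_cases j with rfl | rfl <;> simp [sg]
      have h1' : (Polynomial.C (S.gen false n a) : S.P[X]) * Polynomial.C (S.gen false m b) =
          sg (j * l) • (Polynomial.C (S.gen false m b) * Polynomial.C (S.gen false n a)) := by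
        rw [← map_mul, h1, ← Polynomial.smul_C, map_mul]
      have h2' : (Polynomial.C (S.gen false n (S.tw i a)) : S.P[X]) *
          Polynomial.C (S.gen false m (S.tw i b)) = sg (j * l) •
            (Polynomial.C (S.gen false m (S.tw i b)) *
              Polynomial.C (S.gen false n (S.tw i a))) := by
        rw [← map_mul, h2, ← Polynomial.smul_C, map_mul]
      ext1 k' l'
      fin_cases k' <;> fin_cases l'
      · simp [sy, h2']
      · simp [sy, k1, k2, smul_smul, h3, add_comm]
      · simp [sy]
      · simp [sy, h1']
    | ideal_zero hq => exact absurd hq (by decide)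
    | ideal_succ hq => exact absurd hq (by decide))

/-- The twist `x ↦ (-1)^{i p(x)} x` on `𝒫`. -/
def twP (i : ZMod 2) : S.P →ₐ[ℂ] S.P := if i = 0 then AlgHom.id ℂ _ else S.sgn false

lemma twP_gen (i : ZMod 2) (n : ℕ) (a : g) :
    S.twP i (S.gen false n a) = S.gen false n (S.tw i a) := by
  rcases zmod2_cases i with rfl | rfl <;> simp [twP, tw, sgn_gen]

lemma extHom_gen (i : ZMod 2) (φ : g →ₗ[ℂ] S.P[X]) (n : ℕ) (a : g) :
    S.extHom i φ (S.gen false n a) = !![Polynomial.C (S.gen false n (S.tw i a)),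
      (S.lamD ^ n) (S.comp i φ a); 0, Polynomial.C (S.gen false n a)] := by
  conv_lhs => rw [extHom, ← proj_sy, lift_proj, sy, FreeAlgebra.lift_ι_apply]

lemma extHom_diag (i : ZMod 2) (φ : g →ₗ[ℂ] S.P[X]) (x : S.P) :
    S.extHom i φ x 0 0 = Polynomial.C (S.twP i x) ∧ S.extHom i φ x 1 0 = 0 ∧
      S.extHom i φ x 1 1 = Polynomial.C x := by
  induction x using S.DA_induction false with
  | scalar c => simp [Matrix.algebraMap_matrix_apply, Polynomial.algebraMap_apply]
  | gen n a => simp [extHom_gen, twP_gen]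
  | mul x y hx hy => simp [Matrix.mul_apply, Fin.sum_univ_two, hx, hy]
  | add x y hx hy => simp [hx, hy]

/-- The super-derivation of parity `i` with `∂^n a ↦ (λ+∂)^n (φᵢ a)`. -/
def extPar (i : ZMod 2) (φ : g →ₗ[ℂ] S.P[X]) : S.P →ₗ[ℂ] S.P[X] where
  toFun x := S.extHom i φ x 0 1
  map_add' x y := by simp
  map_smul' c x := by simp

lemma extPar_gen (i : ZMod 2) (φ : g →ₗ[ℂ] S.P[X]) (n : ℕ) (a : g) :
    S.extPar i φ (S.gen false n a) = (S.lamD ^ n) (S.comp i φ a) := by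
  change S.extHom i φ (S.gen false n a) 0 1 = _
  rw [extHom_gen]
  rfl

lemma extPar_algebraMap (i : ZMod 2) (φ : g →ₗ[ℂ] S.P[X]) (c : ℂ) :
    S.extPar i φ (algebraMap ℂ _ c) = 0 := by
  change S.extHom i φ (algebraMap ℂ _ c) 0 1 = 0
  simp [Matrix.algebraMap_matrix_apply]

lemma extPar_mul (i : ZMod 2) (φ : g →ₗ[ℂ] S.P[X]) (x y : S.P) :
    S.extPar i φ (x * y) =
      S.extPar i φ x * Polynomial.C y + Polynomial.C (S.twP i x) * S.extPar i φ y := by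
  change S.extHom i φ (x * y) 0 1 = S.extHom i φ x 0 1 * _ + _ * S.extHom i φ y 0 1
  simp [Matrix.mul_apply, Fin.sum_univ_two, extHom_diag, add_comm]

/-- The sum of the two super-derivations attached to the even and to the odd component of `φ`. -/
def ext (φ : g →ₗ[ℂ] S.P[X]) : S.P →ₗ[ℂ] S.P[X] := S.extPar 0 φ + S.extPar 1 φ

lemma ext_add (φ ψ : g →ₗ[ℂ] S.P[X]) : S.ext (φ + ψ) = S.ext φ + S.ext ψ := by
  have key : ∀ i x, S.extPar i (φ + ψ) x = S.extPar i φ x + S.extPar i ψ x := by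
    intro i x
    induction x using S.DA_induction false with
    | scalar c => simp [extPar_algebraMap]
    | gen n a =>
      simp only [extPar_gen, ← map_add]
      congr 1
      simp only [comp, LinearMap.smul_apply, LinearMap.add_apply, LinearMap.comp_apply, map_add,
        smul_add]
      abel
    | mul x y hx hy =>
      rw [extPar_mul, extPar_mul, extPar_mul, hx, hy, add_mul, mul_add]
      abel
    | add x y hx hy =>
      simp only [map_add, hx, hy]
      abel
  refine LinearMap.ext fun x => ?_
  simp only [ext, LinearMap.add_apply, key]
  abel

lemma ext_smul (c : ℂ) (φ : g →ₗ[ℂ] S.P[X]) : S.ext (c • φ) = c • S.ext φ := by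
  have key : ∀ i x, S.extPar i (c • φ) x = c • S.extPar i φ x := by
    intro i x
    induction x using S.DA_induction false with
    | scalar c => simp [extPar_algebraMap]
    | gen n a =>
      simp only [extPar_gen, ← map_smul]
      congr 1
      simp only [comp, LinearMap.smul_apply, LinearMap.add_apply, LinearMap.comp_apply, map_smul,
        smul_add, smul_smul]
      congr 2 <;> ring
    | mul x y hx hy =>
      rw [extPar_mul, extPar_mul, hx, hy, smul_add, smul_mul_assoc, mul_smul_comm]
    | add x y hx hy => simp only [map_add, hx, hy, smul_add]
  refine LinearMap.ext fun x => ?_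
  simp only [ext, LinearMap.add_apply, LinearMap.smul_apply, key, smul_add]

/-- For `γ a b = {a_λ b}` prescribed on `a, b ∈ g`, this is `b ↦ {b_λ u}` for `u ∈ 𝒫`: the
extension of `γ b` to `𝒫` by the Leibniz rule and by sesquilinearity. -/
def lamGen (γ : g →ₗ[ℂ] g →ₗ[ℂ] S.P[X]) (u : S.P) : g →ₗ[ℂ] S.P[X] where
  toFun b := S.ext (γ b) u
  map_add' a b := by rw [map_add, ext_add, LinearMap.add_apply]
  map_smul' c a := by rw [map_smul, ext_smul, LinearMap.smul_apply, RingHom.id_apply]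

/-- The value `{u_λ b} = -(-1)^{p(u)p(b)} {b_{-λ-∂} u}` for `u ∈ 𝒫`, `b ∈ g` forced by
skew-symmetry. -/
def lamSkew (γ : g →ₗ[ℂ] g →ₗ[ℂ] S.P[X]) (u : S.P) : g →ₗ[ℂ] S.P[X] :=
  -(S.flip ∘ₗ (S.lamGen γ u ∘ₗ S.ev + S.lamGen γ (S.sgn false u) ∘ₗ S.od))

/-- The `λ`-bracket `{u_λ v} ∈ 𝒫[λ]` on `𝒫 = S(ℂ[∂] ⊗ g)` with `{a_λ b} = γ a b` for `a, b ∈ g`. -/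
def lam (γ : g →ₗ[ℂ] g →ₗ[ℂ] S.P[X]) (u v : S.P) : S.P[X] := S.ext (S.lamSkew γ u) v

/-- `{a_λ b}₁ = [a,b] + k λ (a|b)` for `a, b ∈ g`. -/
def gam1 (k : ℂ) : g →ₗ[ℂ] g →ₗ[ℂ] S.P[X] :=
  LinearMap.mk₂ ℂ
    (fun a b => Polynomial.C (S.gen false 0 (S.br a b)) + (k * S.B a b) • Polynomial.X)
    (fun a a' b => by simp only [map_add, LinearMap.add_apply, mul_add, add_smul]; abel)
    (fun c a b => by
      simp only [map_smul, LinearMap.smul_apply, smul_add, smul_smul, smul_eq_mul,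
        Polynomial.smul_C]
      ring_nf)
    (fun a b b' => by simp only [map_add, mul_add, add_smul]; abel)
    (fun c a b => by
      simp only [map_smul, smul_add, smul_smul, smul_eq_mul, Polynomial.smul_C]
      ring_nf)

/-- `{a_λ b}₂ = (s|[a,b])` for `a, b ∈ g`. -/
def gam2 (s : g) : g →ₗ[ℂ] g →ₗ[ℂ] S.P[X] :=
  (S.br.compr₂ (S.B s)).compr₂ (Algebra.linearMap ℂ S.P[X])

/-! ### The classical affine W-superalgebra -/

/-- The extension of `𝒫 → 𝒱` to `𝒫[λ] → 𝒱[λ]`. -/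
def rhoX : S.P[X] →+* S.V[X] := Polynomial.mapRingHom S.rho.toRingHom

/-- `W(g,f,k) = (𝒫/ℐ)^{ad_λ 𝔫}`: the classes in `𝒱 = 𝒫/ℐ` of the `A ∈ 𝒫` such that
`{n_λ A}₁ ∈ ℐ[λ]` for all `n ∈ 𝔫`. -/
def W (k : ℂ) : Submodule ℂ S.V :=
  Submodule.map S.rho.toLinearMap
    { carrier := {A | ∀ n ∈ S.nn, S.rhoX (S.lam (S.gam1 k) (S.gen false 0 n) A) = 0}
      zero_mem' := fun n _ => by simp [lam]
      add_mem' := fun {A A'} hA hA' n hn => by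
        have h1 := hA n hn
        have h2 := hA' n hn
        simp only [lam] at h1 h2 ⊢
        rw [map_add, map_add, h1, h2, add_zero]
      smul_mem' := fun c A hA n hn => by
        have h1 := hA n hn
        simp only [lam] at h1 ⊢
        rw [map_smul, Algebra.smul_def, map_mul, h1, mul_zero] }

/-- A representative in `𝒫` of an element of `𝒱 = 𝒫/ℐ`. -/
def rep (u : S.V) : S.P := Function.surjInv S.rho_surjective u

/-- The `λ`-bracket on `W(g,f,k)` induced from the `λ`-bracket of `𝒫` determined by `γ`: bracket of
representatives, reduced modulo `ℐ`. (For elements of `W(g,f,k)` the choice of the representatives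
is immaterial.) -/
def lamW (γ : g →ₗ[ℂ] g →ₗ[ℂ] S.P[X]) (u v : S.V) : S.V[X] :=
  S.rhoX (S.lam γ (S.rep u) (S.rep v))

/-- `{u_λ v}₁|_{λ=0}` -/
def zero1 (k : ℂ) (u v : S.V) : S.V := (S.lamW (S.gam1 k) u v).eval 0

/-- `{u_λ v}₂|_{λ=0}` -/
def zero2 (s : g) (u v : S.V) : S.V := (S.lamW (S.gam2 s) u v).eval 0

/-- `∂W` -/
def dW (k : ℂ) : Submodule ℂ S.V := (S.W k).map (S.der true)

/-- The local functional `∫u`, i.e. the class of `u` modulo `∂W`. (It is defined on `𝒱 ⊇ W`; on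
`W` it is the quotient map onto `W/∂W ⊆ 𝒱/∂W`.) -/
def int (k : ℂ) : S.V →ₗ[ℂ] S.V ⧸ S.dW k := (S.dW k).mkQ

/-- `∫w`, `w ∈ W`, is an integral of motion of `du/dt = {H_λ u}₁|_{λ=0}`, `u ∈ W`. -/
def IsIntegralOfMotion (k : ℂ) (H w : S.V) : Prop :=
  w ∈ S.W k ∧ S.int k (S.zero1 k H w) = 0

/-- `du/dt = {H_λ u}₁|_{λ=0}`, `u ∈ W`, is an integrable super-Hamiltonian equation on `W`: `H` is
an even element of `W`, the equation is an evolution equation on `W`, and it has infinitely many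
linearly independent integrals of motion. -/
def IsIntegrable (k : ℂ) (H : S.V) : Prop :=
  H ∈ S.W k ∧ S.sgn true H = H ∧ (∀ u ∈ S.W k, S.zero1 k H u ∈ S.W k) ∧
    ∃ F : ℕ → S.V, (∀ j, S.IsIntegralOfMotion k H (F j)) ∧
      LinearIndependent ℂ fun j => S.int k (F j)

/-! ### The Lie superalgebra `ℂ∂ ⋉ (g((z⁻¹)) ⊗ 𝒱)` -/

/-- `𝒱((z⁻¹))`; the coefficient of index `m` is the coefficient of `z^{-m}`. -/
abbrev A : Type _ := HahnSeries ℤ S.V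

/-- `g((z⁻¹)) ⊗ 𝒱`, completed: since `g` is finite dimensional it is `g ⊗ 𝒱((z⁻¹))`. -/
abbrev G : Type _ := g ⊗[ℂ] S.A

/-- Coefficientwise action of an endomorphism of `𝒱` on `𝒱((z⁻¹))`. -/
def cwA (φ : S.V →ₗ[ℂ] S.V) : S.A →ₗ[ℂ] S.A where
  toFun x := x.map φ
  map_add' x y := by ext n; simp
  map_smul' c x := by ext n; simp

/-- The parity involution of `𝒱((z⁻¹))` (with `z` even). -/
def sgnA : S.A →ₗ[ℂ] S.A := S.cwA (S.sgn true).toLinearMap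

/-- The coefficient of `z^{-m}`, an element of `g ⊗ 𝒱`. -/
def coeffG (m : ℤ) : S.G →ₗ[ℂ] g ⊗[ℂ] S.V :=
  LinearMap.lTensor g (HahnSeries.coeff.linearMap m)

/-- The parity involution of `g((z⁻¹)) ⊗ 𝒱`. -/
def sgnG : S.G →ₗ[ℂ] S.G := TensorProduct.map S.par S.sgnA

/-- `∂ (a ⊗ F) = a ⊗ ∂F` -/
def derG : S.G →ₗ[ℂ] S.G := LinearMap.lTensor g (S.cwA (S.der true))

/-- The sign twist `(a ⊗ F)^σ = (-1)^{p(a)p(F)} a ⊗ F`. -/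
def sigma : S.G →ₗ[ℂ] S.G :=
  TensorProduct.map S.ev LinearMap.id + TensorProduct.map S.od S.sgnA

/-- The bracket `[a ⊗ F, b ⊗ G] = (-1)^{p(b)p(F)} [a,b] ⊗ FG`. -/
def brG : S.G →ₗ[ℂ] S.G →ₗ[ℂ] S.G :=
  (TensorProduct.map₂ S.br (LinearMap.mul ℂ S.A)).compl₂ (LinearMap.rTensor S.A S.ev) +
    ((TensorProduct.map₂ S.br (LinearMap.mul ℂ S.A)) ∘ₗ (LinearMap.lTensor g S.sgnA)).compl₂
      (LinearMap.rTensor S.A S.od)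

/-- The form `(a z^m ⊗ F | b z^n ⊗ G) = (-1)^{p(b)p(F)} (a|b) δ_{m+n,0} FG`. -/
def formG (x y : S.G) : S.V :=
  (TensorProduct.lid ℂ S.A
    (TensorProduct.map₂ S.B (LinearMap.mul ℂ S.A) x (LinearMap.rTensor S.A S.ev y) +
      TensorProduct.map₂ S.B (LinearMap.mul ℂ S.A) (LinearMap.lTensor g S.sgnA x)
        (LinearMap.rTensor S.A S.od y))).coeff 0

/-- `ad X` on `ℂ∂ ⋉ (g((z⁻¹)) ⊗ 𝒱)` for `X ∈ g((z⁻¹)) ⊗ 𝒱`, a pair `(c, Y)` standing for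
`c∂ + Y`. -/
def adOp (X : S.G) : (ℂ × S.G) →ₗ[ℂ] (ℂ × S.G) :=
  LinearMap.inr ℂ ℂ S.G ∘ₗ
    (S.brG X ∘ₗ LinearMap.snd ℂ ℂ S.G - (LinearMap.fst ℂ ℂ S.G).smulRight (S.derG X))

/-- `e^{ad X} L = L'`, where the exponential series converges coefficientwise in `z`, each
coefficient of its partial sums being eventually constant. -/
def IsExpAd (X : S.G) (L L' : ℂ × S.G) : Prop :=
  ∀ m : ℤ, ∀ᶠ N : ℕ in Filter.atTop,
    (∑ n ∈ Finset.range N, ((n.factorial : ℂ)⁻¹) • (S.adOp X ^ n) L).1 = L'.1 ∧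
    S.coeffG m (∑ n ∈ Finset.range N, ((n.factorial : ℂ)⁻¹) • (S.adOp X ^ n) L).2 =
      S.coeffG m L'.2

/-- `z^n ∈ 𝒱((z⁻¹))` -/
def zpow (n : ℤ) : S.A := HahnSeries.single (-n) 1

/-- `z^n Λ ⊗ 1`, where `Λ = f + z s`. -/
def Lam (s : g) (n : ℤ) : S.G := S.f ⊗ₜ S.zpow n + s ⊗ₜ S.zpow (n + 1)

/-- Given `s ∈ g(D/2)`, grade `g((z⁻¹))` by `deg z = -D/2-1` and `deg a = i` for `a ∈ g(i)`. This
is the condition that `x ∈ g((z⁻¹)) ⊗ 𝒱` only involves degrees `t` with `2t > c`. -/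
def DegGT (D c : ℤ) (x : S.G) : Prop :=
  ∀ m : ℤ, S.coeffG m x ∈
    LinearMap.range (LinearMap.rTensor S.V
      (⨆ j : ℤ, ⨆ _ : c < j + m * (D + 2), S.gr j : Submodule ℂ g).subtype)

/-- `q_univ = Σ qᵢ ⊗ q^i`, for bases `q^i` of `𝔭` and `qᵢ` of `𝔪^⊥`. -/
def quniv {ι : Type*} [Fintype ι] (qlo : Module.Basis ι ℂ S.mperp)
    (qup : Module.Basis ι ℂ S.pp) : S.G :=
  ∑ i, (qlo i : g) ⊗ₜ HahnSeries.C (S.gen true 0 (qup i))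

/-- `T` is an even element of `⨁_{t>0} im(ad Λ)_t ⊗ 𝒱`, `h` is an even element of
`⨁_{t>-1} ker(ad Λ)_t ⊗ 𝒱`, and
`e^{ad T^σ} (k∂ + q_univ^σ - Λ ⊗ 1) = k∂ + h^σ - Λ ⊗ 1`. -/
structure IsDressing (k : ℂ) (D : ℤ) (s : g) (q T h : S.G) : Prop where
  T_even : S.sgnG T = T
  T_deg : S.DegGT D 0 T
  T_im : T ∈ LinearMap.range (S.brG (S.Lam s 0))
  h_even : S.sgnG h = h
  h_deg : S.DegGT D (-2) h
  h_ker : S.brG (S.Lam s 0) h = 0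
  conj : S.IsExpAd (S.sigma T) (k, S.sigma q - S.Lam s 0) (k, S.sigma h - S.Lam s 0)

/-- `H_n = (h^σ | z^n Λ ⊗ 1)` -/
def Ham (s : g) (h : S.G) (n : ℤ) : S.V := S.formG (S.sigma h) (S.Lam s n)

/-- `w` is an even element of `W` which differs from `H ∈ 𝒱` by a total derivative, i.e. the local
functional of `H` is the image of `∫w ∈ W/∂W`. -/
def IsDensity (k : ℂ) (H w : S.V) : Prop :=
  w ∈ S.W k ∧ S.sgn true w = w ∧ H - w ∈ LinearMap.range (S.der true)

end Setup

/-- The field `ℂ((z⁻¹))`, as a `ℂ`-algebra; index `m` is the coefficient of `z^{-m}`. -/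
def Kz : Type := HahnSeries ℤ ℂ

instance : CommRing Kz := inferInstanceAs (CommRing (HahnSeries ℤ ℂ))

instance : Algebra ℂ Kz := inferInstanceAs (Algebra ℂ (HahnSeries ℤ ℂ))

/-- `z ∈ ℂ((z⁻¹))` -/
def Kz.z : Kz := (HahnSeries.single (-1 : ℤ) (1 : ℂ) : HahnSeries ℤ ℂ)

/-- `ad Λ`, `Λ = f + z s`, as an endomorphism of the `ℂ((z⁻¹))`-vector space
`g((z⁻¹)) = ℂ((z⁻¹)) ⊗ g`. -/
def Setup.adLam {g : Type*} [AddCommGroup g] [Module ℂ g] (S : Setup g) (s : g) :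
    Module.End Kz (Kz ⊗[ℂ] g) :=
  LinearMap.baseChange Kz (S.br S.f) + Kz.z • LinearMap.baseChange Kz (S.br s)

end WSuper

/-! Degrees in the code are doubled, so that they are integers: `Λ` has degree `-2` and `z` has
degree `-(D + 2)`. Write `T` for the dressing element, already twisted by `σ`, and `L = k∂ + Q - zs`
with `Q = q_univ^σ - f`. The element `Q` is characterised by `(Q | a ⊗ 1) = a` in `𝒱` for all `a ∈
g` (`formT_univ`).

Dressing. Since `ad Λ` is semisimple and homogeneous, it has a pseudo-inverse of degree `2` which is
a polynomial in `ad Λ` and powers of `z` (`exists_pseudo_inverse`). Hence the loop algebra is the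
direct sum of kernel and image, and `e^{ad T} L = k∂ + h - Λ` is solved degree by degree, with a
unique solution (`exists_dressing`, `dressing_unique`). Evenness of the solution follows from
uniqueness.

Variation. Put `M_n = e^{-ad T}(z^n Λ)` and let `m_n` be its constant term in `z`. If `Δ` is a
derivation compatible with `∂`, then `e^{ad T} Δ e^{-ad T} = Δ - ad Z` for some `Z`. Invariance of
the form and `[h - Λ, z^n Λ] = 0` give `(ΔQ | M_n) = Δ(H_n)` up to a total derivative
(`IsVariation.variation`, `variation_ham`). So `m_n` is the variational derivative of `H_n`.
Moreover `M_n` commutes with `L`, whose constant term gives the recursion `[Q, m_n] + k ∂m_n = [s,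
m_{n+1}]` (`recursion`).

Densities in `W`. For `n ∈ 𝔫` the operator `{n_λ ·}₁` acts on `L` as an infinitesimal gauge
transformation, hence on `M_r` as `-ad n` (`gauge_conjLam`). Since `[n, s] = 0`, the element
`(m_{n+1} | s)` lies in `W`. Taking `Δ = z d/dz` in the variation formula shows that it equals `(n +
2/(D+2)) H_n` plus a constant and a total derivative (`density`). The coefficient is never zero,
which yields the required even element of `W` (`exists_density`).

Lenard–Magri relations. The two brackets with `H_n` are evolutionary derivations, with generators
given by `-(m_n | [s, b])` for the second bracket and by the `𝔭`-part of `m_n` for the first. By the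
recursion, the derivation of `H_{n+1}` for the second bracket differs from that of `H_n` for the
first by a gauge derivation attached to the `𝔪`-part of `m_n`, and this vanishes on `W`
(`zero1_eq_zero2`). Also `H_{-1} = 0` for degree reasons.

Involution. `A(p,q) = (m_p | [s, m_q])` is antisymmetric, and the recursion gives `A(p, q+1) =
A(p+1, q)` modulo total derivatives. Shifting from `(p, q)` to `(q, p)` makes `2 A(p,q)` a total
derivative (`formT_br_s_mem`). Since `λ + ∂` is injective, `W ∩ ∂𝒱 = ∂W`, so the integrals also
vanish in `W/∂W`.

Independence. A linear relation among the `∫H_n` gives, by variation in the direction `s` and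
`density`, a shorter relation; the last coefficient is detected by `(m_0 | e) = 1`
(`eq_zero_of_sum_mem`). -/

namespace WSuper

/-! ### Exponentials of operators raising a complete filtration -/

section Exponential

variable {X Y Z : Type*} [AddCommGroup X] [Module ℂ X] [AddCommGroup Y] [Module ℂ Y]
  [AddCommGroup Z] [Module ℂ Z]

/-- A decreasing, exhaustive, separated and complete filtration. -/
structure CompleteFiltration (F : ℤ → Submodule ℂ X) : Prop where
  anti : Antitone F
  exhaustive : ∀ x, ∃ c, x ∈ F c
  separated : ∀ x, (∀ c, x ∈ F c) → x = 0
  complete : ∀ (c : ℤ) (x : ℕ → X), (∀ n : ℕ, x n ∈ F (c + n)) →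
    ∃ y, ∀ N : ℕ, y - ∑ n ∈ Finset.range N, x n ∈ F (c + N)

/-- The linear map `a` shifts filtrations by at least `d`. -/
def Raises (F : ℤ → Submodule ℂ X) (G : ℤ → Submodule ℂ Y) (a : X →ₗ[ℂ] Y) (d : ℤ) : Prop :=
  ∀ c, ∀ x ∈ F c, a x ∈ G (c + d)

/-- Partial sums of the exponential series. -/
def expSum (a : Module.End ℂ X) (N : ℕ) (x : X) : X :=
  ∑ n ∈ Finset.range N, ((n.factorial : ℂ)⁻¹) • (a ^ n) x

variable {F : ℤ → Submodule ℂ X} {G : ℤ → Submodule ℂ Y} {H : ℤ → Submodule ℂ Z}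

lemma CompleteFiltration.eq_of_forall (hF : CompleteFiltration F) {x y : X} (c : ℤ)
    (h : ∀ N : ℕ, x - y ∈ F (c + N)) : x = y := by
  refine sub_eq_zero.1 (hF.separated _ fun d => ?_)
  exact hF.anti (by have := Int.self_le_toNat (d - c); omega) (h (d - c).toNat)

lemma Raises.pow {a : Module.End ℂ X} (ha : Raises F F a 1) (n : ℕ) : Raises F F (a ^ n) n := by
  induction n with
  | zero => intro c x hx; simpa using hx
  | succ n ih =>
    intro c x hx
    rw [pow_succ', Module.End.mul_apply]
    have := ha _ _ (ih c x hx)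
    rwa [add_assoc, ← Nat.cast_succ] at this

lemma exp_term_mem {a : Module.End ℂ X} (ha : Raises F F a 1) {c : ℤ} {x : X} (hx : x ∈ F c)
    (n : ℕ) : ((n.factorial : ℂ)⁻¹) • (a ^ n) x ∈ F (c + n) :=
  Submodule.smul_mem _ _ (ha.pow n c x hx)

lemma expSum_sub_mem (hF : CompleteFiltration F) {a : Module.End ℂ X} (ha : Raises F F a 1) {c : ℤ}
    {x : X} (hx : x ∈ F c) {N N' : ℕ} (h : N ≤ N') : expSum a N' x - expSum a N x ∈ F (c + N) := by
  induction N', h using Nat.le_induction with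
  | base => simp
  | succ n hn ih =>
    rw [expSum, Finset.sum_range_succ, ← expSum, add_sub_right_comm]
    exact add_mem ih (hF.anti (by omega) (exp_term_mem ha hx n))

/-- `y` is the sum of the exponential series of `a` at `x`. -/
def IsExpLim (F : ℤ → Submodule ℂ X) (a : Module.End ℂ X) (x y : X) : Prop :=
  ∃ c, ∀ N : ℕ, y - expSum a N x ∈ F (c + N)

open Classical in
/-- The exponential of `a`, as a function. -/
def fexp (F : ℤ → Submodule ℂ X) (a : Module.End ℂ X) (x : X) : X :=
  -- The default value is never reached for an operator that raises a complete filtration by one.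
  if h : ∃ y, IsExpLim F a x y then h.choose else 0

lemma fexp_isExpLim (hF : CompleteFiltration F) {a : Module.End ℂ X} (ha : Raises F F a 1) (x : X) :
    IsExpLim F a x (fexp F a x) := by
  have h : ∃ y, IsExpLim F a x y := by
    obtain ⟨c, hc⟩ := hF.exhaustive x
    obtain ⟨y, hy⟩ := hF.complete c _ (exp_term_mem ha hc)
    exact ⟨y, c, hy⟩
  rw [fexp, dif_pos h]
  exact h.choose_spec

lemma IsExpLim.eq_fexp (hF : CompleteFiltration F) {a : Module.End ℂ X} (ha : Raises F F a 1)
    {x y : X} (h : IsExpLim F a x y) : y = fexp F a x := by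
  obtain ⟨c, hc⟩ := h
  obtain ⟨d, hd⟩ := fexp_isExpLim hF ha x
  refine hF.eq_of_forall (min c d) fun N => ?_
  rw [← sub_sub_sub_cancel_right _ _ (expSum a N x)]
  exact sub_mem (hF.anti (by omega) (hc N)) (hF.anti (by omega) (hd N))

/-- The limit comes with an unknown index `d`. Comparison with a partial sum that is `(c - d).toNat`
terms longer restores the index `c` of `x`. -/
lemma fexp_sub_mem (hF : CompleteFiltration F) {a : Module.End ℂ X} (ha : Raises F F a 1) {c : ℤ}
    {x : X} (hx : x ∈ F c) (N : ℕ) : fexp F a x - expSum a N x ∈ F (c + N) := by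
  obtain ⟨d, hd⟩ := fexp_isExpLim hF ha x
  have h1 := hd (N + (c - d).toNat)
  have h2 := expSum_sub_mem hF ha hx (Nat.le_add_right N (c - d).toNat)
  rw [← sub_add_sub_cancel _ (expSum a (N + (c - d).toNat) x)]
  refine add_mem (hF.anti ?_ h1) h2
  have := Int.self_le_toNat (c - d)
  push_cast
  omega

lemma fexp_mem (hF : CompleteFiltration F) {a : Module.End ℂ X} (ha : Raises F F a 1) {c : ℤ}
    {x : X} (hx : x ∈ F c) : fexp F a x ∈ F c := by
  simpa [expSum] using fexp_sub_mem hF ha hx 0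

lemma fexp_sub_self_mem (hF : CompleteFiltration F) {a : Module.End ℂ X} (ha : Raises F F a 1)
    {c : ℤ} {x : X} (hx : x ∈ F c) : fexp F a x - x ∈ F (c + 1) := by
  simpa [expSum] using fexp_sub_mem hF ha hx 1

lemma expSum_mem (hF : CompleteFiltration F) {a : Module.End ℂ X} (ha : Raises F F a 1) {c : ℤ}
    {x : X} (hx : x ∈ F c) (N : ℕ) : expSum a N x ∈ F c :=
  Submodule.sum_mem _ fun n _ => hF.anti (by omega) (exp_term_mem ha hx n)

/-- Both series correspond term by term under `T`, and a fixed shift `d`, even a negative one, does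
not affect convergence. Parity and multiplication by `z^n` are moved through exponentials in this
way. -/
lemma map_fexp (hF : CompleteFiltration F) (hG : CompleteFiltration G) {a : Module.End ℂ X}
    {b : Module.End ℂ Y} (ha : Raises F F a 1) (hb : Raises G G b 1) {T : X →ₗ[ℂ] Y} {d : ℤ}
    (hT : Raises F G T d) (h : ∀ x, T (a x) = b (T x)) (x : X) :
    T (fexp F a x) = fexp G b (T x) := by
  obtain ⟨c, hc⟩ := fexp_isExpLim hF ha x
  refine IsExpLim.eq_fexp hG hb ⟨c + d, fun N => ?_⟩
  have hpow : ∀ n x, T ((a ^ n) x) = (b ^ n) (T x) := by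
    intro n
    induction n with
    | zero => intro x; rfl
    | succ n ih =>
      intro x
      rw [pow_succ', pow_succ', Module.End.mul_apply, Module.End.mul_apply, h, ih]
  have := hT _ _ (hc N)
  rw [map_sub, add_right_comm] at this
  convert this using 2
  simp [expSum, hpow]

lemma fexp_add_right (hF : CompleteFiltration F) {a : Module.End ℂ X} (ha : Raises F F a 1)
    (x y : X) : fexp F a (x + y) = fexp F a x + fexp F a y := by
  obtain ⟨c, hc⟩ := fexp_isExpLim hF ha x
  obtain ⟨d, hd⟩ := fexp_isExpLim hF ha y
  refine (IsExpLim.eq_fexp hF ha ⟨min c d, fun N => ?_⟩).symm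
  have : expSum a N (x + y) = expSum a N x + expSum a N y := by
    simp [expSum, Finset.sum_add_distrib]
  rw [this, add_sub_add_comm]
  exact add_mem (hF.anti (by omega) (hc N)) (hF.anti (by omega) (hd N))

/-- The square and the triangle of a Cauchy product differ only in terms with `N ≤ i + j`. -/
lemma sum_square_sub_mem {Z : Type*} [AddCommGroup Z] [Module ℂ Z] (P : Submodule ℂ Z)
    (t : ℕ → ℕ → Z) (N : ℕ) (h : ∀ i j, N ≤ i + j → t i j ∈ P) :
    ∑ i ∈ Finset.range N, ∑ j ∈ Finset.range N, t i j -
      ∑ n ∈ Finset.range N, ∑ p ∈ Finset.HasAntidiagonal.antidiagonal n, t p.1 p.2 ∈ P := by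
  set S := (Finset.range N ×ˢ Finset.range N) with hS
  have h1 : ∑ n ∈ Finset.range N, ∑ p ∈ Finset.HasAntidiagonal.antidiagonal n, t p.1 p.2 =
      ∑ p ∈ S with p.1 + p.2 < N, t p.1 p.2 := by
    rw [← Finset.sum_fiberwise_of_maps_to (g := fun p : ℕ × ℕ => p.1 + p.2)
      (t := Finset.range N)]
    · refine Finset.sum_congr rfl fun n hn => Finset.sum_congr ?_ fun _ _ => rfl
      ext ⟨i, j⟩
      simp [hS] at hn ⊢
      omega
    · intro p hp
      simpa using (Finset.mem_filter.1 hp).2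
  rw [h1, ← Finset.sum_product', ← Finset.sum_filter_add_sum_filter_not S
    (fun p => p.1 + p.2 < N), add_sub_cancel_left]
  refine Submodule.sum_mem _ fun p hp => h _ _ ?_
  simpa using (Finset.mem_filter.1 hp).2

lemma inv_factorial_mul_choose {n i j : ℕ} (h : i + j = n) :
    (n.factorial : ℂ)⁻¹ * (n.choose i : ℂ) = (i.factorial : ℂ)⁻¹ * (j.factorial : ℂ)⁻¹ := by
  subst h
  have := Nat.add_choose_mul_factorial_mul_factorial i j
  rw [← Nat.choose_symm_add] at this
  have h1 : ((i + j).factorial : ℂ) ≠ 0 := by exact_mod_cast (i + j).factorial_ne_zero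
  have h2 : (i.factorial : ℂ) ≠ 0 := by exact_mod_cast i.factorial_ne_zero
  have h3 : (j.factorial : ℂ) ≠ 0 := by exact_mod_cast j.factorial_ne_zero
  field_simp
  exact_mod_cast this

lemma exp_term_add {a b : Module.End ℂ X} (h : Commute a b) (n : ℕ) (x : X) :
    ((n.factorial : ℂ)⁻¹) • ((a + b) ^ n) x = ∑ p ∈ Finset.HasAntidiagonal.antidiagonal n,
      ((p.1.factorial : ℂ)⁻¹) • (a ^ p.1) (((p.2.factorial : ℂ)⁻¹) • (b ^ p.2) x) := by
  rw [h.add_pow', LinearMap.sum_apply, Finset.smul_sum]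
  refine Finset.sum_congr rfl fun p hp => ?_
  rw [LinearMap.smul_apply, Module.End.mul_apply, map_smul, smul_smul,
    ← inv_factorial_mul_choose (Finset.HasAntidiagonal.mem_antidiagonal.1 hp), mul_smul, Nat.cast_smul_eq_nsmul]

lemma fexp_fexp_of_commute (hF : CompleteFiltration F) {a b : Module.End ℂ X} (ha : Raises F F a 1)
    (hb : Raises F F b 1) (h : Commute a b) (x : X) :
    fexp F a (fexp F b x) = fexp F (a + b) x := by
  have hab : Raises F F (a + b) 1 := fun c x hx => add_mem (ha c x hx) (hb c x hx)
  obtain ⟨c, hc⟩ := hF.exhaustive x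
  refine IsExpLim.eq_fexp hF hab ⟨c, fun N => ?_⟩
  have h1 : fexp F a (fexp F b x) - expSum a N (fexp F b x) ∈ F (c + N) :=
    fexp_sub_mem hF ha (fexp_mem hF hb hc) N
  have h2 : expSum a N (fexp F b x) - expSum a N (expSum b N x) ∈ F (c + N) := by
    have : expSum a N (fexp F b x) - expSum a N (expSum b N x) =
        expSum a N (fexp F b x - expSum b N x) := by
      simp [expSum, Finset.sum_sub_distrib, smul_sub]
    rw [this]
    exact expSum_mem hF ha (fexp_sub_mem hF hb hc N) N
  have h3 : expSum a N (expSum b N x) - expSum (a + b) N x ∈ F (c + N) := by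
    have := sum_square_sub_mem (F (c + N))
      (fun i j => ((i.factorial : ℂ)⁻¹) • (a ^ i) (((j.factorial : ℂ)⁻¹) • (b ^ j) x)) N
      (fun i j hij => hF.anti (by omega)
        (exp_term_mem ha (exp_term_mem hb hc j) i))
    simp only [← exp_term_add h] at this
    simpa only [expSum, map_sum, Finset.smul_sum] using this
  simpa using add_mem (add_mem h1 h2) h3

lemma fexp_neg_fexp (hF : CompleteFiltration F) {a : Module.End ℂ X} (ha : Raises F F a 1) (x : X) :
    fexp F (-a) (fexp F a x) = x := by
  have ha' : Raises F F (-a) 1 := fun c x hx => neg_mem (ha c x hx)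
  rw [fexp_fexp_of_commute hF ha' ha (Commute.neg_left (Commute.refl a)), neg_add_cancel]
  obtain ⟨c, hc⟩ := hF.exhaustive x
  refine (IsExpLim.eq_fexp hF (fun c x _ => by simp) ⟨c, fun N => ?_⟩).symm
  cases N with
  | zero => simpa [expSum] using hc
  | succ N => simp [expSum, Finset.sum_range_succ']

lemma fexp_fexp_neg (hF : CompleteFiltration F) {a : Module.End ℂ X} (ha : Raises F F a 1) (x : X) :
    fexp F a (fexp F (-a) x) = x := by
  have ha' : Raises F F (-a) 1 := fun c x hx => neg_mem (ha c x hx)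
  simpa using fexp_neg_fexp hF ha' x

/-- An infinitesimal symmetry of `β` exponentiates to a symmetry. The lemma serves for brackets, for
invariant forms and for the action of `k∂ + x`. -/
lemma bilin_fexp (hF : CompleteFiltration F) (hG : CompleteFiltration G) (hH : CompleteFiltration H)
    {a : Module.End ℂ X} {b : Module.End ℂ Y} {c : Module.End ℂ Z}
    (ha : Raises F F a 1) (hb : Raises G G b 1) (hc : Raises H H c 1)
    (β : X →ₗ[ℂ] Y →ₗ[ℂ] Z) {d : ℤ}
    (hβ : ∀ i j x y, x ∈ F i → y ∈ G j → β x y ∈ H (i + j + d))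
    (h : ∀ x y, c (β x y) = β (a x) y + β x (b y)) (x : X) (y : Y) :
    β (fexp F a x) (fexp G b y) = fexp H c (β x y) := by
  obtain ⟨i, hi⟩ := hF.exhaustive x
  obtain ⟨j, hj⟩ := hG.exhaustive y
  refine IsExpLim.eq_fexp hH hc ⟨i + j + d, fun N => ?_⟩
  have h1 : β (fexp F a x) (fexp G b y) - β (expSum a N x) (fexp G b y) ∈ H (i + j + d + N) := by
    rw [← LinearMap.sub_apply, ← map_sub]
    exact hH.anti (by omega) (hβ _ _ _ _ (fexp_sub_mem hF ha hi N) (fexp_mem hG hb hj))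
  have h2 : β (expSum a N x) (fexp G b y) - β (expSum a N x) (expSum b N y) ∈
      H (i + j + d + N) := by
    rw [← map_sub]
    exact hH.anti (by omega) (hβ _ _ _ _ (expSum_mem hF ha hi N) (fexp_sub_mem hG hb hj N))
  have hterm : ∀ n, ((n.factorial : ℂ)⁻¹) • (c ^ n) (β x y) = ∑ p ∈ Finset.HasAntidiagonal.antidiagonal n,
      β (((p.1.factorial : ℂ)⁻¹) • (a ^ p.1) x) (((p.2.factorial : ℂ)⁻¹) • (b ^ p.2) y) := by
    intro n
    -- On `X ⊗ Y` the Leibniz rule reads `c ∘ β = β ∘ (a ⊗ 1 + 1 ⊗ b)` with commuting summands, so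
    -- the binomial theorem gives the `n`-th term.
    set A : Module.End ℂ (X ⊗[ℂ] Y) := LinearMap.rTensor Y a
    set B : Module.End ℂ (X ⊗[ℂ] Y) := LinearMap.lTensor X b
    have hAB : Commute A B := by
      refine TensorProduct.ext' fun x y => ?_
      simp [A, B]
    have hcm : ∀ t, c (TensorProduct.lift β t) = TensorProduct.lift β ((A + B) t) := by
      intro t
      induction t with
      | zero => simp
      | tmul x y => simp [A, B, h]
      | add s t hs ht => rw [map_add, map_add, hs, ht, map_add, map_add]
    have hcn : ∀ n t, (c ^ n) (TensorProduct.lift β t) =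
        TensorProduct.lift β (((A + B) ^ n) t) := by
      intro n
      induction n with
      | zero => intro t; rfl
      | succ n ih =>
        intro t
        rw [pow_succ, Module.End.mul_apply, hcm, ih, pow_succ, Module.End.mul_apply]
    have hA : ∀ n x y, (A ^ n) (x ⊗ₜ[ℂ] y) = ((a ^ n) x) ⊗ₜ y := by
      intro n x y
      induction n with
      | zero => rfl
      | succ n ih =>
        rw [pow_succ', Module.End.mul_apply, ih, pow_succ', Module.End.mul_apply]
        simp [A]
    have hB : ∀ n x y, (B ^ n) (x ⊗ₜ[ℂ] y) = x ⊗ₜ ((b ^ n) y) := by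
      intro n x y
      induction n with
      | zero => rfl
      | succ n ih =>
        rw [pow_succ', Module.End.mul_apply, ih, pow_succ', Module.End.mul_apply]
        simp [B]
    have := congrArg (TensorProduct.lift β) (exp_term_add hAB n (x ⊗ₜ[ℂ] y))
    rw [map_smul, ← hcn, TensorProduct.lift.tmul, map_sum] at this
    rw [this]
    refine Finset.sum_congr rfl fun p _ => ?_
    rw [map_smul, hB, map_smul, hA]
    simp only [map_smul, LinearMap.smul_apply, TensorProduct.lift.tmul]
    rw [smul_comm]
  have h3 : β (expSum a N x) (expSum b N y) - expSum c N (β x y) ∈ H (i + j + d + N) := by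
    have := sum_square_sub_mem (H (i + j + d + N))
      (fun i j => β (((i.factorial : ℂ)⁻¹) • (a ^ i) x) (((j.factorial : ℂ)⁻¹) • (b ^ j) y)) N
      (fun i' j' hij => hH.anti (by omega)
        (hβ _ _ _ _ (exp_term_mem ha hi i') (exp_term_mem hb hj j')))
    simp only [← hterm] at this
    rw [Finset.sum_comm] at this
    simpa only [expSum, map_sum, LinearMap.sum_apply] using this
  simpa using add_mem (add_mem h1 h2) h3

/-- The filtration of `ℂ × X` in which `ℂ` has degree `0`. -/
def pairFil (F : ℤ → Submodule ℂ X) (c : ℤ) : Submodule ℂ (ℂ × X) where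
  carrier := {p | p.2 ∈ F c ∧ (0 < c → p.1 = 0)}
  zero_mem' := by simp
  add_mem' := fun {p q} hp hq => ⟨add_mem hp.1 hq.1, fun h => by simp [hp.2 h, hq.2 h]⟩
  smul_mem' := fun t p hp => ⟨Submodule.smul_mem _ t hp.1, fun h => by simp [hp.2 h]⟩

/-- `(t, x) ↦ (0, a x - t w)`. -/
def pairOp (a : Module.End ℂ X) (w : X) : Module.End ℂ (ℂ × X) :=
  LinearMap.inr ℂ ℂ X ∘ₗ (a ∘ₗ LinearMap.snd ℂ ℂ X - (LinearMap.fst ℂ ℂ X).smulRight w)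

@[simp] lemma pairOp_apply (a : Module.End ℂ X) (w : X) (p : ℂ × X) :
    pairOp a w p = (0, a p.2 - p.1 • w) := rfl

lemma CompleteFiltration.pair (hF : CompleteFiltration F) : CompleteFiltration (pairFil F) where
  anti := fun c d hcd p hp => ⟨hF.anti hcd hp.1, fun h => hp.2 (by omega)⟩
  exhaustive := fun p => by
    obtain ⟨c, hc⟩ := hF.exhaustive p.2
    exact ⟨min c 0, hF.anti (min_le_left _ _) hc, fun h => absurd h (by omega)⟩
  separated := fun p hp => Prod.ext ((hp 1).2 one_pos) (hF.separated _ fun c => (hp c).1)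
  complete := fun c p hp => by
    obtain ⟨y, hy⟩ := hF.complete c (fun n => (p n).2) (fun n => (hp n).1)
    -- From `n = 1 - c` on, `p n` lies in positive degree and has no component in `ℂ`, so the first
    -- coordinate is a finite sum.
    refine ⟨(∑ n ∈ Finset.range (1 - c).toNat, (p n).1, y), fun N => ⟨?_, fun hN => ?_⟩⟩
    · simpa [Prod.snd_sum] using hy N
    · have h0 : ∀ n, (1 - c).toNat ≤ n → (p n).1 = 0 := fun n hn => (hp n).2 (by omega)
      have h1 : ∀ M, (1 - c).toNat ≤ M → ∑ n ∈ Finset.range M, (p n).1 =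
          ∑ n ∈ Finset.range (1 - c).toNat, (p n).1 := by
        intro M hM
        refine (Finset.sum_subset (Finset.range_mono hM) fun n _ hn => h0 n ?_).symm
        simpa using hn
      simp only [Prod.fst_sub, Prod.fst_sum]
      rw [h1 N (by omega), sub_self]

/-- With `a = ad S` and `w = ∂S` the operator is `ad S` on `t∂ + x`, because `[S, ∂] = -∂S`. -/
lemma raises_pairOp (hF : CompleteFiltration F) {a : Module.End ℂ X} (ha : Raises F F a 1) {w : X}
    (hw : w ∈ F 1) : Raises (pairFil F) (pairFil F) (pairOp a w) 1 := by
  intro c p hp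
  refine ⟨sub_mem (ha _ _ hp.1) ?_, fun _ => rfl⟩
  by_cases hc : 0 < c
  · simp [hp.2 hc]
  · exact Submodule.smul_mem _ _ (hF.anti (by omega) hw)

lemma fexp_pair_fst (hF : CompleteFiltration F) {a : Module.End ℂ X} (ha : Raises F F a 1) {w : X}
    (hw : w ∈ F 1) (p : ℂ × X) : (fexp (pairFil F) (pairOp a w) p).1 = p.1 := by
  obtain ⟨c, hc⟩ := hF.pair.exhaustive p
  have h := fexp_sub_mem hF.pair (raises_pairOp hF ha hw) hc ((1 - c).toNat + 1)
  have h1 := h.2 (by omega)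
  have h2 : ∀ N, (expSum (pairOp a w) (N + 1) p).1 = p.1 := by
    intro N
    induction N with
    | zero => simp [expSum]
    | succ N ih =>
      rw [expSum, Finset.sum_range_succ, ← expSum, Prod.fst_add, ih, pow_succ',
        Module.End.mul_apply]
      simp
  rw [Prod.fst_sub, h2, sub_eq_zero] at h1
  exact h1

lemma fexp_pair_inr (hF : CompleteFiltration F) {a : Module.End ℂ X} (ha : Raises F F a 1) {w : X}
    (hw : w ∈ F 1) (x : X) : fexp (pairFil F) (pairOp a w) (0, x) = (0, fexp F a x) := by
  refine (map_fexp (T := LinearMap.inr ℂ ℂ X) (d := 0) hF hF.pair ha (raises_pairOp hF ha hw)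
    ?_ ?_ x).symm
  · intro c x hx
    exact ⟨by simpa using hx, fun _ => rfl⟩
  · intro x
    simp

end Exponential

end WSuper

namespace WSuper

/-! ### Dressing in a filtered algebra -/

section Dressing

variable {X : Type*} [AddCommGroup X] [Module ℂ X]

/-- A complete filtered algebra with an element `Λ` of degree `-2` such that `ad Λ` has a quasi-inverse
`ψ` of degree `2` commuting with it, so that the algebra is the sum of `ker (ad Λ)` and
`im (ad Λ)`. -/
structure IsLoop (F : ℤ → Submodule ℂ X) (br : X →ₗ[ℂ] X →ₗ[ℂ] X) (del : X →ₗ[ℂ] X) (Λ : X)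
    (ψ : X →ₗ[ℂ] X) : Prop where
  cf : CompleteFiltration F
  br_mem : ∀ i j x y, x ∈ F i → y ∈ F j → br x y ∈ F (i + j)
  del_mem : ∀ i x, x ∈ F i → del x ∈ F i
  mem : Λ ∈ F (-2)
  skew : ∀ x, br x Λ = -br Λ x
  raises : Raises F F ψ 2
  comm : ∀ x, br Λ (ψ x) = ψ (br Λ x)
  inv : ∀ x, br Λ (br Λ (ψ x)) = br Λ x

variable {F : ℤ → Submodule ℂ X} {br : X →ₗ[ℂ] X →ₗ[ℂ] X} {del : X →ₗ[ℂ] X} {Λ : X}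
  {ψ : X →ₗ[ℂ] X}

namespace IsLoop

lemma raises_br (hD : IsLoop F br del Λ ψ) {S : X} (hS : S ∈ F 1) : Raises F F (br S) 1 :=
  fun c x hx => by rw [add_comm]; exact hD.br_mem _ _ _ _ hS hx

lemma raises_pair (hD : IsLoop F br del Λ ψ) {S : X} (hS : S ∈ F 1) :
    Raises (pairFil F) (pairFil F) (pairOp (br S) (del S)) 1 :=
  raises_pairOp hD.cf (hD.raises_br hS) (hD.del_mem _ _ hS)

/-- Telescoping: if `u` and `v` are the iterates for `S` and `S'`, the next difference is `[S, u -
v] + [S - S', v]`. Every further bracket gains one degree, starting from `-2`, the degree of `q -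
Λ`. -/
lemma pow_sub_mem (hD : IsLoop F br del Λ ψ) {S S' q : X} (hS : S ∈ F 1) (hS' : S' ∈ F 1) (k : ℂ)
    (hq : q ∈ F (-1)) {t : ℤ} (ht : 1 ≤ t) (hSS : S - S' ∈ F t) (n : ℕ) :
    ((pairOp (br S) (del S) ^ (n + 1)) (k, q - Λ)).2 -
      ((pairOp (br S') (del S') ^ (n + 1)) (k, q - Λ)).2 ∈ F (t + n - 2) := by
  have hL : (k, q - Λ) ∈ pairFil F (-2) :=
    ⟨sub_mem (hD.cf.anti (by omega) hq) hD.mem, fun h => absurd h (by omega)⟩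
  have hl : ∀ (p : ℂ × X) (j : ℤ), p ∈ pairFil F j → j ≤ 0 →
      br (S - S') p.2 - p.1 • del (S - S') ∈ F (t + j) := by
    intro p j hp hj
    exact sub_mem (hD.br_mem _ _ _ _ hSS hp.1)
      (Submodule.smul_mem _ _ (hD.cf.anti (by omega) (hD.del_mem _ _ hSS)))
  induction n with
  | zero =>
    have := hl _ _ hL (by omega)
    simp only [map_sub, LinearMap.sub_apply, smul_sub] at this
    simp only [zero_add, pow_one, pairOp_apply, map_sub]
    convert hD.cf.anti (show t + ((0 : ℕ) : ℤ) - 2 ≤ t + -2 by simp) this using 1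
    abel
  | succ n ih =>
    set A := pairOp (br S) (del S)
    set B := pairOp (br S') (del S')
    set u := (A ^ (n + 1)) (k, q - Λ) with hu
    set v := (B ^ (n + 1)) (k, q - Λ) with hv
    have hu0 : u.1 = 0 := by rw [hu, pow_succ', Module.End.mul_apply]; rfl
    have hv0 : v.1 = 0 := by rw [hv, pow_succ', Module.End.mul_apply]; rfl
    have hvm : v.2 ∈ F (-2 + (n + 1 : ℕ)) := ((hD.raises_pair hS').pow (n + 1) _ _ hL).1
    rw [pow_succ' A, pow_succ' B, Module.End.mul_apply, Module.End.mul_apply, ← hu, ← hv]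
    have e1 : (A u).2 - (B v).2 = br S (u.2 - v.2) + br (S - S') v.2 := by
      simp only [A, B, pairOp_apply, hu0, hv0, zero_smul, sub_zero, map_sub, LinearMap.sub_apply]
      abel
    rw [e1]
    refine add_mem (hD.cf.anti ?_ (hD.br_mem _ _ _ _ hS ih))
      (hD.cf.anti ?_ (hD.br_mem _ _ _ _ hSS hvm))
    · push_cast; omega
    · push_cast; omega

/-- To first order, `e^{ad S} (k∂ + q - Λ)` depends on `S` through `-[S, Λ]`. -/
lemma fexp_sub_fexp_mem (hD : IsLoop F br del Λ ψ) {S S' q : X} (hS : S ∈ F 1) (hS' : S' ∈ F 1)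
    (k : ℂ) (hq : q ∈ F (-1)) {t : ℤ} (ht : 1 ≤ t) (hSS : S - S' ∈ F t) :
    (fexp (pairFil F) (pairOp (br S) (del S)) (k, q - Λ)).2 -
      (fexp (pairFil F) (pairOp (br S') (del S')) (k, q - Λ)).2 - br Λ (S - S') ∈ F (t - 1) := by
  have hL : (k, q - Λ) ∈ pairFil F (-2) :=
    ⟨sub_mem (hD.cf.anti (by omega) hq) hD.mem, fun h => absurd h (by omega)⟩
  -- With `N + 2` terms both tails lie in `F N`, and `N = t + 1`.
  set N := (t + 1).toNat with hN
  have h1 := (fexp_sub_mem hD.cf.pair (hD.raises_pair hS) hL (N + 2)).1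
  have h2 := (fexp_sub_mem hD.cf.pair (hD.raises_pair hS') hL (N + 2)).1
  have h3 : (expSum (pairOp (br S) (del S)) (N + 2) (k, q - Λ)).2 -
      (expSum (pairOp (br S') (del S')) (N + 2) (k, q - Λ)).2 - br Λ (S - S') ∈ F (t - 1) := by
    have e : (expSum (pairOp (br S) (del S)) (N + 2) (k, q - Λ)).2 -
        (expSum (pairOp (br S') (del S')) (N + 2) (k, q - Λ)).2 =
        ∑ n ∈ Finset.range N, (((n + 2).factorial : ℂ)⁻¹) •
          (((pairOp (br S) (del S) ^ (n + 2)) (k, q - Λ)).2 -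
            ((pairOp (br S') (del S') ^ (n + 2)) (k, q - Λ)).2) +
        (br (S - S') (q - Λ) - k • del (S - S')) := by
      simp only [expSum, Finset.sum_range_succ' _ (N + 1), Finset.sum_range_succ' _ N, Prod.snd_add,
        Prod.snd_sum, Prod.smul_snd, smul_sub, Finset.sum_sub_distrib]
      simp only [map_sub, LinearMap.sub_apply, smul_sub, zero_add, pow_one, pairOp_apply,
        Nat.factorial_one, Nat.cast_one, inv_one, one_smul, pow_zero, Nat.factorial_zero,
        Module.End.one_apply, add_assoc, Nat.reduceAdd]
      abel
    -- Only `[S - S', -Λ] = [Λ, S - S']` can have degree below `t - 1`, and it is subtracted in the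
    -- claim.
    rw [e, map_sub (br (S - S')), hD.skew]
    have e2 : ∀ w : X, w + (br (S - S') q - -(br Λ (S - S')) - k • del (S - S')) -
        br Λ (S - S') = w + (br (S - S') q - k • del (S - S')) := fun w => by abel
    rw [e2]
    refine add_mem (Submodule.sum_mem _ fun n _ => Submodule.smul_mem _ _ ?_) (sub_mem ?_ ?_)
    · exact hD.cf.anti (by push_cast; omega) (hD.pow_sub_mem hS hS' k hq ht hSS (n + 1))
    · exact hD.br_mem _ _ _ _ hSS hq
    · exact Submodule.smul_mem _ _ (hD.cf.anti (by omega) (hD.del_mem _ _ hSS))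
  have h4 := sub_mem (hD.cf.anti (show t - 1 ≤ -2 + ((N + 2 : ℕ) : ℤ) by push_cast; omega) h1)
    (hD.cf.anti (show t - 1 ≤ -2 + ((N + 2 : ℕ) : ℤ) by push_cast; omega) h2)
  have h5 := add_mem h3 h4
  simp only [Prod.snd_sub] at h5
  convert h5 using 1
  abel

/-- The operator `br Λ ∘ ψ` is the projection onto the image of `ad Λ` along its kernel, and its
degree is `-2 + 2 = 0`. -/
lemma proj_mem (hD : IsLoop F br del Λ ψ) {c : ℤ} {x : X} (hx : x ∈ F c) : br Λ (ψ x) ∈ F c :=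
  hD.cf.anti (by omega) (hD.br_mem _ _ _ _ hD.mem (hD.raises _ _ hx))

lemma proj_range (hD : IsLoop F br del Λ ψ) (x : X) : br Λ (ψ (br Λ x)) = br Λ x := by
  rw [← hD.comm, hD.inv]

lemma br_eq_zero_of_proj (hD : IsLoop F br del Λ ψ) {x : X} (hx : br Λ (ψ x) = 0) : br Λ x = 0 := by
  rw [← hD.inv, hx, map_zero]

lemma proj_eq_zero (hD : IsLoop F br del Λ ψ) {x : X} (hx : br Λ x = 0) : br Λ (ψ x) = 0 := by
  rw [hD.comm, hx, map_zero]

/-- Uniqueness of the dressing. -/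
lemma dressing_unique (hD : IsLoop F br del Λ ψ) (k : ℂ) {q S S' h h' : X} (hq : q ∈ F (-1))
    (hS : S ∈ F 1) (hSr : ∃ x, br Λ x = S) (hh : br Λ h = 0)
    (hE : fexp (pairFil F) (pairOp (br S) (del S)) (k, q - Λ) = (k, h - Λ))
    (hS' : S' ∈ F 1) (hSr' : ∃ x, br Λ x = S') (hh' : br Λ h' = 0)
    (hE' : fexp (pairFil F) (pairOp (br S') (del S')) (k, q - Λ) = (k, h' - Λ)) :
    S = S' ∧ h = h' := by
  have key : ∀ n : ℕ, S - S' ∈ F (1 + n) := by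
    intro n
    induction n with
    | zero => simpa using sub_mem hS hS'
    | succ n ih =>
      -- Since `h - h'` lies in the kernel, projecting to the image puts `[Λ, S - S']` in degree `t
      -- - 1`, where `t = 1 + n`. As `S - S'` is in the image, `ψ` recovers it, now in degree `t +
      -- 1`.
      have h1 := hD.fexp_sub_fexp_mem hS hS' k hq (by omega) ih
      rw [hE, hE'] at h1
      have h2 := hD.raises _ _ (hD.proj_mem h1)
      have e : br Λ (ψ (h - Λ - (h' - Λ) - br Λ (S - S'))) = -br Λ (S - S') := by
        have : h - Λ - (h' - Λ) - br Λ (S - S') = (h - h') - br Λ (S - S') := by abel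
        rw [this, map_sub, map_sub, hD.proj_eq_zero (by rw [map_sub, hh, hh', sub_zero]), zero_sub,
          hD.proj_range]
      obtain ⟨x, hx⟩ := hSr
      obtain ⟨x', hx'⟩ := hSr'
      rw [e, map_neg, ← hD.comm, ← hx, ← hx', ← map_sub, hD.proj_range, map_sub, hx, hx'] at h2
      exact hD.cf.anti (by push_cast; omega) (neg_mem_iff.1 h2)
  have hSS : S = S' := hD.cf.eq_of_forall 1 key
  subst hSS
  refine ⟨rfl, ?_⟩
  have := hE.symm.trans hE'
  simpa using this

/-- Existence of the dressing. -/
lemma exists_dressing (hD : IsLoop F br del Λ ψ) (k : ℂ) {q : X} (hq : q ∈ F (-1)) :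
    ∃ S h, S ∈ F 1 ∧ (∃ x, br Λ x = S) ∧ h ∈ F (-1) ∧ br Λ h = 0 ∧
      fexp (pairFil F) (pairOp (br S) (del S)) (k, q - Λ) = (k, h - Λ) := by
  set ev : X → X := fun S => (fexp (pairFil F) (pairOp (br S) (del S)) (k, q - Λ)).2 + Λ with hev
  -- `ev S` is the conjugate with `-Λ` removed. The correction lies in the image and satisfies `[Λ,
  -- step S] = -br Λ (ψ (ev S))`, so to first order it cancels the image component of `ev S`.
  set step : X → X := fun S => -br Λ (ψ (ψ (ev S))) with hstep
  set s : ℕ → X := fun n => Nat.rec 0 (fun _ S => S + step S) n with hs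
  have hs1 : ∀ n, s (n + 1) = s n + step (s n) := fun n => rfl
  have hev0 : ev 0 = q := by
    have h0 : pairOp (br 0) (del 0) = 0 := by
      refine LinearMap.ext fun p => ?_
      simp
    have h1 : fexp (pairFil F) (pairOp (br 0) (del 0)) (k, q - Λ) = (k, q - Λ) := by
      rw [h0]
      refine (IsExpLim.eq_fexp hD.cf.pair (fun c x _ => by simp) ?_).symm
      obtain ⟨c, hc⟩ := hD.cf.pair.exhaustive (k, q - Λ)
      refine ⟨c, fun N => ?_⟩
      cases N with
      | zero => simpa [expSum] using hc
      | succ N => simp [expSum, Finset.sum_range_succ']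
    simp only [hev, h1, sub_add_cancel]
  -- Each step gains one degree in the image component of `ev (s n)`; this makes the corrections
  -- summable. The third clause keeps `s n` in the image.
  have main : ∀ n : ℕ, s n ∈ F 1 ∧ br Λ (ψ (ev (s n))) ∈ F (n - 1) ∧ br Λ (ψ (s n)) = s n := by
    intro n
    induction n with
    | zero =>
      refine ⟨zero_mem _, ?_, by simp [hs]⟩
      have : br Λ (ψ (ev 0)) ∈ F (-1) := hD.proj_mem (hev0 ▸ hq)
      simpa [hs] using this
    | succ n ih =>
      obtain ⟨h1, h2, h3⟩ := ih
      have hst : step (s n) ∈ F (n + 1) := by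
        have := hD.raises _ _ h2
        rw [← hD.comm] at this
        exact neg_mem (hD.cf.anti (by omega) this)
      have hsn : s (n + 1) ∈ F 1 := by
        rw [hs1]
        exact add_mem h1 (hD.cf.anti (by omega) hst)
      refine ⟨hsn, ?_, ?_⟩
      · have h4 := hD.proj_mem (hD.fexp_sub_fexp_mem hsn h1 k hq (t := n + 1) (by omega)
          (by rw [hs1, add_sub_cancel_left]; exact hst))
        have e : br Λ (ψ ((fexp (pairFil F) (pairOp (br (s (n + 1))) (del (s (n + 1))))
            (k, q - Λ)).2 - (fexp (pairFil F) (pairOp (br (s n)) (del (s n))) (k, q - Λ)).2 -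
              br Λ (s (n + 1) - s n))) = br Λ (ψ (ev (s (n + 1)))) := by
          have : br Λ (ψ (br Λ (s (n + 1) - s n))) = - br Λ (ψ (ev (s n))) := by
            rw [hs1, add_sub_cancel_left, hD.proj_range, hstep, map_neg, hD.inv]
          rw [map_sub ψ, map_sub, this]
          simp only [hev, map_sub, map_add]
          abel
        rw [e] at h4
        exact hD.cf.anti (by push_cast; omega) h4
      · rw [hs1, map_add, map_add, h3, hstep]
        simp only [map_neg]
        rw [hD.proj_range]
  have hstep_mem : ∀ n : ℕ, step (s n) ∈ F (1 + n) := by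
    intro n
    have := hD.raises _ _ (main n).2.1
    rw [← hD.comm] at this
    exact neg_mem (hD.cf.anti (by omega) this)
  obtain ⟨S, hS⟩ := hD.cf.complete 1 (fun n => step (s n)) hstep_mem
  have hsum : ∀ N, ∑ n ∈ Finset.range N, step (s n) = s N := by
    intro N
    induction N with
    | zero => rfl
    | succ N ih => rw [Finset.sum_range_succ, ih, hs1]
  simp only [hsum] at hS
  have hS1 : S ∈ F 1 := by simpa [hs] using hS 0
  have hSev : ∀ n : ℕ, ev S - ev (s n) - br Λ (S - s n) ∈ F n := by
    intro n
    have := hD.fexp_sub_fexp_mem hS1 (main n).1 k hq (t := 1 + n) (by omega) (hS n)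
    simp only [hev, add_sub_add_right_eq_sub]
    exact hD.cf.anti (by omega) this
  have hP : br Λ (ψ (ev S)) = 0 := by
    refine hD.cf.eq_of_forall (-1) fun n => ?_
    have h1 := hD.proj_mem (hSev n)
    have h2 := (main n).2.1
    have h3 : br Λ (S - s n) ∈ F (n - 1) :=
      hD.cf.anti (by omega) (hD.br_mem _ _ _ _ hD.mem (hS n))
    rw [map_sub ψ, map_sub, map_sub ψ, map_sub, hD.proj_range] at h1
    rw [sub_zero]
    have h4 := add_mem (add_mem (hD.cf.anti (show (n : ℤ) - 1 ≤ n by omega) h1) h2) h3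
    rw [sub_right_comm, sub_add_cancel, sub_add_cancel] at h4
    exact hD.cf.anti (by omega) h4
  have hPS : br Λ (ψ S) = S := by
    refine hD.cf.eq_of_forall 1 fun n => ?_
    have h1 := sub_mem (hD.proj_mem (hS n)) (hS n)
    rw [map_sub, map_sub, (main n).2.2] at h1
    simpa using h1
  refine ⟨S, ev S, hS1, ⟨_, hPS⟩, ?_, hD.br_eq_zero_of_proj hP, ?_⟩
  · have h1 := hSev 0
    have h2 : br Λ (S - s 0) ∈ F (-1) :=
      hD.cf.anti (by omega) (hD.br_mem _ _ _ _ hD.mem (hS 0))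
    have h3 : ev (s 0) ∈ F (-1) := by
      have : ev (s 0) = q := hev0
      rw [this]; exact hq
    have h4 := add_mem (add_mem (hD.cf.anti (by omega) h1) h2) h3
    simpa using h4
  · refine Prod.ext (fexp_pair_fst hD.cf (hD.raises_br hS1) (hD.del_mem _ _ hS1) _) ?_
    simp [hev]

end IsLoop

end Dressing

end WSuper

namespace WSuper

/-! ### Variation of the dressing -/

section Variation

variable {X Y R : Type*} [AddCommGroup X] [Module ℂ X] [AddCommGroup Y] [Module ℂ Y]
  [AddCommGroup R] [Module ℂ R]

/-- The filtration of a module all of whose elements have degree `0`. -/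
def trivFil (R : Type*) [AddCommGroup R] [Module ℂ R] (c : ℤ) : Submodule ℂ R :=
  if 0 < c then ⊥ else ⊤

lemma trivFil_complete : CompleteFiltration (trivFil R) where
  anti := fun c d hcd => by
    unfold trivFil
    split_ifs
    · exact le_rfl
    · exact bot_le
    · omega
    · exact le_rfl
  exhaustive := fun x => ⟨0, by simp [trivFil]⟩
  separated := fun x hx => by simpa [trivFil] using hx 1
  complete := fun c x hx => by
    refine ⟨∑ n ∈ Finset.range (1 - c).toNat, x n, fun N => ?_⟩
    unfold trivFil
    split_ifs with h
    · have h0 : ∀ n : ℕ, (1 - c).toNat ≤ n → x n = 0 := fun n hn => by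
        have := hx n
        rw [trivFil, if_pos (by omega)] at this
        simpa using this
      rw [Submodule.mem_bot, sub_eq_zero]
      refine Finset.sum_subset (Finset.range_mono (by omega)) fun n _ hn => h0 n ?_
      simpa using hn
    · trivial

/-- The hypotheses needed to conjugate a derivation `Δ`, commuting with `∂`, by `e^{ad S}`: `Y` is a
bimodule over the algebra `X`. -/
structure IsVariation (F : ℤ → Submodule ℂ X) (G : ℤ → Submodule ℂ Y) (br : X →ₗ[ℂ] X →ₗ[ℂ] X)
    (del : X →ₗ[ℂ] X) (act : X →ₗ[ℂ] Y →ₗ[ℂ] Y) (ract : Y →ₗ[ℂ] X →ₗ[ℂ] Y) (delY : Y →ₗ[ℂ] Y)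
    (Δ : X →ₗ[ℂ] Y) (S : X) : Prop where
  cf : CompleteFiltration F
  cfY : CompleteFiltration G
  br_mem : ∀ i j x y, x ∈ F i → y ∈ F j → br x y ∈ F (i + j)
  del_mem : ∀ i x, x ∈ F i → del x ∈ F i
  act_mem : ∀ i j x y, x ∈ F i → y ∈ G j → act x y ∈ G (i + j)
  ract_mem : ∀ i j y x, y ∈ G i → x ∈ F j → ract y x ∈ G (i + j)
  delY_mem : ∀ i y, y ∈ G i → delY y ∈ G i
  Δ_mem : ∀ i x, x ∈ F i → Δ x ∈ G i
  mem : S ∈ F 1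
  act_ract : ∀ y x, act S (ract y x) = ract (act S y) x + ract y (br S x)
  Δ_br : ∀ x, Δ (br S x) = ract (Δ S) x + act S (Δ x)
  delY_act : ∀ y, delY (act S y) = act (del S) y + act S (delY y)
  Δ_del : Δ (del S) = delY (Δ S)
  ract_del : ∀ y, ract y (del S) = -act (del S) y

variable {F : ℤ → Submodule ℂ X} {G : ℤ → Submodule ℂ Y} {br : X →ₗ[ℂ] X →ₗ[ℂ] X}
  {del : X →ₗ[ℂ] X} {act : X →ₗ[ℂ] Y →ₗ[ℂ] Y} {ract : Y →ₗ[ℂ] X →ₗ[ℂ] Y} {delY : Y →ₗ[ℂ] Y}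
  {Δ : X →ₗ[ℂ] Y} {S : X}

/-- `[t Δ + y, k ∂ + x]` -/
def varPair (ract : Y →ₗ[ℂ] X →ₗ[ℂ] Y) (delY : Y →ₗ[ℂ] Y) (Δ : X →ₗ[ℂ] Y) :
    (ℂ × Y) →ₗ[ℂ] (ℂ × X) →ₗ[ℂ] Y :=
  LinearMap.mk₂ ℂ (fun p q => p.1 • Δ q.2 + ract p.2 q.2 - q.1 • delY p.2)
    (fun p p' q => by simp [add_smul]; abel)
    (fun c p q => by simp [smul_add, smul_sub, smul_smul, mul_comm])
    (fun p q q' => by simp [add_smul]; abel)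
    (fun c p q => by simp [smul_add, smul_sub, smul_smul, mul_comm])

lemma varPair_apply (p : ℂ × Y) (q : ℂ × X) :
    varPair ract delY Δ p q = p.1 • Δ q.2 + ract p.2 q.2 - q.1 • delY p.2 := rfl

namespace IsVariation

lemma raises_br (hV : IsVariation F G br del act ract delY Δ S) : Raises F F (br S) 1 :=
  fun c x hx => by rw [add_comm]; exact hV.br_mem _ _ _ _ hV.mem hx

lemma raises_act (hV : IsVariation F G br del act ract delY Δ S) : Raises G G (act S) 1 :=
  fun c x hx => by rw [add_comm]; exact hV.act_mem _ _ _ _ hV.mem hx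

/-- The derivation property required by `bilin_fexp` is the Jacobi identity for `S`, `tΔ + y` and
`k∂ + x`. -/
lemma varPair_fexp (hV : IsVariation F G br del act ract delY Δ S) (p : ℂ × Y) (q : ℂ × X) :
    varPair ract delY Δ (fexp (pairFil G) (pairOp (act S) (Δ S)) p)
      (fexp (pairFil F) (pairOp (br S) (del S)) q) =
      fexp G (act S) (varPair ract delY Δ p q) := by
  refine bilin_fexp hV.cfY.pair hV.cf.pair hV.cfY
    (raises_pairOp hV.cfY hV.raises_act (hV.Δ_mem _ _ hV.mem))
    (raises_pairOp hV.cf hV.raises_br (hV.del_mem _ _ hV.mem)) hV.raises_act _ (d := 0) ?_ ?_ _ _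
  · intro i j p q hp hq
    rw [varPair_apply, add_zero]
    refine sub_mem (add_mem ?_ (hV.ract_mem _ _ _ _ hp.1 hq.1)) ?_
    · by_cases hi : 0 < i
      · simp [hp.2 hi]
      · exact Submodule.smul_mem _ _ (hV.cfY.anti (by omega) (hV.Δ_mem _ _ hq.1))
    · by_cases hj : 0 < j
      · simp [hq.2 hj]
      · exact Submodule.smul_mem _ _ (hV.cfY.anti (by omega) (hV.delY_mem _ _ hp.1))
  · intro p q
    simp only [varPair_apply, pairOp_apply, map_add, map_sub, map_smul, hV.act_ract, hV.Δ_br,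
      hV.delY_act, hV.Δ_del, LinearMap.sub_apply, LinearMap.smul_apply, zero_smul, smul_sub,
      smul_add, hV.ract_del, smul_neg, smul_comm q.1 p.1]
    abel

/-- The element `Z` with `e^{ad S} Δ = Δ - Z`. -/
def Z (G : ℤ → Submodule ℂ Y) (act : X →ₗ[ℂ] Y →ₗ[ℂ] Y) (Δ : X →ₗ[ℂ] Y) (S : X) : Y :=
  -(fexp (pairFil G) (pairOp (act S) (Δ S)) (1, 0)).2

lemma fexp_one_zero (hV : IsVariation F G br del act ract delY Δ S) :
    fexp (pairFil G) (pairOp (act S) (Δ S)) (1, 0) = (1, -Z G act Δ S) := by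
  refine Prod.ext ?_ (by simp [Z])
  rw [fexp_pair_fst hV.cfY hV.raises_act (hV.Δ_mem _ _ hV.mem)]

/-- This is `e^{ad S} Δ e^{-ad S} = Δ - ad Z`, evaluated on a conjugated element. -/
lemma conj_apply (hV : IsVariation F G br del act ract delY Δ S) (x : X) :
    Δ (fexp F (br S) x) - ract (Z G act Δ S) (fexp F (br S) x) = fexp G (act S) (Δ x) := by
  have := hV.varPair_fexp (1, 0) (0, x)
  rw [hV.fexp_one_zero, fexp_pair_inr hV.cf hV.raises_br (hV.del_mem _ _ hV.mem)] at this
  simpa [varPair_apply, sub_eq_add_neg] using this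

/-- The same conjugation applied to `[Δ, k∂ + l] = Δ l`; the term with `delY` comes from `[-Z, k∂] =
k ∂Z`. -/
lemma conj_apply_pair (hV : IsVariation F G br del act ract delY Δ S) {k : ℂ} {l l' : X}
    (hl : fexp (pairFil F) (pairOp (br S) (del S)) (k, l) = (k, l')) :
    Δ l' - ract (Z G act Δ S) l' + k • delY (Z G act Δ S) = fexp G (act S) (Δ l) := by
  have := hV.varPair_fexp (1, 0) (k, l)
  rw [hV.fexp_one_zero, hl] at this
  simpa [varPair_apply, sub_eq_add_neg] using this

lemma conj_pair (hV : IsVariation F G br del act ract delY Δ S) {k : ℂ} {l l' : X}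
    (hl : fexp (pairFil F) (pairOp (br S) (del S)) (k, l) = (k, l')) (y : Y) :
    ract (fexp G (act S) y) l' - k • delY (fexp G (act S) y) =
      fexp G (act S) (ract y l - k • delY y) := by
  have := hV.varPair_fexp (0, y) (k, l)
  rw [fexp_pair_inr hV.cfY hV.raises_act (hV.Δ_mem _ _ hV.mem), hl] at this
  simpa [varPair_apply] using this

lemma conj_ract (hV : IsVariation F G br del act ract delY Δ S) (y : Y) (x : X) :
    ract (fexp G (act S) y) (fexp F (br S) x) = fexp G (act S) (ract y x) := by
  have := hV.varPair_fexp (0, y) (0, x)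
  rw [fexp_pair_inr hV.cfY hV.raises_act (hV.Δ_mem _ _ hV.mem),
    fexp_pair_inr hV.cf hV.raises_br (hV.del_mem _ _ hV.mem)] at this
  simpa [varPair_apply] using this

/-- The variation formula: `(Δ ℓ | M) = (Δ ℓ' | m)` up to a total derivative, where `ℓ'` and `m` are
the conjugates of `ℓ` and `M`. -/
lemma variation (hV : IsVariation F G br del act ract delY Δ S) {k : ℂ} {l l' : X}
    (hl : fexp (pairFil F) (pairOp (br S) (del S)) (k, l) = (k, l'))
    (κ : Y →ₗ[ℂ] X →ₗ[ℂ] R) (hκ : ∀ i j y x, y ∈ G i → x ∈ F j → 0 < i + j → κ y x = 0)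
    (hinv : ∀ y x, κ (act S y) x + κ y (br S x) = 0) (m : X)
    (hm : ∀ y, κ (ract y l') m = 0) :
    κ (Δ l) (fexp F (-br S) m) = κ (Δ l') m + k • κ (delY (Z G act Δ S)) m := by
  -- Infinitesimal invariance of `κ` integrates: `bilin_fexp` is used with the zero operator on the
  -- target, whose exponential is the identity.
  have h1 : κ (fexp G (act S) (Δ l)) (fexp F (br S) (fexp F (-br S) m)) =
      κ (Δ l) (fexp F (-br S) m) := by
    rw [bilin_fexp hV.cfY hV.cf (trivFil_complete (R := R)) hV.raises_act hV.raises_br (c := 0)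
      (fun c x _ => by simp) κ (d := 0) ?_ ?_]
    · refine (IsExpLim.eq_fexp trivFil_complete (fun c x _ => by simp) ⟨0, fun N => ?_⟩).symm
      cases N with
      | zero => simp [trivFil]
      | succ N => simp [expSum, Finset.sum_range_succ']
    · intro i j y x hy hx
      unfold trivFil
      split_ifs with h
      · exact hκ _ _ _ _ hy hx (by simpa using h)
      · trivial
    · intro y x
      rw [hinv]; rfl
  rw [fexp_fexp_neg hV.cf hV.raises_br] at h1
  rw [← h1, ← hV.conj_apply_pair hl]
  simp only [map_add, map_sub, LinearMap.add_apply, LinearMap.sub_apply, hm, sub_zero, map_smul,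
    LinearMap.smul_apply]

/-- If `Δ L = [L, N]`, then `Δ M = [M, N]` for the elements `M` obtained by dressing. -/
lemma gauge (hV : IsVariation F G br del act ract delY Δ S) {k : ℂ} {l h Λ : X}
    (hl : fexp (pairFil F) (pairOp (br S) (del S)) (k, l) = (k, h - Λ))
    (hh : h ∈ F (-1)) (ψ : Y →ₗ[ℂ] Y) (hψ : Raises G G ψ 2)
    (hcomm : ∀ y, act Λ (ψ y) = ψ (act Λ y)) (hinv : ∀ y, act Λ (act Λ (ψ y)) = act Λ y)
    (hskew : ∀ y, ract y Λ = -act Λ y)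
    (hactΔ : act Λ (Δ h) = 0) (hΔΛ : Δ Λ = 0)
    (hacth : ∀ y, act Λ (ract y h) = ract (act Λ y) h) (hψh : ∀ y, ψ (ract y h) = ract (ψ y) h)
    (hactd : ∀ y, act Λ (delY y) = delY (act Λ y)) (hψd : ∀ y, ψ (delY y) = delY (ψ y))
    {N : Y} (hN : Δ l = -ract N l + k • delY N) {m : X} (hΔm : Δ m = 0)
    (hm : ∀ y, act Λ y = 0 → ract y m = 0) :
    Δ (fexp F (-br S) m) = -ract N (fexp F (-br S) m) := by
  -- The hypothesis `hN` says that `Δ + N` commutes with `k∂ + l`. Its conjugate `Δ - Z'` then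
  -- commutes with `k∂ + h - Λ`, which is `e1`.
  set Z' := Z G act Δ S - fexp G (act S) N with hZ'
  have hneg : ∀ y, fexp G (act S) (-y) = -fexp G (act S) y := by
    intro y
    have := fexp_add_right hV.cfY hV.raises_act (-y) y
    rw [neg_add_cancel] at this
    have h0 := fexp_add_right hV.cfY hV.raises_act (0 : Y) 0
    rw [add_zero] at h0
    rw [left_eq_add.1 h0] at this
    exact eq_neg_of_add_eq_zero_left this.symm
  have e1 : act Λ Z' = Δ h - ract Z' h + k • delY Z' := by
    have h1 := hV.conj_apply_pair hl
    rw [show Δ l = -(ract N l - k • delY N) by rw [hN]; abel, hneg, ← hV.conj_pair hl] at h1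
    have h2 : ract Z' Λ = -act Λ Z' := hskew Z'
    rw [hZ'] at h2 ⊢
    simp only [map_sub, LinearMap.sub_apply, hΔΛ, sub_zero, smul_sub] at h1 h2 ⊢
    rw [← sub_eq_zero] at h1 h2 ⊢
    rw [← neg_eq_zero, ← h1, ← sub_zero (_ - _), ← h2]
    abel
  -- The image component of `Z'`. Projecting `e1` to the image removes `Δ h`, which lies in the
  -- kernel, and leaves a homogeneous equation for `w`.
  set w := act Λ (ψ Z') with hw
  have hPw : ψ (act Λ w) = w := by
    rw [← hcomm, hw, ← hcomm (ψ Z'), hinv]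
  have e2 : act Λ w = -ract w h + k • delY w := by
    have h1 : act Λ (ψ (act Λ Z')) = act Λ w := by rw [hw, hcomm Z']
    rw [← h1, e1]
    simp only [map_add, map_sub, map_smul]
    rw [hcomm, hactΔ, map_zero, zero_sub, hψh, hacth, hψd, hactd]
  -- In `e2` the right side loses at most one degree, while `ψ` gains two and recovers `w` from `act
  -- Λ w`. So `w` lies in every step of the filtration.
  have hw0 : w = 0 := by
    obtain ⟨c, hc⟩ := hV.cfY.exhaustive w
    have key : ∀ n : ℕ, w ∈ G (c + n) := by
      intro n
      induction n with
      | zero => simpa using hc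
      | succ n ih =>
        have h1 : act Λ w ∈ G (c + n - 1) := by
          rw [e2]
          refine add_mem (neg_mem (hV.cfY.anti (by omega) (hV.ract_mem _ _ _ _ ih hh))) ?_
          exact Submodule.smul_mem _ _ (hV.cfY.anti (by omega) (hV.delY_mem _ _ ih))
        have h2 := hψ _ _ h1
        rw [hPw] at h2
        exact hV.cfY.anti (by push_cast; omega) h2
    exact hV.cfY.eq_of_forall c (by simpa using key)
  have hZ0 : act Λ Z' = 0 := by rw [← hinv, ← hw, hw0, map_zero]
  have h3 := hV.conj_apply (fexp F (-br S) m)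
  rw [fexp_fexp_neg hV.cf hV.raises_br, hΔm, zero_sub] at h3
  have h4 : ract (Z G act Δ S) m = ract (fexp G (act S) N) m := by
    have := hm _ hZ0
    rwa [hZ', map_sub, LinearMap.sub_apply, sub_eq_zero] at this
  have h5 := hV.conj_ract N (fexp F (-br S) m)
  rw [fexp_fexp_neg hV.cf hV.raises_br] at h5
  rw [h4, h5, ← hneg] at h3
  have h6 := congrArg (fexp G (-act S)) h3
  rw [fexp_neg_fexp hV.cfY hV.raises_act, fexp_neg_fexp hV.cfY hV.raises_act] at h6
  exact h6.symm

end IsVariation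

end Variation

end WSuper

namespace WSuper

/-! ### Finite dimensional representations of `sl₂` -/

section SlTwo

variable {E : Type*} [AddCommGroup E] [Module ℂ E]

/-- The operator `4 f e + (h + 1)² - (h - a)²`; the first two terms are the Casimir operator. -/
def casSub (c h : Module.End ℂ E) (a : ℂ) : Module.End ℂ E := c - (h - algebraMap ℂ _ a) ^ 2

/-- Products of the operators `casSub c h (2 i + 1)`. -/
def casProd (c h : Module.End ℂ E) : ℕ → Module.End ℂ E
  | 0 => 1
  | n + 1 => casProd c h n * casSub c h (2 * n + 1)

/-- One has `e f^{n+1} = f^n (fe + (n+1)(h - n))`, and completing the square turns `4 (fe + (n+1)(h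
- n))` into `c - (h - (2n+1))²`. -/
lemma pow_mul_pow_eq_casProd {e f h : Module.End ℂ E} (hf : h * f - f * h = -(2 * f))
    (hef : e * f - f * e = h) (n : ℕ) :
    (4 : ℂ) ^ n • (e ^ n * f ^ n) = casProd (4 * (f * e) + (h + 1) ^ 2) h n := by
  have h1 : h * f = f * h - 2 * f := by
    have : h * f = f * h + -(2 * f) := by rw [← hf]; abel
    rw [this, sub_eq_add_neg]
  have h2 : e * f = f * e + h := by rw [← hef]; abel
  have key : ∀ n : ℕ, e * f * f ^ n = f ^ n * (f * e + ((n : ℂ) + 1) • (h - algebraMap ℂ _ (n : ℂ))) := by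
    intro n
    induction n with
    | zero => simp [h2]
    | succ n ih =>
      rw [pow_succ, ← mul_assoc, ih, mul_assoc, mul_assoc]
      congr 1
      have h3 : f * e * f = f * (f * e + h) := by rw [mul_assoc, h2]
      rw [add_mul, h3, smul_mul_assoc, sub_mul, h1, Algebra.algebraMap_eq_smul_one,
        Algebra.algebraMap_eq_smul_one, mul_add, mul_add, mul_smul_comm, mul_sub, smul_mul_assoc,
        mul_smul_comm, one_mul, mul_one, add_assoc]
      congr 1
      push_cast
      rw [show (2 : Module.End ℂ E) * f = (2 : ℂ) • f by rw [two_smul, two_mul]]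
      module
  induction n with
  | zero => simp [casProd]
  | succ n ih =>
    rw [casProd, ← ih, pow_succ e, pow_succ' f, mul_assoc, ← mul_assoc e f, key, ← mul_assoc,
      pow_succ, mul_smul, smul_mul_assoc, ← mul_smul_comm]
    congr 2
    have h4 : (h - algebraMap ℂ _ (2 * (n : ℂ) + 1)) ^ 2 =
        h ^ 2 - (2 * (2 * (n : ℂ) + 1)) • h + ((2 * (n : ℂ) + 1) ^ 2) • (1 : Module.End ℂ E) := by
      rw [Algebra.algebraMap_eq_smul_one, sq, sub_mul, mul_sub, mul_sub]
      simp only [mul_smul_comm, smul_mul_assoc, mul_one, one_mul, smul_smul]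
      rw [sq]
      module
    have h5 : (h + 1) ^ 2 = h ^ 2 + (2 : ℂ) • h + 1 := by
      rw [sq, sq, add_mul, mul_add, one_mul, mul_one]
      module
    rw [casSub, h4, h5, Algebra.algebraMap_eq_smul_one,
      show (4 : Module.End ℂ E) * (f * e) = (4 : ℂ) • (f * e) by
        rw [Algebra.smul_def, map_ofNat]]
    module

/-- The simultaneous generalized eigenspaces of `h` and `c`. -/
def block (c h : Module.End ℂ E) (γ μ : ℂ) : Submodule ℂ E :=
  c.maxGenEigenspace γ ⊓ h.maxGenEigenspace μ

lemma commute_casSub {c h : Module.End ℂ E} (hc : Commute c h) (a : ℂ) :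
    Commute c (casSub c h a) ∧ Commute h (casSub c h a) :=
  ⟨(Commute.refl c).sub_right ((hc.sub_right (Algebra.commutes a c).symm).pow_right 2),
    hc.symm.sub_right (((Commute.refl h).sub_right (Algebra.commutes a h).symm).pow_right 2)⟩

lemma commute_casSub_casSub {c h : Module.End ℂ E} (hc : Commute c h) (a b : ℂ) :
    Commute (casSub c h a) (casSub c h b) :=
  (commute_casSub hc b).1.sub_left
    (((commute_casSub hc b).2.sub_left (Algebra.commutes a _)).pow_left 2)

lemma casSub_mem_block {c h : Module.End ℂ E} (hc : Commute c h) (a : ℂ) {γ μ : ℂ} {x : E}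
    (hx : x ∈ block c h γ μ) : casSub c h a x ∈ block c h γ μ :=
  ⟨Module.End.mapsTo_maxGenEigenspace_of_comm (commute_casSub hc a).1 γ hx.1,
    Module.End.mapsTo_maxGenEigenspace_of_comm (commute_casSub hc a).2 μ hx.2⟩

/-- On such an `x` the commuting operators `c` and `(h - a)²` agree, so `x` is a generalized
eigenvector of the second one for both `γ` and `(μ - a)²`. These are different, hence `x = 0`. -/
lemma eq_zero_of_casSub {c h : Module.End ℂ E} (hc : Commute c h) {a γ μ : ℂ} {x : E}
    (hx : x ∈ block c h γ μ) (ha : γ ≠ (μ - a) ^ 2) (h0 : casSub c h a x = 0) : x = 0 := by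
  set b := (h - algebraMap ℂ _ a) ^ 2 with hb
  have hch : Commute c b := (hc.sub_right (Algebra.commutes a c).symm).pow_right 2
  have hcb : c x = b x := by simpa [casSub, sub_eq_zero] using h0
  obtain ⟨m, hm⟩ := Module.End.mem_maxGenEigenspace _ _ _ |>.1 hx.1
  obtain ⟨n, hn⟩ := Module.End.mem_maxGenEigenspace _ _ _ |>.1 hx.2
  have h1 : x ∈ b.maxGenEigenspace γ := by
    refine (Module.End.mem_maxGenEigenspace _ _ _).2 ⟨m, ?_⟩
    rw [← hm]
    clear hm
    have hcomm : Commute (c - γ • 1) (b - γ • 1) := by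
      refine (hch.sub_right ?_).sub_left ?_
      · exact (Commute.one_right c).smul_right γ
      · exact (((Commute.one_left b).smul_left γ).sub_right (Commute.refl _))
    induction m with
    | zero => rfl
    | succ m ih =>
      rw [pow_succ', Module.End.mul_apply, ih, ← Module.End.mul_apply,
        ← (hcomm.pow_left m).eq, Module.End.mul_apply, pow_succ, Module.End.mul_apply]
      simp [hcb]
  have h2 : x ∈ b.maxGenEigenspace ((μ - a) ^ 2) := by
    refine (Module.End.mem_maxGenEigenspace _ _ _).2 ⟨n, ?_⟩
    have e : b - ((μ - a) ^ 2) • (1 : Module.End ℂ E) =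
        (h + (μ - 2 * a) • 1) * (h - μ • 1) := by
      rw [hb, Algebra.algebraMap_eq_smul_one, sq, sub_mul, mul_sub, mul_sub, add_mul, mul_sub,
        mul_sub]
      simp only [mul_smul_comm, smul_mul_assoc, mul_one, one_mul, smul_smul]
      module
    have hcomm : Commute (h + (μ - 2 * a) • 1) (h - μ • 1) := by
      refine ((Commute.refl h).sub_right ((Commute.one_right h).smul_right μ)).add_left ?_
      exact (((Commute.one_left h).smul_left _).sub_right ((Commute.refl _).smul_right μ |>.smul_left _))
    rw [e, hcomm.mul_pow, Module.End.mul_apply, hn, map_zero]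
  exact Submodule.disjoint_def.1
    (Module.End.disjoint_genEigenspace b ha ⊤ ⊤) x h1 h2

lemma eq_zero_of_casProd {c h : Module.End ℂ E} (hc : Commute c h) {γ μ : ℂ} (n : ℕ)
    (hgood : ∀ i < n, γ ≠ (μ - (2 * (i : ℂ) + 1)) ^ 2) {x : E} (hx : x ∈ block c h γ μ)
    (h0 : casProd c h n x = 0) : x = 0 := by
  induction n generalizing x with
  | zero => simpa [casProd] using h0
  | succ n ih =>
    rw [casProd, Module.End.mul_apply] at h0
    exact eq_zero_of_casSub hc hx (hgood n (by omega))
      (ih (fun i hi => hgood i (by omega)) (casSub_mem_block hc _ hx) h0)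

/-- All factors except the one with index `i₀` are injective on the block, and all factors commute,
so they can be cancelled. -/
lemma casSub_eq_zero_of_casProd {c h : Module.End ℂ E} (hc : Commute c h) {γ μ : ℂ} (i₀ : ℕ)
    (hgood : ∀ i, i ≠ i₀ → γ ≠ (μ - (2 * (i : ℂ) + 1)) ^ 2) (n : ℕ) {x : E}
    (hx : x ∈ block c h γ μ) (h0 : casProd c h n x = 0) :
    casSub c h (2 * (i₀ : ℂ) + 1) x = 0 := by
  induction n generalizing x with
  | zero =>
    have : x = 0 := by simpa [casProd] using h0
    rw [this, map_zero]
  | succ n ih =>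
    rw [casProd, Module.End.mul_apply] at h0
    by_cases hn : n = i₀
    · subst hn
      exact eq_zero_of_casProd hc n (fun i hi => hgood i (by omega)) (casSub_mem_block hc _ hx) h0
    · have h1 := ih (casSub_mem_block hc _ hx) h0
      refine eq_zero_of_casSub hc (casSub_mem_block hc _ hx) (hgood n hn) ?_
      rw [← Module.End.mul_apply] at h1 ⊢
      rwa [(commute_casSub_casSub hc _ _).eq]

/-- `f` shifts generalized eigenvalues of `h` by `t ≠ 0`, and in finite dimension only finitely many
of them occur. -/
lemma pow_eq_zero_of_mem_maxGenEigenspace [FiniteDimensional ℂ E] {f h : Module.End ℂ E} {t : ℂ}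
    (ht : t ≠ 0) (hf : h * f - f * h = t • f) {μ : ℂ} {x : E} (hx : x ∈ h.maxGenEigenspace μ) :
    ∃ n : ℕ, (f ^ n) x = 0 := by
  have hstep : ∀ ν y, y ∈ h.maxGenEigenspace ν → f y ∈ h.maxGenEigenspace (ν + t) := by
    intro ν y hy
    obtain ⟨n, hn⟩ := (Module.End.mem_maxGenEigenspace _ _ _).1 hy
    refine (Module.End.mem_maxGenEigenspace _ _ _).2 ⟨n, ?_⟩
    have e : (h - (ν + t) • (1 : Module.End ℂ E)) * f = f * (h - ν • 1) := by
      rw [sub_mul, mul_sub, smul_mul_assoc, mul_smul_comm, one_mul, mul_one, add_smul, ← hf]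
      abel
    have e' : ∀ n : ℕ, (h - (ν + t) • (1 : Module.End ℂ E)) ^ n * f = f * (h - ν • 1) ^ n := by
      intro n
      induction n with
      | zero => simp
      | succ n ih => rw [pow_succ', mul_assoc, ih, ← mul_assoc, e, mul_assoc, ← pow_succ']
    rw [← Module.End.mul_apply, e', Module.End.mul_apply, hn, map_zero]
  have hpow : ∀ n : ℕ, (f ^ n) x ∈ h.maxGenEigenspace (μ + n * t) := by
    intro n
    induction n with
    | zero => simpa using hx
    | succ n ih =>
      rw [pow_succ', Module.End.mul_apply]
      convert hstep _ _ ih using 2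
      push_cast
      ring
  by_contra! hne
  have hfin := WellFoundedGT.finite_ne_bot_of_iSupIndep h.independent_maxGenEigenspace
  have hinj : Function.Injective fun n : ℕ => μ + n * t := by
    intro m n hmn
    have : (m : ℂ) * t = n * t := by simpa using hmn
    exact_mod_cast mul_right_cancel₀ ht this
  refine Set.infinite_range_of_injective hinj (hfin.subset ?_)
  rintro _ ⟨n, rfl⟩ hbot
  have := hpow n
  rw [hbot] at this
  exact hne n (by simpa using this)

/-- In a finite dimensional representation of `sl₂`, `h` is diagonalizable with integer
eigenvalues. -/
theorem iSup_eigenspace_int_eq_top [FiniteDimensional ℂ E] {e f h : Module.End ℂ E}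
    (he : h * e - e * h = 2 * e) (hf : h * f - f * h = -(2 * f)) (hef : e * f - f * e = h) :
    ⨆ j : ℤ, h.eigenspace (j : ℂ) = ⊤ := by
  set c : Module.End ℂ E := 4 * (f * e) + (h + 1) ^ 2 with hcdef
  have hhe : h * e = e * h + 2 * e := by rw [← he]; abel
  have hhf : h * f = f * h - 2 * f := by
    have : h * f = f * h + -(2 * f) := by rw [← hf]; abel
    rw [this, sub_eq_add_neg]
  have two_comm : ∀ u : Module.End ℂ E, u * 2 = 2 * u := fun u => by rw [mul_two, two_mul]
  have hcomm : Commute h (f * e) := by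
    change h * (f * e) = f * e * h
    rw [← mul_assoc, hhf, sub_mul, mul_assoc f h e, hhe, mul_add, ← mul_assoc f 2 e, two_comm,
      ← mul_assoc]
    abel
  have hc : Commute c h := by
    have h4 : Commute (4 : Module.End ℂ E) h := Nat.cast_commute 4 h
    exact (h4.mul_left hcomm.symm).add_left
      (((Commute.refl h).add_left (Commute.one_left h)).pow_left 2)
  have hc' : Commute c (-h) := hc.neg_right
  -- The Casimir operator is invariant under `(e, f, h) ↦ (f, e, -h)`, so nilpotency of `e` gives
  -- the same information about `-h` as nilpotency of `f` gives about `h`.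
  have hc2 : 4 * (e * f) + (-h + 1) ^ 2 = c := by
    have h2 : e * f = f * e + h := by rw [← hef]; abel
    have h4 : ∀ u : Module.End ℂ E, 4 * u = u + u + (u + u) := fun u => by
      rw [show (4 : Module.End ℂ E) = 2 + 2 by norm_num, add_mul, two_mul]
    rw [hcdef, h2, h4, h4, sq, sq]
    noncomm_ring
  have hblock : ∀ γ μ, block c h γ μ ≤ ⨆ j : ℤ, h.eigenspace (j : ℂ) := by
    intro γ μ x hx
    have hx' : x ∈ block c (-h) γ (-μ) := by
      refine ⟨hx.1, ?_⟩
      obtain ⟨n, hn⟩ := (Module.End.mem_maxGenEigenspace _ _ _).1 hx.2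
      refine (Module.End.mem_maxGenEigenspace _ _ _).2 ⟨n, ?_⟩
      rw [neg_smul, sub_neg_eq_add, neg_add_eq_sub, ← neg_sub, neg_pow, Module.End.mul_apply, hn,
        map_zero]
    obtain ⟨n, hn⟩ := pow_eq_zero_of_mem_maxGenEigenspace (t := -2) (by norm_num)
      (by rw [hf, neg_smul, two_smul, two_mul]) hx.2
    obtain ⟨m, hm⟩ := pow_eq_zero_of_mem_maxGenEigenspace (t := 2) (by norm_num)
      (by rw [he, two_smul, two_mul]) hx.2
    have hA : casProd c h n x = 0 := by
      rw [hcdef, ← pow_mul_pow_eq_casProd hf hef, LinearMap.smul_apply, Module.End.mul_apply, hn,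
        map_zero, smul_zero]
    have hB : casProd c (-h) m x = 0 := by
      rw [← hc2, ← pow_mul_pow_eq_casProd (e := f) (f := e) (h := -h)
        (by rw [← he]; noncomm_ring) (by rw [← hef]; abel), LinearMap.smul_apply,
        Module.End.mul_apply, hm, map_zero, smul_zero]
    by_cases hga : ∀ i < n, γ ≠ (μ - (2 * (i : ℂ) + 1)) ^ 2
    · rw [eq_zero_of_casProd hc n hga hx hA]
      exact zero_mem _
    by_cases hgb : ∀ i < m, γ ≠ (-μ - (2 * (i : ℂ) + 1)) ^ 2
    · rw [eq_zero_of_casProd hc' m hgb hx' hB]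
      exact zero_mem _
    push Not at hga hgb
    obtain ⟨i, -, hi⟩ := hga
    obtain ⟨j, -, hj⟩ := hgb
    -- Factor the difference of the two squares; one factor is the nonzero number `2i + 2j + 2`.
    have key : ∀ i j : ℕ, γ = (μ - (2 * (i : ℂ) + 1)) ^ 2 → γ = (-μ - (2 * (j : ℂ) + 1)) ^ 2 →
        μ = i - j := by
      intro i j hi hj
      have h1 : ((2 * (i : ℂ) + 1) + (2 * j + 1)) * (2 * μ - 2 * (i - j)) = 0 := by
        linear_combination hi - hj
      rcases mul_eq_zero.1 h1 with h2 | h2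
      · exfalso
        have : ((2 * i + 1 + (2 * j + 1) : ℕ) : ℂ) = 0 := by push_cast; exact h2
        exact absurd (Nat.cast_eq_zero.1 this) (by omega)
      · linear_combination h2 / 2
    have hμ := key i j hi hj
    -- For fixed `j` the index is determined by `μ = i - j`, so at most one factor of each product
    -- fails to be injective on the block.
    have h1 := casSub_eq_zero_of_casProd hc i (fun i' hi' hb => hi' (by
      have := (key i' j hb hj).symm.trans hμ
      have : (i' : ℂ) = i := by linear_combination this
      exact_mod_cast this)) n hx hA
    have h2 := casSub_eq_zero_of_casProd hc' j (fun j' hj' hb => hj' (by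
      have := (key i j' hi hb).symm.trans hμ
      have : (j' : ℂ) = j := by linear_combination -this
      exact_mod_cast this)) m hx' hB
    -- Subtracting the two quadratic relations cancels `c` and `h²`. A linear relation in `h`
    -- remains, so `x` is a true eigenvector.
    have h3 : (4 * ((i : ℂ) + j + 1)) • (h x - ((i : ℂ) - j) • x) = 0 := by
      have e : (4 * ((i : ℂ) + j + 1)) • (h - ((i : ℂ) - j) • (1 : Module.End ℂ E)) =
          casSub c h (2 * (i : ℂ) + 1) - casSub c (-h) (2 * (j : ℂ) + 1) := by
        rw [casSub, casSub, Algebra.algebraMap_eq_smul_one, Algebra.algebraMap_eq_smul_one, sq, sq,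
          sub_mul, mul_sub, mul_sub, sub_mul, mul_sub, mul_sub]
        simp only [mul_smul_comm, smul_mul_assoc, mul_one, one_mul, smul_smul, neg_mul_neg]
        module
      have := congrArg (fun u : Module.End ℂ E => u x) e
      simp only [LinearMap.smul_apply, LinearMap.sub_apply, h1, h2, sub_zero,
        Module.End.one_apply] at this
      exact this
    have h4 : (4 * ((i : ℂ) + j + 1)) ≠ 0 := by
      have : ((4 * (i + j + 1) : ℕ) : ℂ) ≠ 0 := Nat.cast_ne_zero.2 (by omega)
      exact_mod_cast this
    refine Submodule.mem_iSup_of_mem ((i : ℤ) - j) ?_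
    rw [Module.End.mem_eigenspace_iff]
    push_cast
    exact sub_eq_zero.1 ((smul_eq_zero.1 h3).resolve_left h4)
  rw [eq_top_iff]
  have htop := Module.End.iSup_iInf_maxGenEigenspace_eq_top_of_iSup_maxGenEigenspace_eq_top_of_commute
    (fun b : Bool => if b then c else h) (by
      intro a b hab
      cases a <;> cases b <;> simp at hab ⊢
      · exact hc.symm
      · exact hc)
    (fun b => Module.End.iSup_maxGenEigenspace_eq_top _)
  rw [← htop]
  refine iSup_le fun χ => le_trans ?_ (hblock (χ true) (χ false))
  exact le_inf (iInf_le_of_le true (by simp)) (iInf_le_of_le false (by simp))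

end SlTwo

end WSuper

namespace WSuper

/-! ### Tensor products with supercommutative algebras -/

lemma sg_add (i j : ZMod 2) : sg (i + j) = sg i * sg j := by
  rcases Setup.zmod2_cases i with rfl | rfl <;> rcases Setup.zmod2_cases j with rfl | rfl <;>
    simp [sg, show (1 : ZMod 2) + 1 = 0 from rfl]

lemma sg_mul_self (i : ZMod 2) : sg i * sg i = 1 := by
  rcases Setup.zmod2_cases i with rfl | rfl <;> simp [sg]

/-- `ε` is the parity involution of the supercommutative algebra `B`. -/
structure IsSuperComm {B : Type*} [Ring B] [Algebra ℂ B] (ε : B →ₗ[ℂ] B) : Prop where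
  sq : ∀ x, ε (ε x) = x
  map_mul : ∀ x y, ε (x * y) = ε x * ε y
  map_one : ε 1 = 1
  comm : ∀ x y, ε y = y → x * y = y * x
  anti : ∀ x y, ε y = -y → x * y = y * ε x

lemma IsSuperComm.mul_comm_sg {B : Type*} [Ring B] [Algebra ℂ B] {ε : B →ₗ[ℂ] B}
    (hε : IsSuperComm ε) {i j : ZMod 2} {x y : B} (hx : ε x = sg i • x) (hy : ε y = sg j • y) :
    x * y = sg (i * j) • (y * x) := by
  rcases Setup.zmod2_cases j with rfl | rfl
  · simpa [sg] using hε.comm x y (by simpa [sg] using hy)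
  · rw [hε.anti x y (by simpa [sg] using hy), hx, mul_one, mul_smul_comm]

namespace Setup

variable {g : Type*} [AddCommGroup g] [Module ℂ g] (S : Setup g)

lemma par_ev (a : g) : S.par (S.ev a) = S.ev a := by
  simp [ev, S.par_par, add_comm]

lemma par_od (a : g) : S.par (S.od a) = -S.od a := by
  simp [od, S.par_par, ← smul_neg]

lemma ev_add_od (a : g) : S.ev a + S.od a = a := by
  simp only [ev, od, LinearMap.smul_apply, LinearMap.add_apply, LinearMap.sub_apply,
    LinearMap.id_apply, ← smul_add, add_add_sub_cancel]
  rw [← two_smul ℂ a, smul_smul]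
  norm_num

lemma ev_of_even {a : g} (ha : S.par a = a) : S.ev a = a := by
  simp only [ev, LinearMap.smul_apply, LinearMap.add_apply, LinearMap.id_apply, ha,
    ← two_smul ℂ a, smul_smul]
  norm_num

lemma od_of_even {a : g} (ha : S.par a = a) : S.od a = 0 := by
  simp [od, ha]

lemma ev_of_odd {a : g} (ha : S.par a = -a) : S.ev a = 0 := by
  simp [ev, ha]

lemma od_of_odd {a : g} (ha : S.par a = -a) : S.od a = a := by
  simp only [od, LinearMap.smul_apply, LinearMap.sub_apply, LinearMap.id_apply, ha,
    sub_neg_eq_add, ← two_smul ℂ a, smul_smul]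
  norm_num

section Tensor

variable {B : Type*} [Ring B] [Algebra ℂ B] (ε : B →ₗ[ℂ] B)

/-- The bracket of `g ⊗ B`. -/
def brT : g ⊗[ℂ] B →ₗ[ℂ] g ⊗[ℂ] B →ₗ[ℂ] g ⊗[ℂ] B :=
  (TensorProduct.map₂ S.br (LinearMap.mul ℂ B)).compl₂ (LinearMap.rTensor B S.ev) +
    ((TensorProduct.map₂ S.br (LinearMap.mul ℂ B)) ∘ₗ (LinearMap.lTensor g ε)).compl₂
      (LinearMap.rTensor B S.od)

/-- The `B`-valued form of `g ⊗ B`. -/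
def formT : g ⊗[ℂ] B →ₗ[ℂ] g ⊗[ℂ] B →ₗ[ℂ] B :=
  ((TensorProduct.map₂ S.B (LinearMap.mul ℂ B)).compl₂ (LinearMap.rTensor B S.ev) +
    ((TensorProduct.map₂ S.B (LinearMap.mul ℂ B)) ∘ₗ (LinearMap.lTensor g ε)).compl₂
      (LinearMap.rTensor B S.od)).compr₂ (TensorProduct.lid ℂ B).toLinearMap

lemma brT_tmul (a b : g) (x y : B) : S.brT ε (a ⊗ₜ x) (b ⊗ₜ y) =
    S.br a (S.ev b) ⊗ₜ (x * y) + S.br a (S.od b) ⊗ₜ (ε x * y) := by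
  simp [brT]

lemma formT_tmul (a b : g) (x y : B) : S.formT ε (a ⊗ₜ x) (b ⊗ₜ y) =
    S.B a (S.ev b) • (x * y) + S.B a (S.od b) • (ε x * y) := by
  simp [formT]

lemma brT_homog {a b : g} {x : B} (y : B) {i j : ZMod 2} (hx : ε x = sg i • x)
    (hb : S.par b = sg j • b) :
    S.brT ε (a ⊗ₜ x) (b ⊗ₜ y) = sg (i * j) • (S.br a b ⊗ₜ (x * y)) := by
  rw [brT_tmul]
  rcases zmod2_cases j with rfl | rfl
  · have hb' : S.par b = b := by simpa [sg] using hb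
    simp [S.ev_of_even hb', S.od_of_even hb', sg]
  · have hb' : S.par b = -b := by simpa [sg] using hb
    simp [S.ev_of_odd hb', S.od_of_odd hb', hx, TensorProduct.tmul_smul]

lemma formT_homog {a b : g} {x : B} (y : B) {i j : ZMod 2} (hx : ε x = sg i • x)
    (hb : S.par b = sg j • b) :
    S.formT ε (a ⊗ₜ x) (b ⊗ₜ y) = sg (i * j) • S.B a b • (x * y) := by
  rw [formT_tmul]
  rcases zmod2_cases j with rfl | rfl
  · have hb' : S.par b = b := by simpa [sg] using hb
    simp [S.ev_of_even hb', S.od_of_even hb', sg]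
  · have hb' : S.par b = -b := by simpa [sg] using hb
    simp [S.ev_of_odd hb', S.od_of_odd hb', hx, smul_smul, mul_comm]

lemma brT_even_left {a : g} (b : g) {x : B} (y : B) (hx : ε x = x) :
    S.brT ε (a ⊗ₜ x) (b ⊗ₜ y) = S.br a b ⊗ₜ (x * y) := by
  rw [brT_tmul, hx, ← TensorProduct.add_tmul, ← map_add, S.ev_add_od]

lemma formT_even_left {a : g} (b : g) {x : B} (y : B) (hx : ε x = x) :
    S.formT ε (a ⊗ₜ x) (b ⊗ₜ y) = S.B a b • (x * y) := by
  rw [formT_tmul, hx, ← add_smul, ← map_add, S.ev_add_od]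

/-- The parity involution of `g ⊗ B`. -/
def parT : g ⊗[ℂ] B →ₗ[ℂ] g ⊗[ℂ] B := TensorProduct.map S.par ε

variable {ε}

lemma exists_homog (hε : ∀ x, ε (ε x) = x) (x : B) :
    ∃ x₀ x₁, x = x₀ + x₁ ∧ ε x₀ = sg 0 • x₀ ∧ ε x₁ = sg 1 • x₁ := by
  refine ⟨(2⁻¹ : ℂ) • (x + ε x), (2⁻¹ : ℂ) • (x - ε x), ?_, ?_, ?_⟩
  · rw [← smul_add, add_add_sub_cancel, ← two_smul ℂ x, smul_smul]; norm_num
  · simp [hε, add_comm, sg]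
  · simp [hε, sg, ← smul_neg]

lemma exists_homog_par (a : g) :
    ∃ x₀ x₁, a = x₀ + x₁ ∧ S.par x₀ = sg 0 • x₀ ∧ S.par x₁ = sg 1 • x₁ :=
  ⟨S.ev a, S.od a, (S.ev_add_od a).symm, by simp [S.par_ev, sg], by simp [S.par_od, sg]⟩

lemma tensor_induction (hε : ∀ x, ε (ε x) = x) {motive : g ⊗[ℂ] B → Prop}
    (add : ∀ x y, motive x → motive y → motive (x + y))
    (tmul : ∀ (i j : ZMod 2) (a : g) (x : B), S.par a = sg i • a → ε x = sg j • x →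
      motive (a ⊗ₜ x)) (x : g ⊗[ℂ] B) : motive x := by
  induction x using TensorProduct.induction_on with
  | zero => simpa using tmul 0 0 0 0 (by simp) (by simp)
  | tmul a x =>
    obtain ⟨a₀, a₁, rfl, h0, h1⟩ := S.exists_homog_par a
    obtain ⟨x₀, x₁, rfl, k0, k1⟩ := exists_homog hε x
    simp only [TensorProduct.add_tmul, TensorProduct.tmul_add]
    exact add _ _ (add _ _ (tmul _ _ _ _ h0 k0) (tmul _ _ _ _ h1 k0))
      (add _ _ (tmul _ _ _ _ h0 k1) (tmul _ _ _ _ h1 k1))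
  | add x y hx hy => exact add _ _ hx hy

lemma parT_tmul {i j : ZMod 2} {a : g} {x : B} (ha : S.par a = sg i • a) (hx : ε x = sg j • x) :
    S.parT ε (a ⊗ₜ x) = (sg i * sg j) • (a ⊗ₜ[ℂ] x) := by
  simp [parT, ha, hx, TensorProduct.smul_tmul', TensorProduct.tmul_smul, smul_smul, mul_comm]

/-- Averaging over the parity involution writes an even element as a sum of tensors whose two
factors have equal parity. Additive identities in an even argument need to be checked only there. -/
lemma even_induction (hε : ∀ x, ε (ε x) = x) {motive : g ⊗[ℂ] B → Prop}
    (add : ∀ x y, motive x → motive y → motive (x + y))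
    (tmul : ∀ (i : ZMod 2) (a : g) (x : B), S.par a = sg i • a → ε x = sg i • x →
      motive (a ⊗ₜ x)) {x : g ⊗[ℂ] B} (hx : S.parT ε x = x) : motive x := by
  have key : ∀ y, motive ((2⁻¹ : ℂ) • (y + S.parT ε y)) := by
    refine S.tensor_induction hε (fun y z hy hz => ?_) (fun i j a x ha hx => ?_)
    · convert add _ _ hy hz using 1
      rw [map_add]
      module
    · have e : (2⁻¹ : ℂ) • (a ⊗ₜ[ℂ] x + S.parT ε (a ⊗ₜ[ℂ] x)) =
          (((2⁻¹ : ℂ) * (1 + sg i * sg j)) • a) ⊗ₜ[ℂ] x := by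
        rw [S.parT_tmul ha hx, TensorProduct.smul_tmul']
        simp only [TensorProduct.smul_tmul', ← TensorProduct.add_tmul]
        congr 1
        module
      rw [e]
      by_cases hij : i = j
      · subst hij
        exact tmul i _ _ (by rw [map_smul, ha, smul_comm]) hx
      · have : (2⁻¹ : ℂ) * (1 + sg i * sg j : ℂ) = 0 := by
          rcases zmod2_cases i with rfl | rfl <;> rcases zmod2_cases j with rfl | rfl <;>
            simp_all [sg]
        rw [this, zero_smul, TensorProduct.zero_tmul]
        simpa using tmul 0 0 0 (by simp) (by simp)
  have := key x
  rwa [hx, ← two_smul ℂ x, smul_smul, inv_mul_cancel₀ two_ne_zero, one_smul] at this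

lemma br_par_homog {i j : ZMod 2} {a b : g} (ha : S.par a = sg i • a) (hb : S.par b = sg j • b) :
    S.par (S.br a b) = sg (i + j) • S.br a b := by
  rw [S.par_br, ha, hb, map_smul, map_smul, LinearMap.smul_apply, smul_smul, sg_add, mul_comm]

lemma mul_homog (hε : IsSuperComm ε) {i j : ZMod 2} {x y : B} (hx : ε x = sg i • x)
    (hy : ε y = sg j • y) : ε (x * y) = sg (i + j) • (x * y) := by
  rw [hε.map_mul, hx, hy, smul_mul_smul_comm, sg_add]

lemma parT_brT (hε : IsSuperComm ε) (x y : g ⊗[ℂ] B) :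
    S.parT ε (S.brT ε x y) = S.brT ε (S.parT ε x) (S.parT ε y) := by
  induction x using S.tensor_induction hε.sq with
  | add x x' hx hx' => simp only [map_add, LinearMap.add_apply, hx, hx']
  | tmul i j a x ha hx =>
    induction y using S.tensor_induction hε.sq with
    | add y y' hy hy' => simp only [map_add, hy, hy']
    | tmul l m b y hb hy =>
      rw [S.parT_tmul ha hx, S.parT_tmul hb hy, map_smul, map_smul, LinearMap.smul_apply,
        S.brT_homog ε y hx hb, map_smul, S.parT_tmul (S.br_par_homog ha hb) (mul_homog hε hx hy)]
      simp only [smul_smul, sg_add]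
      congr 1
      ring

/-- The Jacobi identity of `g ⊗ B`. -/
lemma brT_jacobi (hε : IsSuperComm ε) {x : g ⊗[ℂ] B} (hx : S.parT ε x = x) (y z : g ⊗[ℂ] B) :
    S.brT ε x (S.brT ε y z) = S.brT ε (S.brT ε x y) z + S.brT ε y (S.brT ε x z) := by
  refine S.even_induction hε.sq (motive := fun x => S.brT ε x (S.brT ε y z) = S.brT ε (S.brT ε x y) z + S.brT ε y (S.brT ε x z))
    (fun x x' hx hx' => by simp only [map_add, LinearMap.add_apply, hx, hx']; abel)
    (fun i a x ha hx => ?_) hx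
  induction y using S.tensor_induction hε.sq with
  | add y y' hy hy' => simp only [map_add, LinearMap.add_apply, hy, hy']; abel
  | tmul j l b y hb hy =>
    induction z using S.tensor_induction hε.sq with
    | add z z' hz hz' => simp only [map_add, hz, hz']; abel
    | tmul m n c z hc hz =>
      rw [S.brT_homog ε z hy hc, S.brT_homog ε y hx hb, S.brT_homog ε z hx hc, map_smul, map_smul,
        map_smul, LinearMap.smul_apply, S.brT_homog ε _ hx (S.br_par_homog hb hc),
        S.brT_homog ε _ (mul_homog hε hx hy) hc, S.brT_homog ε _ hy (S.br_par_homog ha hc),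
        S.jacobi i j a b c ha hb, ← mul_assoc y x z, hε.mul_comm_sg hy hx,
        TensorProduct.add_tmul, smul_mul_assoc, ← mul_assoc x y z, smul_add, smul_add]
      simp only [TensorProduct.tmul_smul, ← TensorProduct.smul_tmul', smul_smul, mul_add, add_mul,
        sg_add]
      have h1 := sg_mul_self (i * j)
      have h2 := sg_mul_self (l * i)
      congr 2
      · ring
      · linear_combination (sg (l * m) * sg (i * m)) * (h1 - h2)

/-- For even `x` the two factors of each tensor have equal parity, so the sign of the bracket in `g`
and the sign of reordering in `B` cancel. -/
lemma brT_skew (hε : IsSuperComm ε) {x : g ⊗[ℂ] B} (hx : S.parT ε x = x) (y : g ⊗[ℂ] B) :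
    S.brT ε y x = -S.brT ε x y := by
  refine S.even_induction hε.sq (motive := fun x => S.brT ε y x = -S.brT ε x y)
    (fun x x' hx hx' => by simp only [map_add, LinearMap.add_apply, hx, hx']; abel)
    (fun i a x ha hx => ?_) hx
  induction y using S.tensor_induction hε.sq with
  | add y y' hy hy' => simp only [map_add, LinearMap.add_apply, hy, hy']; abel
  | tmul j l b y hb hy =>
    rw [S.brT_homog ε y hx hb, S.brT_homog ε x hy ha, S.skew j i b a hb ha,
      hε.mul_comm_sg hy hx, TensorProduct.neg_tmul]
    simp only [TensorProduct.tmul_smul, ← TensorProduct.smul_tmul', smul_smul, smul_neg]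
    have := sg_mul_self (l * i)
    rw [mul_comm j i]
    congr 2
    linear_combination (sg (i * j)) * this

lemma formT_inv (hε : IsSuperComm ε) (x y z : g ⊗[ℂ] B) :
    S.formT ε (S.brT ε x y) z = S.formT ε x (S.brT ε y z) := by
  induction x using S.tensor_induction hε.sq with
  | add x x' hx hx' => simp only [map_add, LinearMap.add_apply, hx, hx']
  | tmul i i' a x ha hx =>
    induction y using S.tensor_induction hε.sq with
    | add y y' hy hy' => simp only [map_add, LinearMap.add_apply, hy, hy']
    | tmul j j' b y hb hy =>
      induction z using S.tensor_induction hε.sq with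
      | add z z' hz hz' => simp only [map_add, hz, hz']
      | tmul l l' c z hc hz =>
        rw [S.brT_homog ε y hx hb, S.brT_homog ε z hy hc, map_smul, map_smul, LinearMap.smul_apply,
          S.formT_homog ε _ (mul_homog hε hx hy) hc, S.formT_homog ε _ hx (S.br_par_homog hb hc),
          S.B_inv, mul_assoc]
        simp only [smul_smul, sg_add, mul_add, add_mul]
        congr 1
        ring

lemma formT_symm (hε : IsSuperComm ε) {x : g ⊗[ℂ] B} (hx : S.parT ε x = x) (y : g ⊗[ℂ] B) :
    S.formT ε y x = S.formT ε x y := by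
  refine S.even_induction hε.sq (motive := fun x => S.formT ε y x = S.formT ε x y)
    (fun x x' hx hx' => by simp only [map_add, LinearMap.add_apply, hx, hx'])
    (fun i a x ha hx => ?_) hx
  induction y using S.tensor_induction hε.sq with
  | add y y' hy hy' => simp only [map_add, LinearMap.add_apply, hy, hy']
  | tmul j l b y hb hy =>
    rw [S.formT_homog ε y hx hb, S.formT_homog ε x hy ha, S.B_symm j i b a hb ha,
      hε.mul_comm_sg hy hx]
    simp only [smul_smul, mul_comm j i, mul_comm l i]
    congr 1
    have := sg_mul_self (i * l)
    linear_combination (sg (i * j) * S.B a b) * this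

end Tensor

end Setup

end WSuper

namespace WSuper

/-! ### Laurent series and polynomials with coefficients in a supercommutative algebra -/

section Hahn

variable {R R' R'' : Type*} [Ring R] [Algebra ℂ R] [Ring R'] [Algebra ℂ R'] [Ring R'']
  [Algebra ℂ R'']

/-- Coefficientwise action of a linear map on Laurent series. -/
def cwH (φ : R →ₗ[ℂ] R') : HahnSeries ℤ R →ₗ[ℂ] HahnSeries ℤ R' where
  toFun x := x.map φ
  map_add' x y := by ext n; simp
  map_smul' c x := by ext n; simp

@[simp] lemma coeff_cwH (φ : R →ₗ[ℂ] R') (x : HahnSeries ℤ R) (m : ℤ) :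
    (cwH φ x).coeff m = φ (x.coeff m) := rfl

lemma coeff_eq_zero_of_lt_of_le_order {x : HahnSeries ℤ R} {a m : ℤ} (ha : a ≤ x.order)
    (hm : m < a) : x.coeff m = 0 :=
  HahnSeries.coeff_eq_zero_of_lt_order (hm.trans_le ha)

/-- Replaces the support-dependent sum for a product by a sum over a fixed interval, so that
products of series with different supports can be compared term by term. -/
lemma coeff_mul_eq_sum {x y : HahnSeries ℤ R} {a b : ℤ} (ha : ∀ m < a, x.coeff m = 0)
    (hb : ∀ m < b, y.coeff m = 0) (n : ℤ) :
    (x * y).coeff n = ∑ i ∈ Finset.Icc a (n - b), x.coeff i * y.coeff (n - i) := by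
  rw [HahnSeries.coeff_mul]
  refine Finset.sum_of_injOn Prod.fst ?_ ?_ ?_ ?_
  · rintro ⟨p, q⟩ hp ⟨p', q'⟩ hp' h
    simp only [Finset.mem_coe, Finset.mem_antidiagonal] at hp hp' h
    ext <;> simp <;> omega
  · rintro ⟨p, q⟩ hp
    simp only [Finset.mem_coe, Finset.mem_antidiagonal, HahnSeries.mem_support] at hp
    simp only [Finset.coe_Icc, Set.mem_Icc]
    constructor
    · by_contra h
      exact hp.1 (ha _ (by omega))
    · by_contra h
      exact hp.2.1 (hb _ (by omega))
  · intro i _ hi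
    by_contra h
    refine hi ⟨(i, n - i), ?_, rfl⟩
    simp only [Finset.mem_coe, Finset.mem_antidiagonal, HahnSeries.mem_support]
    exact ⟨left_ne_zero_of_mul h, right_ne_zero_of_mul h, by ring⟩
  · rintro ⟨p, q⟩ hp
    simp only [Finset.mem_antidiagonal] at hp
    rw [← hp.2.2]
    simp

lemma cwH_leibniz {D J J' : R →ₗ[ℂ] R'} (h : ∀ x y, D (x * y) = D x * J y + J' x * D y)
    (x y : HahnSeries ℤ R) : cwH D (x * y) = cwH D x * cwH J y + cwH J' x * cwH D y := by
  ext n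
  have hx : ∀ m < x.order, x.coeff m = 0 := fun m hm => coeff_eq_zero_of_lt_of_le_order le_rfl hm
  have hy : ∀ m < y.order, y.coeff m = 0 := fun m hm => coeff_eq_zero_of_lt_of_le_order le_rfl hm
  rw [HahnSeries.coeff_add, coeff_cwH, coeff_mul_eq_sum hx hy,
    coeff_mul_eq_sum (a := x.order) (b := y.order), coeff_mul_eq_sum (a := x.order) (b := y.order),
    map_sum, ← Finset.sum_add_distrib]
  · simp [h]
  all_goals
    intro m hm
    simp [hx, hy, hm]

lemma cwH_mul {J : R →ₗ[ℂ] R'} (h : ∀ x y, J (x * y) = J x * J y)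
    (x y : HahnSeries ℤ R) : cwH J (x * y) = cwH J x * cwH J y := by
  have := HahnSeries.map_mul (x := x) (y := y) (⟨⟨J, h⟩, map_zero J, map_add J⟩ : R →ₙ+* R')
  exact this

lemma IsSuperComm.hahn {ε : R →ₗ[ℂ] R} (hε : IsSuperComm ε) : IsSuperComm (cwH ε) where
  sq x := by ext n; simp [hε.sq]
  map_mul x y := cwH_mul hε.map_mul x y
  map_one := by
    ext n
    rw [coeff_cwH, HahnSeries.coeff_one]
    split_ifs <;> simp [hε.map_one]
  comm x y hy := by
    ext n
    have h1 : ∀ m < x.order, x.coeff m = 0 := fun m => coeff_eq_zero_of_lt_of_le_order le_rfl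
    have h2 : ∀ m < y.order, y.coeff m = 0 := fun m => coeff_eq_zero_of_lt_of_le_order le_rfl
    rw [coeff_mul_eq_sum h1 h2, coeff_mul_eq_sum h2 h1]
    refine Finset.sum_nbij' (fun i => n - i) (fun i => n - i) ?_ ?_ ?_ ?_ ?_ <;>
      intro i hi <;> simp only [Finset.mem_Icc] at hi ⊢
    any_goals omega
    rw [sub_sub_cancel]
    refine hε.comm _ _ ?_
    rw [← coeff_cwH, hy]
  anti x y hy := by
    ext n
    have h1 : ∀ m < x.order, x.coeff m = 0 := fun m => coeff_eq_zero_of_lt_of_le_order le_rfl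
    have h2 : ∀ m < y.order, y.coeff m = 0 := fun m => coeff_eq_zero_of_lt_of_le_order le_rfl
    rw [coeff_mul_eq_sum h1 h2, coeff_mul_eq_sum h2 (y := cwH ε x) (b := x.order)
      (fun m hm => by simp [h1 m hm])]
    refine Finset.sum_nbij' (fun i => n - i) (fun i => n - i) ?_ ?_ ?_ ?_ ?_ <;>
      intro i hi <;> simp only [Finset.mem_Icc] at hi ⊢
    any_goals omega
    rw [sub_sub_cancel, coeff_cwH]
    refine hε.anti _ _ ?_
    rw [← coeff_cwH, hy, HahnSeries.coeff_neg]

/-- Coefficientwise action of a linear map on polynomials. -/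
def cwX (φ : R →ₗ[ℂ] R') : R[X] →ₗ[ℂ] R'[X] :=
  Polynomial.lsum fun n => (Polynomial.monomial n).restrictScalars ℂ ∘ₗ φ

@[simp] lemma coeff_cwX (φ : R →ₗ[ℂ] R') (p : R[X]) (n : ℕ) :
    (cwX φ p).coeff n = φ (p.coeff n) := by
  induction p using Polynomial.induction_on' with
  | add p q hp hq => simp [hp, hq]
  | monomial m a =>
    simp only [cwX, Polynomial.lsum_apply]
    rw [Polynomial.sum_monomial_index _ _ (by simp)]
    simp only [LinearMap.comp_apply, LinearMap.restrictScalars_apply, Polynomial.coeff_monomial]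
    split_ifs <;> simp

@[simp] lemma cwX_C (φ : R →ₗ[ℂ] R') (x : R) : cwX φ (Polynomial.C x) = Polynomial.C (φ x) := by
  ext m
  simp only [coeff_cwX, Polynomial.coeff_C]
  split_ifs <;> simp

lemma cwX_leibniz {D J J' : R →ₗ[ℂ] R'} (h : ∀ x y, D (x * y) = D x * J y + J' x * D y)
    (p q : R[X]) : cwX D (p * q) = cwX D p * cwX J q + cwX J' p * cwX D q := by
  ext n
  simp [Polynomial.coeff_mul, h, Finset.sum_add_distrib]

lemma cwX_mul {J : R →ₗ[ℂ] R'} (h : ∀ x y, J (x * y) = J x * J y)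
    (p q : R[X]) : cwX J (p * q) = cwX J p * cwX J q := by
  ext n
  simp [Polynomial.coeff_mul, h]

lemma IsSuperComm.polynomial {ε : R →ₗ[ℂ] R} (hε : IsSuperComm ε) : IsSuperComm (cwX ε) where
  sq x := by ext n; simp [hε.sq]
  map_mul x y := cwX_mul hε.map_mul x y
  map_one := by rw [← Polynomial.C_1, cwX_C, hε.map_one]
  comm x y hy := by
    ext n
    rw [Polynomial.coeff_mul, Polynomial.coeff_mul, ← Finset.Nat.sum_antidiagonal_swap]
    refine Finset.sum_congr rfl fun p _ => hε.comm _ _ ?_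
    rw [Prod.fst_swap.symm, ← coeff_cwX, hy]
  anti x y hy := by
    ext n
    rw [Polynomial.coeff_mul, Polynomial.coeff_mul, ← Finset.Nat.sum_antidiagonal_swap]
    refine Finset.sum_congr rfl fun p _ => ?_
    rw [coeff_cwX]
    refine hε.anti _ _ ?_
    rw [← coeff_cwX, hy, Polynomial.coeff_neg]

end Hahn

namespace Setup

variable {g : Type*} [AddCommGroup g] [Module ℂ g] (S : Setup g)

lemma isSuperComm_sgn (q : Bool) : IsSuperComm (S.sgn q).toLinearMap := by
  have key : ∀ (j : ZMod 2) (x y : S.DA q), S.sgn q y = sg j • y →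
      x * y = y * (if j = 0 then x else S.sgn q x) := by
    intro j x y hy
    induction x using S.DA_induction q with
    | scalar c => split_ifs <;> simp [Algebra.commutes]
    | gen n a =>
      rw [← S.ev_add_od a]
      simp only [map_add, add_mul]
      rw [S.gen_mul q n 0 (S.ev a) (by simp [sg, S.par_ev]), S.gen_mul q n 1 (S.od a)
        (by simp [sg, S.par_od]), hy, sgn_gen, sgn_gen, S.par_ev, S.par_od]
      rcases zmod2_cases j with rfl | rfl <;> simp [sg, mul_add]
    | mul x x' hx hx' =>
      rw [mul_assoc, hx', ← mul_assoc, hx, mul_assoc]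
      split_ifs <;> simp
    | add x x' hx hx' =>
      rw [add_mul, hx, hx', ← mul_add]
      split_ifs <;> simp
  refine ⟨S.sgn_sgn q, map_mul (S.sgn q), map_one (S.sgn q), fun x y hy => ?_, fun x y hy => ?_⟩
  · simpa using key 0 x y (by simpa [sg] using hy)
  · simpa using key 1 x y (by simpa [sg] using hy)

/-! ### Super-derivations extended to `g ⊗ B`. -/

section Leibniz

variable {B B' : Type*} [Ring B] [Algebra ℂ B] [Ring B'] [Algebra ℂ B'] {ε : B →ₗ[ℂ] B}
  {ε' : B' →ₗ[ℂ] B'}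

/-- The map `a ⊗ x ↦ (-1)^{i p(a)} a ⊗ D x`. -/
def mapT (i : ZMod 2) (D : B →ₗ[ℂ] B') : g ⊗[ℂ] B →ₗ[ℂ] g ⊗[ℂ] B' := TensorProduct.map (S.tw i) D

/-- `D` is a super-derivation of parity `i` along the homomorphism `J`. -/
structure IsDer (ε : B →ₗ[ℂ] B) (ε' : B' →ₗ[ℂ] B') (i : ZMod 2) (J D : B →ₗ[ℂ] B') : Prop where
  J_par : ∀ x, ε' (J x) = J (ε x)
  D_par : ∀ x, ε' (D x) = sg i • D (ε x)
  D_mul : ∀ x y, D (x * y) = D x * J y + J (if i = 0 then x else ε x) * D y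

lemma IsDer.D_mul_homog {i l : ZMod 2} {J D : B →ₗ[ℂ] B'} (h : IsDer ε ε' i J D) {x : B}
    (hx : ε x = sg l • x) (y : B) : D (x * y) = D x * J y + sg (i * l) • (J x * D y) := by
  rw [h.D_mul]
  rcases zmod2_cases i with rfl | rfl
  · simp [sg]
  · simp [hx]

lemma mapT_zero (D : B →ₗ[ℂ] B') : S.mapT 0 D = LinearMap.lTensor g D := by
  simp [mapT, tw, LinearMap.lTensor]

lemma mapT_tmul_homog {i j : ZMod 2} (D : B →ₗ[ℂ] B') {a : g} (ha : S.par a = sg j • a) (x : B) :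
    S.mapT i D (a ⊗ₜ x) = sg (i * j) • (a ⊗ₜ[ℂ] D x) := by
  rw [mapT, TensorProduct.map_tmul, S.tw_homog i ha, TensorProduct.smul_tmul']

/-- The factor `(-1)^{i p(a)}` in `mapT` pays for moving `D` past `a`, so for even `x` the Leibniz
rule carries no further sign. -/
lemma mapT_brT (hε : IsSuperComm ε) {i : ZMod 2} {J D : B →ₗ[ℂ] B'} (h : IsDer ε ε' i J D)
    {x : g ⊗[ℂ] B} (hx : S.parT ε x = x) (y : g ⊗[ℂ] B) :
    S.mapT i D (S.brT ε x y) = S.brT ε' (S.mapT i D x) (S.mapT 0 J y) +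
      S.brT ε' (S.mapT 0 J x) (S.mapT i D y) := by
  refine S.even_induction hε.sq (motive := fun x => S.mapT i D (S.brT ε x y) =
      S.brT ε' (S.mapT i D x) (S.mapT 0 J y) + S.brT ε' (S.mapT 0 J x) (S.mapT i D y))
    (fun x x' hx hx' => by simp only [map_add, LinearMap.add_apply, hx, hx']; abel)
    (fun l a x ha hx => ?_) hx
  induction y using S.tensor_induction hε.sq with
  | add y y' hy hy' => simp only [map_add, hy, hy']; abel
  | tmul j m b y hb hy =>
    have hD : ε' (D x) = sg (i + l) • D x := by rw [h.D_par, hx, map_smul, smul_smul, sg_add]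
    have hJ : ε' (J x) = sg l • J x := by rw [h.J_par, hx, map_smul]
    rw [S.brT_homog ε y hx hb, map_smul, S.mapT_tmul_homog D (S.br_par_homog ha hb),
      S.mapT_tmul_homog D ha, S.mapT_tmul_homog J ha, S.mapT_tmul_homog D hb,
      S.mapT_tmul_homog J hb]
    simp only [map_smul, LinearMap.smul_apply]
    rw [S.brT_homog ε' _ hD hb, S.brT_homog ε' _ hJ hb, h.D_mul_homog hx, TensorProduct.tmul_add]
    simp only [TensorProduct.tmul_smul, smul_smul, smul_add, mul_add, add_mul, sg_add, zero_mul]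
    have h1 := sg_mul_self (i * l)
    have h2 := sg_mul_self (i * j)
    have h0 : sg 0 = 1 := rfl
    congr 2
    · rw [h0]; ring
    · rw [h0]; linear_combination (sg (l * j) * sg (i * j)) * h1

lemma map_formT (hε : IsSuperComm ε) {i : ZMod 2} {J D : B →ₗ[ℂ] B'} (h : IsDer ε ε' i J D)
    {x : g ⊗[ℂ] B} (hx : S.parT ε x = x) (y : g ⊗[ℂ] B) :
    D (S.formT ε x y) = S.formT ε' (S.mapT i D x) (S.mapT 0 J y) +
      S.formT ε' (S.mapT 0 J x) (S.mapT i D y) := by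
  refine S.even_induction hε.sq (motive := fun x => D (S.formT ε x y) =
      S.formT ε' (S.mapT i D x) (S.mapT 0 J y) + S.formT ε' (S.mapT 0 J x) (S.mapT i D y))
    (fun x x' hx hx' => by simp only [map_add, LinearMap.add_apply, hx, hx']; abel)
    (fun l a x ha hx => ?_) hx
  induction y using S.tensor_induction hε.sq with
  | add y y' hy hy' => simp only [map_add, hy, hy']; abel
  | tmul j m b y hb hy =>
    have hD : ε' (D x) = sg (i + l) • D x := by rw [h.D_par, hx, map_smul, smul_smul, sg_add]
    have hJ : ε' (J x) = sg l • J x := by rw [h.J_par, hx, map_smul]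
    rw [S.formT_homog ε y hx hb, map_smul, map_smul, S.mapT_tmul_homog D ha,
      S.mapT_tmul_homog J ha, S.mapT_tmul_homog D hb, S.mapT_tmul_homog J hb]
    simp only [map_smul, LinearMap.smul_apply]
    rw [S.formT_homog ε' _ hD hb, S.formT_homog ε' _ hJ hb, h.D_mul_homog hx]
    -- The form is even and vanishes on elements of different parity, so the signs have to match
    -- only when `l = j`.
    by_cases hlj : l = j
    · subst hlj
      simp only [smul_smul, smul_add, add_mul, sg_add, zero_mul]
      have h1 := sg_mul_self (i * l)
      have h0 : sg 0 = 1 := rfl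
      congr 2
      · rw [h0]; linear_combination (-sg (l * l) * S.B a b) * h1
      · rw [h0]; ring
    · have : S.B a b = 0 := by
        have h1 := S.B_even a b
        rw [ha, hb, map_smul, map_smul, LinearMap.smul_apply, smul_smul] at h1
        have h2 : sg j * sg l = -1 := by
          rcases zmod2_cases l with rfl | rfl <;> rcases zmod2_cases j with rfl | rfl <;>
            simp_all [sg]
        rw [h2, neg_smul, one_smul] at h1
        exact self_eq_neg.1 h1.symm
      simp [this]

end Leibniz

end Setup

end WSuper

namespace WSuper

namespace Setup

variable {g : Type*} [AddCommGroup g] [Module ℂ g] (S : Setup g)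

/-! ### The grading of `g` -/

lemma jacobi_even {a : g} (ha : S.par a = a) (b c : g) :
    S.br a (S.br b c) = S.br (S.br a b) c + S.br b (S.br a c) := by
  rw [← S.ev_add_od b]
  have h0 := S.jacobi 0 0 a (S.ev b) c (by simpa [sg] using ha) (by simp [sg, S.par_ev])
  have h1 := S.jacobi 0 1 a (S.od b) c (by simpa [sg] using ha) (by simp [sg, S.par_od])
  simp only [zero_mul, sg, if_true, one_smul] at h0 h1
  simp only [map_add, LinearMap.add_apply, h0, h1]
  abel

lemma skew_even {a : g} (ha : S.par a = a) (b : g) : S.br b a = -S.br a b := by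
  rw [← S.ev_add_od b]
  have h0 := S.skew 0 0 (S.ev b) a (by simp [sg, S.par_ev]) (by simpa [sg] using ha)
  have h1 := S.skew 1 0 (S.od b) a (by simp [sg, S.par_od]) (by simpa [sg] using ha)
  simp only [mul_zero, sg, if_true, one_smul] at h0 h1
  simp only [map_add, LinearMap.add_apply, h0, h1]
  abel

lemma symm_even {a : g} (ha : S.par a = a) (b : g) : S.B b a = S.B a b := by
  rw [← S.ev_add_od b]
  have h0 := S.B_symm 0 0 (S.ev b) a (by simp [sg, S.par_ev]) (by simpa [sg] using ha)
  have h1 := S.B_symm 1 0 (S.od b) a (by simp [sg, S.par_od]) (by simpa [sg] using ha)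
  simp only [mul_zero, sg, if_true, one_mul] at h0 h1
  simp only [map_add, LinearMap.add_apply, h0, h1]

lemma mem_gr {j : ℤ} {a : g} : a ∈ S.gr j ↔ S.br S.h a = (j : ℂ) • a :=
  Module.End.mem_eigenspace_iff

lemma e_mem : S.e ∈ S.gr 2 := by simpa [mem_gr] using S.br_h_e

lemma f_mem : S.f ∈ S.gr (-2) := by simpa [mem_gr] using S.br_h_f

lemma br_mem_gr {i j : ℤ} {a b : g} (ha : a ∈ S.gr i) (hb : b ∈ S.gr j) :
    S.br a b ∈ S.gr (i + j) := by
  rw [mem_gr] at ha hb ⊢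
  rw [S.jacobi_even S.h_even, ha, hb]
  simp [add_smul]

lemma B_gr {i j : ℤ} (hij : i + j ≠ 0) {a b : g} (ha : a ∈ S.gr i) (hb : b ∈ S.gr j) :
    S.B a b = 0 := by
  rw [mem_gr] at ha hb
  have h1 := S.B_inv a S.h b
  rw [S.skew_even S.h_even, ha, hb, map_neg, map_smul, LinearMap.neg_apply, LinearMap.smul_apply,
    map_smul] at h1
  have h2 : ((i : ℂ) + j) * S.B a b = 0 := by
    simp only [smul_eq_mul] at h1
    linear_combination -h1
  exact (mul_eq_zero.1 h2).resolve_left (by exact_mod_cast hij)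

lemma ev_mem_gr {j : ℤ} {a : g} (ha : a ∈ S.gr j) : S.ev a ∈ S.gr j :=
  Submodule.smul_mem _ _ (add_mem ha (S.par_mem_gr ha))

lemma od_mem_gr {j : ℤ} {a : g} (ha : a ∈ S.gr j) : S.od a ∈ S.gr j :=
  Submodule.smul_mem _ _ (sub_mem ha (S.par_mem_gr ha))

lemma tw_mem_gr (i : ZMod 2) {j : ℤ} {a : g} (ha : a ∈ S.gr j) : S.tw i a ∈ S.gr j := by
  rw [tw]
  split_ifs
  · exact ha
  · exact S.par_mem_gr ha

/-- The element `e` has doubled degree `2`, and it is nonzero because `(e|f) = 1`. -/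
lemma two_le_of_gr_eq_bot {D : ℤ} (hD : ∀ j : ℤ, D < j → S.gr j = ⊥) : 2 ≤ D := by
  by_contra h
  have h1 := S.e_mem
  rw [hD 2 (by omega), Submodule.mem_bot] at h1
  have h2 := S.B_e_f
  rw [h1] at h2
  simp at h2

section Basis

variable [FiniteDimensional ℂ g]

/-- The operators `ad e`, `ad h`, `ad f` form a finite dimensional representation of `sl₂`. -/
lemma iSup_gr : ⨆ j, S.gr j = ⊤ := by
  have hb : ∀ {a b : g}, S.par a = a → S.par b = b →
      S.br a * S.br b - S.br b * S.br a = S.br (S.br a b) := by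
    intro a b ha hb
    ext c
    simp [S.jacobi_even ha]
  refine iSup_eigenspace_int_eq_top (e := S.br S.e) (f := S.br S.f) (h := S.br S.h) ?_ ?_ ?_
  · rw [hb S.h_even S.e_even, S.br_h_e, map_smul, two_smul, two_mul]
  · rw [hb S.h_even S.f_even, S.br_h_f, map_neg, map_smul, two_smul, two_mul]
  · rw [hb S.e_even S.f_even, S.br_e_f]

lemma exists_homogeneous_basis : ∃ (b : Module.Basis (Fin (Module.finrank ℂ g)) ℂ g)
    (d : Fin (Module.finrank ℂ g) → ℤ), ∀ i, b i ∈ S.gr (d i) := by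
  have hind : iSupIndep S.gr :=
    (Module.End.eigenspaces_iSupIndep (S.br S.h)).comp (f := fun j : ℤ => (j : ℂ)) Int.cast_injective
  have hint := DirectSum.isInternal_submodule_of_iSupIndep_of_iSup_eq_top hind S.iSup_gr
  let b := hint.collectedBasis fun j => Module.Basis.ofVectorSpace ℂ (S.gr j)
  haveI : Fintype (Σ j : ℤ, Module.Basis.ofVectorSpaceIndex ℂ (S.gr j)) :=
    Module.Basis.fintypeIndexOfRankLtAleph0 b (Module.rank_lt_aleph0 ℂ g)
  have hcard : Fintype.card (Σ j : ℤ, Module.Basis.ofVectorSpaceIndex ℂ (S.gr j)) =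
      Fintype.card (Fin (Module.finrank ℂ g)) := by
    rw [Fintype.card_fin, Module.finrank_eq_card_basis b]
  let eqv := Fintype.equivOfCardEq hcard
  refine ⟨b.reindex eqv, fun i => (eqv.symm i).1, fun i => ?_⟩
  rw [Module.Basis.reindex_apply]
  exact hint.collectedBasis_mem _ _

/-- A basis of `g` consisting of eigenvectors of `ad h`. -/
def hb : Module.Basis (Fin (Module.finrank ℂ g)) ℂ g := S.exists_homogeneous_basis.choose

/-- The eigenvalues of the elements of the basis `hb`. -/
def deg : Fin (Module.finrank ℂ g) → ℤ := S.exists_homogeneous_basis.choose_spec.choose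

lemma hb_mem (i) : S.hb i ∈ S.gr (S.deg i) := S.exists_homogeneous_basis.choose_spec.choose_spec i

lemma coord_eq_zero {j : ℤ} {a : g} (ha : a ∈ S.gr j) {i} (hi : S.deg i ≠ j) :
    S.hb.coord i a = 0 := by
  have key : S.hb.coord i ∘ₗ S.br S.h = (S.deg i : ℂ) • S.hb.coord i := by
    refine S.hb.ext fun l => ?_
    have := S.hb_mem l
    rw [mem_gr] at this
    simp only [LinearMap.comp_apply, this, map_smul, LinearMap.smul_apply,
      Module.Basis.coord_apply, Module.Basis.repr_self, Finsupp.single_apply]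
    split_ifs with h
    · rw [h]
    · simp
  have h1 := LinearMap.congr_fun key a
  rw [LinearMap.comp_apply, S.mem_gr.1 ha, map_smul, LinearMap.smul_apply, ← sub_eq_zero,
    ← sub_smul] at h1
  refine (smul_eq_zero.1 h1).resolve_left ?_
  exact sub_ne_zero.2 (by exact_mod_cast hi.symm)

/-- The coordinates of an element of `g ⊗ M`. -/
def crd {M : Type*} [AddCommGroup M] [Module ℂ M] (i : Fin (Module.finrank ℂ g)) :
    g ⊗[ℂ] M →ₗ[ℂ] M :=
  (TensorProduct.lid ℂ M).toLinearMap ∘ₗ LinearMap.rTensor M (S.hb.coord i)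

section Crd

variable {M : Type*} [AddCommGroup M] [Module ℂ M]

@[simp] lemma crd_tmul (i) (a : g) (x : M) : S.crd i (a ⊗ₜ x) = S.hb.coord i a • x := by
  simp [crd]

lemma sum_crd (x : g ⊗[ℂ] M) : ∑ i, S.hb i ⊗ₜ S.crd i x = x := by
  induction x using TensorProduct.induction_on with
  | zero => simp
  | tmul a x =>
    simp only [crd_tmul, TensorProduct.tmul_smul, TensorProduct.smul_tmul']
    rw [← TensorProduct.sum_tmul]
    congr 1
    exact S.hb.sum_repr a
  | add x y hx hy => simp only [map_add, TensorProduct.tmul_add, Finset.sum_add_distrib, hx, hy]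

lemma crd_sum (y : Fin (Module.finrank ℂ g) → M) (i) : S.crd i (∑ l, S.hb l ⊗ₜ y l) = y i := by
  simp only [map_sum, crd_tmul, Module.Basis.coord_apply, Module.Basis.repr_self,
    Finsupp.single_apply]
  simp

lemma crd_ext {x y : g ⊗[ℂ] M} (h : ∀ i, S.crd i x = S.crd i y) : x = y := by
  rw [← S.sum_crd x, ← S.sum_crd y]
  simp [h]

end Crd

/-! ### The filtration of `g ⊗ R((z⁻¹))` -/

section Filtration

variable {R R' : Type*} [Ring R] [Algebra ℂ R] [Ring R'] [Algebra ℂ R']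

variable (R) in
/-- The elements of `g ⊗ R((z⁻¹))` of (doubled) degree at least `c`. -/
def fil (D c : ℤ) : Submodule ℂ (g ⊗[ℂ] HahnSeries ℤ R) where
  carrier := {x | ∀ i m, S.deg i + m * (D + 2) < c → (S.crd i x).coeff m = 0}
  zero_mem' := fun i m _ => by simp
  add_mem' := fun {x y} hx hy i m h => by simp [hx i m h, hy i m h]
  smul_mem' := fun t x hx i m h => by simp [hx i m h]

variable {D : ℤ}

lemma tmul_mem_fil {c j : ℤ} {a : g} {X : HahnSeries ℤ R} (ha : a ∈ S.gr j)
    (hX : ∀ m, j + m * (D + 2) < c → X.coeff m = 0) : a ⊗ₜ X ∈ S.fil R D c := by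
  intro i m h
  rw [crd_tmul]
  by_cases hi : S.deg i = j
  · simp [hX m (hi ▸ h)]
  · simp [-Module.Basis.coord_apply, S.coord_eq_zero ha hi]

lemma fil_induction {c : ℤ} {N : Type*} [AddCommGroup N] [Module ℂ N] {P : Submodule ℂ N}
    {T : g ⊗[ℂ] HahnSeries ℤ R →ₗ[ℂ] N}
    (h : ∀ (j : ℤ) (a : g) (X : HahnSeries ℤ R), a ∈ S.gr j →
      (∀ m, j + m * (D + 2) < c → X.coeff m = 0) → T (a ⊗ₜ X) ∈ P)
    {x : g ⊗[ℂ] HahnSeries ℤ R} (hx : x ∈ S.fil R D c) : T x ∈ P := by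
  rw [← S.sum_crd x, map_sum]
  exact Submodule.sum_mem _ fun i _ => h _ _ _ (S.hb_mem i) fun m hm => hx i m hm

lemma fil_complete (hD : 0 < D + 2) : CompleteFiltration (S.fil R D) where
  anti := fun c d hcd x hx i m h => hx i m (by omega)
  exhaustive := fun x => by
    obtain ⟨c, hc⟩ : ∃ c, ∀ i, c ≤ S.deg i + (S.crd i x).order * (D + 2) := by
      obtain ⟨c, hc⟩ := (Set.finite_range
        fun i => S.deg i + (S.crd i x).order * (D + 2)).bddBelow
      exact ⟨c, fun i => hc ⟨i, rfl⟩⟩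
    refine ⟨c, fun i m h => HahnSeries.coeff_eq_zero_of_lt_order ?_⟩
    by_contra hm
    have := hc i
    nlinarith
  separated := fun x hx => S.crd_ext fun i => by
    ext m
    rw [map_zero]
    exact hx (S.deg i + m * (D + 2) + 1) i m (by omega)
  complete := fun c x hx => by
    -- For `n ≥ N i m` the term `x n` has no coefficient at `(i, m)`, so each coefficient of the
    -- limit is a finite sum.
    set N : Fin (Module.finrank ℂ g) → ℤ → ℕ := fun i m => (S.deg i + m * (D + 2) + 1 - c).toNat
      with hN
    set y : Fin (Module.finrank ℂ g) → ℤ → R := fun i m =>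
      ∑ n ∈ Finset.range (N i m), (S.crd i (x n)).coeff m with hy
    have hb : ∀ i, BddBelow (Function.support (y i)) := by
      intro i
      refine ⟨-(S.deg i - c).natAbs, fun m hm => ?_⟩
      by_contra h
      refine hm ?_
      have : N i m = 0 := by
        rw [hN]
        have h2 : S.deg i + m * (D + 2) + 1 - c ≤ 0 := by
          have : m * (D + 2) ≤ m * 1 := by nlinarith
          omega
        simpa using h2
      simp only [hy, this, Finset.range_zero, Finset.sum_empty]
    refine ⟨∑ i, S.hb i ⊗ₜ HahnSeries.ofSuppBddBelow (y i) (hb i), fun n i m h => ?_⟩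
    rw [map_sub, S.crd_sum, HahnSeries.coeff_sub, HahnSeries.coeff_ofSuppBddBelow, map_sum,
      HahnSeries.coeff_sum, sub_eq_zero]
    have hle : N i m ≤ n := by
      rw [hN]
      simp only
      omega
    refine Finset.sum_subset (Finset.range_mono hle) fun l _ hl => hx l i m ?_
    simp only [hN, Finset.mem_range, not_lt] at hl
    omega

lemma brT_mem_fil (ε : R →ₗ[ℂ] R) {c d : ℤ} {x y : g ⊗[ℂ] HahnSeries ℤ R}
    (hx : x ∈ S.fil R D c) (hy : y ∈ S.fil R D d) :
    S.brT (cwH ε) x y ∈ S.fil R D (c + d) := by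
  refine S.fil_induction (T := (S.brT (cwH ε)).flip y) (fun i a X ha hX => ?_) hx
  rw [LinearMap.flip_apply]
  refine S.fil_induction (fun j b Y hb hY => ?_) hy
  have key : ∀ X' : HahnSeries ℤ R, (∀ m, i + m * (D + 2) < c → X'.coeff m = 0) →
      ∀ m, i + j + m * (D + 2) < c + d → (X' * Y).coeff m = 0 := by
    intro X' hX' m hm
    rw [HahnSeries.coeff_mul]
    refine Finset.sum_eq_zero fun p hp => ?_
    rw [Finset.mem_antidiagonal] at hp
    by_cases h1 : i + p.1 * (D + 2) < c
    · rw [hX' _ h1, zero_mul]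
    · rw [hY p.2 (by rw [← hp.2.2] at hm; nlinarith), mul_zero]
  rw [brT_tmul]
  exact add_mem (S.tmul_mem_fil (S.br_mem_gr ha (S.ev_mem_gr hb)) (key X hX))
    (S.tmul_mem_fil (S.br_mem_gr ha (S.od_mem_gr hb)) (key _ fun m hm => by simp [hX m hm]))

/-- The form followed by the coefficient of `z^0` pairs degree `t` only with degree `-t`. -/
lemma formT_coeff_zero (hD : 0 < D + 2) (ε : R →ₗ[ℂ] R) {c d : ℤ} {x y : g ⊗[ℂ] HahnSeries ℤ R}
    (hx : x ∈ S.fil R D c) (hy : y ∈ S.fil R D d) (hcd : 0 < c + d) :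
    (S.formT (cwH ε) x y).coeff 0 = 0 := by
  rw [← Submodule.mem_bot ℂ]
  refine S.fil_induction (T := HahnSeries.coeff.linearMap 0 ∘ₗ (S.formT (cwH ε)).flip y)
    (fun i a X ha hX => ?_) hx
  simp only [LinearMap.comp_apply, LinearMap.flip_apply]
  refine S.fil_induction (T := HahnSeries.coeff.linearMap 0 ∘ₗ S.formT (cwH ε) (a ⊗ₜ X))
    (fun j b Y hb hY => ?_) hy
  simp only [LinearMap.comp_apply]
  rw [Submodule.mem_bot, formT_tmul]
  by_cases hij : i + j = 0
  · have key : ∀ X' : HahnSeries ℤ R, (∀ m, i + m * (D + 2) < c → X'.coeff m = 0) →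
        (X' * Y).coeff 0 = 0 := by
      intro X' hX'
      rw [HahnSeries.coeff_mul]
      refine Finset.sum_eq_zero fun p hp => ?_
      rw [Finset.mem_antidiagonal] at hp
      by_cases h1 : i + p.1 * (D + 2) < c
      · rw [hX' _ h1, zero_mul]
      · have h3 : (i + p.1 * (D + 2)) + (j + p.2 * (D + 2)) = 0 := by
          linear_combination hij + (D + 2) * hp.2.2
        rw [hY p.2 (by omega), mul_zero]
    have h1 := key X hX
    have h2 := key (cwH ε X) fun m hm => by simp [hX m hm]
    simp [h1, h2]
  · rw [S.B_gr hij ha (S.ev_mem_gr hb), S.B_gr hij ha (S.od_mem_gr hb)]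
    simp

lemma mapT_mem_fil (i : ZMod 2) (φ : R →ₗ[ℂ] R') {c : ℤ} {x : g ⊗[ℂ] HahnSeries ℤ R}
    (hx : x ∈ S.fil R D c) : S.mapT i (cwH φ) x ∈ S.fil R' D c := by
  refine S.fil_induction (fun j a X ha hX => ?_) hx
  exact S.tmul_mem_fil (S.tw_mem_gr i ha) fun m hm => by simp [hX m hm]

lemma parT_mem_fil (φ : R →ₗ[ℂ] R) {c : ℤ} {x : g ⊗[ℂ] HahnSeries ℤ R}
    (hx : x ∈ S.fil R D c) : S.parT (cwH φ) x ∈ S.fil R D c := by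
  refine S.fil_induction (fun j a X ha hX => ?_) hx
  exact S.tmul_mem_fil (S.par_mem_gr ha) fun m hm => by simp [hX m hm]

/-- Multiplication by `z^n` on `R((z⁻¹))`. -/
def zmulH (R : Type*) [Ring R] [Algebra ℂ R] (n : ℤ) : HahnSeries ℤ R →ₗ[ℂ] HahnSeries ℤ R :=
  LinearMap.mulLeft ℂ (HahnSeries.single (-n) 1)

lemma coeff_zmulH (n m : ℤ) (X : HahnSeries ℤ R) : (zmulH R n X).coeff m = X.coeff (m + n) := by
  rw [zmulH, LinearMap.mulLeft_apply, HahnSeries.coeff_single_mul, one_mul, sub_neg_eq_add]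

variable (R) in
omit [FiniteDimensional ℂ g] in
/-- Multiplication by `z^n` on `g ⊗ R((z⁻¹))`. -/
def zmul (_ : Setup g) (n : ℤ) : g ⊗[ℂ] HahnSeries ℤ R →ₗ[ℂ] g ⊗[ℂ] HahnSeries ℤ R :=
  LinearMap.lTensor g (zmulH R n)

lemma zmul_mem_fil (n : ℤ) {c : ℤ} {x : g ⊗[ℂ] HahnSeries ℤ R}
    (hx : x ∈ S.fil R D c) : S.zmul R n x ∈ S.fil R D (c - n * (D + 2)) := by
  refine S.fil_induction (fun j a X ha hX => ?_) hx
  refine S.tmul_mem_fil ha fun m hm => ?_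
  change (zmulH R n X).coeff m = 0
  rw [coeff_zmulH]
  exact hX _ (by linarith)

end Filtration

/-! ### Relation with the definitions of the statement -/

variable {D : ℤ}

lemma crd_coeffG (i) (m : ℤ) (x : S.G) : S.crd i (S.coeffG m x) = (S.crd i x).coeff m := by
  induction x using TensorProduct.induction_on with
  | zero => simp
  | tmul a x => simp [coeffG]
  | add x y hx hy => simp only [map_add, HahnSeries.coeff_add, hx, hy]

lemma coeffG_ext {x y : S.G} (h : ∀ m, S.coeffG m x = S.coeffG m y) : x = y := by
  refine S.crd_ext fun i => ?_
  ext m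
  rw [← crd_coeffG, h, crd_coeffG]

/-- Degrees are integers, so the strict bound `> c` becomes membership at `c + 1`, read off in
homogeneous coordinates. -/
lemma degGT_iff {c : ℤ} {x : S.G} : S.DegGT D c x ↔ x ∈ S.fil S.V D (c + 1) := by
  constructor
  · intro h i m him
    obtain ⟨t, ht⟩ := h m
    rw [← crd_coeffG, ← ht, crd, LinearMap.comp_apply, ← LinearMap.rTensor_comp_apply]
    have : S.hb.coord i ∘ₗ (⨆ j : ℤ, ⨆ _ : c < j + m * (D + 2), S.gr j : Submodule ℂ g).subtype =
        0 := by
      ext ⟨a, ha⟩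
      have hle : (⨆ j : ℤ, ⨆ _ : c < j + m * (D + 2), S.gr j : Submodule ℂ g) ≤
          LinearMap.ker (S.hb.coord i) :=
        iSup₂_le fun j hj a ha => S.coord_eq_zero ha (by rintro rfl; omega)
      exact hle ha
    rw [this]
    simp
  · intro h m
    rw [← S.sum_crd (S.coeffG m x)]
    refine Submodule.sum_mem _ fun i _ => ?_
    rw [crd_coeffG]
    by_cases him : S.deg i + m * (D + 2) < c + 1
    · rw [h i m him, TensorProduct.tmul_zero]
      exact zero_mem _
    · refine ⟨⟨S.hb i, ?_⟩ ⊗ₜ (S.crd i x).coeff m, by simp⟩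
      exact Submodule.mem_iSup_of_mem (S.deg i)
        (Submodule.mem_iSup_of_mem (by omega) (S.hb_mem i))

lemma brG_eq : S.brG = S.brT (cwH (S.sgn true).toLinearMap) := rfl

lemma formG_eq (x y : S.G) :
    S.formG x y = (S.formT (cwH (S.sgn true).toLinearMap) x y).coeff 0 := rfl

lemma sgnG_eq : S.sgnG = S.parT (cwH (S.sgn true).toLinearMap) := rfl

lemma derG_eq : S.derG = S.mapT 0 (cwH (S.der true)) := (S.mapT_zero _).symm

lemma raises_brG (hD : 0 < D + 2) {X : S.G} (hX : X ∈ S.fil S.V D 1) :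
    Raises (S.fil S.V D) (S.fil S.V D) (S.brG X) 1 := fun c x hx => by
  rw [add_comm]
  exact S.brT_mem_fil _ hX hx

/-- A fixed coefficient in `z` is insensitive to sufficiently high filtration degree, because `g`
has finitely many degrees. Coefficientwise stabilization is therefore convergence in the filtration.
-/
lemma isExpAd_iff (hD : 0 < D + 2) {X : S.G} (hX : X ∈ S.fil S.V D 1) (L L' : ℂ × S.G) :
    S.IsExpAd X L L' ↔
      fexp (pairFil (S.fil S.V D)) (pairOp (S.brG X) (S.derG X)) L = L' := by
  have hcf := S.fil_complete (R := S.V) hD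
  have hr := raises_pairOp hcf (S.raises_brG hD hX)
    (show S.derG X ∈ S.fil S.V D 1 by rw [derG_eq]; exact S.mapT_mem_fil _ _ hX)
  obtain ⟨c, hc⟩ := hcf.pair.exhaustive L
  have key : ∀ m : ℤ, ∀ᶠ N : ℕ in Filter.atTop,
      (expSum (S.adOp X) N L).1 = (fexp (pairFil (S.fil S.V D)) (S.adOp X) L).1 ∧
      S.coeffG m (expSum (S.adOp X) N L).2 =
        S.coeffG m (fexp (pairFil (S.fil S.V D)) (S.adOp X) L).2 := by
    intro m
    obtain ⟨d, hd⟩ := (Set.finite_range fun i => S.deg i + m * (D + 2)).bddAbove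
    filter_upwards [Filter.eventually_ge_atTop ((d + 1 - c).toNat + (1 - c).toNat)] with N hN
    have h1 := fexp_sub_mem hcf.pair hr hc N
    refine ⟨(sub_eq_zero.1 (h1.2 (by omega))).symm, ?_⟩
    refine S.crd_ext fun i => ?_
    rw [crd_coeffG, crd_coeffG]
    have h2 := h1.1 i m (by have := hd ⟨i, rfl⟩; simp only at this; omega)
    rw [Prod.snd_sub, map_sub, HahnSeries.coeff_sub, sub_eq_zero] at h2
    exact h2.symm
  constructor
  · intro h
    have h0 : ∀ m, L'.1 = (fexp (pairFil (S.fil S.V D)) (S.adOp X) L).1 ∧ S.coeffG m L'.2 =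
        S.coeffG m (fexp (pairFil (S.fil S.V D)) (S.adOp X) L).2 := by
      intro m
      obtain ⟨N, h1, h2⟩ := ((h m).and (key m)).exists
      exact ⟨h1.1.symm.trans h2.1, h1.2.symm.trans h2.2⟩
    exact Prod.ext (h0 0).1.symm (S.coeffG_ext fun m => (h0 m).2.symm)
  · rintro rfl m
    exact key m

end Basis

end Setup

end WSuper

namespace WSuper

/-! ### A pseudo-inverse of `ad Λ` -/

/-- The minimal polynomial is squarefree, so `X` divides it at most once. A Bézout relation between
`X` and the remaining factor provides the polynomial. -/
lemma exists_aeval_mul_sq_eq {K M : Type*} [Field K] [AddCommGroup M] [Module K M]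
    [FiniteDimensional K M] {f : Module.End K M} (hf : f.IsSemisimple) :
    ∃ p : K[X], Polynomial.aeval f p * f ^ 2 = f := by
  have hsq := hf.minpoly_squarefree
  by_cases hX : Polynomial.X ∣ minpoly K f
  · obtain ⟨q, hq⟩ := hX
    have hnd : ¬ (Polynomial.X : K[X]) ∣ q := fun ⟨r, hr⟩ => by
      refine Polynomial.not_isUnit_X (hsq Polynomial.X ⟨r, ?_⟩)
      rw [hq, hr, mul_assoc]
    obtain ⟨a, b, hab⟩ := (Polynomial.irreducible_X.coprime_iff_not_dvd).2 hnd
    refine ⟨a, ?_⟩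
    have h1 := congrArg (fun r : K[X] => Polynomial.aeval f r * f) hab
    have h2 : Polynomial.aeval f q * f = 0 := by
      have h3 := minpoly.aeval K f
      rwa [hq, mul_comm, map_mul, Polynomial.aeval_X] at h3
    simp only [map_add, map_mul, map_one, one_mul, add_mul, mul_assoc, h2, mul_zero, add_zero,
      Polynomial.aeval_X] at h1
    rw [sq, h1]
  · obtain ⟨a, b, hab⟩ := (Polynomial.irreducible_X.coprime_iff_not_dvd).2 hX
    refine ⟨a, ?_⟩
    have h1 := congrArg (Polynomial.aeval f) hab
    rw [map_add, map_mul, map_mul, minpoly.aeval, mul_zero, add_zero, Polynomial.aeval_X,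
      map_one] at h1
    rw [sq, ← mul_assoc, h1, one_mul]

namespace Setup

variable {g : Type*} [AddCommGroup g] [Module ℂ g] (S : Setup g)

lemma exists_aeval_adLam [FiniteDimensional ℂ g] {s : g} (hΛ : (S.adLam s).IsSemisimple) :
    ∃ p : Polynomial Kz, Polynomial.aeval (S.adLam s) p * S.adLam s ^ 2 = S.adLam s := by
  letI : Field Kz := inferInstanceAs (Field (HahnSeries ℤ ℂ))
  exact exists_aeval_mul_sq_eq (K := Kz) hΛ

/-- `f + z s` acting on `g`, as a polynomial in `z`. -/
def lamPoly (s : g) : Polynomial (Module.End ℂ g) :=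
  Polynomial.C (S.br S.f) + Polynomial.C (S.br s) * Polynomial.X

lemma coeff_lamPoly_mul (s : g) (P : Polynomial (Module.End ℂ g)) (k : ℕ) :
    (S.lamPoly s * P).coeff k =
      S.br S.f * P.coeff k + S.br s * (if k = 0 then 0 else P.coeff (k - 1)) := by
  rw [lamPoly, add_mul, mul_assoc, Polynomial.coeff_add, Polynomial.coeff_C_mul,
    Polynomial.coeff_C_mul]
  cases k <;> simp [Polynomial.coeff_X_mul]

/-- `Λ^n` has degree `-2n` and `z^k` has degree `-k(D + 2)`, which fixes the degree of the
coefficient of `z^k`. -/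
lemma lamPoly_pow_mem {s : g} {D : ℤ} (hs : s ∈ S.gr D) (n k : ℕ) {j : ℤ} {a : g}
    (ha : a ∈ S.gr j) : ((S.lamPoly s ^ n).coeff k) a ∈ S.gr (j - 2 * n + k * (D + 2)) := by
  induction n generalizing k with
  | zero =>
    rw [pow_zero, Polynomial.coeff_one]
    split_ifs with h
    · subst h; simpa using ha
    · simp
  | succ n ih =>
    rw [pow_succ', coeff_lamPoly_mul, LinearMap.add_apply]
    refine add_mem ?_ ?_
    · have := S.br_mem_gr S.f_mem (ih k)
      rw [Module.End.mul_apply]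
      convert this using 2
      push_cast
      ring
    · split_ifs with h
      · simp
      · have := S.br_mem_gr hs (ih (k - 1))
        rw [Module.End.mul_apply]
        convert this using 2
        push_cast [Nat.one_le_iff_ne_zero.2 h]
        ring

/-- The coefficient of `z^{-m}` of an element of `ℂ((z⁻¹))`. -/
def Kz.coeff (m : ℤ) : Kz →ₗ[ℂ] ℂ where
  toFun x := HahnSeries.coeff (Γ := ℤ) (R := ℂ) x m
  map_add' _ _ := rfl
  map_smul' c x := by
    have h1 : ∀ x : HahnSeries ℤ ℂ, HahnSeries.coeff (HahnSeries.ofPowerSeries ℤ ℂ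
        (algebraMap ℂ (PowerSeries ℂ) c) * x) m = c * x.coeff m := fun x => by
      rw [PowerSeries.algebraMap_apply, Algebra.algebraMap_self, RingHom.id_apply,
        HahnSeries.ofPowerSeries_C, HahnSeries.C_mul_eq_smul, HahnSeries.coeff_smul, smul_eq_mul]
    rw [Algebra.smul_def]
    exact h1 x

lemma Kz.coeff_mul_z_pow (m : ℤ) (k : ℕ) (x : Kz) :
    Kz.coeff m (x * Kz.z ^ k) = Kz.coeff (m + k) x := by
  induction k generalizing m with
  | zero => simp
  | succ k ih =>
    have h1 : ∀ (m : ℤ) (x : Kz), Kz.coeff m (x * Kz.z) = Kz.coeff (m + 1) x := by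
      intro m x
      have h2 : ∀ x : HahnSeries ℤ ℂ, HahnSeries.coeff (x * HahnSeries.single (-1) 1) m =
          x.coeff (m + 1) := fun x => by
        rw [HahnSeries.coeff_mul_single, mul_one, sub_neg_eq_add]
      exact h2 x
    rw [pow_succ, ← mul_assoc, h1, ih]
    congr 1
    push_cast
    ring

lemma Kz.coeff_one (m : ℤ) : Kz.coeff m 1 = if m = 0 then 1 else 0 := by
  have h1 : HahnSeries.coeff (1 : HahnSeries ℤ ℂ) m = if m = 0 then 1 else 0 := by
    rw [HahnSeries.coeff_one]
    congr
  exact h1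

/-- The coefficients of an element of `g((z⁻¹))`. -/
def coeffK (m : ℤ) : Kz ⊗[ℂ] g →ₗ[ℂ] g :=
  (TensorProduct.lid ℂ g).toLinearMap ∘ₗ LinearMap.rTensor g (Kz.coeff m)

lemma sum_coeff_mul (s : g) (p : Polynomial Kz) (n : ℕ) (m : ℤ) (a : g) :
    coeffK m (((Polynomial.aeval (S.adLam s) p) * S.adLam s ^ n) (1 ⊗ₜ a)) =
      ∑ i ∈ p.support, ∑ k ∈ (S.lamPoly s ^ (i + n)).support,
        Kz.coeff (m + k) (p.coeff i) • ((S.lamPoly s ^ (i + n)).coeff k) a := by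
  have h1 : ∀ n : ℕ, (S.adLam s ^ n) (1 ⊗ₜ a) = ∑ k ∈ (S.lamPoly s ^ n).support,
      (Kz.z ^ k) ⊗ₜ[ℂ] (((S.lamPoly s ^ n).coeff k) a) := by
    intro n
    set E : Polynomial (Module.End ℂ g) → Kz ⊗[ℂ] g := fun P =>
      P.sum fun k w => (Kz.z ^ k) ⊗ₜ[ℂ] (w a) with hE
    have hadd : ∀ P Q, E (P + Q) = E P + E Q := fun P Q =>
      Polynomial.sum_add_index _ _ _ (fun k => by simp) fun k w w' => by
        simp [TensorProduct.tmul_add]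
    have hmon : ∀ k w, E (Polynomial.monomial k w) = (Kz.z ^ k) ⊗ₜ[ℂ] (w a) := fun k w =>
      Polynomial.sum_monomial_index _ _ (by simp)
    have hmul : ∀ P, E (S.lamPoly s * P) = S.adLam s (E P) := by
      intro P
      induction P using Polynomial.induction_on' with
      | add P Q hP hQ => rw [mul_add, hadd, hP, hQ, hadd, map_add]
      | monomial k w =>
        rw [lamPoly, add_mul, hadd, mul_assoc, Polynomial.X_mul_monomial, Polynomial.C_mul_monomial,
          Polynomial.C_mul_monomial, hmon, hmon, hmon]
        simp only [adLam, LinearMap.add_apply, LinearMap.smul_apply, LinearMap.baseChange_tmul,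
          Module.End.mul_apply, TensorProduct.smul_tmul', smul_eq_mul, pow_succ']
    have hpow : E (S.lamPoly s ^ n) = (S.adLam s ^ n) (1 ⊗ₜ a) := by
      induction n with
      | zero =>
        rw [pow_zero, pow_zero, ← Polynomial.C_1, ← Polynomial.monomial_zero_left, hmon]
        simp
      | succ n ih => rw [pow_succ', hmul, ih, pow_succ', Module.End.mul_apply]
    exact hpow.symm
  rw [Polynomial.aeval_eq_sum_range, Finset.sum_mul, LinearMap.sum_apply, map_sum]
  rw [← Finset.sum_subset (s₁ := p.support)]
  · refine Finset.sum_congr rfl fun i _ => ?_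
    rw [smul_mul_assoc, ← pow_add, LinearMap.smul_apply, h1, Finset.smul_sum, map_sum]
    refine Finset.sum_congr rfl fun k _ => ?_
    rw [TensorProduct.smul_tmul', smul_eq_mul, coeffK, LinearMap.comp_apply,
      LinearMap.rTensor_tmul, Kz.coeff_mul_z_pow]
    simp
  · intro i hi
    rw [Finset.mem_range, Nat.lt_succ_iff]
    exact Polynomial.le_natDegree_of_mem_supp i hi
  · intro i _ hi
    rw [Polynomial.notMem_support_iff.1 hi]
    simp

/-- The homogeneous component of a relation satisfied by `ad Λ`. -/
lemma exists_homogeneous_relation [FiniteDimensional ℂ g] {s : g} {D : ℤ} (hD : 0 < D + 2)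
    (hs : s ∈ S.gr D) (hΛ : (S.adLam s).IsSemisimple) :
    ∃ (I : Finset ℕ) (c : ℕ → ℂ) (d : ℕ → ℕ), (∀ i ∈ I, d i * (D + 2) = 2 * i + 2) ∧
      ∃ M : ℕ, (∀ i ∈ I, d i ≤ M) ∧
      ∑ i ∈ I, Polynomial.C (algebraMap ℂ _ (c i)) * Polynomial.X ^ (M - d i) *
        S.lamPoly s ^ (i + 2) = Polynomial.X ^ M * S.lamPoly s := by
  obtain ⟨p, hp⟩ := S.exists_aeval_adLam hΛ
  -- Take the component of degree `-2` of `p(ad Λ) (ad Λ)² = ad Λ`. The coefficient of `z^{-d}` in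
  -- `p.coeff i` multiplies a term of degree `-2(i + 2)`, which forces `d (D + 2) = 2i + 2`. The
  -- power `M` later clears the negative powers of `z`.
  set I : Finset ℕ := p.support.filter fun i => (D + 2) ∣ 2 * (i : ℤ) + 2 with hI
  set d : ℕ → ℕ := fun i => ((2 * (i : ℤ) + 2) / (D + 2)).toNat with hd
  have hdI : ∀ i ∈ I, (d i : ℤ) * (D + 2) = 2 * i + 2 := by
    intro i hi
    rw [hI, Finset.mem_filter] at hi
    rw [hd]
    simp only
    rw [Int.toNat_of_nonneg (Int.ediv_nonneg (by omega) (by omega)), Int.ediv_mul_cancel hi.2]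
  refine ⟨I, fun i => Kz.coeff (d i) (p.coeff i), d, hdI, I.sup d, fun i hi => Finset.le_sup hi, ?_⟩
  set M := I.sup d with hM
  have hMd : ∀ i ∈ I, d i ≤ M := fun i hi => Finset.le_sup hi
  ext t : 1
  refine S.hb.ext fun j => S.hb.repr.injective (Finsupp.ext fun l => ?_)
  change S.hb.coord l _ = S.hb.coord l _
  set a := S.hb j
  have ha : a ∈ S.gr (S.deg j) := S.hb_mem j
  have hL : S.hb.coord l (((∑ i ∈ I, Polynomial.C (algebraMap ℂ (Module.End ℂ g)
      (Kz.coeff (d i) (p.coeff i))) * Polynomial.X ^ (M - d i) * S.lamPoly s ^ (i + 2)).coeff t) a) =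
      ∑ i ∈ I, Kz.coeff (d i) (p.coeff i) * S.hb.coord l
        ((if M - d i ≤ t then (S.lamPoly s ^ (i + 2)).coeff (t - (M - d i)) else 0) a) := by
    rw [Polynomial.finset_sum_coeff, LinearMap.sum_apply, map_sum]
    refine Finset.sum_congr rfl fun i _ => ?_
    rw [mul_assoc, Polynomial.coeff_C_mul, Polynomial.coeff_X_pow_mul', Module.End.mul_apply,
      Module.algebraMap_end_apply, map_smul, smul_eq_mul]
  have hR : S.hb.coord l (((Polynomial.X ^ M * S.lamPoly s).coeff t) a) =
      S.hb.coord l ((if M ≤ t then (S.lamPoly s).coeff (t - M) else 0) a) := by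
    rw [Polynomial.coeff_X_pow_mul']
  rw [hL, hR]
  -- At matrix entries of the right degree the identity is a coefficient of the original relation;
  -- at all others both sides vanish by `lamPoly_pow_mem`.
  by_cases hl : S.deg l = S.deg j - 2 + ((t : ℤ) - M) * (D + 2)
  · have h1 := S.sum_coeff_mul s p 2 (M - t) a
    have h2 := S.sum_coeff_mul s 1 1 (M - t) a
    rw [hp] at h1
    rw [map_one, one_mul, pow_one] at h2
    rw [h2] at h1
    have h3 := congrArg (S.hb.coord l) h1
    have h4 : ∑ i ∈ (1 : Polynomial Kz).support, ∑ k ∈ (S.lamPoly s ^ (i + 1)).support,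
        Kz.coeff ((M : ℤ) - t + k) ((1 : Polynomial Kz).coeff i) •
          ((S.lamPoly s ^ (i + 1)).coeff k) a =
        (if M ≤ t then (S.lamPoly s).coeff (t - M) else 0) a := by
      rw [Finset.sum_subset (s₂ := {0}), Finset.sum_singleton, zero_add, pow_one]
      · simp only [Polynomial.coeff_one_zero, Kz.coeff_one]
        split_ifs with hMt
        · rw [Finset.sum_eq_single (t - M)]
          · rw [if_pos (by omega), one_smul]
          · intro k _ hk
            rw [if_neg (by omega), zero_smul]
          · intro hk
            rw [Polynomial.notMem_support_iff.1 hk]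
            simp
        · refine Finset.sum_eq_zero fun k _ => ?_
          rw [if_neg (by omega), zero_smul]
      · rw [← Polynomial.C_1]
        exact Polynomial.support_C_subset 1
      · intro i _ hi
        rw [Polynomial.notMem_support_iff.1 hi]
        simp
    rw [h4] at h3
    rw [h3, map_sum, hI, Finset.sum_filter]
    refine Finset.sum_congr rfl fun i hi => ?_
    rw [map_sum]
    have hcoord : ∀ k : ℕ, S.deg l ≠ S.deg j - 2 * (i + 2 : ℕ) + k * (D + 2) →
        S.hb.coord l (((S.lamPoly s ^ (i + 2)).coeff k) a) = 0 := fun k hk =>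
      S.coord_eq_zero (S.lamPoly_pow_mem hs (i + 2) k ha) hk
    split_ifs with hdiv h
    · have hdi := hdI i (Finset.mem_filter.2 ⟨hi, hdiv⟩)
      have hle := hMd i (Finset.mem_filter.2 ⟨hi, hdiv⟩)
      rw [Finset.sum_eq_single (t - (M - d i))]
      · rw [map_smul, smul_eq_mul]
        congr 3
        push_cast [h, hle]
        ring
      · intro k _ hk
        rw [map_smul, hcoord k, smul_zero]
        intro hk'
        apply hk
        have : ((k : ℤ) - (t - (M - d i))) * (D + 2) = 0 := by
          push_cast at hk'
          linear_combination hl - hk' - hdi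
        have := (mul_eq_zero.1 this).resolve_right (by omega)
        omega
      · intro hk
        rw [Polynomial.notMem_support_iff.1 hk]
        simp
    · have hdi := hdI i (Finset.mem_filter.2 ⟨hi, hdiv⟩)
      have hle := hMd i (Finset.mem_filter.2 ⟨hi, hdiv⟩)
      rw [LinearMap.zero_apply, map_zero, mul_zero]
      symm
      refine Finset.sum_eq_zero fun k _ => ?_
      rw [map_smul, hcoord k, smul_zero]
      intro hk'
      have : ((k : ℤ) - (t - (M - d i))) * (D + 2) = 0 := by
        push_cast at hk'
        linear_combination hl - hk' - hdi
      have := (mul_eq_zero.1 this).resolve_right (by omega)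
      omega
    · symm
      refine Finset.sum_eq_zero fun k _ => ?_
      rw [map_smul, hcoord k, smul_zero]
      intro hk'
      refine hdiv ⟨k - (t - M), ?_⟩
      push_cast at hk'
      linear_combination hk' - hl
  · have hz : ∀ (n k : ℕ), S.deg l ≠ S.deg j - 2 * (n : ℕ) + k * (D + 2) →
        S.hb.coord l (((S.lamPoly s ^ n).coeff k) a) = 0 := fun n k hk =>
      S.coord_eq_zero (S.lamPoly_pow_mem hs n k ha) hk
    rw [Finset.sum_eq_zero]
    · split_ifs with h
      · rw [← pow_one (S.lamPoly s), hz]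
        contrapose! hl
        rw [hl]
        push_cast [h]
        ring
      · simp
    · intro i hi
      have hdi := hdI i hi
      have hle := hMd i hi
      split_ifs with h
      · rw [hz, mul_zero]
        contrapose! hl
        rw [hl]
        push_cast [h, hle]
        linear_combination hdi
      · simp

/-! ### Polynomials in `z` acting on `g ⊗ R((z⁻¹))`, and the pseudo-inverse. -/

section Action

variable {R R' : Type*} [Ring R] [Algebra ℂ R] [Ring R'] [Algebra ℂ R']

lemma zmulH_zmulH (m n : ℤ) (X : HahnSeries ℤ R) : zmulH R m (zmulH R n X) = zmulH R (m + n) X := by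
  ext k
  rw [coeff_zmulH, coeff_zmulH, coeff_zmulH, add_assoc]

lemma zmul_zmul (m n : ℤ) (x : g ⊗[ℂ] HahnSeries ℤ R) :
    S.zmul R m (S.zmul R n x) = S.zmul R (m + n) x := by
  induction x using TensorProduct.induction_on with
  | zero => simp
  | tmul a x => simp [zmul, zmulH_zmulH]
  | add x y hx hy => simp only [map_add, hx, hy]

@[simp] lemma zmul_zero (x : g ⊗[ℂ] HahnSeries ℤ R) : S.zmul R 0 x = x := by
  induction x using TensorProduct.induction_on with
  | zero => simp
  | tmul a x => simp [zmul, zmulH]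
  | add x y hx hy => simp only [map_add, hx, hy]

/-- The action of polynomials in `z` with coefficients in `End g`. -/
def polyAct (R : Type*) [Ring R] [Algebra ℂ R] :
    Polynomial (Module.End ℂ g) →+* Module.End ℂ (g ⊗[ℂ] HahnSeries ℤ R) :=
  Polynomial.eval₂RingHom' (Module.End.rTensorAlgHom ℂ g (HahnSeries ℤ R)).toRingHom (S.zmul R 1) (by
    intro w
    change LinearMap.rTensor _ w * LinearMap.lTensor g _ = LinearMap.lTensor g _ * LinearMap.rTensor _ w
    ext a x
    simp)

lemma polyAct_C (w : Module.End ℂ g) :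
    S.polyAct R (Polynomial.C w) = LinearMap.rTensor (HahnSeries ℤ R) w :=
  Polynomial.eval₂_C _ _

lemma polyAct_X : S.polyAct R Polynomial.X = S.zmul R 1 := Polynomial.eval₂_X _ _

lemma polyAct_X_pow (n : ℕ) : S.polyAct R (Polynomial.X ^ n) = S.zmul R n := by
  rw [map_pow, polyAct_X]
  induction n with
  | zero => exact LinearMap.ext fun x => by simp
  | succ n ih =>
    refine LinearMap.ext fun x => ?_
    rw [pow_succ, ih, Module.End.mul_apply, zmul_zmul]
    push_cast
    rfl

/-- `z^n Λ ⊗ 1 ∈ g ⊗ R((z⁻¹))` -/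
def lamT (R : Type*) [Ring R] [Algebra ℂ R] (s : g) (n : ℤ) : g ⊗[ℂ] HahnSeries ℤ R :=
  S.f ⊗ₜ HahnSeries.single (-n) 1 + s ⊗ₜ HahnSeries.single (-(n + 1)) 1

lemma Lam_eq (s : g) (n : ℤ) : S.Lam s n = S.lamT S.V s n := rfl

lemma cwH_single {J : R →ₗ[ℂ] R'} (n : ℤ) (r : R) :
    cwH J (HahnSeries.single n r) = HahnSeries.single n (J r) := by
  ext m
  rw [coeff_cwH, HahnSeries.coeff_single, HahnSeries.coeff_single]
  split_ifs <;> simp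

lemma zmul_lamT (s : g) (m n : ℤ) : S.zmul R m (S.lamT R s n) = S.lamT R s (m + n) := by
  simp only [lamT, zmul, map_add, LinearMap.lTensor_tmul, zmulH, LinearMap.mulLeft_apply,
    HahnSeries.single_mul_single, one_mul]
  congr 3 <;> ring_nf

variable {ε : R →ₗ[ℂ] R}

lemma parT_lamT (hε : IsSuperComm ε) {s : g} (hs : S.par s = s) (n : ℤ) :
    S.parT (cwH ε) (S.lamT R s n) = S.lamT R s n := by
  simp [parT, lamT, cwH_single, hε.map_one, S.f_even, hs]

lemma brT_lamT (hε : IsSuperComm ε) (s : g) (x : g ⊗[ℂ] HahnSeries ℤ R) :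
    S.brT (cwH ε) (S.lamT R s 0) x = S.polyAct R (S.lamPoly s) x := by
  rw [lamPoly, map_add, map_mul, polyAct_C, polyAct_C, polyAct_X]
  induction x using TensorProduct.induction_on with
  | zero => simp
  | add x y hx hy => simp only [map_add, hx, hy]
  | tmul a x =>
    rw [lamT, map_add, LinearMap.add_apply, S.brT_even_left, S.brT_even_left]
    · simp [zmul, zmulH]
    · rw [cwH_single, hε.map_one]
    · rw [cwH_single, hε.map_one]

lemma zmul_brT (hε : IsSuperComm ε) (n : ℤ) (x y : g ⊗[ℂ] HahnSeries ℤ R) :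
    S.zmul R n (S.brT (cwH ε) x y) = S.brT (cwH ε) (S.zmul R n x) y ∧
    S.zmul R n (S.brT (cwH ε) x y) = S.brT (cwH ε) x (S.zmul R n y) := by
  have h1 : cwH ε (HahnSeries.single (-n) 1) = HahnSeries.single (-n) (1 : R) := by
    rw [cwH_single, hε.map_one]
  have h2 : ∀ X Y : HahnSeries ℤ R, HahnSeries.single (-n) (1 : R) * (X * Y) =
      X * (HahnSeries.single (-n) 1 * Y) := by
    intro X Y
    rw [← mul_assoc, ← mul_assoc, hε.hahn.comm X _ h1]
  induction x using TensorProduct.induction_on with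
  | zero => simp
  | add x x' hx hx' =>
    simp only [map_add, LinearMap.add_apply]
    exact ⟨by rw [hx.1, hx'.1], by rw [hx.2, hx'.2]⟩
  | tmul a X =>
    induction y using TensorProduct.induction_on with
    | zero => simp
    | add y y' hy hy' =>
      simp only [map_add]
      exact ⟨by rw [hy.1, hy'.1], by rw [hy.2, hy'.2]⟩
    | tmul b Y =>
      simp only [zmul, zmulH, LinearMap.lTensor_tmul, brT_tmul, map_add, LinearMap.mulLeft_apply,
        hε.hahn.map_mul, h1]
      exact ⟨by simp only [mul_assoc], by simp only [h2]⟩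

lemma lamT_mem_fil [FiniteDimensional ℂ g] {D : ℤ} {s : g} (hs : s ∈ S.gr D) (n : ℤ) :
    S.lamT R s n ∈ S.fil R D (-2 - n * (D + 2)) := by
  refine add_mem (S.tmul_mem_fil S.f_mem fun m hm => ?_) (S.tmul_mem_fil hs fun m hm => ?_)
  · rw [HahnSeries.coeff_single_of_ne]
    rintro rfl
    linarith
  · rw [HahnSeries.coeff_single_of_ne]
    rintro rfl
    linarith

/-- A pseudo-inverse of `ad Λ`. -/
lemma exists_pseudo_inverse [FiniteDimensional ℂ g] (hε : IsSuperComm ε) {s : g} {D : ℤ}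
    (hD : 0 < D + 2) (hs : s ∈ S.gr D) (hΛ : (S.adLam s).IsSemisimple) :
    ∃ ψ : Module.End ℂ (g ⊗[ℂ] HahnSeries ℤ R), Raises (S.fil R D) (S.fil R D) ψ 2 ∧
      (∀ x, S.brT (cwH ε) (S.lamT R s 0) (S.brT (cwH ε) (S.lamT R s 0) (ψ x)) =
        S.brT (cwH ε) (S.lamT R s 0) x) ∧
      ∀ T : Module.End ℂ (g ⊗[ℂ] HahnSeries ℤ R), (∀ n x, T (S.zmul R n x) = S.zmul R n (T x)) →
        (∀ x, T (S.brT (cwH ε) (S.lamT R s 0) x) = S.brT (cwH ε) (S.lamT R s 0) (T x)) →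
        ∀ x, T (ψ x) = ψ (T x) := by
  obtain ⟨I, c, d, hd, M, hM, hrel⟩ := S.exists_homogeneous_relation hD hs hΛ
  set y : Module.End ℂ (g ⊗[ℂ] HahnSeries ℤ R) := S.brT (cwH ε) (S.lamT R s 0) with hy
  have hyr : Raises (S.fil R D) (S.fil R D) y (-2) := fun t x hx => by
    have := S.brT_mem_fil ε (S.lamT_mem_fil hs 0) hx
    convert this using 2
    ring
  have hyp : y = S.polyAct R (S.lamPoly s) := LinearMap.ext fun x => S.brT_lamT hε s x
  -- The degree of each summand is `d_i (D + 2) - 2i = 2`. Being built from `ad Λ` and powers of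
  -- `z`, the sum commutes with every operator commuting with these.
  refine ⟨∑ i ∈ I, c i • (S.zmul R (-(d i : ℤ)) * y ^ i), ?_, ?_, ?_⟩
  · intro t x hx
    rw [LinearMap.sum_apply]
    refine Submodule.sum_mem _ fun i hi => Submodule.smul_mem _ _ ?_
    have hpow : ∀ n : ℕ, (y ^ n) x ∈ S.fil R D (t - 2 * n) := by
      intro n
      induction n with
      | zero => simpa using hx
      | succ n ih =>
        rw [pow_succ', Module.End.mul_apply]
        convert hyr _ _ ih using 2
        push_cast
        ring
    have := S.zmul_mem_fil (-(d i : ℤ)) (hpow i)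
    rwa [show t - 2 * (i : ℤ) - -(d i : ℤ) * (D + 2) = t + 2 by linear_combination hd i hi] at this
  · intro x
    have hinj : Function.Injective (S.zmul (g := g) R M) := fun u v huv => by
      have := congrArg (S.zmul R (-(M : ℤ))) huv
      simpa [zmul_zmul] using this
    apply hinj
    have h1 := congrArg (fun P => S.polyAct R P x) hrel
    simp only [map_sum, map_mul, LinearMap.sum_apply] at h1
    rw [polyAct_X_pow, ← hyp, Module.End.mul_apply] at h1
    rw [← h1, LinearMap.sum_apply, map_sum, map_sum, map_sum]
    refine Finset.sum_congr rfl fun i hi => ?_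
    have hz : ∀ (n : ℤ) u, S.zmul R n (y u) = y (S.zmul R n u) := fun n u =>
      (S.zmul_brT hε n _ u).2
    rw [polyAct_X_pow, map_pow, ← hyp, polyAct_C]
    have hc : LinearMap.rTensor (HahnSeries ℤ R) (algebraMap ℂ (Module.End ℂ g) (c i)) =
        c i • LinearMap.id := by
      ext a u
      simp [TensorProduct.smul_tmul']
    rw [hc]
    simp only [Module.End.mul_apply, LinearMap.smul_apply, LinearMap.id_apply, map_smul, hz]
    congr 1
    have hz' : ∀ (m : ℤ) (n : ℕ) u, S.zmul R m ((y ^ n) u) = (y ^ n) (S.zmul R m u) := by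
      intro m n u
      induction n with
      | zero => rfl
      | succ n ih => rw [pow_succ', Module.End.mul_apply, hz, ih, Module.End.mul_apply]
    rw [hz', hz', hz', zmul_zmul, pow_add, (Commute.pow_pow_self y i 2).eq, sq,
      Module.End.mul_apply, Module.End.mul_apply, Nat.cast_sub (hM i hi), sub_eq_add_neg]
  · intro T hTz hTy x
    have hpow : ∀ (n : ℕ) u, T ((y ^ n) u) = (y ^ n) (T u) := by
      intro n u
      induction n with
      | zero => rfl
      | succ n ih => rw [pow_succ', Module.End.mul_apply, hTy, ih, Module.End.mul_apply]
    simp only [LinearMap.sum_apply, map_sum, LinearMap.smul_apply, map_smul, Module.End.mul_apply,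
      hTz, hpow]

end Action

end Setup

end WSuper

namespace WSuper
namespace Setup

variable {g : Type*} [AddCommGroup g] [Module ℂ g] (S : Setup g)

/-! ### A section of `𝒫 → 𝒱` -/

section Section

variable [FiniteDimensional ℂ g]

/-- The projection of `g` onto `𝔭` along `𝔪`. -/
def prp : g →ₗ[ℂ] g := S.hb.constr ℂ fun i => if S.deg i < 2 then S.hb i else 0

lemma prp_hb (i) : S.prp (S.hb i) = if S.deg i < 2 then S.hb i else 0 := S.hb.constr_basis _ _ i

lemma prp_gr {j : ℤ} {a : g} (ha : a ∈ S.gr j) : S.prp a = if j < 2 then a else 0 := by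
  have h1 : a = ∑ i, S.hb.coord i a • S.hb i := (S.hb.sum_repr a).symm
  conv_lhs => rw [h1]
  rw [map_sum]
  have h2 : ∀ i, S.prp (S.hb.coord i a • S.hb i) = if j < 2 then S.hb.coord i a • S.hb i else 0 := by
    intro i
    by_cases hi : S.deg i = j
    · rw [map_smul, prp_hb, hi]
      split_ifs <;> simp
    · rw [S.coord_eq_zero ha hi]
      simp
  rw [Finset.sum_congr rfl fun i _ => h2 i]
  split_ifs
  · exact h1.symm
  · simp

lemma gr_induction {motive : g → Prop} (add : ∀ a b, motive a → motive b → motive (a + b))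
    (gr : ∀ j a, a ∈ S.gr j → motive a) (a : g) : motive a := by
  rw [← S.hb.sum_repr a]
  refine Finset.sum_induction _ motive add (gr 0 0 (zero_mem _)) fun i _ => ?_
  exact gr _ _ (Submodule.smul_mem _ _ (S.hb_mem i))

lemma prp_mm {a : g} (ha : a ∈ S.mm) : S.prp a = 0 := by
  have : S.mm ≤ LinearMap.ker S.prp := iSup₂_le fun j hj x hx => by
    rw [LinearMap.mem_ker, S.prp_gr hx, if_neg (by omega)]
  exact this ha

lemma gr_le_mm {j : ℤ} (hj : 2 ≤ j) : S.gr j ≤ S.mm :=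
  le_iSup₂_of_le (f := fun (j : ℤ) (_ : 2 ≤ j) => S.gr j) j hj le_rfl

lemma gr_le_nn {j : ℤ} (hj : 0 < j) : S.gr j ≤ S.nn :=
  le_iSup₂_of_le (f := fun (j : ℤ) (_ : 0 < j) => S.gr j) j hj le_rfl

lemma gr_le_pp {j : ℤ} (hj : j < 2) : S.gr j ≤ S.pp :=
  le_iSup₂_of_le (f := fun (j : ℤ) (_ : j < 2) => S.gr j) j hj le_rfl

lemma mm_le_nn : S.mm ≤ S.nn := iSup₂_le fun _ hj => S.gr_le_nn (by omega)

lemma sub_prp_mem (a : g) : a - S.prp a ∈ S.mm := by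
  induction a using S.gr_induction with
  | add a b ha hb => rw [map_add, add_sub_add_comm]; exact add_mem ha hb
  | gr j a ha =>
    rw [S.prp_gr ha]
    split_ifs with h
    · simp
    · simpa using S.gr_le_mm (by omega) ha

lemma par_prp (a : g) : S.par (S.prp a) = S.prp (S.par a) := by
  induction a using S.gr_induction with
  | add a b ha hb => simp only [map_add, ha, hb]
  | gr j a ha =>
    rw [S.prp_gr ha, S.prp_gr (S.par_mem_gr ha)]
    split_ifs <;> simp

lemma B_f_prp (a : g) : S.B S.f (S.prp a) = 0 := by
  induction a using S.gr_induction with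
  | add a b ha hb => simp only [map_add, ha, hb, add_zero]
  | gr j a ha =>
    rw [S.prp_gr ha]
    split_ifs with h
    · exact S.B_gr (by omega) S.f_mem ha
    · simp

lemma prp_homog {i : ZMod 2} {a : g} (ha : S.par a = sg i • a) :
    S.par (S.prp a) = sg i • S.prp a := by
  rw [par_prp, ha, map_smul]

lemma B_f_odd {a : g} (ha : S.par a = sg 1 • a) : S.B S.f a = 0 := by
  have := S.B_even S.f a
  rw [S.f_even, ha] at this
  simp only [sg, one_ne_zero, if_false, neg_smul, one_smul, map_neg] at this
  exact self_eq_neg.1 this.symm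

lemma gen_true_prp_succ (n : ℕ) (a : g) : S.gen true (n + 1) (S.prp a) = S.gen true (n + 1) a := by
  have := S.gen_true_succ n _ (S.sub_prp_mem a)
  rw [map_sub, sub_eq_zero] at this
  exact this.symm

lemma gen_true_prp_zero (a : g) :
    S.gen true 0 (S.prp a) - algebraMap ℂ _ (S.B S.f a) = S.gen true 0 a := by
  have := S.gen_true_zero _ (S.sub_prp_mem a)
  rw [map_sub, map_sub, B_f_prp, sub_zero, map_neg] at this
  rw [sub_eq_iff_eq_add.1 this]
  abel

/-- The values of the section of `𝒫 → 𝒱` on generators. -/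
def secGen (x : ℕ × g) : S.P :=
  S.gen false x.1 (S.prp x.2) - algebraMap ℂ _ (if x.1 = 0 then S.B S.f x.2 else 0)

/-- A section of `𝒫 → 𝒱`. -/
def sec : S.V →ₐ[ℂ] S.P :=
  S.lift true S.secGen (by
    intro x y hxy
    induction hxy with
    | add n a b =>
      simp only [sy, FreeAlgebra.lift_ι_apply, secGen, map_add]
      split_ifs <;> simp only [map_add, map_zero] <;> abel
    | smul n c a =>
      simp only [sy, FreeAlgebra.lift_ι_apply, secGen, map_smul]
      split_ifs <;> simp [Algebra.algebraMap_eq_smul_one, smul_sub, smul_smul]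
    | comm n m i j a b ha hb =>
      simp only [sy, FreeAlgebra.lift_ι_apply, secGen, map_mul, map_smul]
      have h1 := S.gen_comm false n m i j _ _ (S.prp_homog ha) (S.prp_homog hb)
      have h2 : ∀ (i j : ZMod 2) (n : ℕ) (a : g), S.par a = sg i • a → ∀ u : S.P,
          u * algebraMap ℂ _ (if n = 0 then S.B S.f a else 0) =
            sg (i * j) • (algebraMap ℂ _ (if n = 0 then S.B S.f a else 0) * u) := by
        intro i j n a ha u
        rw [Algebra.commutes]
        rcases zmod2_cases i with rfl | rfl
        · simp [sg]
        · rw [S.B_f_odd ha]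
          simp
      have h3 := h2 j i m b hb (S.gen false n (S.prp a))
      have h4 := h2 i j n a ha (S.gen false m (S.prp b))
      have h5 := h2 j i m b hb (algebraMap ℂ _ (if n = 0 then S.B S.f a else 0))
      rw [mul_comm j i] at h3 h5
      rw [sub_mul, mul_sub, mul_sub, h1, h3, h5, sub_mul, mul_sub, mul_sub, h4]
      simp only [smul_sub, smul_smul, sg_mul_self, one_smul]
      abel
    | ideal_zero hq a ha =>
      simp [sy, secGen, S.prp_mm ha]
    | ideal_succ hq n a ha =>
      simp [sy, secGen, S.prp_mm ha])

lemma sec_gen (n : ℕ) (a : g) : S.sec (S.gen true n a) = S.gen false n (S.prp a) -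
    algebraMap ℂ _ (if n = 0 then S.B S.f a else 0) := by
  rw [sec, ← proj_sy, lift_proj, sy, FreeAlgebra.lift_ι_apply, secGen]

/-- The section chooses the representative written in generators from `𝔭`; computations in `𝒱` are
made with it instead of arbitrary representatives. -/
lemma rho_sec (x : S.V) : S.rho (S.sec x) = x := by
  induction x using S.DA_induction true with
  | scalar c => simp
  | gen n a =>
    rw [sec_gen, map_sub, rho_gen, AlgHom.commutes]
    cases n with
    | zero => rw [if_pos rfl, gen_true_prp_zero]
    | succ n => simp [gen_true_prp_succ]
  | mul x y hx hy => simp only [map_mul, hx, hy]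
  | add x y hx hy => simp only [map_add, hx, hy]

lemma sec_sgn (x : S.V) : S.sec (S.sgn true x) = S.sgn false (S.sec x) := by
  induction x using S.DA_induction true with
  | scalar c => simp
  | gen n a =>
    rw [sgn_gen, sec_gen, sec_gen, map_sub, sgn_gen, par_prp, AlgHom.commutes]
    congr 3
    rw [← S.B_even, S.f_even, S.par_par]
  | mul x y hx hy => simp only [map_mul, hx, hy]
  | add x y hx hy => simp only [map_add, hx, hy]

lemma sec_der (x : S.V) : S.sec (S.der true x) = S.der false (S.sec x) := by
  induction x using S.DA_induction true with
  | scalar c => simp [der_algebraMap]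
  | gen n a =>
    rw [der_gen, sec_gen, sec_gen, map_sub, der_gen, der_algebraMap]
    simp
  | mul x y hx hy => simp only [map_mul, der_mul, map_add, hx, hy]
  | add x y hx hy => simp only [map_add, hx, hy]

end Section

lemma rho_sgn (x : S.P) : S.rho (S.sgn false x) = S.sgn true (S.rho x) := by
  induction x using S.DA_induction false with
  | scalar c => simp
  | gen n a => rw [sgn_gen, rho_gen, rho_gen, sgn_gen]
  | mul x y hx hy => simp only [map_mul, hx, hy]
  | add x y hx hy => simp only [map_add, hx, hy]

lemma rho_der (x : S.P) : S.rho (S.der false x) = S.der true (S.rho x) := by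
  induction x using S.DA_induction false with
  | scalar c => simp [der_algebraMap]
  | gen n a => rw [der_gen, rho_gen, rho_gen, der_gen]
  | mul x y hx hy => simp only [map_mul, der_mul, map_add, hx, hy]
  | add x y hx hy => simp only [map_add, hx, hy]

lemma rhoX_eq (p : S.P[X]) : S.rhoX p = cwX S.rho.toLinearMap p := by
  ext n
  simp [rhoX]

/-! ### The polynomials `𝒱[λ]` -/

/-- The operator `λ + ∂` on `𝒱[λ]`. -/
def lamV : S.V[X] →ₗ[ℂ] S.V[X] := LinearMap.mulLeft ℂ Polynomial.X + cwX (S.der true)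

lemma lamV_apply (p : S.V[X]) : S.lamV p = Polynomial.X * p + cwX (S.der true) p := rfl

lemma rhoX_lamD (p : S.P[X]) : S.rhoX (S.lamD p) = S.lamV (S.rhoX p) := by
  have h1 : S.lamD p = Polynomial.X * p + cwX (S.der false) p := rfl
  rw [h1, lamV_apply, map_add, map_mul, rhoX_eq, rhoX_eq, rhoX_eq]
  congr 1
  · congr 1
    ext n
    simp only [coeff_cwX, Polynomial.coeff_X]
    split_ifs <;> simp
  · ext n
    simp [rho_der]

lemma lamV_C_mul (p : S.V[X]) (x : S.V) : S.lamV (Polynomial.C x * p) =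
    Polynomial.C (S.der true x) * p + Polynomial.C x * S.lamV p := by
  have : Polynomial.X * (Polynomial.C x * p) = Polynomial.C x * (Polynomial.X * p) := by
    rw [← mul_assoc, Polynomial.X_mul_C, mul_assoc]
  rw [lamV_apply, lamV_apply, this]
  ext n
  simp [der_mul, mul_add]
  abel

/-- Multiplication by `λ` moves the leading coefficient to degree `natDegree + 1`, where `∂`
contributes nothing. This is what makes `W ∩ ∂𝒱 = ∂W`. -/
lemma lamV_injective {p : S.V[X]} (h : S.lamV p = 0) : p = 0 := by
  by_contra hp
  have h1 := congrArg (fun q => Polynomial.coeff q (p.natDegree + 1)) h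
  simp only [lamV_apply, Polynomial.coeff_add, Polynomial.coeff_X_mul, coeff_cwX,
    Polynomial.coeff_zero, Polynomial.coeff_eq_zero_of_natDegree_lt (Nat.lt_succ_self _),
    map_zero, add_zero, Polynomial.coeff_natDegree] at h1
  exact hp (Polynomial.leadingCoeff_eq_zero.1 h1)

/-- The substitution `λ ↦ -∂`. -/
def evD : S.V[X] →ₗ[ℂ] S.V := Polynomial.lsum fun n => (-S.der true) ^ n

lemma evD_monomial (n : ℕ) (x : S.V) :
    S.evD (Polynomial.monomial n x) = ((-S.der true) ^ n) x := by
  rw [evD, Polynomial.lsum_apply, Polynomial.sum_monomial_index _ _ (by simp)]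

lemma evD_C (x : S.V) : S.evD (Polynomial.C x) = x := by
  rw [← Polynomial.monomial_zero_left, evD_monomial]
  rfl

lemma cwX_monomial {R R' : Type*} [Ring R] [Algebra ℂ R] [Ring R'] [Algebra ℂ R'] (φ : R →ₗ[ℂ] R')
    (n : ℕ) (x : R) : cwX φ (Polynomial.monomial n x) = Polynomial.monomial n (φ x) := by
  ext m
  simp only [coeff_cwX, Polynomial.coeff_monomial]
  split_ifs <;> simp

/-- Consequently `evD` applied to a bracket `{b_λ u}` depends on `u` only modulo total derivatives:
it computes variational derivatives. -/
lemma evD_lamV (p : S.V[X]) : S.evD (S.lamV p) = 0 := by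
  induction p using Polynomial.induction_on' with
  | add p q hp hq => rw [map_add, map_add, hp, hq, add_zero]
  | monomial n x =>
    rw [lamV_apply, Polynomial.X_mul_monomial, cwX_monomial, map_add, evD_monomial, evD_monomial,
      pow_succ, Module.End.mul_apply]
    simp

/-- `Σ pₙ λⁿ ↦ Σ ∂ⁿF pₙ` -/
def subF (F : S.V) : S.V[X] →ₗ[ℂ] S.V :=
  Polynomial.lsum fun n => LinearMap.mulLeft ℂ ((S.der true ^ n) F)

lemma subF_monomial (F : S.V) (n : ℕ) (x : S.V) :
    S.subF F (Polynomial.monomial n x) = (S.der true ^ n) F * x := by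
  rw [subF, Polynomial.lsum_apply, Polynomial.sum_monomial_index _ _ (by simp)]
  rfl

lemma subF_lamV (F : S.V) (p : S.V[X]) : S.subF F (S.lamV p) = S.der true (S.subF F p) := by
  induction p using Polynomial.induction_on' with
  | add p q hp hq => simp only [map_add, hp, hq]
  | monomial n x =>
    rw [lamV_apply, Polynomial.X_mul_monomial, cwX_monomial, map_add, subF_monomial, subF_monomial,
      subF_monomial, der_mul, pow_succ', Module.End.mul_apply]

lemma subF_mul_C (F : S.V) (p : S.V[X]) (x : S.V) :
    S.subF F (p * Polynomial.C x) = S.subF F p * x := by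
  induction p using Polynomial.induction_on' with
  | add p q hp hq => simp only [add_mul, map_add, hp, hq]
  | monomial n y =>
    rw [Polynomial.monomial_mul_C, subF_monomial, subF_monomial, mul_assoc]

/-- The twist `x ↦ (-1)^{i p(x)} x` on `𝒱`. -/
def twV (i : ZMod 2) (x : S.V) : S.V := if i = 0 then x else S.sgn true x

lemma subF_C_mul {l : ZMod 2} {F : S.V} (hF : S.sgn true F = sg l • F) (p : S.V[X]) (x : S.V) :
    S.subF F (Polynomial.C x * p) = S.twV l x * S.subF F p := by
  have hd : ∀ n : ℕ, S.sgn true ((S.der true ^ n) F) = sg l • (S.der true ^ n) F := by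
    intro n
    induction n with
    | zero => exact hF
    | succ n ih => rw [pow_succ', Module.End.mul_apply, sgn_der, ih, map_smul]
  induction p using Polynomial.induction_on' with
  | add p q hp hq => simp only [mul_add, map_add, hp, hq]
  | monomial n y =>
    rw [Polynomial.C_mul_monomial, subF_monomial, subF_monomial, ← mul_assoc, ← mul_assoc]
    congr 1
    have h1 := S.isSuperComm_sgn true
    rcases zmod2_cases l with rfl | rfl
    · simpa [twV] using (h1.comm x _ (by simpa [sg] using hd n)).symm
    · have := h1.anti (S.sgn true x) _ (by simpa [sg] using hd n)
      simp only [AlgHom.toLinearMap_apply, sgn_sgn] at this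
      simpa [twV] using this.symm

lemma eval_zero_lamV (p : S.V[X]) :
    (S.lamV p).eval 0 = S.der true (p.eval 0) := by
  rw [← Polynomial.coeff_zero_eq_eval_zero, ← Polynomial.coeff_zero_eq_eval_zero, lamV_apply]
  simp

/-- At `λ = 0` the substitution `λ ↦ -λ-∂` becomes `λ ↦ -∂`. -/
lemma rhoX_flip_eval (p : S.P[X]) : (S.rhoX (S.flip p)).eval 0 = S.evD (S.rhoX p) := by
  have h0 : ∀ (n : ℕ) (q : S.P[X]), (S.rhoX (((-S.lamD) ^ n) q)).eval 0 =
      ((-S.der true) ^ n) ((S.rhoX q).eval 0) := by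
    intro n
    induction n with
    | zero => intro q; rfl
    | succ n ih =>
      intro q
      rw [pow_succ, Module.End.mul_apply, ih, pow_succ, Module.End.mul_apply, LinearMap.neg_apply,
        map_neg, rhoX_lamD, Polynomial.eval_neg, eval_zero_lamV, LinearMap.neg_apply]
  induction p using Polynomial.induction_on' with
  | add p q hp hq => simp only [map_add, Polynomial.eval_add, hp, hq]
  | monomial n x =>
    have h1 : S.flip (Polynomial.monomial n x) = ((-S.lamD) ^ n) (Polynomial.monomial 0 x) := by
      rw [flip, Polynomial.lsum_apply, Polynomial.sum_monomial_index _ _ (by simp)]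
      rfl
    rw [h1, h0, rhoX_eq, rhoX_eq, cwX_monomial, cwX_monomial, evD_monomial]
    simp

end Setup
end WSuper

namespace WSuper
namespace Setup

variable {g : Type*} [AddCommGroup g] [Module ℂ g] (S : Setup g)

/-! ### Super-derivations of the differential superalgebras -/

/-- A super-derivation of parity `i` over `J` from one of the differential superalgebras, which
intertwines `∂` with `δ`. -/
structure SDer (q : Bool) {B : Type*} [Ring B] [Algebra ℂ B] (ε δ : B →ₗ[ℂ] B) (i : ZMod 2)
    (J D : S.DA q →ₗ[ℂ] B) : Prop extends IsDer (S.sgn q).toLinearMap ε i J D where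
  J_one : J 1 = 1
  D_der : ∀ x, D (S.der q x) = δ (D x)

namespace SDer

variable {S} {q : Bool} {B : Type*} [Ring B] [Algebra ℂ B] {ε δ : B →ₗ[ℂ] B} {i : ZMod 2}
  {J D D' : S.DA q →ₗ[ℂ] B}

lemma map_one (h : S.SDer q ε δ i J D) : D 1 = 0 := by
  have := h.D_mul 1 1
  rw [mul_one, h.J_one] at this
  have h1 : (if i = 0 then (1 : S.DA q) else (S.sgn q).toLinearMap 1) = 1 := by
    split_ifs <;> simp
  rw [h1, h.J_one, mul_one, one_mul] at this
  simpa using this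

lemma map_gen (h : S.SDer q ε δ i J D) (n : ℕ) (a : g) :
    D (S.gen q n a) = (δ ^ n) (D (S.gen q 0 a)) := by
  induction n with
  | zero => rfl
  | succ n ih => rw [← S.der_gen, h.D_der, ih, pow_succ', Module.End.mul_apply]

/-- The Leibniz rule and compatibility with `∂` leave only the generators of order zero free.
Identities between brackets are reduced to `g` through this lemma. -/
lemma ext (h : S.SDer q ε δ i J D) (h' : S.SDer q ε δ i J D')
    (hg : ∀ a, D (S.gen q 0 a) = D' (S.gen q 0 a)) : D = D' := by
  refine LinearMap.ext fun x => ?_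
  induction x using S.DA_induction q with
  | scalar c => rw [Algebra.algebraMap_eq_smul_one, map_smul, map_smul, h.map_one, h'.map_one]
  | gen n a => rw [h.map_gen, h'.map_gen, hg]
  | mul x y hx hy => rw [h.D_mul, h'.D_mul, hx, hy]
  | add x y hx hy => rw [map_add, map_add, hx, hy]

lemma zero (hJ : J 1 = 1) (hε : ∀ x, ε (J x) = J (S.sgn q x)) : S.SDer q ε δ i J 0 where
  J_par := hε
  D_par x := by simp
  D_mul x y := by simp
  J_one := hJ
  D_der x := by simp

lemma add (h : S.SDer q ε δ i J D) (h' : S.SDer q ε δ i J D') : S.SDer q ε δ i J (D + D') where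
  J_par := h.J_par
  D_par x := by simp only [LinearMap.add_apply, map_add, h.D_par, h'.D_par, smul_add]
  D_mul x y := by
    simp only [LinearMap.add_apply, h.D_mul, h'.D_mul, add_mul, mul_add]
    abel
  J_one := h.J_one
  D_der x := by simp only [LinearMap.add_apply, h.D_der, h'.D_der, map_add]

lemma smul (h : S.SDer q ε δ i J D) (c : ℂ) : S.SDer q ε δ i J (c • D) where
  J_par := h.J_par
  D_par x := by simp only [LinearMap.smul_apply, map_smul, h.D_par, smul_comm c]
  D_mul x y := by
    simp only [LinearMap.smul_apply, h.D_mul, smul_add, smul_mul_assoc, mul_smul_comm]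
  J_one := h.J_one
  D_der x := by simp only [LinearMap.smul_apply, h.D_der, map_smul]

lemma map {B' : Type*} [Ring B'] [Algebra ℂ B'] {ε' δ' : B' →ₗ[ℂ] B'} (h : S.SDer q ε δ i J D)
    (K : B →ₗ[ℂ] B') (K_one : K 1 = 1) (K_mul : ∀ x y, K (x * y) = K x * K y)
    (K_par : ∀ x, ε' (K x) = K (ε x)) (K_der : ∀ x, K (δ x) = δ' (K x)) :
    S.SDer q ε' δ' i (K ∘ₗ J) (K ∘ₗ D) where
  J_par x := by simp only [LinearMap.comp_apply, K_par, h.J_par]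
  D_par x := by simp only [LinearMap.comp_apply, K_par, h.D_par, map_smul]
  D_mul x y := by simp only [LinearMap.comp_apply, h.D_mul, map_add, K_mul]
  J_one := by simp only [LinearMap.comp_apply, h.J_one, K_one]
  D_der x := by simp only [LinearMap.comp_apply, h.D_der, K_der]

lemma comap {q' : Bool} (h : S.SDer q ε δ i J D) (φ : S.DA q' →ₐ[ℂ] S.DA q)
    (hsgn : ∀ x, φ (S.sgn q' x) = S.sgn q (φ x)) (hder : ∀ x, φ (S.der q' x) = S.der q (φ x)) :
    S.SDer q' ε δ i (J ∘ₗ φ.toLinearMap) (D ∘ₗ φ.toLinearMap) where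
  J_par x := by
    simp only [LinearMap.comp_apply, AlgHom.toLinearMap_apply, h.J_par, hsgn]
  D_par x := by
    simp only [LinearMap.comp_apply, AlgHom.toLinearMap_apply, h.D_par, hsgn]
  D_mul x y := by
    simp only [LinearMap.comp_apply, AlgHom.toLinearMap_apply, map_mul, h.D_mul]
    split_ifs <;> simp only [hsgn]
  J_one := by simp only [LinearMap.comp_apply, AlgHom.toLinearMap_apply, _root_.map_one, h.J_one]
  D_der x := by simp only [LinearMap.comp_apply, AlgHom.toLinearMap_apply, hder, h.D_der]

end SDer

/-- The embedding of the constants into the polynomials. -/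
def cl (R : Type*) [Ring R] [Algebra ℂ R] : R →ₗ[ℂ] R[X] :=
  (Polynomial.CAlgHom (R := ℂ) (A := R)).toLinearMap

@[simp] lemma cl_apply {R : Type*} [Ring R] [Algebra ℂ R] (x : R) :
    cl R x = Polynomial.C x := rfl

lemma twP_eq (i : ZMod 2) (x : S.P) :
    S.twP i x = if i = 0 then x else (S.sgn false).toLinearMap x := by
  unfold twP; split_ifs <;> rfl

lemma sgnX_mul (p r : S.P[X]) : S.sgnX (p * r) = S.sgnX p * S.sgnX r :=
  cwX_mul (fun x y => map_mul (S.sgn false) x y) p r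

lemma sder_extPar (i : ZMod 2) (φ : g →ₗ[ℂ] S.P[X]) :
    S.SDer false S.sgnX S.lamD i (cl S.P) (S.extPar i φ) where
  J_par x := cwX_C _ _
  D_par x := by
    induction x using S.DA_induction false with
    | scalar c => simp [extPar_algebraMap]
    | gen n a =>
      simp only [AlgHom.toLinearMap_apply, sgn_gen, extPar_gen, sgnX_lamD_pow, sgnX_comp, map_smul]
    | mul x y hx hy =>
      have h1 : ∀ x, S.sgnX (Polynomial.C x) = Polynomial.C (S.sgn false x) := fun x => cwX_C _ _
      have h2 : S.twP i (S.sgn false x) = S.sgn false (S.twP i x) := by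
        unfold twP; split_ifs <;> rfl
      simp only [AlgHom.toLinearMap_apply] at hx hy ⊢
      rw [extPar_mul, map_mul, extPar_mul, map_add, sgnX_mul, sgnX_mul, hx, hy, h1, h1, h2,
        smul_mul_assoc, mul_smul_comm, smul_add]
    | add x y hx hy => simp only [map_add, hx, hy, smul_add]
  D_mul x y := by rw [extPar_mul, twP_eq]; rfl
  J_one := by simp
  D_der x := by
    induction x using S.DA_induction false with
    | scalar c => simp [extPar_algebraMap, der_algebraMap]
    | gen n a =>
      rw [der_gen, extPar_gen, extPar_gen, pow_succ', Module.End.mul_apply]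
    | mul x y hx hy =>
      have h2 : S.twP i (S.der false x) = S.der false (S.twP i x) := by
        unfold twP; split_ifs
        · rfl
        · exact S.sgn_der _ _
      have h5 : ∀ p r : S.P[X], cwX (S.der false) (p * r) =
          cwX (S.der false) p * r + p * cwX (S.der false) r := fun p r => by
        have hid : ∀ p : S.P[X], cwX LinearMap.id p = p := fun p => by ext n; simp
        simpa only [hid] using cwX_leibniz (J := LinearMap.id) (J' := LinearMap.id)
          (S.der_mul false) p r
      have h3 : ∀ p r : S.P[X], S.lamD (p * r) = S.lamD p * r + p * cwX (S.der false) r := by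
        intro p r
        have h1 : ∀ p, S.lamD p = Polynomial.X * p + cwX (S.der false) p := fun _ => rfl
        rw [h1, h1, h5, add_mul, mul_assoc, add_assoc]
      have h4 : ∀ p r : S.P[X], S.lamD (p * r) = cwX (S.der false) p * r + p * S.lamD r := by
        intro p r
        have h1 : ∀ p, S.lamD p = Polynomial.X * p + cwX (S.der false) p := fun _ => rfl
        rw [h1, h1, h5, mul_add, ← mul_assoc, ← mul_assoc,
          Polynomial.X_mul]
        abel
      rw [der_mul, map_add, extPar_mul, extPar_mul, extPar_mul, map_add, h3, h4, hx, hy, h2,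
        cwX_C, cwX_C]
      abel
    | add x y hx hy => simp only [map_add, hx, hy]

/-- A linear map `g → 𝒫[λ]` of parity `i`. -/
def HasParity (i : ZMod 2) (φ : g →ₗ[ℂ] S.P[X]) : Prop :=
  ∀ a, S.sgnX (φ (S.par a)) = sg i • φ a

variable {S} in
lemma HasParity.extPar_gen_zero {i : ZMod 2} {φ : g →ₗ[ℂ] S.P[X]} (h : S.HasParity i φ) (a : g) :
    S.extPar i φ (S.gen false 0 a) = φ a := by
  rw [extPar_gen, pow_zero, Module.End.one_apply]
  simp only [comp, LinearMap.smul_apply, LinearMap.add_apply, LinearMap.comp_apply, h a]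
  rw [smul_smul, sg_mul_self, one_smul, ← two_smul ℂ (φ a), smul_smul]
  norm_num

-- The super-derivation of the opposite parity is built from the zero component of `φ`, hence
-- vanishes.
variable {S} in
lemma HasParity.ext_eq {i : ZMod 2} {φ : g →ₗ[ℂ] S.P[X]} (h : S.HasParity i φ) :
    S.ext φ = S.extPar i φ := by
  have key : ∀ j : ZMod 2, sg j * sg i = -1 → S.extPar j φ = 0 := by
    intro j hj
    refine (S.sder_extPar j φ).ext (SDer.zero (by simp) fun x => cwX_C _ _) fun a => ?_
    rw [extPar_gen, pow_zero, Module.End.one_apply]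
    simp only [comp, LinearMap.smul_apply, LinearMap.add_apply, LinearMap.comp_apply, h a]
    rw [smul_smul, hj]
    simp
  unfold ext
  rcases zmod2_cases i with rfl | rfl
  · rw [key 1 (by simp [sg]), add_zero]
  · rw [key 0 (by simp [sg]), zero_add]

lemma ext_gen_zero (φ : g →ₗ[ℂ] S.P[X]) (a : g) : S.ext φ (S.gen false 0 a) = φ a := by
  simp only [ext, LinearMap.add_apply, extPar_gen, pow_zero, Module.End.one_apply, comp,
    LinearMap.smul_apply, LinearMap.comp_apply, sg]
  simp only [if_true, one_ne_zero, if_false, ← smul_add]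
  rw [add_add_add_comm, ← add_smul]
  simp only [one_smul, add_neg_cancel, zero_smul, add_zero, ← two_smul ℂ (φ a), smul_smul]
  norm_num

/-- `𝒫[λ] → 𝒱[λ]` as a linear map. -/
def rhoL : S.P[X] →ₗ[ℂ] S.V[X] := cwX S.rho.toLinearMap

lemma rhoL_eq (p : S.P[X]) : S.rhoL p = S.rhoX p := (S.rhoX_eq p).symm

/-- The parity involution of `𝒱[λ]`. -/
def sgnVX : S.V[X] →ₗ[ℂ] S.V[X] := cwX (S.sgn true).toLinearMap

lemma rhoX_sgnX (p : S.P[X]) : S.rhoX (S.sgnX p) = S.sgnVX (S.rhoX p) := by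
  ext n
  simp [rhoX_eq, sgnVX, sgnX, coeff_cw, rho_sgn]

lemma SDer.rhoL {i : ZMod 2} {D : S.P →ₗ[ℂ] S.P[X]}
    (h : S.SDer false S.sgnX S.lamD i (cl S.P) D) :
    S.SDer false S.sgnVX S.lamV i (cl S.V ∘ₗ S.rho.toLinearMap) (S.rhoL ∘ₗ D) := by
  have h1 := h.map (ε' := S.sgnVX) (δ' := S.lamV) S.rhoL
    (by rw [rhoL_eq]; exact S.rhoX.map_one) (fun x y => by simp only [rhoL_eq, S.rhoX.map_mul])
    (fun x => by rw [rhoL_eq, rhoL_eq, rhoX_sgnX]) fun x => by rw [rhoL_eq, rhoL_eq, rhoX_lamD]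
  have h2 : S.rhoL ∘ₗ cl S.P = cl S.V ∘ₗ S.rho.toLinearMap :=
    LinearMap.ext fun x => cwX_C _ _
  rwa [h2] at h1

/-- Evaluation at `λ = 0`. -/
def ev0 : S.V[X] →ₗ[ℂ] S.V := (Polynomial.lcoeff S.V 0).restrictScalars ℂ

lemma ev0_apply (p : S.V[X]) : S.ev0 p = p.eval 0 := Polynomial.coeff_zero_eq_eval_zero p

lemma SDer.ev0 {q : Bool} {i : ZMod 2} {J : S.DA q →ₗ[ℂ] S.V} {D : S.DA q →ₗ[ℂ] S.V[X]}
    (h : S.SDer q S.sgnVX S.lamV i (cl S.V ∘ₗ J) D) :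
    S.SDer q (S.sgn true).toLinearMap (S.der true) i J (S.ev0 ∘ₗ D) := by
  have h1 := h.map (ε' := (S.sgn true).toLinearMap) (δ' := S.der true) S.ev0
    (by simp [ev0_apply]) (fun x y => Polynomial.mul_coeff_zero x y)
    (fun x => (coeff_cwX _ _ _).symm) fun x => by rw [ev0_apply, ev0_apply, eval_zero_lamV]
  have h2 : S.ev0 ∘ₗ cl S.V ∘ₗ J = J :=
    LinearMap.ext fun x => by simp [ev0_apply]
  rwa [h2] at h1

section Sec

variable [FiniteDimensional ℂ g]
variable {S} {B : Type*} [Ring B] [Algebra ℂ B] {ε δ : B →ₗ[ℂ] B} {i : ZMod 2}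

lemma rho_sec_comp : S.rho.toLinearMap ∘ₗ S.sec.toLinearMap = LinearMap.id :=
  LinearMap.ext S.rho_sec

lemma SDer.sec {J : S.V →ₗ[ℂ] B} {D : S.P →ₗ[ℂ] B}
    (h : S.SDer false ε δ i (J ∘ₗ S.rho.toLinearMap) D) :
    S.SDer true ε δ i J (D ∘ₗ S.sec.toLinearMap) := by
  have := h.comap S.sec S.sec_sgn S.sec_der
  rwa [LinearMap.comp_assoc, rho_sec_comp, LinearMap.comp_id] at this

/-- A derivation over `𝒱` that kills `𝔪` kills `ℐ`, and so factors through the quotient. -/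
lemma SDer.eq_sec {J : S.V →ₗ[ℂ] B} {D : S.P →ₗ[ℂ] B}
    (h : S.SDer false ε δ i (J ∘ₗ S.rho.toLinearMap) D)
    (hm : ∀ m ∈ S.mm, D (S.gen false 0 m) = 0) (x : S.P) : D x = D (S.sec (S.rho x)) := by
  have h1 := h.sec.comap S.rho S.rho_sgn S.rho_der
  refine LinearMap.congr_fun (h.ext h1 fun a => ?_) x
  have h2 := hm _ (S.sub_prp_mem a)
  rw [map_sub, map_sub, sub_eq_zero] at h2
  simp only [LinearMap.comp_apply, AlgHom.toLinearMap_apply, rho_gen, sec_gen, map_sub, h2,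
    Algebra.algebraMap_eq_smul_one, map_smul, h.map_one, smul_zero, sub_zero]

end Sec

end Setup
end WSuper

namespace WSuper
namespace Setup

variable {g : Type*} [AddCommGroup g] [Module ℂ g] (S : Setup g)

/-! ### The `λ`-brackets modulo `ℐ` -/

lemma sgnX_flip (p : S.P[X]) : S.sgnX (S.flip p) = S.flip (S.sgnX p) := by
  have h0 : ∀ (n : ℕ) (q : S.P[X]), S.sgnX (((-S.lamD) ^ n) q) = ((-S.lamD) ^ n) (S.sgnX q) := by
    intro n
    induction n with
    | zero => intro q; rfl
    | succ n ih =>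
      intro q
      rw [pow_succ, Module.End.mul_apply, ih, Module.End.mul_apply, LinearMap.neg_apply,
        LinearMap.neg_apply, map_neg, sgnX_lamD]
  have h1 : ∀ n (x : S.P), S.flip (Polynomial.monomial n x) =
      ((-S.lamD) ^ n) (Polynomial.monomial 0 x) := by
    intro n x
    rw [flip, Polynomial.lsum_apply, Polynomial.sum_monomial_index _ _ (by simp)]
    rfl
  have h2 : ∀ n (x : S.P), S.sgnX (Polynomial.monomial n x) =
      Polynomial.monomial n (S.sgn false x) := fun n x => cwX_monomial _ n x
  induction p using Polynomial.induction_on' with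
  | add p q hp hq => simp only [map_add, hp, hq]
  | monomial n x => rw [h1, h0, h2, h2, h1]

/-- A `λ`-bracket on the generators which respects parities. -/
def IsEvenGen (γ : g →ₗ[ℂ] g →ₗ[ℂ] S.P[X]) : Prop :=
  ∀ a b, S.sgnX (γ (S.par a) (S.par b)) = γ a b

lemma isEvenGen_gam1 (k : ℂ) : S.IsEvenGen (S.gam1 k) := by
  intro a b
  have h1 : ∀ x, S.sgnX (Polynomial.C x) = Polynomial.C (S.sgn false x) := fun x => cwX_C _ _
  have h2 : S.sgnX Polynomial.X = Polynomial.X := by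
    have : (Polynomial.X : S.P[X]) = Polynomial.monomial 1 1 := rfl
    rw [this]
    exact (cwX_monomial _ 1 1).trans (by simp)
  simp only [gam1, LinearMap.mk₂_apply, map_add, map_smul, h1, h2, sgn_gen, S.par_br, S.par_par,
    S.B_even]

variable {S} in
lemma isEvenGen_gam2 {s : g} (hs : S.par s = s) : S.IsEvenGen (S.gam2 s) := by
  intro a b
  have h1 : ∀ x, S.sgnX (Polynomial.C x) = Polynomial.C (S.sgn false x) := fun x => cwX_C _ _
  have h2 : S.B s (S.par (S.br a b)) = S.B s (S.br a b) := by
    conv_lhs => rw [← hs, S.B_even]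
  simp only [gam2, LinearMap.compr₂_apply, Algebra.linearMap_apply, Polynomial.algebraMap_apply, h1,
    AlgHom.commutes, ← S.par_br, h2]

variable {S} in
lemma IsEvenGen.hasParity {γ : g →ₗ[ℂ] g →ₗ[ℂ] S.P[X]} (hγ : S.IsEvenGen γ) {j : ZMod 2} {b : g}
    (hb : S.par b = sg j • b) : S.HasParity j (γ b) := by
  intro a
  have h := hγ b a
  rw [hb, map_smul, LinearMap.smul_apply, map_smul] at h
  rw [← h, smul_smul, sg_mul_self, one_smul]

lemma lamSkew_homog (γ : g →ₗ[ℂ] g →ₗ[ℂ] S.P[X]) {i j : ZMod 2} {b : g} {u : S.P}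
    (hb : S.par b = sg j • b) (hu : S.sgn false u = sg i • u) :
    S.lamSkew γ u b = -(sg (i * j) • S.flip (S.ext (γ b) u)) := by
  simp only [lamSkew, LinearMap.neg_apply, LinearMap.comp_apply, LinearMap.add_apply]
  have h0 : S.ext 0 = 0 := by simpa using S.ext_smul 0 0
  rcases zmod2_cases j with rfl | rfl
  · rw [S.ev_of_even (by simpa [sg] using hb), S.od_of_even (by simpa [sg] using hb)]
    simp [sg, lamGen, h0]
  · rw [S.ev_of_odd (by simpa [sg] using hb), S.od_of_odd (by simpa [sg] using hb), hu]
    simp [lamGen, h0]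

lemma lamSkew_even (γ : g →ₗ[ℂ] g →ₗ[ℂ] S.P[X]) {u : S.P} (hu : S.sgn false u = u) (b : g) :
    S.lamSkew γ u b = -S.flip (S.ext (γ b) u) := by
  simp only [lamSkew, LinearMap.neg_apply, LinearMap.comp_apply, LinearMap.add_apply, hu,
    ← map_add, ev_add_od]
  rfl

lemma hasParity_of_homog {i : ZMod 2} {φ : g →ₗ[ℂ] S.P[X]}
    (h : ∀ j b, S.par b = sg j • b → S.sgnX (φ b) = sg (i + j) • φ b) : S.HasParity i φ := by
  intro a
  rw [← S.ev_add_od a]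
  simp only [map_add, smul_add]
  rw [S.par_ev, S.par_od, map_neg, map_neg, h 0 _ (by rw [S.par_ev]; simp [sg]),
    h 1 _ (by rw [S.par_od]; simp [sg]), sg_add, sg_add]
  simp [sg]

variable {S} in
lemma IsEvenGen.hasParity_lamSkew {γ : g →ₗ[ℂ] g →ₗ[ℂ] S.P[X]} (hγ : S.IsEvenGen γ) {i : ZMod 2}
    {u : S.P} (hu : S.sgn false u = sg i • u) : S.HasParity i (S.lamSkew γ u) := by
  refine S.hasParity_of_homog fun j b hb => ?_
  have h1 := (S.sder_extPar j (γ b)).D_par u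
  rw [AlgHom.toLinearMap_apply, hu] at h1
  rw [S.lamSkew_homog γ hb hu, map_neg, map_smul, sgnX_flip, (hγ.hasParity hb).ext_eq, h1]
  simp only [map_smul, smul_neg, smul_smul]
  congr 2
  rcases zmod2_cases i with rfl | rfl <;> rcases zmod2_cases j with rfl | rfl <;>
    simp [sg, show (1 : ZMod 2) + 1 = 0 from rfl]

/-- `{u_λ v}|_{λ=0}` modulo `ℐ`. -/
def bd (γ : g →ₗ[ℂ] g →ₗ[ℂ] S.P[X]) : S.P →ₗ[ℂ] S.P →ₗ[ℂ] S.V where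
  toFun u := S.ev0 ∘ₗ S.rhoL ∘ₗ S.ext (S.lamSkew γ u)
  map_add' u v := by
    have h : S.lamSkew γ (u + v) = S.lamSkew γ u + S.lamSkew γ v := by
      ext1 b
      simp only [lamSkew, lamGen, LinearMap.neg_apply, LinearMap.comp_apply, LinearMap.add_apply,
        LinearMap.coe_mk, AddHom.coe_mk, map_add]
      abel
    rw [h, ext_add, LinearMap.comp_add, LinearMap.comp_add]
  map_smul' c u := by
    have h : S.lamSkew γ (c • u) = c • S.lamSkew γ u := by
      ext1 b
      simp only [lamSkew, lamGen, LinearMap.neg_apply, LinearMap.comp_apply, LinearMap.add_apply,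
        LinearMap.coe_mk, AddHom.coe_mk, map_smul, LinearMap.smul_apply, map_add, smul_neg,
        smul_add]
    rw [h, ext_smul, LinearMap.comp_smul, LinearMap.comp_smul, RingHom.id_apply]

lemma bd_apply (γ : g →ₗ[ℂ] g →ₗ[ℂ] S.P[X]) (u v : S.P) :
    S.bd γ u v = (S.rhoX (S.lam γ u v)).eval 0 := by
  rw [← rhoL_eq, ← ev0_apply]
  rfl

/-- `{b_λ u}` modulo `ℐ`, for `b ∈ g`. -/
def brP (γ : g →ₗ[ℂ] g →ₗ[ℂ] S.P[X]) : g →ₗ[ℂ] S.P →ₗ[ℂ] S.V[X] where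
  toFun b := S.rhoL ∘ₗ S.ext (γ b)
  map_add' a b := by rw [map_add, ext_add, LinearMap.comp_add]
  map_smul' c a := by rw [map_smul, ext_smul, LinearMap.comp_smul, RingHom.id_apply]

lemma brP_gen (γ : g →ₗ[ℂ] g →ₗ[ℂ] S.P[X]) (b a : g) :
    S.brP γ b (S.gen false 0 a) = S.rhoX (γ b a) := by
  change S.rhoL (S.ext (γ b) _) = _
  rw [ext_gen_zero, rhoL_eq]

section

variable {S} {γ : g →ₗ[ℂ] g →ₗ[ℂ] S.P[X]} (hγ : S.IsEvenGen γ)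

include hγ

lemma IsEvenGen.sder_brP {j : ZMod 2} {b : g} (hb : S.par b = sg j • b) :
    S.SDer false S.sgnVX S.lamV j (cl S.V ∘ₗ S.rho.toLinearMap) (S.brP γ b) := by
  change S.SDer false S.sgnVX S.lamV j (cl S.V ∘ₗ S.rho.toLinearMap) (S.rhoL ∘ₗ S.ext (γ b))
  rw [(hγ.hasParity hb).ext_eq]
  exact (S.sder_extPar j (γ b)).rhoL

lemma IsEvenGen.sder_bd {i : ZMod 2} {u : S.P} (hu : S.sgn false u = sg i • u) :
    S.SDer false (S.sgn true).toLinearMap (S.der true) i S.rho.toLinearMap (S.bd γ u) := by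
  change S.SDer false _ _ i _ (S.ev0 ∘ₗ S.rhoL ∘ₗ S.ext (S.lamSkew γ u))
  rw [(hγ.hasParity_lamSkew hu).ext_eq]
  exact (S.sder_extPar i _).rhoL.ev0

end

/-- Skew-symmetry at `λ = 0`: the bracket with `u` on the left is minus, up to sign, the bracket
with `b` on the left evaluated at `λ = -∂`. -/
lemma bd_gen_homog (γ : g →ₗ[ℂ] g →ₗ[ℂ] S.P[X]) {i j : ZMod 2} {b : g} {u : S.P}
    (hb : S.par b = sg j • b) (hu : S.sgn false u = sg i • u) :
    S.bd γ u (S.gen false 0 b) = -(sg (i * j) • S.evD (S.brP γ b u)) := by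
  change S.ev0 (S.rhoL (S.ext (S.lamSkew γ u) _)) = -(sg (i * j) • S.evD (S.rhoL (S.ext (γ b) u)))
  rw [ext_gen_zero, S.lamSkew_homog γ hb hu, map_neg, map_neg, map_smul, map_smul, rhoL_eq, rhoL_eq,
    ev0_apply, rhoX_flip_eval]

lemma bd_gen_even (γ : g →ₗ[ℂ] g →ₗ[ℂ] S.P[X]) {u : S.P} (hu : S.sgn false u = u) (b : g) :
    S.bd γ u (S.gen false 0 b) = -S.evD (S.brP γ b u) := by
  change S.ev0 (S.rhoL (S.ext (S.lamSkew γ u) _)) = -S.evD (S.rhoL (S.ext (γ b) u))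
  rw [ext_gen_zero, S.lamSkew_even γ hu, map_neg, map_neg, rhoL_eq, rhoL_eq, ev0_apply,
    rhoX_flip_eval]

/-- Integration by parts: `evD` kills the image of `λ + ∂`, so each `λ + ∂` moves to the factor `F`
as `-∂`. -/
lemma evD_C_mul_lamV_pow (n : ℕ) (F : S.V) (p : S.V[X]) :
    S.evD (Polynomial.C F * (S.lamV ^ n) p) =
      S.evD (Polynomial.C (((-S.der true) ^ n) F) * p) := by
  induction n generalizing F with
  | zero => rfl
  | succ n ih =>
    have h := S.evD_lamV (Polynomial.C F * (S.lamV ^ n) p)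
    rw [lamV_C_mul, map_add, add_comm, add_eq_zero_iff_eq_neg, ← map_neg, ← neg_mul,
      ← map_neg] at h
    rw [pow_succ', Module.End.mul_apply, h, ih, pow_succ, Module.End.mul_apply,
      LinearMap.neg_apply]

lemma evD_C_mul_linear (F x : S.V) (c : ℂ) :
    S.evD (Polynomial.C F * (Polynomial.C x + c • Polynomial.X)) = F * x - c • S.der true F := by
  have h : Polynomial.C F * (Polynomial.C x + c • Polynomial.X) =
      Polynomial.C (F * x) + c • Polynomial.monomial 1 F := by
    rw [mul_add, map_mul, mul_smul_comm, Polynomial.C_mul_X_eq_monomial]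
  rw [h, map_add, map_smul, evD_C, evD_monomial, pow_one, LinearMap.neg_apply, smul_neg,
    sub_eq_add_neg]

lemma subF_linear (F x : S.V) (c : ℂ) :
    S.subF F (Polynomial.C x + c • Polynomial.X) = F * x + c • S.der true F := by
  have h : Polynomial.C x + c • (Polynomial.X : S.V[X]) =
      Polynomial.monomial 0 x + c • Polynomial.monomial 1 1 := rfl
  rw [h, map_add, map_smul, subF_monomial, subF_monomial, pow_zero, pow_one, mul_one,
    Module.End.one_apply]

lemma sgn_der_pow (n : ℕ) (x : S.V) :
    S.sgn true ((S.der true ^ n) x) = (S.der true ^ n) (S.sgn true x) := by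
  induction n with
  | zero => rfl
  | succ n ih => rw [pow_succ', Module.End.mul_apply, sgn_der, ih, Module.End.mul_apply]

variable {S} in
lemma SDer.subF {q : Bool} {j l : ZMod 2} {J : S.DA q →ₗ[ℂ] S.V} {D : S.DA q →ₗ[ℂ] S.V[X]}
    (h : S.SDer q S.sgnVX S.lamV j (cl S.V ∘ₗ J) D)
    (hJ : ∀ x, S.sgn true (J x) = J (S.sgn q x)) {F : S.V} (hF : S.sgn true F = sg l • F) :
    S.SDer q (S.sgn true).toLinearMap (S.der true) (l + j) J (S.subF F ∘ₗ D) where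
  J_par := hJ
  D_par x := by
    have h1 : ∀ p, S.sgn true (S.subF F p) = sg l • S.subF F (S.sgnVX p) := by
      intro p
      induction p using Polynomial.induction_on' with
      | add p q hp hq => simp only [map_add, hp, hq, smul_add]
      | monomial n x =>
        rw [sgnVX, cwX_monomial, subF_monomial, subF_monomial, map_mul, sgn_der_pow, hF, map_smul,
          smul_mul_assoc]
        rfl
    rw [LinearMap.comp_apply, AlgHom.toLinearMap_apply, h1, h.D_par, map_smul, smul_smul, sg_add]
    rfl
  D_mul x y := by
    rw [LinearMap.comp_apply, h.D_mul, map_add]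
    simp only [LinearMap.comp_apply, cl_apply]
    rw [subF_mul_C, S.subF_C_mul hF]
    congr 2
    have h2 : S.sgn true (J (S.sgn q x)) = J x := by rw [hJ, sgn_sgn]
    rcases zmod2_cases l with rfl | rfl <;> rcases zmod2_cases j with rfl | rfl <;>
      simp [twV, hJ, h2, show (1 : ZMod 2) + 1 = 0 from rfl, sgn_sgn]
  J_one := by
    have := congrArg (fun p => Polynomial.coeff p 0) h.J_one
    simpa using this
  D_der x := by rw [LinearMap.comp_apply, h.D_der, subF_lamV]; rfl

/-! ### The first bracket -/

variable [FiniteDimensional ℂ g]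

lemma rhoX_gam1 (k : ℂ) (a b : g) : S.rhoX (S.gam1 k a b) =
    Polynomial.C (S.gen true 0 (S.br a b)) + (k * S.B a b) • Polynomial.X := by
  have h : (S.gam1 k a b) = Polynomial.C (S.gen false 0 (S.br a b)) +
      (k * S.B a b) • Polynomial.X := rfl
  have h2 : S.rhoL Polynomial.X = Polynomial.X := by
    rw [rhoL_eq]; exact Polynomial.map_X _
  rw [h, ← rhoL_eq, map_add, map_smul, h2, rhoL, cwX_C, AlgHom.toLinearMap_apply, rho_gen]

lemma nn_induction {motive : (a : g) → a ∈ S.nn → Prop} (zero : motive 0 (zero_mem _))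
    (add : ∀ a b ha hb, motive a ha → motive b hb → motive (a + b) (add_mem ha hb))
    (gr : ∀ j (hj : 0 < j) a (ha : a ∈ S.gr j), motive a (S.gr_le_nn hj ha)) {a : g}
    (ha : a ∈ S.nn) : motive a ha := by
  induction ha using Submodule.iSup_induction' with
  | mem j x hx =>
    by_cases hj : 0 < j
    · exact gr j hj x (by rwa [iSup_pos hj] at hx)
    · rw [iSup_neg hj, Submodule.mem_bot] at hx
      subst hx
      exact zero
  | zero => exact zero
  | add x y h1 h2 hx hy => exact add x y h1 h2 hx hy

lemma mm_induction {motive : (a : g) → a ∈ S.mm → Prop} (zero : motive 0 (zero_mem _))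
    (add : ∀ a b ha hb, motive a ha → motive b hb → motive (a + b) (add_mem ha hb))
    (gr : ∀ j (hj : 2 ≤ j) a (ha : a ∈ S.gr j), motive a (S.gr_le_mm hj ha)) {a : g}
    (ha : a ∈ S.mm) : motive a ha := by
  induction ha using Submodule.iSup_induction' with
  | mem j x hx =>
    by_cases hj : 2 ≤ j
    · exact gr j hj x (by rwa [iSup_pos hj] at hx)
    · rw [iSup_neg hj, Submodule.mem_bot] at hx
      subst hx
      exact zero
  | zero => exact zero
  | add x y h1 h2 hx hy => exact add x y h1 h2 hx hy

lemma par_mem_nn {a : g} (ha : a ∈ S.nn) : S.par a ∈ S.nn := by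
  induction ha using S.nn_induction with
  | zero => simp
  | add a b _ _ ha hb => rw [map_add]; exact add_mem ha hb
  | gr j hj a ha => exact S.gr_le_nn hj (S.par_mem_gr ha)

lemma ev_mem_nn {a : g} (ha : a ∈ S.nn) : S.ev a ∈ S.nn :=
  Submodule.smul_mem _ _ (add_mem ha (S.par_mem_nn ha))

lemma od_mem_nn {a : g} (ha : a ∈ S.nn) : S.od a ∈ S.nn :=
  Submodule.smul_mem _ _ (sub_mem ha (S.par_mem_nn ha))

lemma ev_mem_mm {a : g} (ha : a ∈ S.mm) : S.ev a ∈ S.mm :=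
  Submodule.smul_mem _ _ (add_mem ha (S.par_mem_mm ha))

lemma od_mem_mm {a : g} (ha : a ∈ S.mm) : S.od a ∈ S.mm :=
  Submodule.smul_mem _ _ (sub_mem ha (S.par_mem_mm ha))

lemma par_ev' (a : g) : S.par (S.ev a) = sg 0 • S.ev a := by rw [S.par_ev]; simp [sg]

lemma par_od' (a : g) : S.par (S.od a) = sg 1 • S.od a := by rw [S.par_od]; simp [sg]

-- For `n` of degree at least `1` and `m` of degree at least `2`, `[n, m]` has degree at least `3`.
-- It therefore lies in `𝔪` and is orthogonal to `f`, and `(n|m) = 0`.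
variable {S} in
lemma rhoX_gam1_nn (k : ℂ) {n m : g} (hn : n ∈ S.nn) (hm : m ∈ S.mm) :
    S.rhoX (S.gam1 k n m) = 0 := by
  induction hn using S.nn_induction with
  | zero => simp
  | add a b _ _ ha hb => simp only [map_add, LinearMap.add_apply, ha, hb, add_zero]
  | gr j hj n hn =>
    induction hm using S.mm_induction with
    | zero => simp
    | add a b _ _ ha hb => simp only [map_add, ha, hb, add_zero]
    | gr l hl m hm =>
      have h1 := S.br_mem_gr hn hm
      rw [rhoX_gam1, S.gen_true_zero _ (S.gr_le_mm (by omega) h1),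
        S.B_gr (by omega) S.f_mem h1, S.B_gr (by omega) hn hm]
      simp

lemma flip_linear (x : S.P) (c : ℂ) : S.flip (Polynomial.C x + c • Polynomial.X) =
    Polynomial.C x - c • Polynomial.X := by
  have h1 : ∀ n (x : S.P), S.flip (Polynomial.monomial n x) =
      ((-S.lamD) ^ n) (Polynomial.monomial 0 x) := by
    intro n x
    rw [flip, Polynomial.lsum_apply, Polynomial.sum_monomial_index _ _ (by simp)]
    rfl
  have h2 : S.lamD (Polynomial.C 1) = Polynomial.X := by
    have h : S.lamD (Polynomial.C 1) = Polynomial.X * Polynomial.C 1 +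
      cwX (S.der false) (Polynomial.C 1) := rfl
    have h3 : S.der false 1 = 0 := by simpa using S.der_algebraMap false 1
    rw [h, cwX_C, h3]
    simp
  have h4 : Polynomial.C x + c • (Polynomial.X : S.P[X]) =
      Polynomial.monomial 0 x + c • Polynomial.monomial 1 1 := rfl
  rw [h4, map_add, map_smul, h1, h1, pow_zero, pow_one, LinearMap.neg_apply]
  simp only [Polynomial.monomial_zero_left]
  rw [h2, smul_neg, sub_eq_add_neg]
  rfl

/-- The prescribed bracket on `g` is already skew-symmetric, so extending by skew-symmetry does not
change it. -/
lemma lamSkew_gam1_gen (k : ℂ) (n : g) : S.lamSkew (S.gam1 k) (S.gen false 0 n) = S.gam1 k n := by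
  have key : ∀ (i j : ZMod 2) (n b : g), S.par n = sg i • n → S.par b = sg j • b →
      S.lamSkew (S.gam1 k) (S.gen false 0 n) b = S.gam1 k n b := by
    intro i j n b hn hb
    have h : ∀ a b, (S.gam1 k a b) = Polynomial.C (S.gen false 0 (S.br a b)) +
      (k * S.B a b) • Polynomial.X := fun _ _ => rfl
    rw [S.lamSkew_homog _ hb (by rw [sgn_gen, hn, map_smul] : _ = sg i • _), ext_gen_zero, h, h,
      flip_linear, S.skew i j n b hn hb, S.B_symm i j n b hn hb]
    simp only [map_neg, map_smul, smul_sub, ← Polynomial.smul_C, smul_smul, neg_sub]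
    rw [sub_eq_neg_add]
    congr 2
    ring
  have h1 : ∀ x : S.P, S.lamSkew (S.gam1 k) x = -(S.flip ∘ₗ (S.lamGen (S.gam1 k) x ∘ₗ S.ev +
    S.lamGen (S.gam1 k) (S.sgn false x) ∘ₗ S.od)) := fun _ => rfl
  have hadd : ∀ x y : S.P, S.lamSkew (S.gam1 k) (x + y) =
      S.lamSkew (S.gam1 k) x + S.lamSkew (S.gam1 k) y := by
    intro u v
    ext1 b
    simp only [lamSkew, lamGen, LinearMap.neg_apply, LinearMap.comp_apply, LinearMap.add_apply,
      LinearMap.coe_mk, AddHom.coe_mk, map_add]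
    abel
  ext1 b
  rw [← S.ev_add_od n, ← S.ev_add_od b]
  simp only [map_add, hadd, LinearMap.add_apply]
  rw [key 0 0 _ _ (S.par_ev' n) (S.par_ev' b), key 1 0 _ _ (S.par_od' n) (S.par_ev' b),
    key 0 1 _ _ (S.par_ev' n) (S.par_od' b), key 1 1 _ _ (S.par_od' n) (S.par_od' b)]

end Setup
end WSuper

namespace WSuper
namespace Setup

variable {g : Type*} [AddCommGroup g] [Module ℂ g] [FiniteDimensional ℂ g] (S : Setup g)

/-! ### The brackets on `W` -/

section

variable {S}

lemma brP_gam1_mm (k : ℂ) {n m : g} (hn : n ∈ S.nn) (hm : m ∈ S.mm) :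
    S.brP (S.gam1 k) n (S.gen false 0 m) = 0 := by
  rw [brP_gen, rhoX_gam1_nn k hn hm]

/-- For `n ∈ 𝔫` the derivation `{n_λ ·}` kills `𝔪` modulo `ℐ`, hence descends to `𝒱`. Membership in
`W` can then be tested on one representative. -/
lemma brP_gam1_eq_sec (k : ℂ) {n : g} (hn : n ∈ S.nn) (x : S.P) :
    S.brP (S.gam1 k) n x = S.brP (S.gam1 k) n (S.sec (S.rho x)) := by
  have key : ∀ (j : ZMod 2) n, S.par n = sg j • n → n ∈ S.nn →
      S.brP (S.gam1 k) n x = S.brP (S.gam1 k) n (S.sec (S.rho x)) := fun j n hj hn =>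
    ((S.isEvenGen_gam1 k).sder_brP hj).eq_sec (fun m hm => brP_gam1_mm k hn hm) x
  rw [← S.ev_add_od n]
  simp only [map_add, LinearMap.add_apply]
  rw [key 0 _ (S.par_ev' n) (S.ev_mem_nn hn), key 1 _ (S.par_od' n) (S.od_mem_nn hn)]

/-- `{b_λ v}` for `b ∈ g`, `v ∈ 𝒱`, computed on the chosen representatives. -/
def brV (S : Setup g) (γ : g →ₗ[ℂ] g →ₗ[ℂ] S.P[X]) (b : g) : S.V →ₗ[ℂ] S.V[X] :=
  S.brP γ b ∘ₗ S.sec.toLinearMap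

lemma brV_apply (γ : g →ₗ[ℂ] g →ₗ[ℂ] S.P[X]) (b : g) (v : S.V) :
    S.brV γ b v = S.brP γ b (S.sec v) := rfl

lemma brV_add (γ : g →ₗ[ℂ] g →ₗ[ℂ] S.P[X]) (a b : g) : S.brV γ (a + b) = S.brV γ a + S.brV γ b := by
  rw [brV, map_add]; rfl

lemma brV_sub (γ : g →ₗ[ℂ] g →ₗ[ℂ] S.P[X]) (a b : g) : S.brV γ (a - b) = S.brV γ a - S.brV γ b := by
  rw [brV, map_sub]; rfl

lemma IsEvenGen.sder_brV {γ : g →ₗ[ℂ] g →ₗ[ℂ] S.P[X]} (hγ : S.IsEvenGen γ) {j : ZMod 2} {b : g}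
    (hb : S.par b = sg j • b) : S.SDer true S.sgnVX S.lamV j (cl S.V) (S.brV γ b) :=
  (hγ.sder_brP hb).sec

lemma SDer.apply_gen_sec {B : Type*} [Ring B] [Algebra ℂ B] {ε δ : B →ₗ[ℂ] B} {i : ZMod 2}
    {J D : S.P →ₗ[ℂ] B} (h : S.SDer false ε δ i J D) (a : g) :
    D (S.sec (S.gen true 0 a)) = D (S.gen false 0 (S.prp a)) := by
  rw [sec_gen, map_sub, Algebra.algebraMap_eq_smul_one, map_smul, h.map_one, smul_zero, sub_zero]

lemma IsEvenGen.brV_gen {γ : g →ₗ[ℂ] g →ₗ[ℂ] S.P[X]} (hγ : S.IsEvenGen γ) {j : ZMod 2} {b : g}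
    (hb : S.par b = sg j • b) (a : g) : S.brV γ b (S.gen true 0 a) = S.rhoX (γ b (S.prp a)) := by
  rw [brV_apply, (hγ.sder_brP hb).apply_gen_sec, brP_gen]

lemma mem_W_iff (k : ℂ) (v : S.V) :
    v ∈ S.W k ↔ ∀ n ∈ S.nn, S.brV (S.gam1 k) n v = 0 := by
  have h1 : ∀ n A, S.rhoX (S.lam (S.gam1 k) (S.gen false 0 n) A) = S.brP (S.gam1 k) n A := by
    intro n A
    rw [lam, lamSkew_gam1_gen, ← rhoL_eq]
    rfl
  constructor
  · rintro ⟨A, hA, rfl⟩ n hn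
    have := hA n hn
    rw [h1, brP_gam1_eq_sec k hn] at this
    exact this
  · intro h
    refine ⟨S.sec v, fun n hn => ?_, S.rho_sec v⟩
    rw [h1]
    exact h n hn

lemma mem_W_iff_homog (k : ℂ) (v : S.V) : v ∈ S.W k ↔
    ∀ j : ℤ, 0 < j → ∀ (i : ZMod 2), ∀ n ∈ S.gr j, S.par n = sg i • n →
      S.brV (S.gam1 k) n v = 0 := by
  rw [mem_W_iff]
  refine ⟨fun h j hj i n hn _ => h n (S.gr_le_nn hj hn), fun h n hn => ?_⟩
  induction hn using S.nn_induction with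
  | zero => rw [brV, map_zero]; rfl
  | add a b _ _ ha hb => rw [brV_add, LinearMap.add_apply, ha, hb, add_zero]
  | gr j hj n hn =>
    rw [← S.ev_add_od n, brV_add, LinearMap.add_apply,
      h j hj 0 _ (S.ev_mem_gr hn) (S.par_ev' n), h j hj 1 _ (S.od_mem_gr hn) (S.par_od' n),
      add_zero]

lemma brV_der (k : ℂ) (b : g) (v : S.V) :
    S.brV (S.gam1 k) b (S.der true v) = S.lamV (S.brV (S.gam1 k) b v) := by
  rw [← S.ev_add_od b, brV_add, LinearMap.add_apply, LinearMap.add_apply, map_add,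
    ((S.isEvenGen_gam1 k).sder_brV (S.par_ev' b)).D_der,
    ((S.isEvenGen_gam1 k).sder_brV (S.par_od' b)).D_der]

/-- `{n_λ ∂v} = (λ + ∂){n_λ v}` and `λ + ∂` is injective. Thus an element of `W` which is a total
derivative in `𝒱` is the derivative of an element of `W`. -/
lemma mem_W_of_der_mem {k : ℂ} {v : S.V} (h : S.der true v ∈ S.W k) : v ∈ S.W k := by
  rw [mem_W_iff] at h ⊢
  intro n hn
  have := h n hn
  rw [brV_der] at this
  exact S.lamV_injective this

lemma int_eq_zero_of_mem {k : ℂ} {v : S.V} (h : v ∈ S.W k)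
    (hv : v ∈ LinearMap.range (S.der true)) : S.int k v = 0 := by
  obtain ⟨x, rfl⟩ := hv
  exact (Submodule.Quotient.mk_eq_zero _).2 ⟨x, mem_W_of_der_mem h, rfl⟩

lemma mem_range_of_int_eq_zero {k : ℂ} {v : S.V} (h : S.int k v = 0) :
    v ∈ LinearMap.range (S.der true) := by
  obtain ⟨x, _, hx⟩ := (Submodule.Quotient.mk_eq_zero _).1 h
  exact ⟨x, hx⟩

/-- The elements `∂ⁿ (m + (f|m))`. -/
def idealGen (S : Setup g) (n : ℕ) : g →ₗ[ℂ] S.P :=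
  S.gen false n + (if n = 0 then S.B S.f else 0).smulRight 1

lemma idealGen_apply (n : ℕ) (m : g) : S.idealGen n m =
    S.gen false n m + algebraMap ℂ _ (if n = 0 then S.B S.f m else 0) := by
  rw [idealGen, LinearMap.add_apply, LinearMap.smulRight_apply, Algebra.algebraMap_eq_smul_one]
  split_ifs <;> rfl

lemma rho_idealGen (n : ℕ) {m : g} (hm : m ∈ S.mm) : S.rho (S.idealGen n m) = 0 := by
  rw [idealGen_apply, map_add, rho_gen, AlgHom.commutes]
  cases n with
  | zero => rw [S.gen_true_zero _ hm, if_pos rfl, ← map_add, neg_add_cancel, map_zero]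
  | succ n => rw [S.gen_true_succ _ _ hm]; simp

lemma sgn_idealGen (n : ℕ) (m : g) :
    S.sgn false (S.idealGen n m) = S.idealGen n (S.par m) := by
  have : S.B S.f (S.par m) = S.B S.f m := by
    rw [← S.B_even, S.f_even, S.par_par]
  rw [idealGen_apply, idealGen_apply, map_add, sgn_gen, AlgHom.commutes, this]

lemma idealGen_mul (n : ℕ) {j : ZMod 2} {m : g} (hm : S.par m = sg j • m) (x : S.P) :
    S.idealGen n m * x = (if j = 0 then x else S.sgn false x) * S.idealGen n m := by
  rw [idealGen_apply, add_mul, mul_add, S.gen_mul false n j m hm]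
  congr 1
  rcases zmod2_cases j with rfl | rfl
  · rw [if_pos rfl, Algebra.commutes]
  · rw [S.B_f_odd hm]
    simp

/-- The difference lies in the ideal generated by `∂ⁿ(m + (f|m))`. Left multiples suffice, because
homogeneous generators supercommute with everything. -/
lemma sub_sec_mem (x : S.P) : x - S.sec (S.rho x) ∈ Submodule.span ℂ
    {y | ∃ (z : S.P) (n : ℕ) (j : ZMod 2) (m : g), m ∈ S.mm ∧ S.par m = sg j • m ∧
      y = z * S.idealGen n m} := by
  set J := Submodule.span ℂ {y | ∃ (z : S.P) (n : ℕ) (j : ZMod 2) (m : g), m ∈ S.mm ∧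
    S.par m = sg j • m ∧ y = z * S.idealGen n m} with hJ
  have hl : ∀ w, ∀ y ∈ J, w * y ∈ J := by
    intro w y hy
    induction hy using Submodule.span_induction with
    | mem y hy =>
      obtain ⟨z, n, j, m, hm, hj, rfl⟩ := hy
      rw [← mul_assoc]
      exact Submodule.subset_span ⟨_, n, j, m, hm, hj, rfl⟩
    | zero => rw [mul_zero]; exact zero_mem _
    | add a b _ _ ha hb => rw [mul_add]; exact add_mem ha hb
    | smul c a _ ha => rw [mul_smul_comm]; exact Submodule.smul_mem _ _ ha
  have hr : ∀ w, ∀ y ∈ J, y * w ∈ J := by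
    intro w y hy
    induction hy using Submodule.span_induction with
    | mem y hy =>
      obtain ⟨z, n, j, m, hm, hj, rfl⟩ := hy
      rw [mul_assoc, idealGen_mul n hj, ← mul_assoc]
      exact Submodule.subset_span ⟨_, n, j, m, hm, hj, rfl⟩
    | zero => rw [zero_mul]; exact zero_mem _
    | add a b _ _ ha hb => rw [add_mul]; exact add_mem ha hb
    | smul c a _ ha => rw [smul_mul_assoc]; exact Submodule.smul_mem _ _ ha
  induction x using S.DA_induction false with
  | scalar c => simp
  | gen n a =>
    have h1 : S.gen false n a - S.sec (S.rho (S.gen false n a)) =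
        S.idealGen n (a - S.prp a) := by
      rw [rho_gen, sec_gen, idealGen_apply, map_sub, map_sub, B_f_prp, sub_zero]
      abel
    have hm := S.sub_prp_mem a
    rw [h1, ← S.ev_add_od (a - S.prp a), map_add]
    exact add_mem
      (Submodule.subset_span ⟨1, n, 0, _, S.ev_mem_mm hm, S.par_ev' _, (one_mul _).symm⟩)
      (Submodule.subset_span ⟨1, n, 1, _, S.od_mem_mm hm, S.par_od' _, (one_mul _).symm⟩)
  | mul x y hx hy =>
    have : x * y - S.sec (S.rho (x * y)) = (x - S.sec (S.rho x)) * y +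
        S.sec (S.rho x) * (y - S.sec (S.rho y)) := by
      rw [map_mul, map_mul, sub_mul, mul_sub]
      abel
    rw [this]
    exact add_mem (hr _ _ hx) (hl _ _ hy)
  | add x y hx hy =>
    rw [map_add, map_add, add_sub_add_comm]
    exact add_mem hx hy

/-- Modulo `ℐ` the Leibniz rule keeps only the term where the bracket meets the generator of the
ideal. Integration by parts moves `∂ⁿ` to `x`, and both sides are derivations, compared on
generators. -/
lemma bd_idealGen_mul (k : ℂ) {i j : ZMod 2} {x : S.P} (hx : S.sgn false x = sg i • x) (n : ℕ)
    {m : g} (hm : m ∈ S.mm) (hj : S.par m = sg j • m) : S.bd (S.gam1 k) (x * S.idealGen n m) =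
      S.subF (((-S.der true) ^ n) (S.rho x)) ∘ₗ S.brP (S.gam1 k) m := by
  have hγ := S.isEvenGen_gam1 k
  have hF0 : ∀ n : ℕ, S.sgn true (((-S.der true) ^ n) (S.rho x)) =
      sg i • ((-S.der true) ^ n) (S.rho x) := by
    intro n
    induction n with
    | zero => rw [pow_zero, Module.End.one_apply, ← rho_sgn, hx, map_smul]
    | succ n ih =>
      rw [pow_succ', Module.End.mul_apply, LinearMap.neg_apply, map_neg, sgn_der, ih, map_smul,
        smul_neg]
  have hu : S.sgn false (x * S.idealGen n m) = sg (i + j) • (x * S.idealGen n m) := by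
    rw [map_mul, hx, sgn_idealGen, hj, map_smul, smul_mul_smul_comm, sg_add]
  refine (hγ.sder_bd hu).ext ((hγ.sder_brP hj).subF (fun x => (S.rho_sgn x).symm) (hF0 n)) ?_
  have key : ∀ (l : ZMod 2) (b : g), S.par b = sg l • b →
      S.bd (S.gam1 k) (x * S.idealGen n m) (S.gen false 0 b) =
      S.subF (((-S.der true) ^ n) (S.rho x)) (S.brP (S.gam1 k) m (S.gen false 0 b)) := by
    intro l b hb
    have hD := hγ.sder_brP (b := b) hb
    have h1 : ∀ n, S.brP (S.gam1 k) b (S.idealGen n m) =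
        (S.lamV ^ n) (S.brP (S.gam1 k) b (S.gen false 0 m)) := by
      intro n
      rw [idealGen_apply, map_add, Algebra.algebraMap_eq_smul_one, map_smul, hD.map_one, smul_zero,
        add_zero, hD.map_gen]
    have h2 : S.brP (S.gam1 k) b (x * S.idealGen n m) = sg (l * i) •
        (Polynomial.C (S.rho x) * (S.lamV ^ n) (S.brP (S.gam1 k) b (S.gen false 0 m))) := by
      rw [hD.D_mul_homog (by exact hx), h1]
      simp only [LinearMap.comp_apply, AlgHom.toLinearMap_apply, rho_idealGen n hm, map_zero,
        mul_zero, zero_add, cl_apply]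
    rw [S.bd_gen_homog _ hb hu, h2, map_smul, evD_C_mul_lamV_pow, brP_gen, brP_gen, rhoX_gam1,
      rhoX_gam1, evD_C_mul_linear, subF_linear, S.skew j l m b hj hb, S.B_symm j l m b hj hb]
    rcases zmod2_cases i with rfl | rfl <;> rcases zmod2_cases j with rfl | rfl <;>
      rcases zmod2_cases l with rfl | rfl <;>
      simp [sg, show (1 : ZMod 2) + 1 = 0 from rfl, sub_eq_add_neg, add_comm]
  intro b
  rw [← S.ev_add_od b]
  simp only [map_add]
  rw [key 0 _ (S.par_ev' b), key 1 _ (S.par_od' b)]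
  simp only [LinearMap.comp_apply]

/-- By `bd_idealGen_mul` such brackets are built from `{m_λ v}`, which vanishes for `v` in `W`
because `𝔪 ⊆ 𝔫`. The first bracket on `W` is thus independent of the left representative. -/
lemma bd_gam1_eq_zero (k : ℂ) {x v : S.P} (hx : S.rho x = 0) (hv : S.rho v ∈ S.W k) :
    S.bd (S.gam1 k) x v = 0 := by
  have h := S.sub_sec_mem x
  rw [hx, map_zero, sub_zero] at h
  clear hx
  induction h using Submodule.span_induction with
  | mem y hy =>
    obtain ⟨z, n, j, m, hm, hj, rfl⟩ := hy
    have h1 : S.brP (S.gam1 k) m v = 0 := by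
      rw [brP_gam1_eq_sec k (S.mm_le_nn hm)]
      exact (mem_W_iff k _).1 hv m (S.mm_le_nn hm)
    have hz : z = (2⁻¹ : ℂ) • (z + S.sgn false z) + (2⁻¹ : ℂ) • (z - S.sgn false z) := by
      rw [← smul_add, add_add_sub_cancel, ← two_smul ℂ z, smul_smul]
      norm_num
    rw [hz, add_mul, map_add, LinearMap.add_apply,
      bd_idealGen_mul (i := 0) k (by simp [sg, sgn_sgn, add_comm]) n hm hj,
      bd_idealGen_mul (i := 1) k (by simp [sg, sgn_sgn, ← smul_neg]) n hm hj]
    simp only [LinearMap.comp_apply, h1, map_zero, add_zero]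
  | zero => simp
  | add a b _ _ ha hb => rw [map_add, LinearMap.add_apply, ha, hb, add_zero]
  | smul c a _ ha => rw [map_smul, LinearMap.smul_apply, ha, smul_zero]

end

end Setup
end WSuper

namespace WSuper
namespace Setup

variable {g : Type*} [AddCommGroup g] [Module ℂ g] [FiniteDimensional ℂ g] {S : Setup g}

/-! ### The evolutionary derivations attached to the brackets -/

/-- A derivation of `𝒱` of parity `i` which commutes with `∂`. -/
abbrev EvDer (S : Setup g) (i : ZMod 2) (T : S.V →ₗ[ℂ] S.V) : Prop :=
  S.SDer true (S.sgn true).toLinearMap (S.der true) i LinearMap.id T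

lemma EvDer.map_gen_prp {i : ZMod 2} {T : S.V →ₗ[ℂ] S.V} (h : S.EvDer i T) (a : g) :
    T (S.gen true 0 (S.prp a)) = T (S.gen true 0 a) := by
  rw [← S.gen_true_prp_zero a, map_sub, Algebra.algebraMap_eq_smul_one, map_smul, h.map_one,
    smul_zero, sub_zero]

/-- The flow of an element of `W` extends to an evolutionary derivation of `𝒱`. Its generators may
be computed from `H` instead of `w`, because `evD` annihilates total derivatives. -/
lemma zero1_eq {k : ℂ} {H w : S.V} (hw : S.IsDensity k H w) : ∃ T, S.EvDer 0 T ∧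
    (∀ b, T (S.gen true 0 b) = -S.evD (S.brV (S.gam1 k) (S.prp b) H)) ∧
    ∀ v ∈ S.W k, S.zero1 k w v = T v := by
  obtain ⟨hwW, hw0, x, hx⟩ := hw
  have hγ := S.isEvenGen_gam1 k
  have hs : S.sgn false (S.sec w) = S.sec w := by rw [← sec_sgn, hw0]
  have hT := hγ.sder_bd (i := 0) (u := S.sec w) (by simp [sg, hs])
  have hH : H = w + S.der true x := by rw [hx]; abel
  refine ⟨_, SDer.sec (J := LinearMap.id) hT, fun b => ?_, fun v hv => ?_⟩
  · rw [LinearMap.comp_apply, AlgHom.toLinearMap_apply, hT.apply_gen_sec, S.bd_gen_even _ hs, hH,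
      map_add, brV_der, map_add, evD_lamV, add_zero, brV_apply]
  · have hr : ∀ u : S.V, S.rho (S.rep u) = u := Function.surjInv_eq S.rho_surjective
    have h1 : S.bd (S.gam1 k) (S.rep w) (S.rep v) = S.bd (S.gam1 k) (S.sec w) (S.rep v) := by
      have := bd_gam1_eq_zero k (x := S.rep w - S.sec w) (v := S.rep v)
        (by rw [map_sub, hr, rho_sec, sub_self]) (by rwa [hr])
      rwa [map_sub, LinearMap.sub_apply, sub_eq_zero] at this
    rw [zero1, lamW, ← bd_apply, h1, SDer.eq_sec (J := LinearMap.id) hT _ (S.rep v), hr]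
    · rfl
    · intro m hm
      rw [S.bd_gen_even _ hs, ← brV_apply, (mem_W_iff k w).1 hwW m (S.mm_le_nn hm), map_zero,
        neg_zero]

lemma br_s_gr {D : ℤ} (hD : ∀ j : ℤ, D < j → S.gr j = ⊥) {s : g} (hs : s ∈ S.gr D) {j : ℤ}
    (hj : 0 < j) {n : g} (hn : n ∈ S.gr j) : S.br s n = 0 := by
  have := S.br_mem_gr hs hn
  rw [hD _ (by omega)] at this
  exact this

lemma br_s_nn {D : ℤ} (hD : ∀ j : ℤ, D < j → S.gr j = ⊥) {s : g} (hs : s ∈ S.gr D) {n : g}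
    (hn : n ∈ S.nn) : S.br s n = 0 := by
  induction hn using S.nn_induction with
  | zero => simp
  | add a b _ _ ha hb => rw [map_add, ha, hb, add_zero]
  | gr j hj n hn => exact br_s_gr hD hs hj hn

lemma rhoX_gam2 (s a b : g) :
    S.rhoX (S.gam2 s a b) = Polynomial.C (algebraMap ℂ S.V (S.B (S.br s a) b)) := by
  have h : S.gam2 s a b = Polynomial.C (algebraMap ℂ S.P (S.B s (S.br a b))) := rfl
  rw [h, ← rhoL_eq, rhoL, cwX_C, AlgHom.toLinearMap_apply, AlgHom.commutes, S.B_inv]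

section

variable {D : ℤ} (hD : ∀ j : ℤ, D < j → S.gr j = ⊥) {s : g} (hs : s ∈ S.gr D) (hs0 : S.par s = s)

include hD hs hs0

/-- By invariance this is a pairing with `[s, m]`, which lies above the top degree. So the second
bracket does not see `𝔪` and descends to all of `𝒱`. -/
lemma B_br_s_mm (a : g) {m : g} (hm : m ∈ S.mm) : S.B (S.br s a) m = 0 := by
  have h1 : S.B (S.br a s) m = 0 := by
    rw [S.B_inv, br_s_nn hD hs (S.mm_le_nn hm), map_zero]
  rwa [S.skew_even hs0, map_neg, LinearMap.neg_apply, neg_eq_zero] at h1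

lemma B_br_s_prp (a b : g) : S.B (S.br s a) (S.prp b) = S.B (S.br s a) b := by
  have := B_br_s_mm hD hs hs0 a (S.sub_prp_mem b)
  rw [map_sub, sub_eq_zero] at this
  exact this.symm

lemma brP_gam2_eq_sec (b : g) (x : S.P) :
    S.brP (S.gam2 s) b x = S.brP (S.gam2 s) b (S.sec (S.rho x)) := by
  have key : ∀ (j : ZMod 2) b, S.par b = sg j • b →
      S.brP (S.gam2 s) b x = S.brP (S.gam2 s) b (S.sec (S.rho x)) := fun j b hj =>
    ((isEvenGen_gam2 hs0).sder_brP hj).eq_sec (fun m hm => by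
      rw [brP_gen, rhoX_gam2, B_br_s_mm hD hs hs0 _ hm, map_zero, map_zero]) x
  rw [← S.ev_add_od b]
  simp only [map_add, LinearMap.add_apply]
  rw [key 0 _ (S.par_ev' b), key 1 _ (S.par_od' b)]

lemma bd_gam2_eq_zero {x : S.P} (hx : S.rho x = 0) : S.bd (S.gam2 s) x = 0 := by
  have hγ := isEvenGen_gam2 hs0
  have key : ∀ (i : ZMod 2) (x : S.P), S.rho x = 0 → S.sgn false x = sg i • x →
      S.bd (S.gam2 s) x = 0 := by
    intro i x hx hi
    refine (hγ.sder_bd hi).ext (SDer.zero (by simp) fun x => (S.rho_sgn x).symm) ?_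
    have key2 : ∀ (j : ZMod 2) b, S.par b = sg j • b →
        S.bd (S.gam2 s) x (S.gen false 0 b) = 0 := by
      intro j b hb
      rw [S.bd_gen_homog _ hb hi, brP_gam2_eq_sec hD hs hs0, hx]
      simp
    intro b
    rw [← S.ev_add_od b]
    simp only [map_add]
    rw [key2 0 _ (S.par_ev' b), key2 1 _ (S.par_od' b)]
    simp
  have hz : x = (2⁻¹ : ℂ) • (x + S.sgn false x) + (2⁻¹ : ℂ) • (x - S.sgn false x) := by
    rw [← smul_add, add_add_sub_cancel, ← two_smul ℂ x, smul_smul]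
    norm_num
  have hx' : S.rho (S.sgn false x) = 0 := by rw [rho_sgn, hx, map_zero]
  rw [hz, map_add, key 0 _ (by simp [hx, hx']) (by simp [sg, sgn_sgn, add_comm]),
    key 1 _ (by simp [hx, hx']) (by simp [sg, sgn_sgn, ← smul_neg]), add_zero]

lemma brV_gam2_gen {j : ZMod 2} {b : g} (hb : S.par b = sg j • b) (a : g) :
    S.brV (S.gam2 s) b (S.gen true 0 a) =
      Polynomial.C (algebraMap ℂ S.V (S.B (S.br s b) a)) := by
  rw [(isEvenGen_gam2 hs0).brV_gen hb, rhoX_gam2, B_br_s_prp hD hs hs0]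

lemma brV_gam2_nn {n : g} (hn : n ∈ S.nn) : S.brV (S.gam2 s) n = 0 := by
  have key : ∀ (j : ZMod 2) (n : g), S.par n = sg j • n → n ∈ S.nn → S.brV (S.gam2 s) n = 0 := by
    intro j n hj hn
    refine ((isEvenGen_gam2 hs0).sder_brV hj).ext (SDer.zero (by simp) fun x => cwX_C _ _)
      fun a => ?_
    rw [brV_gam2_gen hD hs hs0 hj, br_s_nn hD hs hn]
    simp
  rw [← S.ev_add_od n, brV_add, key 0 _ (S.par_ev' n) (S.ev_mem_nn hn),
    key 1 _ (S.par_od' n) (S.od_mem_nn hn), add_zero]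

lemma brV_gam2_prp (b : g) : S.brV (S.gam2 s) (S.prp b) = S.brV (S.gam2 s) b := by
  have := brV_gam2_nn hD hs hs0 (S.mm_le_nn (S.sub_prp_mem b))
  rw [brV_sub, sub_eq_zero] at this
  exact this.symm

lemma brV_gam2_der (b : g) (v : S.V) :
    S.brV (S.gam2 s) b (S.der true v) = S.lamV (S.brV (S.gam2 s) b v) := by
  have hγ := isEvenGen_gam2 hs0
  rw [← S.ev_add_od b, brV_add, LinearMap.add_apply, LinearMap.add_apply, map_add,
    (hγ.sder_brV (S.par_ev' b)).D_der, (hγ.sder_brV (S.par_od' b)).D_der]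

lemma zero2_eq {k : ℂ} {H w : S.V} (hw : S.IsDensity k H w) : ∃ T, S.EvDer 0 T ∧
    (∀ b, T (S.gen true 0 b) = -S.evD (S.brV (S.gam2 s) b H)) ∧ ∀ v, S.zero2 s w v = T v := by
  obtain ⟨hwW, hw0, x, hx⟩ := hw
  have hγ := isEvenGen_gam2 hs0
  have hse : S.sgn false (S.sec w) = S.sec w := by rw [← sec_sgn, hw0]
  have hT := hγ.sder_bd (i := 0) (u := S.sec w) (by simp [sg, hse])
  have hH : H = w + S.der true x := by rw [hx]; abel
  refine ⟨_, SDer.sec (J := LinearMap.id) hT, fun b => ?_, fun v => ?_⟩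
  · rw [LinearMap.comp_apply, AlgHom.toLinearMap_apply, hT.apply_gen_sec, S.bd_gen_even _ hse, hH,
      map_add, brV_gam2_der hD hs hs0, map_add, evD_lamV, add_zero, ← brV_apply,
      brV_gam2_prp hD hs hs0]
  · have hr : ∀ u : S.V, S.rho (S.rep u) = u := Function.surjInv_eq S.rho_surjective
    have h1 : S.bd (S.gam2 s) (S.rep w) = S.bd (S.gam2 s) (S.sec w) := by
      have := bd_gam2_eq_zero hD hs hs0 (x := S.rep w - S.sec w)
        (by rw [map_sub, hr, rho_sec, sub_self])
      rwa [map_sub, sub_eq_zero] at this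
    rw [zero2, lamW, ← bd_apply, h1, SDer.eq_sec (J := LinearMap.id) hT _ (S.rep v), hr]
    · rfl
    · intro m hm
      rw [S.bd_gen_even _ hse, ← brV_apply, brV_gam2_nn hD hs hs0 (S.mm_le_nn hm)]
      simp

end

/-- The gauge derivation attached to `m ∈ 𝔫` and `F ∈ 𝒱`. -/
def gaugeDer (S : Setup g) (k : ℂ) (m : g) (F : S.V) : S.V →ₗ[ℂ] S.V :=
  S.subF F ∘ₗ S.brV (S.gam1 k) m

lemma evDer_gaugeDer (k : ℂ) {j l : ZMod 2} {m : g} {F : S.V} (hm : S.par m = sg j • m)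
    (hF : S.sgn true F = sg l • F) : S.EvDer (l + j) (S.gaugeDer k m F) :=
  SDer.subF ((S.isEvenGen_gam1 k).sder_brV hm) (fun _ => rfl) hF

lemma gaugeDer_eq_zero (k : ℂ) {m : g} (hm : m ∈ S.nn) (F : S.V) {v : S.V} (hv : v ∈ S.W k) :
    S.gaugeDer k m F v = 0 := by
  rw [gaugeDer, LinearMap.comp_apply, (mem_W_iff k v).1 hv m hm, map_zero]

lemma gaugeDer_gen (k : ℂ) {j : ZMod 2} {m : g} (F : S.V) (hm : S.par m = sg j • m) (b : g) :
    S.gaugeDer k m F (S.gen true 0 b) =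
      F * S.gen true 0 (S.br m (S.prp b)) + (k * S.B m (S.prp b)) • S.der true F := by
  rw [gaugeDer, LinearMap.comp_apply, (S.isEvenGen_gam1 k).brV_gen hm, rhoX_gam1, subF_linear]

lemma brV_gam1_gen (k : ℂ) {j : ZMod 2} {n : g} (hn : S.par n = sg j • n) (a : g) :
    S.brV (S.gam1 k) n (S.gen true 0 a) = Polynomial.C (S.gen true 0 (S.br n (S.prp a))) +
      (k * S.B n (S.prp a)) • Polynomial.X := by
  rw [(S.isEvenGen_gam1 k).brV_gen hn, rhoX_gam1]

/-- For `n ∈ 𝔫` the `𝔪`-part of `a` contributes nothing, so the projection to `𝔭` disappears from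
the formula. -/
lemma brV_gam1_nn_gen (k : ℂ) {j : ZMod 2} {n : g} (hj : S.par n = sg j • n) (hn : n ∈ S.nn)
    (a : g) : S.brV (S.gam1 k) n (S.gen true 0 a) =
      Polynomial.C (S.gen true 0 (S.br n a)) + (k * S.B n a) • Polynomial.X := by
  have := rhoX_gam1_nn k hn (S.sub_prp_mem a)
  rw [map_sub, map_sub, sub_eq_zero, rhoX_gam1, rhoX_gam1] at this
  rw [brV_gam1_gen k hj, this]

end Setup
end WSuper

namespace WSuper
namespace Setup

variable {g : Type*} [AddCommGroup g] [Module ℂ g] {S : Setup g}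

/-! ### The sign twist and the universal element -/

section Sigma

variable {B : Type*} [Ring B] [Algebra ℂ B] {ε : B →ₗ[ℂ] B}

lemma ev_par (a : g) : S.ev (S.par a) = S.ev a := by
  simp [ev, S.par_par, add_comm]

lemma od_par (a : g) : S.od (S.par a) = -S.od a := by
  simp [od, S.par_par, ← smul_neg]

lemma ev_ev (a : g) : S.ev (S.ev a) = S.ev a := S.ev_of_even (S.par_ev a)

lemma od_ev (a : g) : S.od (S.ev a) = 0 := S.od_of_even (S.par_ev a)

lemma ev_od (a : g) : S.ev (S.od a) = 0 := S.ev_of_odd (S.par_od a)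

lemma od_od (a : g) : S.od (S.od a) = S.od a := S.od_of_odd (S.par_od a)

/-- The sign twist `(a ⊗ x)^σ = (-1)^{p(a)p(x)} a ⊗ x`. -/
def sigT (S : Setup g) (ε : B →ₗ[ℂ] B) : g ⊗[ℂ] B →ₗ[ℂ] g ⊗[ℂ] B :=
  TensorProduct.map S.ev LinearMap.id + TensorProduct.map S.od ε

lemma sigT_tmul (a : g) (x : B) : S.sigT ε (a ⊗ₜ x) = S.ev a ⊗ₜ x + S.od a ⊗ₜ ε x := rfl

lemma sigT_sigT (hε : IsSuperComm ε) (x : g ⊗[ℂ] B) : S.sigT ε (S.sigT ε x) = x := by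
  induction x using TensorProduct.induction_on with
  | zero => simp
  | tmul a x =>
    simp only [sigT_tmul, map_add, ev_ev, od_ev, ev_od, od_od, TensorProduct.zero_tmul, hε.sq,
      add_zero, zero_add, ← TensorProduct.add_tmul, ev_add_od]
  | add x y hx hy => rw [map_add, map_add, hx, hy]

lemma sigT_parT (x : g ⊗[ℂ] B) :
    S.sigT ε (S.parT ε x) = S.parT ε (S.sigT ε x) := by
  induction x using TensorProduct.induction_on with
  | zero => simp
  | tmul a x =>
    have h : ∀ (a : g) (x : B), S.parT ε (a ⊗ₜ x) = S.par a ⊗ₜ ε x := fun _ _ => rfl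
    simp only [sigT_tmul, h, map_add, ev_par, od_par, par_ev, par_od]
  | add x y hx hy => simp only [map_add, hx, hy]

lemma sigT_brT_even {c : g} (hc : S.par c = c) {u : B} (hu : ε u = u)
    (hmul : ∀ x y, ε (x * y) = ε x * ε y) (x : g ⊗[ℂ] B) :
    S.sigT ε (S.brT ε (c ⊗ₜ u) x) = S.brT ε (c ⊗ₜ u) (S.sigT ε x) := by
  have h1 : ∀ a, S.ev (S.br c a) = S.br c (S.ev a) := fun a => by
    simp [ev, S.par_br, hc]
  have h2 : ∀ a, S.od (S.br c a) = S.br c (S.od a) := fun a => by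
    simp [od, S.par_br, hc]
  induction x using TensorProduct.induction_on with
  | zero => simp
  | tmul a x => simp only [S.brT_even_left ε _ _ hu, sigT_tmul, map_add, h1, h2, hmul, hu]
  | add x y hx hy => simp only [map_add, hx, hy]

lemma B_ev_od (a b : g) : S.B (S.ev a) (S.od b) = 0 := by
  have := S.B_even (S.ev a) (S.od b)
  rw [par_ev, par_od, map_neg] at this
  exact self_eq_neg.1 this.symm

lemma B_od_ev (a b : g) : S.B (S.od a) (S.ev b) = 0 := by
  have := S.B_even (S.od a) (S.ev b)
  rw [par_ev, par_od, map_neg, LinearMap.neg_apply] at this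
  exact self_eq_neg.1 this.symm

/-- The twist cancels the sign in the definition of the form; this is why `σ` enters the dressing
equation. -/
lemma formT_sigT (hε : ∀ x, ε (ε x) = x) (x : g) (F : B) (a : g) :
    S.formT ε (S.sigT ε (x ⊗ₜ F)) (a ⊗ₜ 1) = S.B x a • F := by
  have h : S.B x a = S.B (S.ev x) (S.ev a) + S.B (S.od x) (S.od a) := by
    conv_lhs => rw [← S.ev_add_od x, ← S.ev_add_od a]
    simp only [map_add, LinearMap.add_apply, B_ev_od, B_od_ev]
    ring
  simp only [sigT_tmul, map_add, LinearMap.add_apply, formT_tmul, B_ev_od, B_od_ev, hε, mul_one,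
    zero_smul, zero_add, add_zero]
  rw [h, add_smul]

lemma formT_parT (hε : IsSuperComm ε) (x y : g ⊗[ℂ] B) :
    S.formT ε (S.parT ε x) (S.parT ε y) = ε (S.formT ε x y) := by
  induction x using S.tensor_induction hε.sq with
  | add x x' hx hx' => simp only [map_add, LinearMap.add_apply, hx, hx']
  | tmul i j a x ha hx =>
    induction y using S.tensor_induction hε.sq with
    | add y y' hy hy' => simp only [map_add, hy, hy']
    | tmul l m b y hb hy =>
      have h := S.B_even a b
      rw [ha, hb, map_smul, map_smul, LinearMap.smul_apply, smul_eq_mul, smul_eq_mul] at h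
      rw [S.parT_tmul ha hx, S.parT_tmul hb hy, map_smul, map_smul, LinearMap.smul_apply,
        S.formT_homog ε y hx hb, map_smul, map_smul, hε.map_mul, hx, hy]
      conv_rhs => rw [← h]
      simp only [smul_smul, smul_mul_smul_comm]
      congr 1
      ring

end Sigma

/-! ### Nondegeneracy of the pairing with `g`. -/

section Ext

variable [FiniteDimensional ℂ g] {B : Type*} [Ring B] [Algebra ℂ B] {ε : B →ₗ[ℂ] B}

lemma formT_apply_one (x : g ⊗[ℂ] B) (a : g) :
    S.formT ε x (a ⊗ₜ 1) = ∑ i, S.B (S.hb i) (S.ev a) • S.crd i x +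
      ∑ i, S.B (S.hb i) (S.od a) • ε (S.crd i x) := by
  conv_lhs => rw [← S.sum_crd x]
  simp only [map_sum, LinearMap.sum_apply, formT_tmul, mul_one, Finset.sum_add_distrib]

/-- An element of `g ⊗ B` is determined by its pairings with the elements of `g`. -/
lemma formT_ext (hε : IsSuperComm ε) {x y : g ⊗[ℂ] B}
    (h : ∀ a, S.formT ε x (a ⊗ₜ 1) = S.formT ε y (a ⊗ₜ 1)) : x = y := by
  suffices key : ∀ x : g ⊗[ℂ] B, (∀ a, S.formT ε x (a ⊗ₜ 1) = 0) → x = 0 by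
    rw [← sub_eq_zero]
    refine key _ fun a => ?_
    rw [map_sub, LinearMap.sub_apply, h, sub_self]
  intro x h
  have key : ∀ x : g ⊗[ℂ] B, (∀ a, ∑ i, S.B (S.hb i) a • S.crd i x = 0) → x = 0 := by
    intro x hx
    let β : g →ₗ[ℂ] Module.Dual ℂ g := S.B.flip
    -- Nondegeneracy is given in the left argument; supersymmetry, applied to even and odd
    -- components separately, transfers it to the right one.
    have hβi : Function.Injective β := by
      rw [injective_iff_map_eq_zero]
      intro a ha
      refine S.B_nondeg a fun b => ?_
      have h1 : ∀ c, S.B c a = 0 := fun c => LinearMap.congr_fun ha c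
      have h2 : ∀ b, S.par b = b → S.B a b = 0 := fun b hb => by rw [S.symm_even hb, h1]
      rw [← S.ev_add_od b, map_add, h2 _ (S.par_ev b), zero_add, ← S.ev_add_od a, map_add,
        LinearMap.add_apply, B_ev_od, zero_add,
        S.B_symm 1 1 _ _ (S.par_od' a) (S.par_od' b)]
      have h3 := h1 (S.od b)
      rw [← S.ev_add_od a, map_add, B_od_ev, zero_add] at h3
      rw [h3, mul_zero]
    have hβ : Function.Surjective β :=
      (LinearMap.injective_iff_surjective_of_finrank_eq_finrank
        (Subspace.dual_finrank_eq (K := ℂ) (V := g)).symm).1 hβi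
    refine S.crd_ext fun i => ?_
    obtain ⟨a, ha⟩ := hβ (S.hb.coord i)
    have h1 := hx a
    have h2 : ∀ l, S.B (S.hb l) a = if l = i then 1 else 0 := fun l => by
      have : S.B (S.hb l) a = S.hb.coord i (S.hb l) := LinearMap.congr_fun ha (S.hb l)
      rw [this, Module.Basis.coord_apply, Module.Basis.repr_self, Finsupp.single_apply]
    simpa [h2] using h1
  have h1 : ∀ a, ∑ i, S.B (S.hb i) (S.ev a) • S.crd i x = 0 := fun a => by
    have := h (S.ev a)
    rw [formT_apply_one, ev_ev, od_ev] at this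
    simpa using this
  have h2 : ∀ a, ∑ i, S.B (S.hb i) (S.od a) • S.crd i x = 0 := fun a => by
    have := h (S.od a)
    rw [formT_apply_one, od_od, ev_od] at this
    have h3 : ε (∑ i, S.B (S.hb i) (S.od a) • S.crd i x) = 0 := by simpa using this
    rw [← hε.sq (∑ i, _), h3, map_zero]
  refine key x fun a => ?_
  rw [← S.ev_add_od a]
  simp only [map_add, add_smul, Finset.sum_add_distrib, h1, h2, add_zero]

end Ext

section Universal

variable [FiniteDimensional ℂ g] {ι : Type*} [Fintype ι] [DecidableEq ι]
  (qlo : Module.Basis ι ℂ S.mperp) (qup : Module.Basis ι ℂ S.pp)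
  (hdual : ∀ i j, S.B (qlo i) (qup j) = if i = j then 1 else 0)

lemma B_mperp_mm {a b : g} (ha : a ∈ S.mperp) (hb : b ∈ S.mm) : S.B a b = 0 := by
  have h : S.mperp ≤ LinearMap.ker (S.B.flip b) := iSup₂_le fun j hj a ha => by
    rw [LinearMap.mem_ker, LinearMap.flip_apply]
    induction hb using S.mm_induction with
    | zero => simp
    | add b c _ _ hb hc => rw [map_add, hb, hc, add_zero]
    | gr l hl b hb => exact S.B_gr (by omega) ha hb
  exact h ha

lemma prp_mem (a : g) : S.prp a ∈ S.pp := by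
  induction a using S.gr_induction with
  | add a b ha hb => rw [map_add]; exact add_mem ha hb
  | gr j a ha =>
    rw [S.prp_gr ha]
    split_ifs with h
    · exact S.gr_le_pp h ha
    · exact zero_mem _

include hdual in
lemma sum_dual (a : g) : ∑ i, S.B (qlo i) a • (qup i : g) = S.prp a := by
  have h1 : ∀ i, S.B (qlo i) a = S.B (qlo i) (S.prp a) := fun i => by
    have := B_mperp_mm (qlo i).2 (S.sub_prp_mem a)
    rwa [map_sub, sub_eq_zero] at this
  obtain ⟨c, hc⟩ : ∃ c : ι → ℂ, S.prp a = ∑ j, c j • (qup j : g) := by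
    refine ⟨fun j => qup.repr ⟨_, S.prp_mem a⟩ j, ?_⟩
    have := congrArg Subtype.val (qup.sum_repr ⟨_, S.prp_mem a⟩)
    rw [AddSubmonoidClass.coe_finset_sum] at this
    exact this.symm
  have h3 : ∀ i, S.B (qlo i) a = c i := fun i => by
    rw [h1, hc, map_sum]
    simp [hdual]
  rw [hc]
  exact Finset.sum_congr rfl fun i _ => by rw [h3 i]

/-- The parity involution of `𝒱((z⁻¹))`. -/
abbrev eA (S : Setup g) : S.A →ₗ[ℂ] S.A := cwH (S.sgn true).toLinearMap

lemma isSuperComm_eA : IsSuperComm S.eA := (S.isSuperComm_sgn true).hahn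

lemma sigma_eq : S.sigma = S.sigT S.eA := rfl

/-- The element `q_univ^σ - f`. -/
def univ (qlo : Module.Basis ι ℂ S.mperp) (qup : Module.Basis ι ℂ S.pp) : S.G :=
  S.sigma (S.quniv qlo qup) - S.f ⊗ₜ 1

-- The dual bases reproduce the projection to `𝔭`, and `-f` supplies exactly the constant `-(f|a)`
-- which the class of `a` picks up in `𝒱`.
include hdual in
lemma formT_univ (a : g) : S.formT S.eA (univ qlo qup) (a ⊗ₜ 1) =
    HahnSeries.C (S.gen true 0 a) := by
  have h1 : S.formT S.eA (S.sigma (S.quniv qlo qup)) (a ⊗ₜ 1) =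
      HahnSeries.C (S.gen true 0 (S.prp a)) := by
    rw [quniv, map_sum, map_sum, LinearMap.sum_apply]
    simp only [sigma_eq, formT_sigT isSuperComm_eA.sq]
    rw [← sum_dual qlo qup hdual a, map_sum, map_sum]
    refine Finset.sum_congr rfl fun i _ => ?_
    rw [map_smul]
    ext m
    simp only [HahnSeries.coeff_smul, HahnSeries.C_apply, HahnSeries.coeff_single]
    split_ifs <;> simp
  rw [univ, map_sub, LinearMap.sub_apply, h1, S.formT_even_left _ _ _ isSuperComm_eA.map_one,
    ← S.gen_true_prp_zero a, map_sub, mul_one]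
  congr 1
  ext m
  simp only [HahnSeries.coeff_smul, HahnSeries.C_apply, HahnSeries.coeff_single,
    HahnSeries.coeff_one, Algebra.algebraMap_eq_smul_one]
  split_ifs <;> simp

-- The pairings with `g` are unchanged by parity, since parity of `𝒱` maps the class of `a` to that
-- of `par a`; `formT_ext` concludes.
include hdual in
lemma parT_univ : S.parT S.eA (univ qlo qup) = univ qlo qup := by
  refine formT_ext (S := S) (isSuperComm_eA (S := S)) fun a => ?_
  have h : ∀ (a : g), (a ⊗ₜ[ℂ] (1 : S.A)) = S.parT S.eA (S.par a ⊗ₜ 1) := fun a => by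
    have : S.parT S.eA (S.par a ⊗ₜ 1) = S.par (S.par a) ⊗ₜ S.eA 1 := rfl
    rw [this, S.par_par, isSuperComm_eA.map_one]
  conv_lhs => rw [h a]
  rw [formT_parT isSuperComm_eA, formT_univ qlo qup hdual, formT_univ qlo qup hdual]
  ext m
  simp only [coeff_cwH, HahnSeries.C_apply, HahnSeries.coeff_single]
  split_ifs
  · simp [sgn_gen, S.par_par]
  · simp

lemma mperp_tmul_mem_fil {R : Type*} [Ring R] [Algebra ℂ R] {D : ℤ} (hD : 0 < D + 2) {a : g}
    (ha : a ∈ S.mperp) (x : R) : a ⊗ₜ HahnSeries.C x ∈ S.fil R D (-1) := by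
  have h : S.mperp ≤ (S.fil R D (-1)).comap ((TensorProduct.mk ℂ g (HahnSeries ℤ R)).flip
      (HahnSeries.C x)) := iSup₂_le fun j hj a ha => by
    refine S.tmul_mem_fil ha fun m hm => ?_
    have : m < 0 := by
      by_contra hm'
      have : 0 ≤ m * (D + 2) := mul_nonneg (by omega) (by omega)
      omega
    rw [HahnSeries.C_apply, HahnSeries.coeff_single_of_ne (by omega)]
  exact h ha

lemma sigT_mem_fil {D c : ℤ} {x : S.G} (hx : x ∈ S.fil S.V D c) :
    S.sigT S.eA x ∈ S.fil S.V D c := by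
  refine S.fil_induction (T := S.sigT S.eA) (fun j a X ha hX => ?_) hx
  rw [sigT_tmul]
  refine add_mem (S.tmul_mem_fil (S.ev_mem_gr ha) hX) (S.tmul_mem_fil (S.od_mem_gr ha) fun m hm => ?_)
  rw [coeff_cwH, hX m hm, map_zero]

end Universal

end Setup
end WSuper

namespace WSuper
namespace Setup

variable {g : Type*} [AddCommGroup g] [Module ℂ g] [FiniteDimensional ℂ g] {S : Setup g}

/-! ### Existence and uniqueness of the dressing -/

lemma exists_isLoop {D : ℤ} (hD : ∀ j : ℤ, D < j → S.gr j = ⊥) {s : g} (hs0 : S.par s = s)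
    (hs : s ∈ S.gr D) (hΛ : (S.adLam s).IsSemisimple) :
    ∃ ψ, IsLoop (S.fil S.V D) S.brG S.derG (S.Lam s 0) ψ := by
  have h2 := S.two_le_of_gr_eq_bot hD
  have hε := S.isSuperComm_sgn true
  obtain ⟨ψ, h3, h4, h5⟩ := S.exists_pseudo_inverse hε (by omega) hs hΛ
  rw [← Lam_eq] at h4 h5
  refine ⟨ψ, ?_⟩
  rw [brG_eq, derG_eq]
  exact {
    cf := S.fil_complete (by omega)
    br_mem := fun i j x y hx hy => S.brT_mem_fil _ hx hy
    del_mem := fun i x hx => S.mapT_mem_fil _ _ hx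
    mem := by
      have := S.lamT_mem_fil (R := S.V) hs 0
      rw [Lam_eq]
      simpa using this
    skew := fun x => S.brT_skew hε.hahn (by rw [Lam_eq]; exact S.parT_lamT hε hs0 0) x
    raises := h3
    comm := fun x => h5 _ (fun n x => ((S.zmul_brT hε n _ _).2).symm) (fun _ => rfl) x
    inv := h4 }

lemma sigma_brG_Lam {s : g} (hs0 : S.par s = s) (n : ℤ) (x : S.G) :
    S.sigma (S.brG (S.Lam s n) x) = S.brG (S.Lam s n) (S.sigma x) := by
  have hz : ∀ n, S.eA (S.zpow n) = S.zpow n := fun n => by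
    rw [zpow, cwH_single]; simp
  rw [brG_eq, sigma_eq, Lam]
  simp only [map_add, LinearMap.add_apply]
  rw [sigT_brT_even S.f_even (hz _) isSuperComm_eA.map_mul,
    sigT_brT_even hs0 (hz _) isSuperComm_eA.map_mul]

lemma sigma_sigma (x : S.G) : S.sigma (S.sigma x) = x := by
  rw [sigma_eq, sigT_sigT isSuperComm_eA]

lemma sgnG_sigma (x : S.G) : S.sgnG (S.sigma x) = S.sigma (S.sgnG x) := by
  rw [sigma_eq, sgnG_eq, sigT_parT]

/-- The conjugation of `k∂ + Q - z s` into the kernel of `ad Λ`. -/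
structure IsConj (S : Setup g) (k : ℂ) (D : ℤ) (s : g) (Q T h : S.G) : Prop where
  gr_eq_bot : ∀ j : ℤ, D < j → S.gr j = ⊥
  s_mem : s ∈ S.gr D
  s_even : S.par s = s
  semisimple : (S.adLam s).IsSemisimple
  Q_even : S.parT S.eA Q = Q
  Q_form : ∀ a, S.formT S.eA Q (a ⊗ₜ 1) = HahnSeries.C (S.gen true 0 a)
  T_even : S.parT S.eA T = T
  T_mem : T ∈ S.fil S.V D 1
  h_even : S.parT S.eA h = h
  h_mem : h ∈ S.fil S.V D (-1)
  h_ker : S.brT S.eA (S.lamT S.V s 0) h = 0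
  conj : fexp (pairFil (S.fil S.V D)) (pairOp (S.brT S.eA T) (S.mapT 0 (cwH (S.der true)) T))
    (k, Q - s ⊗ₜ HahnSeries.single (-1) 1) = (k, h - S.lamT S.V s 0)

section

variable {k : ℂ} {D : ℤ} (hD : ∀ j : ℤ, D < j → S.gr j = ⊥) {s : g} (hs0 : S.par s = s)
  (hs : s ∈ S.gr D) (hΛ : (S.adLam s).IsSemisimple)

include hD in
lemma isDressing_iff (q T h : S.G) : S.IsDressing k D s q T h ↔
    S.sgnG T = T ∧ T ∈ S.fil S.V D 1 ∧ T ∈ LinearMap.range (S.brG (S.Lam s 0)) ∧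
    S.sgnG h = h ∧ h ∈ S.fil S.V D (-1) ∧ S.brG (S.Lam s 0) h = 0 ∧
    fexp (pairFil (S.fil S.V D)) (pairOp (S.brG (S.sigma T)) (S.derG (S.sigma T)))
      (k, S.sigma q - S.Lam s 0) = (k, S.sigma h - S.Lam s 0) := by
  have h2 := S.two_le_of_gr_eq_bot hD
  constructor
  · intro H
    have hT := S.degGT_iff.1 H.T_deg
    refine ⟨H.T_even, hT, H.T_im, H.h_even, S.degGT_iff.1 H.h_deg, H.h_ker, ?_⟩
    exact (S.isExpAd_iff (by omega) (sigT_mem_fil hT) _ _).1 H.conj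
  · rintro ⟨h1, hT, h3, h4, h5, h6, h7⟩
    exact ⟨h1, S.degGT_iff.2 hT, h3, h4, S.degGT_iff.2 h5, h6,
      (S.isExpAd_iff (by omega) (sigT_mem_fil hT) _ _).2 h7⟩

include hD hs0 hs hΛ

/-- The abstract dressing says nothing about parity. The parity image of a solution solves the same
problem, so uniqueness makes it even. The involution `σ` commutes with `ad Λ` and translates between
`T, h` and their twists. -/
lemma existsUnique_dressing {q : S.G} (hq : q ∈ S.fil S.V D (-1)) (hq0 : S.sgnG q = q) :
    ∃! Th : S.G × S.G, S.IsDressing k D s q Th.1 Th.2 := by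
  have h2 := S.two_le_of_gr_eq_bot hD
  obtain ⟨ψ, hψ⟩ := exists_isLoop hD hs0 hs hΛ
  have hσ : ∀ {T : S.G}, T ∈ LinearMap.range (S.brG (S.Lam s 0)) →
      S.sigma T ∈ LinearMap.range (S.brG (S.Lam s 0)) := by
    rintro _ ⟨x, rfl⟩
    exact ⟨S.sigma x, (sigma_brG_Lam hs0 0 x).symm⟩
  have hq' : S.sigma q ∈ S.fil S.V D (-1) := sigT_mem_fil hq
  have hε := isSuperComm_eA (S := S)
  obtain ⟨X, h, hX, hXr, hh, hker, hc⟩ := hψ.exists_dressing k hq'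
  have hΛ0 : S.sgnG (S.Lam s 0) = S.Lam s 0 := by
    rw [sgnG_eq, Lam_eq]; exact S.parT_lamT (S.isSuperComm_sgn true) hs0 0
  have hbr : ∀ x y, S.sgnG (S.brG x y) = S.brG (S.sgnG x) (S.sgnG y) := fun x y => by
    rw [sgnG_eq, brG_eq]; exact S.parT_brT hε x y
  have hpar : ∀ {c : ℤ} {x : S.G}, x ∈ S.fil S.V D c → S.sgnG x ∈ S.fil S.V D c := fun hx => by
    rw [sgnG_eq]; exact S.parT_mem_fil _ hx
  have hder : ∀ x, S.sgnG (S.derG x) = S.derG (S.sgnG x) := by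
    intro x
    rw [sgnG_eq, derG_eq]
    induction x using TensorProduct.induction_on with
    | zero => simp
    | tmul a X =>
      have h1 : ∀ (a : g) (x : S.A), S.parT S.eA (a ⊗ₜ x) = S.par a ⊗ₜ S.eA x := fun _ _ => rfl
      simp only [mapT_zero, LinearMap.lTensor_tmul, h1]
      congr 1
      ext m
      simp [sgn_der]
    | add x y hx hy => simp only [map_add, hx, hy]
  have hc' : fexp (pairFil (S.fil S.V D)) (pairOp (S.brG (S.sgnG X)) (S.derG (S.sgnG X)))
      (k, S.sigma q - S.Lam s 0) = (k, S.sgnG h - S.Lam s 0) := by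
    have hcf := S.fil_complete (R := S.V) (D := D) (by omega)
    have hdm : ∀ {Y : S.G}, Y ∈ S.fil S.V D 1 → S.derG Y ∈ S.fil S.V D 1 := fun hY =>
      hψ.del_mem _ _ hY
    have := map_fexp (T := LinearMap.prodMap LinearMap.id S.sgnG) (d := 0) hcf.pair hcf.pair
      (raises_pairOp hcf (S.raises_brG (by omega) hX) (hdm hX))
      (raises_pairOp hcf (S.raises_brG (by omega) (hpar hX)) (hdm (hpar hX)))
      (fun c p hp => ⟨by simpa using hpar hp.1, fun h => hp.2 (by omega)⟩)
      (fun p => by simp [hbr, hder]) (k, S.sigma q - S.Lam s 0)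
    rw [hc] at this
    simp only [LinearMap.prodMap_apply, LinearMap.id_apply, map_sub, hΛ0, sgnG_sigma, hq0] at this
    exact this.symm
  have hXr' : ∃ x, S.brG (S.Lam s 0) x = S.sgnG X := by
    obtain ⟨x, hx⟩ := hXr
    exact ⟨S.sgnG x, by rw [← hx, hbr, hΛ0]⟩
  have hker' : S.brG (S.Lam s 0) (S.sgnG h) = 0 := by
    rw [← hΛ0, ← hbr, hker, map_zero]
  obtain ⟨e1, e2⟩ := hψ.dressing_unique k hq' hX hXr hker hc (hpar hX) hXr' hker' hc'
  refine ⟨(S.sigma X, S.sigma h), (isDressing_iff hD _ _ _).2 ⟨?_, sigT_mem_fil hX, hσ hXr, ?_,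
    sigT_mem_fil hh, ?_, ?_⟩, ?_⟩
  · rw [sgnG_sigma, ← e1]
  · rw [sgnG_sigma, ← e2]
  · rw [← sigma_brG_Lam hs0, hker, map_zero]
  · rw [sigma_sigma, sigma_sigma, hc]
  · rintro ⟨T, h'⟩ H
    obtain ⟨_, H2, H3, _, H5, H6, H7⟩ := (isDressing_iff hD _ _ _).1 H
    obtain ⟨e3, e4⟩ := hψ.dressing_unique k hq' hX hXr hker hc (sigT_mem_fil H2) (hσ H3)
      (by rw [← sigma_brG_Lam hs0, H6, map_zero]) H7
    rw [e3, ← sigma_eq, e4, sigma_sigma, sigma_sigma]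

lemma IsDressing.isConj {ι : Type*} [Fintype ι] [DecidableEq ι]
    (qlo : Module.Basis ι ℂ S.mperp) (qup : Module.Basis ι ℂ S.pp)
    (hdual : ∀ i j, S.B (qlo i) (qup j) = if i = j then 1 else 0) {T h : S.G}
    (H : S.IsDressing k D s (S.quniv qlo qup) T h) :
    S.IsConj k D s (univ qlo qup) (S.sigma T) (S.sigma h) := by
  obtain ⟨H1, H2, _, H4, H5, H6, H7⟩ := (isDressing_iff hD _ _ _).1 H
  refine ⟨hD, hs, hs0, hΛ, parT_univ qlo qup hdual, formT_univ qlo qup hdual, ?_, sigT_mem_fil H2, ?_,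
    sigT_mem_fil H5, ?_, ?_⟩
  · rw [← sgnG_eq, sgnG_sigma, H1]
  · rw [← sgnG_eq, sgnG_sigma, H4]
  · rw [← brG_eq, ← Lam_eq, ← sigma_brG_Lam hs0, H6, map_zero]
  · rw [← brG_eq, ← derG_eq, ← Lam_eq, ← H7]
    congr 2
    rw [univ, Lam, zpow, zpow, sub_sub]
    rfl

end

lemma sgnG_quniv {ι : Type*} [Fintype ι] [DecidableEq ι]
    (qlo : Module.Basis ι ℂ S.mperp) (qup : Module.Basis ι ℂ S.pp)
    (hdual : ∀ i j, S.B (qlo i) (qup j) = if i = j then 1 else 0) :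
    S.sgnG (S.quniv qlo qup) = S.quniv qlo qup := by
  have h1 : S.parT S.eA (S.f ⊗ₜ 1) = S.f ⊗ₜ 1 := by
    have : S.parT S.eA (S.f ⊗ₜ 1) = S.par S.f ⊗ₜ S.eA 1 := rfl
    rw [this, S.f_even, isSuperComm_eA.map_one]
  have h2 := parT_univ qlo qup hdual
  rw [univ, map_sub, h1, sub_left_inj, ← sgnG_eq, sgnG_sigma] at h2
  rw [← sigma_sigma (S.sgnG _), h2, sigma_sigma]

lemma quniv_mem_fil {D : ℤ} (hD : 0 < D + 2) {ι : Type*} [Fintype ι] [DecidableEq ι]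
    (qlo : Module.Basis ι ℂ S.mperp) (qup : Module.Basis ι ℂ S.pp) :
    S.quniv qlo qup ∈ S.fil S.V D (-1) :=
  sum_mem fun i _ => mperp_tmul_mem_fil hD (qlo i).2 _

end Setup
end WSuper

namespace WSuper
namespace Setup

variable {g : Type*} [AddCommGroup g] [Module ℂ g] {S : Setup g}

/-! ### Variation of the densities -/

lemma eq_zero_of_eq_neg {M : Type*} [AddCommGroup M] [Module ℂ M] {x : M} (h : x = -x) : x = 0 := by
  have h2 : (2 : ℂ) • x = 0 := by
    rw [two_smul]
    nth_rewrite 2 [h]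
    exact add_neg_cancel x
  simpa using h2

section General

variable {B B' : Type*} [Ring B] [Algebra ℂ B] [Ring B'] [Algebra ℂ B'] {ε : B →ₗ[ℂ] B}
  {ε' : B' →ₗ[ℂ] B'} {K : B →ₗ[ℂ] B'}

lemma mapT_zero_tmul (K : B →ₗ[ℂ] B') (a : g) (x : B) :
    S.mapT 0 K (a ⊗ₜ x) = a ⊗ₜ K x := by
  rw [mapT_zero, LinearMap.lTensor_tmul]

lemma mapT_zero_brT (hK : ∀ x y, K (x * y) = K x * K y) (hε : ∀ x, ε' (K x) = K (ε x))
    (x y : g ⊗[ℂ] B) :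
    S.mapT 0 K (S.brT ε x y) = S.brT ε' (S.mapT 0 K x) (S.mapT 0 K y) := by
  induction x using TensorProduct.induction_on with
  | zero => simp
  | add x x' hx hx' => simp only [map_add, LinearMap.add_apply, hx, hx']
  | tmul a x =>
    induction y using TensorProduct.induction_on with
    | zero => simp
    | add y y' hy hy' => simp only [map_add, hy, hy']
    | tmul b y => simp only [brT_tmul, mapT_zero_tmul, map_add, hK, hε]

lemma parT_mapT_zero (hε : ∀ x, ε' (K x) = K (ε x)) (x : g ⊗[ℂ] B) :
    S.parT ε' (S.mapT 0 K x) = S.mapT 0 K (S.parT ε x) := by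
  induction x using TensorProduct.induction_on with
  | zero => simp
  | add x x' hx hx' => simp only [map_add, hx, hx']
  | tmul a x =>
    have h : ∀ (a : g) (x : B), S.parT ε (a ⊗ₜ x) = S.par a ⊗ₜ ε x := fun _ _ => rfl
    have h' : ∀ (a : g) (x : B'), S.parT ε' (a ⊗ₜ x) = S.par a ⊗ₜ ε' x := fun _ _ => rfl
    rw [mapT_zero_tmul, h, h', mapT_zero_tmul, hε]

lemma formT_tmul_right (x : g ⊗[ℂ] B) (a : g) (y : B) :
    S.formT ε x (a ⊗ₜ y) = S.formT ε x (a ⊗ₜ 1) * y := by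
  induction x using TensorProduct.induction_on with
  | zero => simp
  | add x x' hx hx' => simp only [map_add, LinearMap.add_apply, hx, hx', add_mul]
  | tmul b x => simp only [formT_tmul, mul_one, add_mul, smul_mul_assoc]

lemma formT_mapT_even {c : g} (hc : S.par c = c) (K : B →ₗ[ℂ] B') (r : ℤ)
    (x : g ⊗[ℂ] HahnSeries ℤ B) :
    (S.formT (cwH ε') (S.mapT 0 (cwH K) x) (c ⊗ₜ HahnSeries.single r 1)).coeff 0 =
      K ((S.formT (cwH ε) x (c ⊗ₜ HahnSeries.single r 1)).coeff 0) := by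
  induction x using TensorProduct.induction_on with
  | zero => simp
  | add x x' hx hx' =>
    simp only [map_add, LinearMap.add_apply, HahnSeries.coeff_add, hx, hx']
  | tmul a x =>
    have h0 : (0 : ℤ) = -r + r := by ring
    simp only [mapT_zero_tmul, formT_tmul, S.ev_of_even hc, S.od_of_even hc, map_zero, zero_smul,
      add_zero, HahnSeries.coeff_smul]
    rw [h0, HahnSeries.coeff_mul_single_add, HahnSeries.coeff_mul_single_add, mul_one, mul_one,
      coeff_cwH, map_smul]

end General

/-- The target `B` of the derivations of `𝒱` along `J`, where `δ` extends `∂`. -/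
structure IsBase (S : Setup g) {B : Type*} [Ring B] [Algebra ℂ B] (ε δ : B →ₗ[ℂ] B)
    (J : S.V →ₗ[ℂ] B) : Prop where
  comm : IsSuperComm ε
  J_one : J 1 = 1
  J_mul : ∀ x y, J (x * y) = J x * J y
  J_par : ∀ x, ε (J x) = J (S.sgn true x)
  δ_mul : ∀ x y, δ (J x * y) = J (S.der true x) * y + J x * δ y

lemma isBase_id : S.IsBase (S.sgn true).toLinearMap (S.der true) LinearMap.id where
  comm := S.isSuperComm_sgn true
  J_one := rfl
  J_mul _ _ := rfl
  J_par _ := rfl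
  δ_mul := S.der_mul true

lemma isBase_cl : S.IsBase S.sgnVX S.lamV (cl S.V) where
  comm := (S.isSuperComm_sgn true).polynomial
  J_one := by simp
  J_mul x y := by simp
  J_par x := cwX_C _ _
  δ_mul x y := S.lamV_C_mul y x

section Base

variable {B : Type*} [Ring B] [Algebra ℂ B] {ε δ : B →ₗ[ℂ] B} {J : S.V →ₗ[ℂ] B}

lemma IsBase.hahn_δ_mul (hB : S.IsBase ε δ J) (x : S.A) (y : HahnSeries ℤ B) :
    cwH δ (cwH J x * y) = cwH J (cwH (S.der true) x) * y + cwH J x * cwH δ y := by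
  obtain ⟨a, ha⟩ : ∃ a, ∀ m < a, x.coeff m = 0 :=
    ⟨x.order, fun m hm => coeff_eq_zero_of_lt_of_le_order le_rfl hm⟩
  obtain ⟨b, hb⟩ : ∃ b, ∀ m < b, y.coeff m = 0 :=
    ⟨y.order, fun m hm => coeff_eq_zero_of_lt_of_le_order le_rfl hm⟩
  ext n
  rw [coeff_cwH, HahnSeries.coeff_add,
    coeff_mul_eq_sum (a := a) (b := b) (fun m hm => by simp [ha m hm]) hb,
    coeff_mul_eq_sum (a := a) (b := b) (fun m hm => by simp [ha m hm]) hb,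
    coeff_mul_eq_sum (a := a) (b := b) (fun m hm => by simp [ha m hm])
      (fun m hm => by simp [hb m hm]), map_sum, ← Finset.sum_add_distrib]
  exact Finset.sum_congr rfl fun i _ => by simp [hB.δ_mul]

/-- The extension of scalars along `J`. -/
def jT (S : Setup g) {B : Type*} [Ring B] [Algebra ℂ B] (J : S.V →ₗ[ℂ] B) :
    S.G →ₗ[ℂ] g ⊗[ℂ] HahnSeries ℤ B := S.mapT 0 (cwH J)

lemma IsBase.jT_brT (hB : S.IsBase ε δ J) (x y : S.G) :
    S.jT J (S.brT S.eA x y) = S.brT (cwH ε) (S.jT J x) (S.jT J y) :=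
  mapT_zero_brT (cwH_mul hB.J_mul) (fun x => by ext m; simp [hB.J_par]) x y

lemma IsBase.parT_jT (hB : S.IsBase ε δ J) {x : S.G} (hx : S.parT S.eA x = x) :
    S.parT (cwH ε) (S.jT J x) = S.jT J x := by
  rw [jT, parT_mapT_zero (ε := S.eA) (fun x => by ext m; simp [hB.J_par]), hx]

lemma IsBase.jT_lamT (hB : S.IsBase ε δ J) (s : g) (n : ℤ) :
    S.jT J (S.lamT S.V s n) = S.lamT B s n := by
  simp only [lamT, jT, map_add, mapT_zero_tmul, cwH_single, hB.J_one]

lemma IsBase.delY_act (hB : S.IsBase ε δ J) (x : S.G) (y : g ⊗[ℂ] HahnSeries ℤ B) :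
    S.mapT 0 (cwH δ) (S.brT (cwH ε) (S.jT J x) y) =
      S.brT (cwH ε) (S.jT J (S.mapT 0 (cwH (S.der true)) x)) y +
        S.brT (cwH ε) (S.jT J x) (S.mapT 0 (cwH δ) y) := by
  have h1 : ∀ x : S.A, cwH ε (cwH J x) = cwH J (S.eA x) := fun x => by ext m; simp [hB.J_par]
  have h2 : ∀ x : S.A, S.eA (cwH (S.der true) x) = cwH (S.der true) (S.eA x) := fun x => by
    ext m; simp [sgn_der]
  induction x using TensorProduct.induction_on with
  | zero => simp
  | add x x' hx hx' => simp only [map_add, LinearMap.add_apply, hx, hx']; abel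
  | tmul a x =>
    induction y using TensorProduct.induction_on with
    | zero => simp
    | add y y' hy hy' => simp only [map_add, hy, hy']; abel
    | tmul b y =>
      simp only [jT, brT_tmul, mapT_zero_tmul, map_add, h1, h2, hB.hahn_δ_mul,
        TensorProduct.tmul_add]
      abel

/-- `a ⊗ F ↦ θ(a) J(F)` -/
def ctr (S : Setup g) {B : Type*} [Ring B] [Algebra ℂ B] (J : S.V →ₗ[ℂ] B) (θ : g →ₗ[ℂ] B) :
    g ⊗[ℂ] S.V →ₗ[ℂ] B :=
  TensorProduct.lift (((LinearMap.mul ℂ B).compl₂ J) ∘ₗ θ)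

@[simp] lemma ctr_tmul (J : S.V →ₗ[ℂ] B) (θ : g →ₗ[ℂ] B) (a : g) (F : S.V) :
    S.ctr J θ (a ⊗ₜ F) = θ a * J F := rfl

section Loop

variable [FiniteDimensional ℂ g] {k : ℂ} {D : ℤ} {s : g} {Q T h : S.G}

/-- The conjugate of `zⁿΛ`. -/
def conjLam (S : Setup g) (D : ℤ) (s : g) (T : S.G) (n : ℤ) : S.G :=
  fexp (S.fil S.V D) (-S.brT S.eA T) (S.lamT S.V s n)

namespace IsConj

variable (H : S.IsConj k D s Q T h)
include H

lemma two_le : 2 ≤ D := S.two_le_of_gr_eq_bot H.gr_eq_bot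

lemma isVariation (hB : S.IsBase ε δ J) {i : ZMod 2} {Δ : S.A →ₗ[ℂ] HahnSeries ℤ B}
    (hΔ : IsDer S.eA (cwH ε) i (cwH J) Δ)
    (hΔm : ∀ c x, x ∈ S.fil S.V D c → S.mapT i Δ x ∈ S.fil B D c)
    (hΔd : ∀ x, Δ (cwH (S.der true) x) = cwH δ (Δ x)) :
    IsVariation (S.fil S.V D) (S.fil B D) (S.brT S.eA) (S.mapT 0 (cwH (S.der true)))
      ((S.brT (cwH ε)) ∘ₗ S.jT J) ((S.brT (cwH ε)).compl₂ (S.jT J)) (S.mapT 0 (cwH δ))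
      (S.mapT i Δ) T where
  cf := S.fil_complete (by linarith [H.two_le])
  cfY := S.fil_complete (by linarith [H.two_le])
  br_mem _ _ _ _ hx hy := S.brT_mem_fil _ hx hy
  del_mem _ _ hx := S.mapT_mem_fil _ _ hx
  act_mem _ _ _ _ hx hy := S.brT_mem_fil _ (S.mapT_mem_fil _ _ hx) hy
  ract_mem _ _ _ _ hx hy := S.brT_mem_fil _ hx (S.mapT_mem_fil _ _ hy)
  delY_mem _ _ hx := S.mapT_mem_fil _ _ hx
  Δ_mem := hΔm
  mem := H.T_mem
  act_ract y x := by
    simp only [LinearMap.comp_apply, LinearMap.compl₂_apply]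
    rw [S.brT_jacobi hB.comm.hahn (hB.parT_jT H.T_even), hB.jT_brT]
  Δ_br x := S.mapT_brT isSuperComm_eA hΔ H.T_even x
  delY_act y := hB.delY_act T y
  Δ_del := by
    generalize T = x
    induction x using TensorProduct.induction_on with
    | zero => simp
    | add x x' hx hx' => simp only [map_add, hx, hx']
    | tmul a x => rw [mapT_zero_tmul, mapT, TensorProduct.map_tmul,
        TensorProduct.map_tmul, mapT_zero_tmul, hΔd]
  ract_del y := by
    simp only [LinearMap.comp_apply, LinearMap.compl₂_apply]
    refine S.brT_skew hB.comm.hahn (hB.parT_jT ?_) y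
    rw [parT_mapT_zero (ε := S.eA) (fun x => by ext m; simp [sgn_der]), H.T_even]

lemma parT_lam (n : ℤ) : S.parT S.eA (S.lamT S.V s n) = S.lamT S.V s n :=
  S.parT_lamT (S.isSuperComm_sgn true) H.s_even n

lemma brT_lam_lam (m n : ℤ) : S.brT S.eA (S.lamT S.V s m) (S.lamT S.V s n) = 0 := by
  have h0 : S.brT S.eA (S.lamT S.V s 0) (S.lamT S.V s 0) = 0 :=
    eq_zero_of_eq_neg (S.brT_skew isSuperComm_eA (H.parT_lam 0) _)
  have h1 : ∀ n, S.lamT S.V s n = S.zmul S.V n (S.lamT S.V s 0) := fun n => by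
    rw [zmul_lamT, add_zero]
  rw [h1 m, h1 n, ← (S.zmul_brT (S.isSuperComm_sgn true) m _ _).1,
    ← (S.zmul_brT (S.isSuperComm_sgn true) n _ _).2, h0, map_zero, map_zero]

lemma brT_lam_h (n : ℤ) : S.brT S.eA (S.lamT S.V s n) h = 0 := by
  have h1 : S.lamT S.V s n = S.zmul S.V n (S.lamT S.V s 0) := by
    rw [zmul_lamT, add_zero]
  rw [h1, ← (S.zmul_brT (S.isSuperComm_sgn true) n _ _).1, H.h_ker, map_zero]

lemma brT_conj_lam (n : ℤ) : S.brT S.eA (h - S.lamT S.V s 0) (S.lamT S.V s n) = 0 := by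
  rw [map_sub, LinearMap.sub_apply, H.brT_lam_lam, sub_zero,
    S.brT_skew isSuperComm_eA (H.parT_lam n), H.brT_lam_h, neg_zero]

/-- Applies because `z^n Λ` commutes with `h - Λ`. It is used for the bracket derivations into
`𝒱[λ]`, for evolutionary derivations of `𝒱`, and for `z d/dz`. -/
lemma variation_formula (hB : S.IsBase ε δ J) {i : ZMod 2} {Δ : S.A →ₗ[ℂ] HahnSeries ℤ B}
    (hΔ : IsDer S.eA (cwH ε) i (cwH J) Δ)
    (hΔm : ∀ c x, x ∈ S.fil S.V D c → S.mapT i Δ x ∈ S.fil B D c)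
    (hΔd : ∀ x, Δ (cwH (S.der true) x) = cwH δ (Δ x)) (n : ℤ) :
    ∃ w, (S.formT (cwH ε) (S.mapT i Δ (Q - s ⊗ₜ HahnSeries.single (-1) 1))
        (S.jT J (S.conjLam D s T n))).coeff 0 =
      (S.formT (cwH ε) (S.mapT i Δ (h - S.lamT S.V s 0)) (S.lamT B s n)).coeff 0 + k • δ w := by
  have hV := H.isVariation hB hΔ hΔm hΔd
  let κ : g ⊗[ℂ] HahnSeries ℤ B →ₗ[ℂ] S.G →ₗ[ℂ] B :=
    ((S.formT (cwH ε)).compl₂ (S.jT J)).compr₂ (HahnSeries.coeff.linearMap 0)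
  have hκ : ∀ x y, κ x y = (S.formT (cwH ε) x (S.jT J y)).coeff 0 := fun _ _ => rfl
  have key := hV.variation H.conj κ
    (fun i j y x hy hx hij => S.formT_coeff_zero (by linarith [H.two_le]) _ hy
      (S.mapT_mem_fil _ _ hx) hij)
    (fun y x => by
      rw [hκ, hκ, LinearMap.comp_apply, hB.jT_brT, ← S.formT_inv hB.comm.hahn,
        S.brT_skew hB.comm.hahn (hB.parT_jT H.T_even) y, map_neg, LinearMap.neg_apply,
        HahnSeries.coeff_neg, add_neg_cancel])
    (S.lamT S.V s n) (fun y => by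
      rw [hκ, LinearMap.compl₂_apply, S.formT_inv hB.comm.hahn, ← hB.jT_brT, H.brT_conj_lam,
        map_zero, map_zero, HahnSeries.coeff_zero])
  refine ⟨κ (IsVariation.Z (S.fil B D) ((S.brT (cwH ε)) ∘ₗ S.jT J) (S.mapT i Δ) T)
    (S.lamT S.V s n), ?_⟩
  rw [hκ, hκ, hκ, hB.jT_lamT] at key
  rw [conjLam, key, hκ, hB.jT_lamT]
  congr 2
  -- The coefficients of `z^n Λ` are constants, so pairing with it commutes with `δ`; the error term
  -- is a total derivative.
  rw [lamT]
  simp only [map_add, HahnSeries.coeff_add]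
  rw [formT_mapT_even (ε := ε) S.f_even, formT_mapT_even (ε := ε) H.s_even]

end IsConj

end Loop

end Base

end Setup
end WSuper

namespace WSuper
namespace Setup

variable {g : Type*} [AddCommGroup g] [Module ℂ g] {S : Setup g}

/-! ### Constant terms in `z`. -/

section Consts

variable {R R' : Type*} [Ring R] [Algebra ℂ R] [Ring R'] [Algebra ℂ R'] {ε : R →ₗ[ℂ] R}
  {ε' : R' →ₗ[ℂ] R'}

/-- The constant term. -/
def ct (S : Setup g) (R : Type*) [Ring R] [Algebra ℂ R] :
    g ⊗[ℂ] HahnSeries ℤ R →ₗ[ℂ] g ⊗[ℂ] R :=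
  LinearMap.lTensor g (HahnSeries.coeff.linearMap 0)

lemma ct_tmul (a : g) (x : HahnSeries ℤ R) : S.ct R (a ⊗ₜ x) = a ⊗ₜ x.coeff 0 := rfl

/-- The embedding of the constants. -/
def cst (S : Setup g) (R : Type*) [Ring R] [Algebra ℂ R] :
    g ⊗[ℂ] R →ₗ[ℂ] g ⊗[ℂ] HahnSeries ℤ R :=
  LinearMap.lTensor g
    { toFun := fun x => HahnSeries.single 0 x
      map_add' := fun x y => by simp
      map_smul' := fun c x => by ext m; simp [HahnSeries.coeff_single] }

lemma cst_tmul (a : g) (x : R) : S.cst R (a ⊗ₜ x) = a ⊗ₜ HahnSeries.single 0 x := rfl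

lemma coeff_single_zero_mul (x : R) (y : HahnSeries ℤ R) (m : ℤ) :
    (HahnSeries.single 0 x * y).coeff m = x * y.coeff m := by
  have := HahnSeries.coeff_single_mul_add (r := x) (x := y) (a := m) (b := 0)
  rwa [add_zero] at this

lemma ct_brT_cst (x : g ⊗[ℂ] R) (y : g ⊗[ℂ] HahnSeries ℤ R) :
    S.ct R (S.brT (cwH ε) (S.cst R x) y) = S.brT ε x (S.ct R y) := by
  induction x using TensorProduct.induction_on with
  | zero => simp
  | add x x' hx hx' => simp only [map_add, LinearMap.add_apply, hx, hx']
  | tmul a x =>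
    induction y using TensorProduct.induction_on with
    | zero => simp
    | add y y' hy hy' => simp only [map_add, hy, hy']
    | tmul b y =>
      simp only [cst_tmul, brT_tmul, map_add, ct_tmul, coeff_single_zero_mul, cwH_single]

lemma coeff_formT_cst (x : g ⊗[ℂ] R) (y : g ⊗[ℂ] HahnSeries ℤ R) :
    (S.formT (cwH ε) (S.cst R x) y).coeff 0 = S.formT ε x (S.ct R y) := by
  induction x using TensorProduct.induction_on with
  | zero => simp
  | add x x' hx hx' =>
    simp only [map_add, LinearMap.add_apply, HahnSeries.coeff_add, hx, hx']
  | tmul a x =>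
    induction y using TensorProduct.induction_on with
    | zero => simp
    | add y y' hy hy' => simp only [map_add, HahnSeries.coeff_add, hy, hy']
    | tmul b y =>
      simp only [cst_tmul, formT_tmul, ct_tmul, HahnSeries.coeff_add, HahnSeries.coeff_smul,
        coeff_single_zero_mul, cwH_single]

lemma coeff_formT_one (x : g ⊗[ℂ] HahnSeries ℤ R) (c : g) :
    (S.formT (cwH ε) x (c ⊗ₜ 1)).coeff 0 = S.formT ε (S.ct R x) (c ⊗ₜ 1) := by
  induction x using TensorProduct.induction_on with
  | zero => simp
  | add x x' hx hx' =>
    simp only [map_add, LinearMap.add_apply, HahnSeries.coeff_add, hx, hx']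
  | tmul a x =>
    simp only [formT_tmul, ct_tmul, HahnSeries.coeff_add, HahnSeries.coeff_smul, mul_one, coeff_cwH]

lemma ct_mapT (i : ZMod 2) (φ : R →ₗ[ℂ] R') (x : g ⊗[ℂ] HahnSeries ℤ R) :
    S.ct R' (S.mapT i (cwH φ) x) = S.mapT i φ (S.ct R x) := by
  induction x using TensorProduct.induction_on with
  | zero => simp
  | add x y hx hy => simp only [map_add, hx, hy]
  | tmul a x => simp only [mapT, TensorProduct.map_tmul, ct_tmul, coeff_cwH]

lemma ct_parT (x : g ⊗[ℂ] HahnSeries ℤ R) :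
    S.ct R (S.parT (cwH ε) x) = S.parT ε (S.ct R x) := by
  induction x using TensorProduct.induction_on with
  | zero => simp
  | add x y hx hy => simp only [map_add, hx, hy]
  | tmul a x =>
    have h : ∀ (a : g) (x : HahnSeries ℤ R), S.parT (cwH ε) (a ⊗ₜ x) = S.par a ⊗ₜ cwH ε x :=
      fun _ _ => rfl
    have h' : ∀ (a : g) (x : R), S.parT ε (a ⊗ₜ x) = S.par a ⊗ₜ ε x := fun _ _ => rfl
    simp only [h, h', ct_tmul, coeff_cwH]

lemma mapT_zmul (i : ZMod 2) (φ : R →ₗ[ℂ] R') (n : ℤ) (x : g ⊗[ℂ] HahnSeries ℤ R) :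
    S.mapT i (cwH φ) (S.zmul R n x) = S.zmul R' n (S.mapT i (cwH φ) x) := by
  induction x using TensorProduct.induction_on with
  | zero => simp
  | add x y hx hy => simp only [map_add, hx, hy]
  | tmul a x =>
    simp only [mapT, zmul, TensorProduct.map_tmul, LinearMap.lTensor_tmul]
    congr 1
    ext m
    simp only [coeff_cwH, coeff_zmulH]

lemma mapT_zero_formT {B B' : Type*} [Ring B] [Algebra ℂ B] [Ring B'] [Algebra ℂ B']
    {ε : B →ₗ[ℂ] B} {ε' : B' →ₗ[ℂ] B'} {K : B →ₗ[ℂ] B'} (hK : ∀ x y, K (x * y) = K x * K y)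
    (hε : ∀ x, ε' (K x) = K (ε x)) (x y : g ⊗[ℂ] B) :
    S.formT ε' (S.mapT 0 K x) (S.mapT 0 K y) = K (S.formT ε x y) := by
  induction x using TensorProduct.induction_on with
  | zero => simp
  | add x x' hx hx' => simp only [map_add, LinearMap.add_apply, hx, hx']
  | tmul a x =>
    induction y using TensorProduct.induction_on with
    | zero => simp
    | add y y' hy hy' => simp only [map_add, hy, hy']
    | tmul b y => simp only [formT_tmul, mapT_zero_tmul, map_add, map_smul, hK, hε]

end Consts

variable {B : Type*} [Ring B] [Algebra ℂ B] {ε δ : B →ₗ[ℂ] B} {J : S.V →ₗ[ℂ] B}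

lemma SDer.hahn {i : ZMod 2} {D : S.V →ₗ[ℂ] B} (h : S.SDer true ε δ i J D) :
    IsDer S.eA (cwH ε) i (cwH J) (cwH D) where
  J_par x := by ext m; simpa using h.J_par _
  D_par x := by ext m; simpa using h.D_par _
  D_mul x y := by
    have h1 : ∀ x y, D (x * y) = D x * J y +
        (if i = 0 then J else J ∘ₗ (S.sgn true).toLinearMap) x * D y := fun x y => by
      rw [h.D_mul]
      split_ifs <;> rfl
    rw [cwH_leibniz h1]
    congr 2
    split_ifs
    · rfl
    · ext m; simp

lemma SDer.hahn_der {i : ZMod 2} {D : S.V →ₗ[ℂ] B} (h : S.SDer true ε δ i J D) (x : S.A) :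
    cwH D (cwH (S.der true) x) = cwH δ (cwH D x) := by
  ext m
  simpa using h.D_der _

lemma SDer.mapT_const {i : ZMod 2} {D : S.V →ₗ[ℂ] B} (h : S.SDer true ε δ i J D) (a : g) (r : ℤ) :
    S.mapT i (cwH D) (a ⊗ₜ HahnSeries.single r 1) = 0 := by
  rw [mapT, TensorProduct.map_tmul, cwH_single, h.map_one, map_zero, TensorProduct.tmul_zero]

lemma SDer.mapT_lam {i : ZMod 2} {D : S.V →ₗ[ℂ] B} (h : S.SDer true ε δ i J D) (s : g) (n : ℤ) :
    S.mapT i (cwH D) (S.lamT S.V s n) = 0 := by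
  rw [lamT, map_add, h.mapT_const, h.mapT_const, add_zero]

section Loop

variable [FiniteDimensional ℂ g] {k : ℂ} {D : ℤ} {s : g} {Q T h : S.G}

/-- The coefficient of `z⁰` in the conjugate of `zⁿΛ`. -/
def conjCoeff (S : Setup g) (D : ℤ) (s : g) (T : S.G) (n : ℤ) : g ⊗[ℂ] S.V :=
  S.ct S.V (S.conjLam D s T n)

/-- `(h | zⁿΛ)` -/
def ham (S : Setup g) (s : g) (h : S.G) (n : ℤ) : S.V :=
  (S.formT S.eA h (S.lamT S.V s n)).coeff 0

namespace IsConj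

variable (H : S.IsConj k D s Q T h)
include H

lemma formT_der_Q (hB : S.IsBase ε δ J) {i : ZMod 2} {Dv : S.V →ₗ[ℂ] B}
    (hD : S.SDer true ε δ i J Dv) (a : g) :
    S.formT (cwH ε) (S.mapT i (cwH Dv) Q) (a ⊗ₜ 1) =
      HahnSeries.single 0 (Dv (S.gen true 0 a)) := by
  have h1 := S.map_formT isSuperComm_eA hD.hahn H.Q_even (a ⊗ₜ 1)
  have h2 : S.mapT 0 (cwH J) (a ⊗ₜ 1) = a ⊗ₜ 1 := by
    rw [mapT_zero_tmul]
    change a ⊗ₜ[ℂ] cwH J (HahnSeries.single 0 1) = _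
    rw [cwH_single, hB.J_one]
    rfl
  have h3 : S.mapT i (cwH Dv) (a ⊗ₜ 1) = 0 := hD.mapT_const a 0
  rw [h2, h3, map_zero, add_zero, H.Q_form, HahnSeries.C_apply, cwH_single] at h1
  exact h1.symm

/-- Identifies the constant term `m_n` of the conjugate of `z^n Λ` as the variational derivative of
`H_n`: since `Q` is constant in `z`, only this term pairs with its variation. -/
lemma variation_ham (hB : S.IsBase ε δ J) {i : ZMod 2} {Dv : S.V →ₗ[ℂ] B}
    (hD : S.SDer true ε δ i J Dv) (n : ℤ) :
    ∃ w, S.ctr J (Dv ∘ₗ S.gen true 0) (S.conjCoeff D s T n) =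
      Dv (S.ham s h n) + k • δ w := by
  obtain ⟨w, hw⟩ := H.variation_formula hB hD.hahn (fun c x hx => S.mapT_mem_fil _ _ hx)
    hD.hahn_der n
  refine ⟨w, ?_⟩
  have h1 : ∀ x : S.G, (S.formT (cwH ε) (S.mapT i (cwH Dv) Q) (S.jT J x)).coeff 0 =
      S.ctr J (Dv ∘ₗ S.gen true 0) (S.ct S.V x) := by
    intro x
    induction x using TensorProduct.induction_on with
    | zero => simp
    | add x y hx hy => simp only [map_add, HahnSeries.coeff_add, hx, hy]
    | tmul a x =>
      rw [jT, mapT_zero_tmul, formT_tmul_right, H.formT_der_Q hB hD, coeff_single_zero_mul,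
        coeff_cwH, ct_tmul, ctr_tmul]
      rfl
  have h2 := S.map_formT isSuperComm_eA hD.hahn H.h_even (S.lamT S.V s n)
  rw [hD.mapT_lam, map_zero, add_zero] at h2
  have h3 := congrArg (fun x => HahnSeries.coeff x 0) h2
  rw [map_sub, hD.mapT_const, sub_zero, h1, map_sub, hD.mapT_lam, sub_zero, ← hB.jT_lamT] at hw
  rw [conjCoeff, hw, ham, ← coeff_cwH, h2]
  rfl

lemma raises_brT : Raises (S.fil S.V D) (S.fil S.V D) (S.brT S.eA T) 1 := by
  rw [← brG_eq]
  exact S.raises_brG (by linarith [H.two_le]) H.T_mem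

lemma raises_neg_brT : Raises (S.fil S.V D) (S.fil S.V D) (-S.brT S.eA T) 1 :=
  fun c x hx => neg_mem (H.raises_brT c x hx)

lemma complete : CompleteFiltration (S.fil S.V D) := S.fil_complete (by linarith [H.two_le])

lemma conjLam_even (n : ℤ) : S.parT S.eA (S.conjLam D s T n) = S.conjLam D s T n := by
  rw [conjLam, map_fexp (T := S.parT S.eA) (d := 0) H.complete H.complete H.raises_neg_brT
    H.raises_neg_brT (fun c x hx => by rw [add_zero]; exact S.parT_mem_fil _ hx) (fun x => ?_),
    H.parT_lam]
  rw [LinearMap.neg_apply, map_neg, S.parT_brT isSuperComm_eA, H.T_even, LinearMap.neg_apply]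

lemma conjCoeff_even (n : ℤ) : S.parT (S.sgn true).toLinearMap (S.conjCoeff D s T n) =
    S.conjCoeff D s T n := by
  rw [conjCoeff, ← ct_parT, H.conjLam_even]

lemma zmul_conjLam (m n : ℤ) : S.zmul S.V m (S.conjLam D s T n) = S.conjLam D s T (m + n) := by
  rw [conjLam, map_fexp (T := S.zmul S.V m) (d := -(m * (D + 2))) H.complete H.complete
    H.raises_neg_brT H.raises_neg_brT (fun c x hx => ?_) (fun x => ?_), zmul_lamT, conjLam]
  · have := S.zmul_mem_fil m hx
    rwa [sub_eq_add_neg] at this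
  · rw [LinearMap.neg_apply, map_neg, (S.zmul_brT (S.isSuperComm_sgn true) m _ _).2,
      LinearMap.neg_apply]

lemma conjLam_sub_mem (n : ℤ) :
    S.conjLam D s T n - S.lamT S.V s n ∈ S.fil S.V D (-2 - n * (D + 2) + 1) :=
  fexp_sub_self_mem H.complete H.raises_neg_brT (S.lamT_mem_fil H.s_mem n)

/-- `z^n Λ` has constant coefficients and commutes with `h - Λ`, hence with `k∂ + h - Λ`;
conjugating back by `e^{-ad T}` gives the claim. -/
lemma commute_conjLam (n : ℤ) :
    S.brT S.eA (Q - s ⊗ₜ HahnSeries.single (-1) 1) (S.conjLam D s T n) +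
      k • S.mapT 0 (cwH (S.der true)) (S.conjLam D s T n) = 0 := by
  let β : (ℂ × S.G) →ₗ[ℂ] S.G →ₗ[ℂ] S.G := LinearMap.mk₂ ℂ
    (fun p y => S.brT S.eA p.2 y + p.1 • S.mapT 0 (cwH (S.der true)) y)
    (fun p p' y => by simp [add_smul]; abel)
    (fun c p y => by simp [smul_smul])
    (fun p y y' => by simp; abel)
    (fun c p y => by simp [smul_smul, mul_comm])
  have hβ : ∀ p y, β p y = S.brT S.eA p.2 y + p.1 • S.mapT 0 (cwH (S.der true)) y :=
    fun _ _ => rfl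
  have hdel : S.mapT 0 (cwH (S.der true)) T ∈ S.fil S.V D 1 := S.mapT_mem_fil _ _ H.T_mem
  have key := bilin_fexp H.complete.pair H.complete H.complete
    (raises_pairOp H.complete H.raises_brT hdel) H.raises_brT H.raises_brT β (d := 0)
    (fun i j p y hp hy => by
      rw [hβ, add_zero]
      refine add_mem (S.brT_mem_fil _ hp.1 hy) ?_
      by_cases hi : 0 < i
      · simp [hp.2 hi]
      · exact Submodule.smul_mem _ _ (H.complete.anti (by omega) (S.mapT_mem_fil _ _ hy)))
    (fun p y => by
      have h1 := (isBase_id (S := S)).delY_act T y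
      have h2 : S.jT LinearMap.id = LinearMap.id := by
        have : cwH (LinearMap.id : S.V →ₗ[ℂ] S.V) = LinearMap.id := by
          ext x m; simp
        rw [jT, this, mapT_zero, LinearMap.lTensor_id]
      rw [h2] at h1
      simp only [LinearMap.id_apply] at h1
      simp only [hβ, pairOp_apply, map_add, map_smul, map_sub, LinearMap.sub_apply,
        LinearMap.smul_apply, S.brT_jacobi isSuperComm_eA H.T_even, h1, zero_smul, smul_add]
      abel)
    (k, Q - s ⊗ₜ HahnSeries.single (-1) 1) (S.conjLam D s T n)
  have h3 : fexp (S.fil S.V D) (S.brT S.eA T) (S.conjLam D s T n) = S.lamT S.V s n :=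
    fexp_fexp_neg H.complete H.raises_brT _
  have h4 : S.mapT 0 (cwH (S.der true)) (S.lamT S.V s n) = 0 := by
    have h5 : S.der true 1 = 0 := by simpa using S.der_algebraMap true 1
    simp only [lamT, map_add, mapT_zero_tmul, cwH_single, h5, map_zero, TensorProduct.tmul_zero,
      add_zero]
  rw [H.conj, h3, hβ, H.brT_conj_lam, h4, smul_zero, add_zero] at key
  have h6 := fexp_neg_fexp H.complete H.raises_brT (β (k, Q - s ⊗ₜ HahnSeries.single (-1) 1)
    (S.conjLam D s T n))
  rw [← key] at h6
  rw [hβ] at h6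
  rw [← h6]
  have h7 := fexp_add_right H.complete H.raises_neg_brT 0 0
  rw [add_zero] at h7
  exact (left_eq_add.1 h7)

end IsConj

end Loop

end Setup
end WSuper

namespace WSuper
namespace Setup

variable {g : Type*} [AddCommGroup g] [Module ℂ g] {S : Setup g}

/-! ### The properties of the coefficients of the conjugates of `zⁿΛ` -/

/-- The derivation `z d/dz`. -/
def zdz (R : Type*) [Ring R] [Algebra ℂ R] : HahnSeries ℤ R →ₗ[ℂ] HahnSeries ℤ R where
  toFun x := ⟨fun m => (-(m : ℂ)) • x.coeff m, x.isPWO_support.mono fun m hm => by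
    simp only [Function.mem_support] at hm ⊢
    intro h
    exact hm (by rw [h, smul_zero])⟩
  map_add' x y := by ext m; simp
  map_smul' c x := by ext m; simp [smul_comm c]

lemma coeff_zdz {R : Type*} [Ring R] [Algebra ℂ R] (x : HahnSeries ℤ R) (m : ℤ) :
    (zdz R x).coeff m = (-(m : ℂ)) • x.coeff m := rfl

lemma zdz_mul {R : Type*} [Ring R] [Algebra ℂ R] (x y : HahnSeries ℤ R) :
    zdz R (x * y) = zdz R x * y + x * zdz R y := by
  obtain ⟨a, ha⟩ : ∃ a, ∀ m < a, x.coeff m = 0 :=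
    ⟨x.order, fun m hm => coeff_eq_zero_of_lt_of_le_order le_rfl hm⟩
  obtain ⟨b, hb⟩ : ∃ b, ∀ m < b, y.coeff m = 0 :=
    ⟨y.order, fun m hm => coeff_eq_zero_of_lt_of_le_order le_rfl hm⟩
  ext n
  rw [coeff_zdz, HahnSeries.coeff_add, coeff_mul_eq_sum ha hb,
    coeff_mul_eq_sum (a := a) (b := b) (fun m hm => by simp [coeff_zdz, ha m hm]) hb,
    coeff_mul_eq_sum (a := a) (b := b) ha (fun m hm => by simp [coeff_zdz, hb m hm]),
    Finset.smul_sum, ← Finset.sum_add_distrib]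
  refine Finset.sum_congr rfl fun i _ => ?_
  rw [coeff_zdz, coeff_zdz, smul_mul_assoc, mul_smul_comm, ← add_smul]
  congr 1
  push_cast
  ring

lemma zdz_single {R : Type*} [Ring R] [Algebra ℂ R] (r : ℤ) (x : R) :
    zdz R (HahnSeries.single r x) = (-(r : ℂ)) • HahnSeries.single r x := by
  ext m
  rw [coeff_zdz, HahnSeries.coeff_smul]
  by_cases h : m = r
  · rw [h]
  · rw [HahnSeries.coeff_single_of_ne h, smul_zero, smul_zero]

lemma isDer_zdz : IsDer S.eA S.eA 0 (cwH LinearMap.id) (zdz S.V) where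
  J_par x := by ext m; simp
  D_par x := by ext m; simp [coeff_zdz, sg]
  D_mul x y := by
    have h : ∀ x : S.A, cwH LinearMap.id x = x := fun x => by ext m; simp
    rw [zdz_mul, h, h, if_pos rfl]

section Loop

variable [FiniteDimensional ℂ g] {k : ℂ} {D : ℤ} {s : g} {Q T h : S.G}

namespace IsConj

variable (H : S.IsConj k D s Q T h)
include H

lemma formT_ct_Q (a : g) : S.formT (S.sgn true).toLinearMap (S.ct S.V Q) (a ⊗ₜ 1) =
    S.gen true 0 a := by
  rw [← coeff_formT_one, H.Q_form, HahnSeries.C_apply, HahnSeries.coeff_single_same]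

lemma ct_Q_even : S.parT (S.sgn true).toLinearMap (S.ct S.V Q) = S.ct S.V Q := by
  rw [← ct_parT, H.Q_even]

lemma cst_ct_Q : S.cst S.V (S.ct S.V Q) = Q := by
  refine formT_ext (S := S) (isSuperComm_eA (S := S)) fun a => ?_
  rw [H.Q_form]
  ext m
  have key : ∀ x : g ⊗[ℂ] S.V, S.formT S.eA (S.cst S.V x) (a ⊗ₜ 1) =
      HahnSeries.single 0 (S.formT (S.sgn true).toLinearMap x (a ⊗ₜ 1)) := by
    intro x
    induction x using TensorProduct.induction_on with
    | zero => simp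
    | add x y hx hy => simp only [map_add, LinearMap.add_apply, hx, hy, HahnSeries.single_add]
    | tmul b x =>
      simp only [cst_tmul, formT_tmul, mul_one, cwH_single, HahnSeries.single_add]
      ext m
      simp only [HahnSeries.coeff_add, HahnSeries.coeff_smul, HahnSeries.coeff_single]
      split_ifs <;> simp
  rw [key, H.formT_ct_Q, HahnSeries.C_apply]

lemma s_z_eq (y : S.G) : S.brT S.eA (s ⊗ₜ HahnSeries.single (-1) 1) y =
    S.brT S.eA (S.cst S.V (s ⊗ₜ 1)) (S.zmul S.V 1 y) := by
  have h1 : s ⊗ₜ HahnSeries.single (-1) 1 = S.zmul S.V 1 (S.cst S.V (s ⊗ₜ 1)) := by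
    rw [cst_tmul, zmul, LinearMap.lTensor_tmul, zmulH, LinearMap.mulLeft_apply,
      HahnSeries.single_mul_single]
    simp
  rw [h1, ← (S.zmul_brT (S.isSuperComm_sgn true) 1 _ _).1,
    (S.zmul_brT (S.isSuperComm_sgn true) 1 _ _).2]

/-- The recursion for the conjugates of `zⁿΛ`. -/
lemma recursion (n : ℤ) :
    S.brT (S.sgn true).toLinearMap (S.ct S.V Q) (S.conjCoeff D s T n) +
      k • S.mapT 0 (S.der true) (S.conjCoeff D s T n) =
    S.brT (S.sgn true).toLinearMap (s ⊗ₜ 1) (S.conjCoeff D s T (n + 1)) := by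
  have h1 := H.commute_conjLam n
  rw [map_sub, LinearMap.sub_apply, H.s_z_eq, H.zmul_conjLam, ← H.cst_ct_Q] at h1
  -- Multiplication by `z` turns the `n`-th conjugate into the next one, so the constant term of
  -- `[zs, M_n]` is `[s, m_{n+1}]`.
  have h2 := congrArg (S.ct S.V) h1
  rw [map_add, map_sub, ct_brT_cst, ct_brT_cst, map_smul, ct_mapT, map_zero,
    sub_add_eq_add_sub, sub_eq_zero, add_comm 1 n] at h2
  exact h2

/-- `h` has degree at least `-1`, and `z^n Λ` has degree at least `D ≥ 2` for negative `n`, so the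
total degree is positive. -/
lemma ham_eq_zero {n : ℤ} (hn : n < 0) : S.ham s h n = 0 := by
  have h2 := H.two_le
  refine S.formT_coeff_zero (by omega) _ H.h_mem (S.lamT_mem_fil H.s_mem n) ?_
  nlinarith

/-- The conjugate of `Λ` is `Λ` up to degree at least `-1`, which cannot pair with `e` of degree
`2`. Only `(f|e) = 1` remains. -/
lemma formT_conjCoeff_zero_e :
    S.formT (S.sgn true).toLinearMap (S.conjCoeff D s T 0) (S.e ⊗ₜ 1) = 1 := by
  have h2 := H.two_le
  have he : S.e ⊗ₜ[ℂ] (1 : S.A) ∈ S.fil S.V D 2 := by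
    refine S.tmul_mem_fil S.e_mem fun m hm => ?_
    have : m ≠ 0 := by rintro rfl; omega
    rw [HahnSeries.coeff_one, if_neg this]
  have h1 := S.formT_coeff_zero (by omega) (S.sgn true).toLinearMap (H.conjLam_sub_mem 0) he (by omega)
  rw [map_sub, LinearMap.sub_apply, HahnSeries.coeff_sub, sub_eq_zero] at h1
  rw [conjCoeff, ← coeff_formT_one, h1, lamT]
  have h4 : S.B S.f S.e = 1 := by rw [S.symm_even S.e_even, S.B_e_f]
  simp only [map_add, LinearMap.add_apply, formT_tmul, S.ev_of_even S.e_even,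
    S.od_of_even S.e_even, map_zero, zero_smul, add_zero, mul_one, HahnSeries.coeff_add,
    HahnSeries.coeff_smul, h4, neg_zero, one_smul, zero_add, HahnSeries.coeff_single_same]
  rw [HahnSeries.coeff_single_of_ne (by omega), smul_zero, add_zero]

/-- Bracketing with the Cartan element gives `[S.h, z^n Λ] = -2 z^n Λ + (D + 2) z^{n+1} s`. Its
pairing with the dressed `h` vanishes by invariance, because `h` commutes with `z^n Λ`. -/
lemma coeff_formT_h_s (n : ℤ) :
    ((D : ℂ) + 2) • (S.formT S.eA h (s ⊗ₜ HahnSeries.single (-(n + 1)) 1)).coeff 0 =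
      (2 : ℂ) • S.ham s h n := by
  have h1 : S.brT S.eA (S.h ⊗ₜ 1) (S.lamT S.V s n) = (-2 : ℂ) • S.lamT S.V s n +
      ((D : ℂ) + 2) • (s ⊗ₜ HahnSeries.single (-(n + 1)) 1) := by
    simp only [lamT, map_add, S.brT_even_left _ _ _ (isSuperComm_eA.map_one), one_mul, S.br_h_f,
      S.mem_gr.1 H.s_mem, ← neg_smul, ← TensorProduct.smul_tmul']
    module
  have hh : S.parT S.eA (S.h ⊗ₜ 1) = S.h ⊗ₜ 1 := by
    have : S.parT S.eA (S.h ⊗ₜ 1) = S.par S.h ⊗ₜ S.eA 1 := rfl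
    rw [this, S.h_even, isSuperComm_eA.map_one]
  have h2 : S.formT S.eA h (S.brT S.eA (S.h ⊗ₜ 1) (S.lamT S.V s n)) = 0 := by
    rw [← S.formT_inv isSuperComm_eA, S.brT_skew isSuperComm_eA hh, map_neg, LinearMap.neg_apply,
      S.formT_inv isSuperComm_eA, S.brT_skew isSuperComm_eA (H.parT_lam n), H.brT_lam_h]
    simp
  rw [h1, map_add, map_smul, map_smul] at h2
  have h3 := congrArg (fun x => HahnSeries.coeff x 0) h2
  simp only [HahnSeries.coeff_add, HahnSeries.coeff_smul, HahnSeries.coeff_zero] at h3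
  rw [ham, ← sub_eq_zero, ← h3, neg_smul]
  abel

/-- The variation formula for `z d/dz`. On the undressed side only `-zs` depends on `z` and produces
`-(m_{n+1} | s)`; on the dressed side one finds `-n H_n - (h | z^{n+1} s)` and a constant occurring
only for `n = -1`. Finally `coeff_formT_h_s` expresses `(h | z^{n+1} s)` through `H_n`. -/
lemma density (n : ℤ) : ∃ x,
    S.formT (S.sgn true).toLinearMap (S.conjCoeff D s T (n + 1)) (s ⊗ₜ 1) =
      ((n : ℂ) + 2 / ((D : ℂ) + 2)) • S.ham s h n + (if n = -1 then S.B s S.f else 0) • 1 +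
        S.der true x := by
  have hid : ∀ x : S.A, cwH LinearMap.id x = x := fun x => by ext m; simp
  have hjid : ∀ x, S.jT LinearMap.id x = x := fun x => by
    have : cwH (LinearMap.id : S.V →ₗ[ℂ] S.V) = LinearMap.id := LinearMap.ext hid
    rw [jT, this, mapT_zero, LinearMap.lTensor_id]; rfl
  have hm : ∀ c x, x ∈ S.fil S.V D c → S.mapT 0 (zdz S.V) x ∈ S.fil S.V D c := by
    intro c x hx
    refine S.fil_induction (fun j a X ha hX => ?_) hx
    rw [mapT_zero_tmul]
    exact S.tmul_mem_fil ha fun m hm => by rw [coeff_zdz, hX m hm, smul_zero]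
  obtain ⟨w, hw⟩ := H.variation_formula isBase_id isDer_zdz hm
    (fun x => by ext m; simp [coeff_zdz]) n
  have h0 : S.mapT 0 (zdz S.V) Q = 0 := by
    rw [← H.cst_ct_Q]
    generalize S.ct S.V Q = y
    induction y using TensorProduct.induction_on with
    | zero => simp
    | add x y hx hy => rw [map_add, map_add, hx, hy, add_zero]
    | tmul a x => rw [cst_tmul, mapT_zero_tmul, zdz_single]; simp
  have h1 : S.mapT 0 (zdz S.V) (s ⊗ₜ HahnSeries.single (-1) 1) =
      s ⊗ₜ HahnSeries.single (-1) 1 := by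
    rw [mapT_zero_tmul, zdz_single]; simp
  have h2 : ∀ n, S.mapT 0 (zdz S.V) (S.lamT S.V s n) = (n : ℂ) • S.lamT S.V s n +
      s ⊗ₜ HahnSeries.single (-(n + 1)) 1 := by
    intro n
    rw [lamT, map_add, mapT_zero_tmul, mapT_zero_tmul, zdz_single, zdz_single, smul_add,
      TensorProduct.tmul_smul, TensorProduct.tmul_smul, add_assoc]
    congr 1
    · simp
    · push_cast
      rw [neg_neg, add_smul, one_smul]
  have hse : S.eA (HahnSeries.single (-1) 1) = HahnSeries.single (-1) 1 := by
    rw [cwH_single]; simp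
  have h3 : (S.formT S.eA (s ⊗ₜ HahnSeries.single (-1) 1) (S.conjLam D s T n)).coeff 0 =
      S.formT (S.sgn true).toLinearMap (S.conjCoeff D s T (n + 1)) (s ⊗ₜ 1) := by
    have h4 : ∀ y : S.G, (S.formT S.eA (s ⊗ₜ HahnSeries.single (-1) 1) y).coeff 0 =
        (S.formT S.eA (S.cst S.V (s ⊗ₜ 1)) (S.zmul S.V 1 y)).coeff 0 := by
      intro y
      induction y using TensorProduct.induction_on with
      | zero => simp
      | add x y hx hy => simp only [map_add, HahnSeries.coeff_add, hx, hy]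
      | tmul a x =>
        rw [cst_tmul, zmul, LinearMap.lTensor_tmul, S.formT_even_left _ _ _ hse,
          S.formT_even_left _ _ _ (by rw [cwH_single]; simp), HahnSeries.coeff_smul,
          HahnSeries.coeff_smul, coeff_single_zero_mul, coeff_zmulH, one_mul]
        have := HahnSeries.coeff_single_mul_add (r := (1 : S.V)) (x := x) (a := 1) (b := -1)
        rw [one_mul] at this
        rw [zero_add, ← this, add_neg_cancel]
    rw [h4, H.zmul_conjLam, coeff_formT_cst, add_comm 1 n]
    exact (S.formT_symm (S.isSuperComm_sgn true) (H.conjCoeff_even (n + 1)) _)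
  have h5 : (S.formT S.eA (s ⊗ₜ HahnSeries.single (-1) 1) (S.lamT S.V s n)).coeff 0 =
      (if n = -1 then S.B s S.f else 0) • 1 := by
    have h6 : S.B s s = 0 := S.B_gr (by linarith [H.two_le]) H.s_mem H.s_mem
    rw [lamT, map_add, S.formT_even_left _ _ _ hse, S.formT_even_left _ _ _ hse, h6, zero_smul,
      add_zero, HahnSeries.single_mul_single, HahnSeries.coeff_smul, one_mul]
    by_cases hn : n = -1
    · subst hn
      simp
    · rw [HahnSeries.coeff_single_of_ne (by omega), if_neg hn, smul_zero, zero_smul]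
  -- The derivation `z d/dz` has no constant term, so it can be moved from `h` to `z^n Λ` with a
  -- sign.
  have h7 := S.map_formT isSuperComm_eA isDer_zdz H.h_even (S.lamT S.V s n)
  have h8 := congrArg (fun x => HahnSeries.coeff x 0) h7
  have hj : ∀ x, S.mapT 0 (cwH (LinearMap.id : S.V →ₗ[ℂ] S.V)) x = x := hjid
  simp only [coeff_zdz, Int.cast_zero, neg_zero, zero_smul, HahnSeries.coeff_add, hj, h2, map_add,
    map_smul, HahnSeries.coeff_smul] at h8
  rw [hjid, map_sub, map_sub, h0, h1, map_zero, zero_sub, LinearMap.neg_apply, HahnSeries.coeff_neg,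
    h3, map_sub, map_sub, LinearMap.sub_apply, HahnSeries.coeff_sub, h2, Int.cast_zero, zero_smul, zero_add,
    zero_add, h5] at hw
  have hne : ((D : ℂ) + 2) ≠ 0 := by
    have := H.two_le
    have h9 : ((D + 2 : ℤ) : ℂ) ≠ 0 := by
      rw [Int.cast_ne_zero]; omega
    push_cast at h9
    exact h9
  have h10 := H.coeff_formT_h_s n
  set c := (S.formT S.eA h (s ⊗ₜ HahnSeries.single (-(n + 1)) 1)).coeff 0 with hc
  have h11 : c = (2 / ((D : ℂ) + 2)) • S.ham s h n := by
    rw [div_eq_inv_mul, mul_smul, ← h10, smul_smul, inv_mul_cancel₀ hne, one_smul]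
  refine ⟨-(k • w), ?_⟩
  have h12 : (S.formT S.eA (S.mapT 0 (zdz S.V) h) (S.lamT S.V s n)).coeff 0 =
      -((n : ℂ) • S.ham s h n + c) := by
    rw [eq_neg_iff_add_eq_zero]
    exact h8.symm
  rw [h12, h11] at hw
  rw [← neg_neg (S.formT _ _ _), hw, map_neg, map_smul, add_smul]
  abel

end IsConj

end Loop

end Setup
end WSuper

namespace WSuper
namespace Setup

variable {g : Type*} [AddCommGroup g] [Module ℂ g] {S : Setup g}

/-! ### Gauge covariance of the conjugates -/

variable [FiniteDimensional ℂ g] {k : ℂ} {D : ℤ} {s : g} {Q T h : S.G}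

lemma jT_tmul_one {B : Type*} [Ring B] [Algebra ℂ B] {ε δ : B →ₗ[ℂ] B} {J : S.V →ₗ[ℂ] B}
    (hB : S.IsBase ε δ J) (a : g) : S.jT J (a ⊗ₜ 1) = a ⊗ₜ 1 := by
  rw [jT, mapT_zero_tmul]
  change a ⊗ₜ[ℂ] cwH J (HahnSeries.single 0 1) = _
  rw [cwH_single, hB.J_one]
  rfl

lemma IsBase.formT_jT {B : Type*} [Ring B] [Algebra ℂ B] {ε δ : B →ₗ[ℂ] B} {J : S.V →ₗ[ℂ] B}
    (hB : S.IsBase ε δ J) (x y : S.G) :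
    S.formT (cwH ε) (S.jT J x) (S.jT J y) = cwH J (S.formT S.eA x y) :=
  mapT_zero_formT (cwH_mul hB.J_mul) (fun x => by ext m; simp [hB.J_par]) x y

lemma lamV_one : S.lamV 1 = Polynomial.X := by
  have h := S.lamV_C_mul 1 1
  have h1 : S.der true 1 = 0 := by simpa using S.der_algebraMap true 1
  simp only [lamV, LinearMap.add_apply, LinearMap.mulLeft_apply, mul_one]
  have h2 : (1 : S.V[X]) = Polynomial.C 1 := rfl
  rw [h2, cwX_C, h1]
  simp

namespace IsConj

variable (H : S.IsConj k D s Q T h)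
include H

/-- Tested against every `a ∈ g`: the bracket `{n_λ a}` is `[n, a] + kλ(n|a)`, where the `λ` arises
from `(λ + ∂) 1 = λ`. The term `zs` is harmless because `[n, s] = 0`. -/
lemma der_Q_gauge {i : ZMod 2} {n : g} (hn : n ∈ S.nn) (hi : S.par n = sg i • n) :
    S.mapT i (cwH (S.brV (S.gam1 k) n)) (Q - s ⊗ₜ HahnSeries.single (-1) 1) =
      -S.brT (cwH S.sgnVX) (n ⊗ₜ 1) (S.jT (cl S.V) (Q - s ⊗ₜ HahnSeries.single (-1) 1)) +
        k • S.mapT 0 (cwH S.lamV) (n ⊗ₜ 1) := by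
  have hB := isBase_cl (S := S)
  have hc := hB.comm.hahn
  have hD := (S.isEvenGen_gam1 k).sder_brV hi
  have h1 : S.brT (cwH S.sgnVX) (n ⊗ₜ 1) (S.jT (cl S.V) (s ⊗ₜ HahnSeries.single (-1) 1)) = 0 := by
    rw [jT, mapT_zero_tmul, S.brT_even_left _ _ _ hc.map_one, S.skew_even H.s_even,
      br_s_nn H.gr_eq_bot H.s_mem hn]
    simp
  have h2 : S.mapT 0 (cwH S.lamV) (n ⊗ₜ 1) =
      n ⊗ₜ (HahnSeries.single 0 Polynomial.X : HahnSeries ℤ S.V[X]) := by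
    rw [mapT_zero_tmul]
    change n ⊗ₜ[ℂ] cwH S.lamV (HahnSeries.single 0 1) = _
    rw [cwH_single, lamV_one]
  have h3 : cwH S.sgnVX (HahnSeries.single 0 Polynomial.X) =
      (HahnSeries.single 0 Polynomial.X : HahnSeries ℤ S.V[X]) := by
    rw [cwH_single]
    congr 1
    exact (cwX_monomial _ 1 1).trans (by simp [Polynomial.monomial_one_one_eq_X])
  rw [map_sub, hD.mapT_const, sub_zero, map_sub, map_sub, h1, sub_zero, h2]
  refine formT_ext (S := S) hc fun a => ?_
  rw [H.formT_der_Q hB hD, brV_gam1_nn_gen k hi hn, HahnSeries.single_add, map_add,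
    LinearMap.add_apply, map_neg,
    LinearMap.neg_apply, map_smul (S.formT (cwH S.sgnVX)), LinearMap.smul_apply, S.formT_even_left _ _ _ h3,
    S.brT_skew hc (hB.parT_jT H.Q_even), map_neg, LinearMap.neg_apply, neg_neg,
    S.formT_inv hc, S.brT_even_left _ _ _ hc.map_one, one_mul, ← jT_tmul_one hB, hB.formT_jT,
    H.Q_form, HahnSeries.C_apply, cwH_single, mul_one, smul_smul, cl_apply]
  congr 1
  ext m
  simp only [HahnSeries.coeff_smul, HahnSeries.coeff_single]
  split_ifs <;> simp

/-- An instance of `IsVariation.gauge` over `𝒱[λ]`, where `λ + ∂` plays the role of `∂`. The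
pseudo-inverse over `𝒱[λ]` commutes with `ad h` and with `λ + ∂`, as both commute with `ad Λ` and
with `z`. -/
lemma gauge_conjLam {i : ZMod 2} {n : g} (hn : n ∈ S.nn) (hi : S.par n = sg i • n) (r : ℤ) :
    S.mapT i (cwH (S.brV (S.gam1 k) n)) (S.conjLam D s T r) =
      -S.brT (cwH S.sgnVX) (n ⊗ₜ 1) (S.jT (cl S.V) (S.conjLam D s T r)) := by
  have hB := isBase_cl (S := S)
  have hc := hB.comm.hahn
  have hD := (S.isEvenGen_gam1 k).sder_brV hi
  have hV := H.isVariation hB hD.hahn (fun c x hx => S.mapT_mem_fil _ _ hx) hD.hahn_der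
  obtain ⟨ψ, hψ, hinv, hcom⟩ := S.exists_pseudo_inverse (R := S.V[X]) hB.comm
    (by linarith [H.two_le]) H.s_mem H.semisimple
  have hL0 : S.jT (cl S.V) (S.lamT S.V s 0) = S.lamT S.V[X] s 0 := hB.jT_lamT s 0
  have hLe : S.parT (cwH S.sgnVX) (S.lamT S.V[X] s 0) = S.lamT S.V[X] s 0 := by
    rw [← hL0, hB.parT_jT (H.parT_lam 0)]
  have hLh : S.brT (cwH S.sgnVX) (S.lamT S.V[X] s 0) (S.jT (cl S.V) h) = 0 := by
    rw [← hL0, ← hB.jT_brT, H.brT_lam_h, map_zero]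
  have hbr : ∀ y, S.brT (cwH S.sgnVX) (S.lamT S.V[X] s 0)
      (S.brT (cwH S.sgnVX) y (S.jT (cl S.V) h)) =
      S.brT (cwH S.sgnVX) (S.brT (cwH S.sgnVX) (S.lamT S.V[X] s 0) y) (S.jT (cl S.V) h) := by
    intro y
    rw [S.brT_jacobi hc hLe, hLh, map_zero, add_zero]
  have hdL : S.mapT 0 (cwH (S.der true)) (S.lamT S.V s 0) = 0 := by
    have h5 : S.der true 1 = 0 := by simpa using S.der_algebraMap true 1
    simp only [lamT, map_add, mapT_zero_tmul, cwH_single, h5, map_zero, TensorProduct.tmul_zero,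
      add_zero]
  have hd : ∀ y, S.brT (cwH S.sgnVX) (S.lamT S.V[X] s 0) (S.mapT 0 (cwH S.lamV) y) =
      S.mapT 0 (cwH S.lamV) (S.brT (cwH S.sgnVX) (S.lamT S.V[X] s 0) y) := by
    intro y
    have := hB.delY_act (S.lamT S.V s 0) y
    rw [hdL, map_zero, map_zero, LinearMap.zero_apply, zero_add, hL0] at this
    exact this.symm
  have hψh : ∀ y, S.brT (cwH S.sgnVX) (ψ y) (S.jT (cl S.V) h) =
      ψ (S.brT (cwH S.sgnVX) y (S.jT (cl S.V) h)) := by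
    generalize S.jT (cl S.V) h = x at hbr
    exact hcom ((S.brT (cwH S.sgnVX)).flip x) (fun n y => (S.zmul_brT hB.comm n y x).1.symm)
      fun y => (hbr y).symm
  refine hV.gauge H.conj H.h_mem ψ hψ ?_ ?_ ?_ ?_ (hD.mapT_lam s 0) ?_ ?_ ?_ ?_
    (H.der_Q_gauge hn hi) (hD.mapT_lam s r) ?_
  · intro y
    rw [LinearMap.comp_apply, hL0]
    exact hcom _ (fun n x => (S.zmul_brT hB.comm n _ _).2.symm) (fun x => rfl) y
  · intro y
    rw [LinearMap.comp_apply, hL0]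
    exact hinv y
  · intro y
    rw [LinearMap.compl₂_apply, LinearMap.comp_apply, hL0]
    exact S.brT_skew hc hLe y
  · have := S.mapT_brT isSuperComm_eA hD.hahn (H.parT_lam 0) h
    rw [H.brT_lam_h, map_zero, hD.mapT_lam, map_zero, LinearMap.zero_apply] at this
    rw [zero_add] at this
    exact this.symm
  · intro y
    rw [LinearMap.comp_apply, LinearMap.compl₂_apply, LinearMap.compl₂_apply, hL0]
    exact hbr y
  · intro y
    rw [LinearMap.compl₂_apply, LinearMap.compl₂_apply]
    exact (hψh y).symm
  · intro y
    rw [LinearMap.comp_apply, hL0]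
    exact hd y
  · exact fun y => (hcom _ (fun n x => mapT_zmul 0 _ n x) (fun x => (hd x).symm) y).symm
  · intro y hy
    rw [LinearMap.comp_apply, hL0] at hy
    have h1 : S.jT (cl S.V) (S.lamT S.V s r) = S.zmul S.V[X] r (S.lamT S.V[X] s 0) := by
      rw [hB.jT_lamT, zmul_lamT, add_zero]
    rw [LinearMap.compl₂_apply, h1, ← (S.zmul_brT hB.comm r _ _).2, S.brT_skew hc hLe, hy,
      neg_zero, map_zero]

/-- The action of `𝔫` on the coefficients of the conjugates. -/
lemma gauge_conjCoeff {i : ZMod 2} {n : g} (hn : n ∈ S.nn) (hi : S.par n = sg i • n) (r : ℤ)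
    (c : g) :
    S.brV (S.gam1 k) n (S.formT (S.sgn true).toLinearMap (S.conjCoeff D s T r) (c ⊗ₜ 1)) =
      Polynomial.C (S.formT (S.sgn true).toLinearMap (S.conjCoeff D s T r) (S.br n c ⊗ₜ 1)) := by
  have hB := isBase_cl (S := S)
  have hc := hB.comm.hahn
  have hD := (S.isEvenGen_gam1 k).sder_brV hi
  have h1 := S.map_formT isSuperComm_eA hD.hahn (H.conjLam_even r) (c ⊗ₜ 1)
  have h3 : S.mapT i (cwH (S.brV (S.gam1 k) n)) (c ⊗ₜ 1) = 0 := hD.mapT_const c 0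
  have h4 : S.mapT 0 (cwH (cl S.V)) (c ⊗ₜ 1) = c ⊗ₜ 1 := jT_tmul_one hB c
  rw [h3, map_zero, add_zero, h4, H.gauge_conjLam hn hi, map_neg, LinearMap.neg_apply,
    S.brT_skew hc (hB.parT_jT (H.conjLam_even r)), map_neg, LinearMap.neg_apply, neg_neg,
    S.formT_inv hc, S.brT_even_left _ _ _ hc.map_one, one_mul, ← jT_tmul_one hB,
    hB.formT_jT] at h1
  have h2 := congrArg (fun x => HahnSeries.coeff x 0) h1
  simp only [coeff_cwH] at h2
  rw [conjCoeff, ← coeff_formT_one, ← coeff_formT_one, h2]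
  rfl

end IsConj

end Setup
end WSuper

namespace WSuper
namespace Setup

variable {g : Type*} [AddCommGroup g] [Module ℂ g] {S : Setup g}

/-! ### The densities and the second bracket -/

lemma ctr_smulRight {B : Type*} [Ring B] [Algebra ℂ B] {J : S.V →ₗ[ℂ] B} (c : g)
    {m : g ⊗[ℂ] S.V} (hm : S.parT (S.sgn true).toLinearMap m = m) :
    S.ctr J ((S.B c).smulRight 1) m = J (S.formT (S.sgn true).toLinearMap m (c ⊗ₜ 1)) := by
  rw [← S.formT_symm (S.isSuperComm_sgn true) hm]
  clear hm
  induction m using TensorProduct.induction_on with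
  | zero => simp
  | add x y hx hy => simp only [map_add, hx, hy]
  | tmul a x =>
    rw [ctr_tmul, S.formT_even_left _ _ _ (by simp), one_mul, map_smul,
      LinearMap.smulRight_apply, smul_mul_assoc, one_mul]

variable [FiniteDimensional ℂ g] {k : ℂ} {D : ℤ} {s : g} {Q T h : S.G}

lemma algebraMap_mem_W (k c : ℂ) : algebraMap ℂ S.V c ∈ S.W k := by
  rw [mem_W_iff_homog]
  intro j _ i n _ hi
  rw [Algebra.algebraMap_eq_smul_one, map_smul, ((S.isEvenGen_gam1 k).sder_brV hi).map_one,
    smul_zero]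

/-- The commutator of a derivation along `𝒱 → 𝒱[λ]` with an even derivation of `𝒱`. -/
lemma SDer.commutator {i : ZMod 2} {E : S.V →ₗ[ℂ] S.V[X]} {T : S.V →ₗ[ℂ] S.V}
    (hE : S.SDer true S.sgnVX S.lamV i (cl S.V) E) (hT : S.EvDer 0 T) :
    S.SDer true S.sgnVX S.lamV i (cl S.V) (E ∘ₗ T - cwX T ∘ₗ E) := by
  have hTm : ∀ x y, T (x * y) = T x * y + x * T y := fun x y => by
    have := hT.D_mul x y
    rwa [if_pos rfl] at this
  have hTs : ∀ x, S.sgn true (T x) = T (S.sgn true x) := fun x => by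
    have := hT.D_par x
    rwa [sg, if_pos rfl, one_smul] at this
  have hid : ∀ p : S.V[X], cwX LinearMap.id p = p := fun p => by ext n; simp
  have hcm : ∀ p r : S.V[X], cwX T (p * r) = cwX T p * r + p * cwX T r := fun p r => by
    simpa only [hid] using cwX_leibniz (J := LinearMap.id) (J' := LinearMap.id) hTm p r
  refine ⟨⟨hE.J_par, fun x => ?_, fun x y => ?_⟩, hE.J_one, fun x => ?_⟩
  · have h1 : ∀ p, S.sgnVX (cwX T p) = cwX T (S.sgnVX p) := fun p => by
      ext n; simp [sgnVX, hTs]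
    simp only [LinearMap.sub_apply, LinearMap.comp_apply, map_sub, hE.D_par, h1, map_smul,
      smul_sub, AlgHom.toLinearMap_apply, hTs]
  · have h1 : T (if i = 0 then x else (S.sgn true).toLinearMap x) =
        if i = 0 then T x else (S.sgn true).toLinearMap (T x) := by
      split_ifs
      · rfl
      · exact (hTs x).symm
    simp only [LinearMap.sub_apply, LinearMap.comp_apply, hTm, map_add, hE.D_mul, hcm, ← h1,
      cl_apply, cwX_C, sub_mul, mul_sub]
    abel
  · have h1 : ∀ p, cwX T (S.lamV p) = S.lamV (cwX T p) := fun p => by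
      have h2 : cwX T (Polynomial.X * p) = Polynomial.X * cwX T p := by
        ext n
        cases n <;> simp [Polynomial.coeff_X_mul]
      have h3 : cwX T (cwX (S.der true) p) = cwX (S.der true) (cwX T p) := by
        ext n
        simpa using hT.D_der (p.coeff n)
      rw [lamV_apply, map_add, h2, h3, lamV_apply]
    simp only [LinearMap.sub_apply, LinearMap.comp_apply, hT.D_der, hE.D_der, h1, map_sub]

/-- `c ↦ (m | c ⊗ 1)` for the coefficient `m` of `z⁰` in the conjugate of `zⁿΛ`. -/
def conjForm (S : Setup g) (D : ℤ) (s : g) (T : S.G) (n : ℤ) : g →ₗ[ℂ] S.V :=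
  S.formT (S.sgn true).toLinearMap (S.conjCoeff D s T n) ∘ₗ (TensorProduct.mk ℂ g S.V).flip 1

lemma conjForm_apply (n : ℤ) (c : g) : S.conjForm D s T n c =
    S.formT (S.sgn true).toLinearMap (S.conjCoeff D s T n) (c ⊗ₜ 1) := rfl

namespace IsConj

variable (H : S.IsConj k D s Q T h)
include H

lemma conjForm_even (n : ℤ) {c : g} (hc : S.par c = c) :
    S.sgn true (S.conjForm D s T n c) = S.conjForm D s T n c := by
  have h1 := formT_parT (S := S) (S.isSuperComm_sgn true) (S.conjCoeff D s T n) (c ⊗ₜ 1)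
  have h2 : S.parT (S.sgn true).toLinearMap (c ⊗ₜ 1) = c ⊗ₜ 1 := by
    have : S.parT (S.sgn true).toLinearMap (c ⊗ₜ 1) = S.par c ⊗ₜ S.sgn true 1 := rfl
    rw [this, hc, map_one]
  rw [H.conjCoeff_even, h2] at h1
  exact h1.symm

lemma brV_conjForm {i : ZMod 2} {n : g} (hn : n ∈ S.nn) (hi : S.par n = sg i • n) (r : ℤ) (c : g) :
    S.brV (S.gam1 k) n (S.conjForm D s T r c) =
      Polynomial.C (S.conjForm D s T r (S.br n c)) := H.gauge_conjCoeff hn hi r c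

lemma br_nn_s {n : g} (hn : n ∈ S.nn) : S.br n s = 0 := by
  rw [S.skew_even H.s_even, br_s_nn H.gr_eq_bot H.s_mem hn, neg_zero]

/-- By gauge covariance `{n_λ (m_r | s)} = (m_r | [n, s]) = 0`, so the left side of `density` lies
in `W`; it remains to subtract the constant and divide. -/
lemma exists_density (n : ℤ) : ∃ w, S.IsDensity k (S.ham s h n) w := by
  obtain ⟨x, hx⟩ := H.density n
  have h2 := H.two_le
  have h0 : ((D : ℂ) + 2) ≠ 0 := by
    have h9 : ((D + 2 : ℤ) : ℂ) ≠ 0 := by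
      rw [Int.cast_ne_zero]; omega
    push_cast at h9
    exact h9
  -- If it vanished, `D + 2` would divide `2`, against `D ≥ 2`.
  have hne : (n : ℂ) + 2 / ((D : ℂ) + 2) ≠ 0 := by
    intro h3
    rw [eq_comm, ← sub_eq_iff_eq_add', zero_sub, eq_div_iff h0] at h3
    have h4 : -n * (D + 2) = 2 := by exact_mod_cast h3
    have h5 : D + 2 ≤ 2 := Int.le_of_dvd (by norm_num) ⟨-n, by linarith⟩
    omega
  set a := (n : ℂ) + 2 / ((D : ℂ) + 2)
  set b : ℂ := if n = -1 then S.B s S.f else 0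
  refine ⟨a⁻¹ • (S.conjForm D s T (n + 1) s - algebraMap ℂ S.V b),
    Submodule.smul_mem _ _ (sub_mem ?_ (algebraMap_mem_W k b)), ?_, -(a⁻¹ • x), ?_⟩
  · rw [mem_W_iff_homog]
    intro j hj i m hm hi
    have hm' := S.gr_le_nn hj hm
    rw [H.brV_conjForm hm' hi, H.br_nn_s hm', map_zero, map_zero]
  · rw [map_smul, map_sub, H.conjForm_even _ H.s_even, AlgHom.commutes]
  · rw [conjForm_apply, hx, Algebra.algebraMap_eq_smul_one, map_neg, map_smul, smul_sub, smul_add,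
      smul_add, smul_smul a⁻¹ a, inv_mul_cancel₀ hne, one_smul]
    abel

/-- For a constant variation `a ↦ (c|a)` the variation formula is exact after `evD`, which discards
the total derivative. -/
lemma evD_eq_conjForm {i : ZMod 2} {E : S.V →ₗ[ℂ] S.V[X]}
    (hE : S.SDer true S.sgnVX S.lamV i (cl S.V) E) {c : g}
    (hc : ∀ a, E (S.gen true 0 a) = S.B c a • 1) (n : ℤ) :
    S.evD (E (S.ham s h n)) = S.conjForm D s T n c := by
  obtain ⟨w, hw⟩ := H.variation_ham isBase_cl hE n
  have h1 : E ∘ₗ S.gen true 0 = (S.B c).smulRight 1 := LinearMap.ext hc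
  rw [h1, ctr_smulRight c (H.conjCoeff_even n)] at hw
  have h2 := congrArg S.evD hw
  rw [map_add, map_smul, evD_lamV, smul_zero, add_zero, cl_apply, evD_C] at h2
  exact h2.symm

lemma evD_brV_gam2 (n : ℤ) (b : g) :
    S.evD (S.brV (S.gam2 s) b (S.ham s h n)) = S.conjForm D s T n (S.br s b) := by
  have key : ∀ (j : ZMod 2) b, S.par b = sg j • b →
      S.evD (S.brV (S.gam2 s) b (S.ham s h n)) = S.conjForm D s T n (S.br s b) := by
    intro j b hb
    refine H.evD_eq_conjForm ((isEvenGen_gam2 H.s_even).sder_brV hb) (fun a => ?_) n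
    rw [brV_gam2_gen H.gr_eq_bot H.s_mem H.s_even hb, Algebra.algebraMap_eq_smul_one,
      ← Polynomial.smul_C, map_one]
  rw [← S.ev_add_od b, brV_add, LinearMap.add_apply, map_add, map_add, map_add,
    key 0 _ (S.par_ev' b), key 1 _ (S.par_od' b)]

/-- `E` commutes with every `{n_λ ·}`, `n ∈ 𝔫`: on a generator `b` both compositions give the
pairing with `-[s, [n, b]]`, by gauge covariance and `[n, s] = 0`. -/
lemma apply_mem_W {n : ℤ} {E : S.V →ₗ[ℂ] S.V} (hE : S.EvDer 0 E)
    (hg : ∀ b, E (S.gen true 0 b) = -S.conjForm D s T n (S.br s b)) {v : S.V} (hv : v ∈ S.W k) :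
    E v ∈ S.W k := by
  rw [mem_W_iff_homog]
  intro j hj i m hm hi
  have hm' := S.gr_le_nn hj hm
  have hM := (S.isEvenGen_gam1 k).sder_brV hi
  have h0 : S.brV (S.gam1 k) m ∘ₗ E - cwX E ∘ₗ S.brV (S.gam1 k) m = 0 := by
    refine (hM.commutator hE).ext (SDer.zero (by simp) fun x => cwX_C _ _) fun b => ?_
    have h1 : S.br m (S.br s b) = S.br s (S.br m b) := by
      have := S.jacobi 0 i s m b (by simp [sg, H.s_even]) hi
      rw [br_s_nn H.gr_eq_bot H.s_mem hm'] at this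
      simpa [sg] using this.symm
    have h2 : cwX E Polynomial.X = 0 := by
      have : (Polynomial.X : S.V[X]) = Polynomial.monomial 1 1 := rfl
      rw [this, cwX_monomial, hE.map_one, map_zero]
    rw [LinearMap.sub_apply, LinearMap.comp_apply, LinearMap.comp_apply, hg, map_neg,
      H.brV_conjForm hm' hi, brV_gam1_nn_gen k hi hm', map_add, cwX_C, hg, map_smul, h2, h1]
    simp
  have h3 := LinearMap.congr_fun h0 v
  rw [LinearMap.sub_apply, LinearMap.comp_apply, LinearMap.comp_apply,
    (mem_W_iff k v).1 hv m hm', map_zero, sub_zero] at h3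
  exact h3

end IsConj

end Setup
end WSuper

namespace WSuper
namespace Setup

variable {g : Type*} [AddCommGroup g] [Module ℂ g] {S : Setup g}

/-! ### The Lenard–Magri relations -/

/-- `a ⊗ F ↦ -[b,a] F + k (b|a) ∂F` -/
def psi (S : Setup g) (k : ℂ) (b : g) : g ⊗[ℂ] S.V →ₗ[ℂ] S.V :=
  k • (S.der true ∘ₗ S.ctr LinearMap.id ((S.B b).smulRight 1)) -
    S.ctr LinearMap.id (S.gen true 0 ∘ₗ S.br b)

lemma psi_tmul (k : ℂ) (b a : g) (F : S.V) : S.psi k b (a ⊗ₜ F) =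
    (k * S.B b a) • S.der true F - S.gen true 0 (S.br b a) * F := by
  simp only [psi, LinearMap.sub_apply, LinearMap.smul_apply, LinearMap.comp_apply, ctr_tmul,
    LinearMap.smulRight_apply, LinearMap.id_apply, smul_mul_assoc, one_mul, map_smul, smul_smul]

lemma psi_add (k : ℂ) (b b' : g) (m : g ⊗[ℂ] S.V) :
    S.psi k (b + b') m = S.psi k b m + S.psi k b' m := by
  induction m using TensorProduct.induction_on with
  | zero => simp
  | add x y hx hy => simp only [map_add, hx, hy]; abel
  | tmul a F =>
    simp only [psi_tmul, map_add, LinearMap.add_apply, mul_add, add_mul, add_smul]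
    abel

lemma mapT_even {m : g ⊗[ℂ] S.V} (hm : S.parT (S.sgn true).toLinearMap m = m) :
    S.parT (S.sgn true).toLinearMap (S.mapT 0 (S.der true) m) = S.mapT 0 (S.der true) m := by
  rw [parT_mapT_zero (ε := (S.sgn true).toLinearMap) (fun x => S.sgn_der true x), hm]

/-- Shows that `psi` is the operator `ad Q + k∂` paired with `b`, the form in which the recursion
applies. -/
lemma psi_eq (k : ℂ) (b : g) {Q₀ m : g ⊗[ℂ] S.V}
    (hQ : ∀ a, S.formT (S.sgn true).toLinearMap Q₀ (a ⊗ₜ 1) = S.gen true 0 a)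
    (hm : S.parT (S.sgn true).toLinearMap m = m) :
    S.psi k b m = S.formT (S.sgn true).toLinearMap
      (S.brT (S.sgn true).toLinearMap Q₀ m + k • S.mapT 0 (S.der true) m) (b ⊗ₜ 1) := by
  have hε := S.isSuperComm_sgn true
  have h1 : ∀ m, S.formT (S.sgn true).toLinearMap Q₀
      (S.brT (S.sgn true).toLinearMap (b ⊗ₜ 1) m) =
        S.ctr LinearMap.id (S.gen true 0 ∘ₗ S.br b) m := by
    intro m
    induction m using TensorProduct.induction_on with
    | zero => simp
    | add x y hx hy => simp only [map_add, hx, hy]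
    | tmul a F =>
      rw [S.brT_even_left _ _ _ hε.map_one, formT_tmul_right, hQ, ctr_tmul, one_mul]
      rfl
  have h2 : ∀ m, S.ctr LinearMap.id ((S.B b).smulRight 1) (S.mapT 0 (S.der true) m) =
      S.der true (S.ctr LinearMap.id ((S.B b).smulRight 1) m) := by
    intro m
    induction m using TensorProduct.induction_on with
    | zero => simp
    | add x y hx hy => simp only [map_add, hx, hy]
    | tmul a F => simp [mapT_zero_tmul]
  rw [map_add, map_smul, LinearMap.add_apply, LinearMap.smul_apply, S.formT_inv hε,
    ← neg_neg (S.brT _ m (b ⊗ₜ 1)), ← S.brT_skew hε hm, map_neg, h1,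
    ← LinearMap.id_apply (R := ℂ) (S.formT _ (S.mapT 0 (S.der true) m) (b ⊗ₜ 1)),
    ← ctr_smulRight b (mapT_even hm), h2, psi]
  simp only [LinearMap.sub_apply, LinearMap.smul_apply, LinearMap.comp_apply]
  abel

variable [FiniteDimensional ℂ g] {k : ℂ} {D : ℤ} {s : g} {Q T h : S.G}

/-- The gauge derivation attached to the component in `𝔪` of an even element of `g ⊗ 𝒱`. -/
lemma exists_gauge_derivation (k : ℂ) {m : g ⊗[ℂ] S.V}
    (hm : S.parT (S.sgn true).toLinearMap m = m) :
    ∃ E, S.EvDer 0 E ∧ (∀ v ∈ S.W k, E v = 0) ∧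
      ∀ b, E (S.gen true 0 b) = S.psi k (S.prp b) (m - LinearMap.rTensor S.V S.prp m) := by
  refine S.even_induction (S.isSuperComm_sgn true).sq (motive := fun m =>
    ∃ E, S.EvDer 0 E ∧ (∀ v ∈ S.W k, E v = 0) ∧
      ∀ b, E (S.gen true 0 b) = S.psi k (S.prp b) (m - LinearMap.rTensor S.V S.prp m)) ?_ ?_ hm
  · rintro x y ⟨E, hE, hE0, hEg⟩ ⟨E', hE', hE0', hEg'⟩
    refine ⟨E + E', hE.add hE', fun v hv => ?_, fun b => ?_⟩
    · rw [LinearMap.add_apply, hE0 v hv, hE0' v hv, add_zero]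
    · rw [LinearMap.add_apply, hEg, hEg', ← map_add, map_add (LinearMap.rTensor _ _)]
      congr 1
      abel
  · intro l a F ha hF
    have hn := S.sub_prp_mem a
    have hnl : S.par (a - S.prp a) = sg l • (a - S.prp a) := by
      rw [map_sub, par_prp, ha, map_smul, smul_sub]
    set n := a - S.prp a with hn_def
    have hE := (S.evDer_gaugeDer k hnl hF).smul (sg l)
    rw [show l + l = 0 from by rcases zmod2_cases l with rfl | rfl <;> rfl] at hE
    refine ⟨_, hE, fun v hv => ?_, fun b => ?_⟩
    · rw [LinearMap.smul_apply, gaugeDer_eq_zero k (S.mm_le_nn hn) F hv, smul_zero]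
    have key : ∀ (j : ZMod 2) c, S.par c = sg j • c →
        sg l • (F * S.gen true 0 (S.br n c) + (k * S.B n c) • S.der true F) =
          S.psi k c (n ⊗ₜ F) := by
      intro j c hc
      have h1 : S.sgn true (S.gen true 0 (S.br n c)) =
          sg (l + j) • S.gen true 0 (S.br n c) := by
        rw [sgn_gen, S.br_par_homog hnl hc, map_smul]
      have h2 := (S.isSuperComm_sgn true).mul_comm_sg hF h1
      have h3 : sg (j * l) * S.B n c = sg l * S.B n c := by
        by_cases hjl : j = l
        · subst hjl
          congr 1
          rcases zmod2_cases j with rfl | rfl <;> rfl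
        · have h4 := S.B_even n c
          rw [hnl, hc, map_smul, map_smul, LinearMap.smul_apply, smul_eq_mul, smul_eq_mul,
            ← mul_assoc] at h4
          have h5 : sg j * sg l = -1 := by
            rcases zmod2_cases l with rfl | rfl <;> rcases zmod2_cases j with rfl | rfl <;>
              simp [sg] at hjl ⊢
          rw [h5] at h4
          have h6 : S.B n c = 0 := eq_zero_of_eq_neg (by linear_combination -h4)
          rw [h6, mul_zero, mul_zero]
      rw [psi_tmul, S.skew j l c n hc hnl, S.B_symm j l c n hc hnl, h3, h2, map_neg, map_smul,
        neg_mul, smul_mul_assoc, sub_neg_eq_add, smul_add, smul_smul, smul_smul, add_comm]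
      congr 1
      · congr 1; ring
      · congr 1
        rcases zmod2_cases l with rfl | rfl <;> rcases zmod2_cases j with rfl | rfl <;>
          simp [sg, show (1 : ZMod 2) + 1 = 0 from rfl]
    rw [LinearMap.rTensor_tmul, ← TensorProduct.sub_tmul, ← hn_def, LinearMap.smul_apply]
    have h7 : ∀ c, S.psi k c (n ⊗ₜ F) =
        sg l • (F * S.gen true 0 (S.br n c) + (k * S.B n c) • S.der true F) := by
      intro c
      rw [← S.ev_add_od c, psi_add, ← key 0 _ (S.par_ev' c), ← key 1 _ (S.par_od' c)]
      simp only [map_add, mul_add, add_smul, smul_add]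
      abel
    rw [h7, gaugeDer_gen k F hnl]

namespace IsConj

variable (H : S.IsConj k D s Q T h)
include H

lemma psi_conjCoeff (n : ℤ) (b : g) :
    S.psi k b (S.conjCoeff D s T n) = -S.conjForm D s T (n + 1) (S.br s b) := by
  have hε := S.isSuperComm_sgn true
  rw [psi_eq k b H.formT_ct_Q (H.conjCoeff_even n), H.recursion,
    S.brT_skew hε (H.conjCoeff_even (n + 1)), map_neg, LinearMap.neg_apply, S.formT_inv hε,
    S.brT_even_left _ _ _ hε.map_one, one_mul, conjForm_apply]

/-- Brackets are computed on representatives in `𝔭`, so only the `𝔭`-part of the variational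
derivative enters the first bracket. -/
lemma evD_brV_gam1 (n : ℤ) (b : g) :
    S.evD (S.brV (S.gam1 k) b (S.ham s h n)) =
      -S.psi k b (LinearMap.rTensor S.V S.prp (S.conjCoeff D s T n)) := by
  have key : ∀ (j : ZMod 2) b, S.par b = sg j • b →
      S.evD (S.brV (S.gam1 k) b (S.ham s h n)) =
        -S.psi k b (LinearMap.rTensor S.V S.prp (S.conjCoeff D s T n)) := by
    intro j b hb
    obtain ⟨w, hw⟩ := H.variation_ham isBase_cl ((S.isEvenGen_gam1 k).sder_brV hb) n
    have h1 : ∀ m, S.evD (S.ctr (cl S.V) (S.brV (S.gam1 k) b ∘ₗ S.gen true 0) m) =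
        -S.psi k b (LinearMap.rTensor S.V S.prp m) := by
      intro m
      induction m using TensorProduct.induction_on with
      | zero => simp
      | add x y hx hy => simp only [map_add, hx, hy, neg_add]
      | tmul a F =>
        have h2 : Polynomial.X * Polynomial.C F = Polynomial.monomial 1 F := by
          rw [Polynomial.X_mul_C, Polynomial.C_mul_X_eq_monomial]
        rw [ctr_tmul, LinearMap.comp_apply, brV_gam1_gen k hb, cl_apply, add_mul, map_add,
          ← map_mul, evD_C, smul_mul_assoc, h2, map_smul, evD_monomial, pow_one,
          LinearMap.rTensor_tmul, psi_tmul, LinearMap.neg_apply, smul_neg]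
        abel
    have h2 := congrArg S.evD hw
    rw [map_add, map_smul, evD_lamV, smul_zero, add_zero, h1] at h2
    exact h2.symm
  rw [← S.ev_add_od b, brV_add, LinearMap.add_apply, map_add, psi_add,
    key 0 _ (S.par_ev' b), key 1 _ (S.par_od' b), neg_add]

lemma exists_zero1 {n : ℤ} {w : S.V} (hw : S.IsDensity k (S.ham s h n) w) : ∃ E, S.EvDer 0 E ∧
    (∀ b, E (S.gen true 0 b) =
      S.psi k (S.prp b) (LinearMap.rTensor S.V S.prp (S.conjCoeff D s T n))) ∧
    ∀ v ∈ S.W k, S.zero1 k w v = E v := by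
  obtain ⟨E, hE, hg, hW⟩ := zero1_eq hw
  exact ⟨E, hE, fun b => by rw [hg, H.evD_brV_gam1, neg_neg], hW⟩

lemma exists_zero2 {n : ℤ} {w : S.V} (hw : S.IsDensity k (S.ham s h n) w) : ∃ E, S.EvDer 0 E ∧
    (∀ b, E (S.gen true 0 b) = -S.conjForm D s T n (S.br s b)) ∧ ∀ v, S.zero2 s w v = E v := by
  obtain ⟨E, hE, hg, hW⟩ := zero2_eq H.gr_eq_bot H.s_mem H.s_even hw
  exact ⟨E, hE, fun b => by rw [hg, H.evD_brV_gam2], hW⟩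

/-- By the recursion, the second flow is `psi` of all of `m_n` and the first one is `psi` of its
`𝔭`-part. The difference is the gauge derivation of the `𝔪`-part, which vanishes on `W`. -/
lemma zero1_eq_zero2 {n : ℤ} {w w' : S.V} (hw : S.IsDensity k (S.ham s h n) w)
    (hw' : S.IsDensity k (S.ham s h (n + 1)) w') {v : S.V} (hv : v ∈ S.W k) :
    S.zero1 k w v = S.zero2 s w' v := by
  obtain ⟨E₁, hE₁, hg₁, hW₁⟩ := H.exists_zero1 hw
  obtain ⟨E₂, hE₂, hg₂, hW₂⟩ := H.exists_zero2 hw'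
  obtain ⟨E, hE, hE0, hg⟩ := exists_gauge_derivation k (H.conjCoeff_even n)
  have h1 : E₂ = E₁ + E := by
    refine hE₂.ext (hE₁.add hE) fun b => ?_
    rw [← hE₂.map_gen_prp, hg₂, ← H.psi_conjCoeff, LinearMap.add_apply, hg₁, hg, ← map_add,
      add_sub_cancel]
  rw [hW₁ v hv, hW₂, h1, LinearMap.add_apply, hE0 v hv, add_zero]

lemma zero2_mem_W {n : ℤ} {w v : S.V} (hw : S.IsDensity k (S.ham s h n) w) (hv : v ∈ S.W k) :
    S.zero2 s w v ∈ S.W k := by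
  obtain ⟨E, hE, hg, hW⟩ := H.exists_zero2 hw
  rw [hW]
  exact H.apply_mem_W hE hg hv

/-- `H_{-1} = 0`, so the relation at `n = -1` has zero on its first-bracket side. -/
lemma zero2_zero_eq_zero {w v : S.V} (hw : S.IsDensity k (S.ham s h 0) w) (hv : v ∈ S.W k) :
    S.zero2 s w v = 0 := by
  obtain ⟨w', hw'⟩ := H.exists_density (-1)
  rw [← H.zero1_eq_zero2 (n := -1) hw' hw hv]
  obtain ⟨E, hE, hg, hW⟩ := zero1_eq hw'
  have h1 : E = 0 := hE.ext (SDer.zero rfl fun x => rfl) fun b => by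
    rw [hg, H.ham_eq_zero (by norm_num)]
    simp
  rw [hW v hv, h1, LinearMap.zero_apply]

/-! ### The integrals of motion -/

/-- The pairing `(m_p | [s ⊗ 1, m_q])` is antisymmetric in `p`, `q`. -/
lemma formT_br_s_antisymm (p q : ℤ) :
    S.formT (S.sgn true).toLinearMap (S.conjCoeff D s T q)
        (S.brT (S.sgn true).toLinearMap (s ⊗ₜ 1) (S.conjCoeff D s T p)) =
      -S.formT (S.sgn true).toLinearMap (S.conjCoeff D s T p)
        (S.brT (S.sgn true).toLinearMap (s ⊗ₜ 1) (S.conjCoeff D s T q)) := by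
  have hε := S.isSuperComm_sgn true
  rw [← S.formT_inv hε, ← neg_eq_iff_eq_neg, ← LinearMap.neg_apply, ← map_neg,
    ← S.brT_skew hε (H.conjCoeff_even q), S.formT_symm hε (H.conjCoeff_even p)]

/-- The recursion turns both `[s, ·]` terms into `ad Q + k∂`, which is skew-adjoint up to the total
derivative of `k (m_p | m_q)`. -/
lemma formT_br_s_shift (p q : ℤ) : ∃ x,
    S.formT (S.sgn true).toLinearMap (S.conjCoeff D s T p)
        (S.brT (S.sgn true).toLinearMap (s ⊗ₜ 1) (S.conjCoeff D s T (q + 1))) =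
      S.formT (S.sgn true).toLinearMap (S.conjCoeff D s T (p + 1))
        (S.brT (S.sgn true).toLinearMap (s ⊗ₜ 1) (S.conjCoeff D s T q)) + S.der true x := by
  have hε := S.isSuperComm_sgn true
  set m := S.conjCoeff D s T
  have hder : IsDer (S.sgn true).toLinearMap (S.sgn true).toLinearMap 0 LinearMap.id
      (S.der true) := by
    refine ⟨fun x => rfl, fun x => ?_, fun x y => ?_⟩
    · rw [sg, if_pos rfl, one_smul]
      exact S.sgn_der true x
    · rw [if_pos rfl]
      exact S.der_mul true x y
  have h1 := S.map_formT hε hder (H.conjCoeff_even p) (m q)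
  have h2 : S.mapT 0 (LinearMap.id : S.V →ₗ[ℂ] S.V) = LinearMap.id := by
    rw [mapT_zero, LinearMap.lTensor_id]
  rw [h2, LinearMap.id_apply, LinearMap.id_apply] at h1
  refine ⟨k • S.formT (S.sgn true).toLinearMap (m p) (m q), ?_⟩
  rw [H.formT_br_s_antisymm q (p + 1), ← H.recursion, ← H.recursion, map_smul, h1]
  simp only [map_add, map_smul]
  have h3 : S.formT (S.sgn true).toLinearMap (m p)
      (S.brT (S.sgn true).toLinearMap (S.ct S.V Q) (m q)) =
      -S.formT (S.sgn true).toLinearMap (m q)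
        (S.brT (S.sgn true).toLinearMap (S.ct S.V Q) (m p)) := by
    rw [← S.formT_inv hε, S.brT_skew hε H.ct_Q_even, map_neg, LinearMap.neg_apply,
      S.formT_symm hε (H.conjCoeff_even q)]
  have h4 : S.formT (S.sgn true).toLinearMap (m q) (S.mapT 0 (S.der true) (m p)) =
      S.formT (S.sgn true).toLinearMap (S.mapT 0 (S.der true) (m p)) (m q) :=
    S.formT_symm hε (mapT_even (H.conjCoeff_even p)) _
  rw [h3, h4, smul_add]
  abel

/-- Shifting `d` times exchanges the indices `p` and `p + d` modulo total derivatives. Antisymmetry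
then makes twice the expression a total derivative. -/
lemma formT_br_s_mem (p q : ℤ) : S.formT (S.sgn true).toLinearMap (S.conjCoeff D s T p)
    (S.brT (S.sgn true).toLinearMap (s ⊗ₜ 1) (S.conjCoeff D s T q)) ∈
      LinearMap.range (S.der true) := by
  set A : ℤ → ℤ → S.V := fun p q => S.formT (S.sgn true).toLinearMap (S.conjCoeff D s T p)
    (S.brT (S.sgn true).toLinearMap (s ⊗ₜ 1) (S.conjCoeff D s T q)) with hA
  have hanti : ∀ p q, A q p = -A p q := fun p q => H.formT_br_s_antisymm p q
  have hshift : ∀ (d : ℕ) p q, A p (q + d) - A (p + d) q ∈ LinearMap.range (S.der true) := by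
    intro d
    induction d with
    | zero => intro p q; simp
    | succ d ih =>
      intro p q
      obtain ⟨x, hx⟩ := H.formT_br_s_shift p (q + d)
      have h1 := ih (p + 1) q
      have h2 : A p (q + (d + 1 : ℕ)) - A (p + (d + 1 : ℕ)) q =
          S.der true x + (A (p + 1) (q + d) - A (p + 1 + d) q) := by
        have h3 : A p (q + d + 1) = A (p + 1) (q + d) + S.der true x := hx
        push_cast
        rw [← add_assoc, h3, show p + ((d : ℤ) + 1) = p + 1 + d by ring]
        abel
      rw [h2]
      exact add_mem ⟨x, rfl⟩ h1
  have hmem : ∀ (d : ℕ) p, A p (p + d) ∈ LinearMap.range (S.der true) := by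
    intro d p
    have h1 := hshift d p p
    rw [hanti p (p + d), sub_neg_eq_add, ← two_smul ℂ] at h1
    exact (Submodule.smul_mem_iff _ two_ne_zero).1 h1
  change A p q ∈ _
  rcases le_total p q with hpq | hpq
  · obtain ⟨d, rfl⟩ := Int.le.dest hpq
    exact hmem d p
  · obtain ⟨d, rfl⟩ := Int.le.dest hpq
    rw [hanti]
    exact neg_mem (hmem d q)

/-- The variation formula for the flow of `w` expresses the bracket as `-(m_p | [s, m_q])` up to
total derivatives. -/
lemma zero2_mem_range {p q : ℤ} {w w' : S.V} (hw : S.IsDensity k (S.ham s h p) w)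
    (hw' : S.IsDensity k (S.ham s h q) w') :
    S.zero2 s w w' ∈ LinearMap.range (S.der true) := by
  obtain ⟨E, hE, hg, hW⟩ := H.exists_zero2 hw
  obtain ⟨-, -, x, hx⟩ := hw'
  obtain ⟨y, hy⟩ := H.variation_ham isBase_id hE q
  have h1 : ∀ m, S.ctr LinearMap.id (E ∘ₗ S.gen true 0) m =
      -S.formT (S.sgn true).toLinearMap (S.conjCoeff D s T p)
        (S.brT (S.sgn true).toLinearMap (s ⊗ₜ 1) m) := by
    intro m
    induction m using TensorProduct.induction_on with
    | zero => simp
    | add x y hx hy => simp only [map_add, hx, hy, neg_add]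
    | tmul a F =>
      rw [ctr_tmul, LinearMap.comp_apply, hg, S.brT_even_left _ _ _ (by simp), formT_tmul_right,
        conjForm_apply, one_mul, neg_mul]
      rfl
  obtain ⟨z, hz⟩ := H.formT_br_s_mem p q
  refine ⟨-z - k • y - E x, ?_⟩
  have h2 : w' = S.ham s h q - S.der true x := by rw [hx]; abel
  rw [h1, ← hz] at hy
  rw [hW, h2, map_sub E, hE.D_der, map_sub, map_sub, map_neg, map_smul, hy]
  abel

end IsConj

end Setup
end WSuper

namespace WSuper
namespace Setup

variable {g : Type*} [AddCommGroup g] [Module ℂ g] [FiniteDimensional ℂ g] {S : Setup g}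
  {k : ℂ} {D : ℤ} {s : g} {Q T h : S.G}

/-! ### Linear independence -/

/-- The augmentation of `𝒱`. -/
lemma exists_augmentation (S : Setup g) : ∃ φ : S.V →ₐ[ℂ] ℂ, ∀ x, φ (S.der true x) = 0 := by
  -- The character `a ↦ -(f|a)` is forced on `𝔪` by the relation `m = -(f|m)`; all derivatives are
  -- sent to zero.
  let F : ℕ × g → ℂ := fun x => if x.1 = 0 then -(S.B S.f x.2) else 0
  have hF : ∀ x y, S.Rel true x y → FreeAlgebra.lift ℂ F x = FreeAlgebra.lift ℂ F y := by
    intro x y hxy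
    induction hxy with
    | add n a b =>
      simp only [sy, map_add, FreeAlgebra.lift_ι_apply, F]
      split_ifs <;> ring
    | smul n c a =>
      simp only [sy, map_smul, FreeAlgebra.lift_ι_apply, F, smul_eq_mul]
      split_ifs <;> ring
    | comm n m i j a b ha hb =>
      simp only [sy, map_smul, map_mul, FreeAlgebra.lift_ι_apply, F, smul_eq_mul]
      rcases zmod2_cases i with rfl | rfl
      · simp only [zero_mul, sg, if_true]; ring
      · rw [S.B_f_odd ha]
        simp
    | ideal_zero _ a ha => simp [sy, F]
    | ideal_succ _ n a ha => simp [sy, F]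
  refine ⟨S.lift true F hF, fun x => ?_⟩
  induction x using S.DA_induction true with
  | scalar c => rw [der_algebraMap, map_zero]
  | gen n a =>
    rw [der_gen, ← proj_sy, lift_proj, sy, FreeAlgebra.lift_ι_apply]
    simp [F]
  | mul x y hx hy => rw [der_mul, map_add, map_mul, map_mul, hx, hy, zero_mul, mul_zero, add_zero]
  | add x y hx hy => rw [map_add, map_add, hx, hy, add_zero]

lemma eq_zero_of_smul_one_mem_range {c : ℂ}
    (hc : c • (1 : S.V) ∈ LinearMap.range (S.der true)) : c = 0 := by
  obtain ⟨φ, hφ⟩ := exists_augmentation S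
  obtain ⟨x, hx⟩ := hc
  have := hφ x
  rw [hx, map_smul, map_one] at this
  simpa using this

lemma B_mm_eq_zero {j : ℤ} (hj : -2 < j) {c : g} (hc : c ∈ S.gr j) {m : g} (hm : m ∈ S.mm) :
    S.B c m = 0 := by
  induction hm using S.mm_induction with
  | zero => rw [map_zero]
  | add a b _ _ ha hb => rw [map_add, ha, hb, add_zero]
  | gr i hi m hm => exact S.B_gr (by omega) hc hm

/-- The derivation `a ↦ (c|a)`. -/
lemma exists_sder_B {c : g} (hc : S.par c = c) (hcm : ∀ m ∈ S.mm, S.B c m = 0) :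
    ∃ E, S.SDer true S.sgnVX S.lamV 0 (cl S.V) E ∧ ∀ a, E (S.gen true 0 a) = S.B c a • 1 := by
  set φ : g →ₗ[ℂ] S.P[X] := (S.B c).smulRight 1 with hφ
  have hpar : S.HasParity 0 φ := by
    intro a
    have h1 : S.B c (S.par a) = S.B c a := by
      conv_lhs => rw [← hc, S.B_even]
    have h2 : S.sgnX 1 = 1 := by
      have : S.sgnX (Polynomial.C 1) = Polynomial.C (S.sgn false 1) := cwX_C _ _
      rwa [map_one (S.sgn false), Polynomial.C_1] at this
    rw [hφ, LinearMap.smulRight_apply, LinearMap.smulRight_apply, map_smul, h1, h2]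
    simp [sg]
  have hE := (S.sder_extPar 0 φ).rhoL
  refine ⟨_, hE.sec, fun a => ?_⟩
  have h3 : S.B c (S.prp a) = S.B c a := by
    have := hcm _ (S.sub_prp_mem a)
    rw [map_sub, sub_eq_zero] at this
    exact this.symm
  rw [LinearMap.comp_apply, AlgHom.toLinearMap_apply, hE.apply_gen_sec, LinearMap.comp_apply,
    hpar.extPar_gen_zero, hφ, LinearMap.smulRight_apply, map_smul, h3, rhoL_eq]
  congr 1
  exact S.rhoX.map_one

namespace IsConj

variable (H : S.IsConj k D s Q T h)
include H

/-- Variation along `a ↦ (c|a)` kills constants and, after `evD`, total derivatives. The bound on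
the degree of `c` makes this variation vanish on `𝔪`, hence defined on `𝒱`. -/
lemma sum_conjForm_eq_zero {j : ℤ} (hj : -2 < j) {c : g} (hc : c ∈ S.gr j) (hc0 : S.par c = c)
    {N : ℕ} {a : ℕ → ℂ} {b : ℂ}
    (hs : ∑ n ∈ Finset.range N, a n • S.ham s h n + b • 1 ∈ LinearMap.range (S.der true)) :
    ∑ n ∈ Finset.range N, a n • S.conjForm D s T n c = 0 := by
  obtain ⟨E, hE, hg⟩ := exists_sder_B hc0 fun m hm => B_mm_eq_zero hj hc hm
  obtain ⟨x, hx⟩ := hs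
  have h1 := congrArg (fun x => S.evD (E x)) hx
  simp only [hE.D_der, evD_lamV, map_add, map_sum, map_smul, hE.map_one, map_zero, smul_zero,
    add_zero, H.evD_eq_conjForm hE hg] at h1
  exact h1.symm

/-- Varying in the direction `s` lowers every index by one through `density`. The constant `b` has
to be included in the induction, because the term of index `0` turns into a multiple of `(s|f)`. -/
lemma eq_zero_of_sum_mem {N : ℕ} {a : ℕ → ℂ} {b : ℂ}
    (hs : ∑ n ∈ Finset.range N, a n • S.ham s h n + b • 1 ∈ LinearMap.range (S.der true)) :
    (∀ n < N, a n = 0) ∧ b = 0 := by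
  induction N generalizing a b with
  | zero =>
    simp only [Finset.range_zero, Finset.sum_empty, zero_add] at hs
    exact ⟨fun n hn => absurd hn (Nat.not_lt_zero n), eq_zero_of_smul_one_mem_range hs⟩
  | succ N ih =>
    have h2 := H.two_le
    have hsum := H.sum_conjForm_eq_zero (by omega) H.s_mem H.s_even hs
    rw [Finset.sum_range_succ'] at hsum
    have hdens : ∀ n : ℕ, ∃ x, S.conjForm D s T ((n + 1 : ℕ) : ℤ) s =
        ((n : ℂ) + 2 / ((D : ℂ) + 2)) • S.ham s h n + S.der true x := by
      intro n
      obtain ⟨x, hx⟩ := H.density n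
      refine ⟨x, ?_⟩
      rw [if_neg (by omega), zero_smul, add_zero] at hx
      push_cast
      exact_mod_cast hx
    choose x hx using hdens
    obtain ⟨y, hy⟩ : ∃ y, S.conjForm D s T ((0 : ℕ) : ℤ) s = S.B s S.f • 1 + S.der true y := by
      obtain ⟨y, hy⟩ := H.density (-1)
      refine ⟨y, ?_⟩
      rw [H.ham_eq_zero (by norm_num), smul_zero, zero_add, if_pos rfl] at hy
      exact hy
    -- Each `(m_{n+1} | s)` is replaced by a multiple of `H_n`, up to total derivatives; the
    -- relation obtained has one term less.
    have hmem : ∑ n ∈ Finset.range N, (a (n + 1) * ((n : ℂ) + 2 / ((D : ℂ) + 2))) • S.ham s h n +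
        (a 0 * S.B s S.f) • 1 ∈ LinearMap.range (S.der true) := by
      refine ⟨-(∑ n ∈ Finset.range N, a (n + 1) • x n + a 0 • y), ?_⟩
      rw [← sub_eq_zero, ← neg_eq_zero, ← hsum, hy]
      simp only [hx, smul_add, smul_smul, Finset.sum_add_distrib, map_neg, map_add, map_sum,
        map_smul]
      abel
    have hpos : ∀ n : ℕ, (n : ℂ) + 2 / ((D : ℂ) + 2) ≠ 0 := by
      intro n
      have hD : (0 : ℝ) < (D : ℝ) + 2 := by
        have : (0 : ℤ) < D + 2 := by omega
        exact_mod_cast this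
      have hp : (0 : ℝ) < (n : ℝ) + 2 / ((D : ℝ) + 2) := by positivity
      exact_mod_cast hp.ne'
    have hsucc : ∀ n < N, a (n + 1) = 0 := fun n hn =>
      (mul_eq_zero.1 ((ih hmem).1 n hn)).resolve_right (hpos n)
    -- Only `a 0` is left, and it is detected by the direction `e`, since `(m_0 | e) = 1`.
    have he := H.sum_conjForm_eq_zero (by norm_num) S.e_mem S.e_even hs
    rw [Finset.sum_range_succ', Finset.sum_eq_zero fun n hn => by
      rw [hsucc n (Finset.mem_range.1 hn), zero_smul], zero_add] at he
    have h0 : a 0 = 0 := by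
      have h1 : S.conjForm D s T ((0 : ℕ) : ℤ) S.e = 1 := H.formT_conjCoeff_zero_e
      rw [h1] at he
      exact eq_zero_of_smul_one_mem_range (S := S) (he ▸ zero_mem _)
    have ha : ∀ n < N + 1, a n = 0 := by
      intro n hn
      cases n with
      | zero => exact h0
      | succ n => exact hsucc n (by omega)
    refine ⟨ha, ?_⟩
    rw [Finset.sum_eq_zero fun n hn => by rw [ha n (Finset.mem_range.1 hn), zero_smul],
      zero_add] at hs
    exact eq_zero_of_smul_one_mem_range hs

lemma linearIndependent {w : ℤ → S.V} (hw : ∀ n, S.IsDensity k (S.ham s h n) (w n)) :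
    LinearIndependent ℂ fun j : ℕ => S.int k (w j) := by
  rw [linearIndependent_iff']
  intro I a ha
  obtain ⟨N, hN⟩ := I.exists_nat_subset_range
  have h1 : S.int k (∑ n ∈ I, a n • w n) = 0 := by
    rw [map_sum, ← ha]
    simp only [map_smul]
  have h2 := mem_range_of_int_eq_zero h1
  have h3 : ∑ n ∈ I, a n • S.ham s h n ∈ LinearMap.range (S.der true) := by
    have h4 : ∑ n ∈ I, a n • S.ham s h n =
        ∑ n ∈ I, a n • w n + ∑ n ∈ I, a n • (S.ham s h n - w n) := by
      rw [← Finset.sum_add_distrib]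
      exact Finset.sum_congr rfl fun n _ => by rw [← smul_add, add_sub_cancel]
    rw [h4]
    exact add_mem h2 (sum_mem fun n _ => Submodule.smul_mem _ _ (hw n).2.2)
  have h5 : ∑ n ∈ Finset.range N, (if n ∈ I then a n else 0) • S.ham s h n + (0 : ℂ) • 1 ∈
      LinearMap.range (S.der true) := by
    simp only [ite_smul, zero_smul, add_zero]
    rwa [Finset.sum_ite_mem, Finset.inter_eq_right.2 hN]
  intro n hn
  have := (H.eq_zero_of_sum_mem h5).1 n (Finset.mem_range.1 (hN hn))
  rwa [if_pos hn] at this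

/-- After passing to the second bracket, the value is in `W` and is a total derivative in `𝒱`, hence
lies in `∂W`. -/
lemma isIntegralOfMotion {p q : ℤ} {w w' w'' : S.V} (hw : S.IsDensity k (S.ham s h p) w)
    (hw'' : S.IsDensity k (S.ham s h (p + 1)) w'') (hw' : S.IsDensity k (S.ham s h q) w') :
    S.IsIntegralOfMotion k w w' := by
  refine ⟨hw'.1, ?_⟩
  rw [H.zero1_eq_zero2 hw hw'' hw'.1]
  exact int_eq_zero_of_mem (H.zero2_mem_W hw'' hw'.1) (H.zero2_mem_range hw'' hw')

end IsConj

lemma Ham_eq_ham (s : g) (h : S.G) (n : ℤ) : S.Ham s h n = S.ham s (S.sigma h) n := by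
  rw [Ham, formG_eq, Lam_eq, ham]

end Setup
end WSuper

open WSuper in
theorem theorem5p10 {g : Type*} [AddCommGroup g] [Module ℂ g] [FiniteDimensional ℂ g]
    (S : Setup g) (k : ℂ)
    -- `s` is a nonzero even element of `g(d)`, `d = D / 2` being the top degree
    (D : ℤ) (hD : ∀ j : ℤ, D < j → S.gr j = ⊥)
    (s : g) (hs : s ≠ 0) (hs_even : S.par s = s) (hs_top : s ∈ S.gr D)
    -- `Λ = f + z s` is semisimple in `g((z⁻¹))`
    (hΛ : (S.adLam s).IsSemisimple)
    -- dual bases of `𝔪^⊥` and `𝔭`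
    {ι : Type*} [Fintype ι] [DecidableEq ι]
    (qlo : Module.Basis ι ℂ S.mperp) (qup : Module.Basis ι ℂ S.pp)
    (hdual : ∀ i j, S.B (qlo i) (qup j) = if i = j then 1 else 0) :
    -- `q_univ` can be conjugated into `ker (ad Λ)`, and for every way of doing this:
    (∃! Th : S.G × S.G, S.IsDressing k D s (S.quniv qlo qup) Th.1 Th.2) ∧
    ∀ T h : S.G, S.IsDressing k D s (S.quniv qlo qup) T h →
      -- the local functional of `H_n` is that of an even element of `W`
      (∀ n : ℤ, ∃ w : S.V, S.IsDensity k (S.Ham s h n) w) ∧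
      ∀ H : ℤ → S.V, (∀ n, S.IsDensity k (S.Ham s h n) (H n)) →
        -- Lenard--Magri relations
        (∀ i : ℤ, ∀ u ∈ S.W k,
          S.zero1 k (H i) u ∈ S.W k ∧ S.zero2 s (H (i + 1)) u ∈ S.W k ∧
          S.int k (S.zero1 k (H i) u) = S.int k (S.zero2 s (H (i + 1)) u)) ∧
        (∀ u ∈ S.W k, S.int k (S.zero2 s (H 0) u) = 0) ∧
        -- the `∫H_j` are integrals of motion
        (∀ i j : ℤ, S.IsIntegralOfMotion k (H i) (H j)) ∧
        -- they are linearly independent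
        (LinearIndependent ℂ fun j : ℕ => S.int k (H j)) ∧
        -- hence the equations are integrable
        (∀ i : ℤ, S.IsIntegrable k (H i)) := by
  have h2 := S.two_le_of_gr_eq_bot hD
  refine ⟨Setup.existsUnique_dressing hD hs_even hs_top hΛ
    (Setup.quniv_mem_fil (by omega) qlo qup) (Setup.sgnG_quniv qlo qup hdual), fun T h hTh => ?_⟩
  have C := Setup.IsDressing.isConj hD hs_even hs_top hΛ qlo qup hdual hTh
  simp only [Setup.Ham_eq_ham]
  refine ⟨C.exists_density, fun H hH => ?_⟩
  have hint : ∀ i j : ℤ, S.IsIntegralOfMotion k (H i) (H j) := fun i j =>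
    C.isIntegralOfMotion (hH i) (hH (i + 1)) (hH j)
  have hmem : ∀ i : ℤ, ∀ u ∈ S.W k, S.zero1 k (H i) u ∈ S.W k := fun i u hu => by
    rw [C.zero1_eq_zero2 (hH i) (hH (i + 1)) hu]
    exact C.zero2_mem_W (hH (i + 1)) hu
  have hlin := C.linearIndependent hH
  exact ⟨fun i u hu => ⟨hmem i u hu, C.zero2_mem_W (hH (i + 1)) hu,
      by rw [C.zero1_eq_zero2 (hH i) (hH (i + 1)) hu]⟩,
    fun u hu => by rw [C.zero2_zero_eq_zero (hH 0) hu, map_zero], hint, hlin,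
    fun i => ⟨(hH i).1, (hH i).2.1, hmem i, fun j => H j, fun j => hint i j, hlin⟩⟩
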